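/- Let $n\ge 0$. A \emph{clan} $\sigma\in\mathcal S_n$ is a set of signed singletons $(a,\epsilon)$ and signed pairs $(a,b)^{\epsilon}$ with $a<b$ and $\epsilon\in\{+,-\}$, in which every number $1,\dots,n$ appears exactly once; its elements are ordered by increasing largest (or only) coordinate. The simple roots of type $D_n$ are $e_2+e_1$ (if $n\ge2$) and $e_{i+1}-e_i$ $(1\le i<n)$. \textbf{$\tau$-invariant of a clan.} Let $\theta$ be the linear map that fixes $e_i$ if $(i,\epsilon)\in\sigma$, interchanges $e_i,e_j$ if $(i,j)^+\in\sigma$, and, if $(i,j)^-\in\sigma$, interchanges $e_i$ and $-e_j$ when $j\neq i+1$ and sends $e_i,e_j$ to $-e_i,-e_j$ when $j=i+1$. Call $e_{i+1}-e_i$ compact imaginary for $\sigma$ if $(i,\epsilon),(i+1,\epsilon)\in\sigma$ for some $\epsilon$ or $(i,i+1)^-\in\sigma$, and $e_2+e_1$ compact imaginary if $(1,\epsilon),(2,-\epsilon)\in\sigma$ for some $\epsilon$ or $(1,2)^+\in\sigma$. Then $\tau(\sigma)$ is the set of simple roots $\alpha$ that are compact imaginary for $\sigma$ or for which $\theta(\alpha)$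 is a negative root. \textbf{Domino tableaux.} $\tau(\mathbf T)$ of a domino tableau $\mathbf T$ contains $e_{i+1}-e_i$ iff the $(i+1)$-domino lies strictly below the $i$-domino, and contains $e_2+e_1$ iff the $2$-domino is vertical and lies in column $1$ or $2$. Cycles of $\mathbf T$, and moving through them, are Garfinkle's for type $D$: the fixed squares are the $S_{ij}$ with $i+j$ even. A domino labelled $k$ with fixed square $S_{ij}$ keeps that square; if its other square is to the right of or above $S_{ij}$, it moves below $S_{ij}$ if the label of $S_{i+1,j-1}$ is $<k$ and to the left of it otherwise; if its other square is to the left of or below $S_{ij}$, it moves to the right of $S_{ij}$ if the label of $S_{i-1,j+1}$ is $<k$ and above it otherwise (labels being $0$ in row or column $0$ and $\infty$ outside $\mathbf T$). Cycles are the classes of the equivalence relation generated by: the new position of one domino meets the old position of the other. A cycle is open if moving through it changes the shape; it then removes one square (its hole) and adds one (its corner). \textbf{The map $H$.} Signed tableaux here consist of double rows (two rows of equal length, in rows $2k-1,2k$, with identical alternating signs); two of them, of the same shape as $\mathbf T_1$, are equivalent if they are related by a sequence of: interchanging double rows of the same length; changing all signs in two double rows of the same odd length; changing all signs in two double rows of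 different odd lengths such that an open cycle of $\mathbf T_1$ has its hole at the end of the lower row of one and its corner at the end of the upper row of the other. $H(\sigma)=(\mathbf T_1,\overline{\mathbf T}_2)$, with $\overline{\mathbf T}_2$ the class of a signed tableau $\mathbf T_2$ of the same shape as $\mathbf T_1$, is computed from empty tableaux by inserting the elements of $\sigma$ in order. \emph{Singleton $(i,\epsilon)$.} Among the available double rows (all of them, unless restricted below), take the highest, $R$, which has odd length, or has even length and is such that it or another available double row of the same length ends in $-\epsilon$. If there is none, start a new double row of length $1$ with both signs $\epsilon$ and a vertical domino labelled $i$. Otherwise let $\ell$ be the length of $R$. (a) If an available double row of length $\ell$ ends in $-\epsilon$, interchange it with $R$ in $\mathbf T_2$, add $\epsilon$ to both rows of $R$, and add a vertical domino labelled $i$ at the end of $R$ in $\mathbf T_1$. (b) If not and there are at least two available double rows of length $\ell$ (now odd), change all signs in the first two of them and proceed as in (a). (c) Otherwise consider the open cycle of the domino of $\mathbf T_1$ in the last square of the lower row of $R$; moving through it removes that square and adds a square at the end of the upper row of a double row $R'$ or in a new row. If $R'=R$, move $\mathbf T_1$ through this cycle, add a horizontal domino labelled $i$ at the end of the lower row of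 $R$, and let the rows of $R$, now of length $\ell+1$, end in $\epsilon$, leaving the other signs unchanged. If not, change all signs in $R$ and in $R'$ (in $R$ only, for a new row) and proceed as in (a), not moving $\mathbf T_1$ through the cycle. \emph{Pair $(i,j)^{\epsilon}$.} Insert $i$ into $\mathbf T_1$ by Garfinkle's insertion, as a horizontal domino in the first row if $\epsilon=+$ and as a vertical domino in the first column if $\epsilon=-$. (The dominos with label $>i$ are put back in increasing order of label: one disjoint from the tableau obtained so far stays in place; a horizontal (vertical) one contained in it goes to the end of the next row (column); one meeting it only in $S_{rc}$ goes to its other square together with $S_{r+1,c+1}$.) The resulting tableau $\mathbf T'$ has one more domino $D$ in its shape, in a double row $R$ of previous length $\ell$ ($\ell=0$ for a new double row). (1) $D$ horizontal, $\ell$ odd: add a horizontal domino labelled $j$ directly below $D$; both rows of $R$ end in the same sign as before. (2) $D$ horizontal, $\ell$ even: move $\mathbf T'$ through the open cycle of the domino in the second square of $D$, so that $R$ becomes a double row of length $\ell+1$; it ends in the sign different from before (in $+$ if $\ell=0$). Then insert $(j,\delta)$ as above with only the double rows strictly below $R$ available, $\delta$ being opposite to the sign that each row has gained. (3) $D$ vertical: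 $R$ has length $\ell+1$ and ends in the same sign as before (in $+$ if $\ell=0$). Then insert $(j,\delta)$ as above with only the double rows strictly below $R$ available, $\delta$ being the sign that each row has gained. All signs not mentioned are unchanged. Put $\tau(H(\sigma))=\tau(\mathbf T_1)$. \textbf{Proposition.} For every clan $\sigma\in\mathcal S_n$ and every simple root $\alpha$ of type $D_n$: $\alpha\in\tau(\sigma)$ if and only if $\alpha\in\tau(H(\sigma))$. -/

import Mathlib

namespace SOStar

/-! ### Clans -/

/-- A constituent of a clan: a signed singleton `(a, ε)` or a signed pair `(a, b)^ε`. -/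
inductive ClanPart where
  | single (a : ℕ) (ε : ℤˣ)
  | pair (a b : ℕ) (ε : ℤˣ)

/-- The numerical coordinates of a constituent. -/
def ClanPart.entries : ClanPart → List ℕ
  | .single a _ => [a]
  | .pair a b _ => [a, b]

/-- The largest (or only) numerical coordinate; in a clan `a < b` holds for every pair. -/
def ClanPart.largest : ClanPart → ℕ
  | .single a _ => a
  | .pair _ b _ => b

/-- A clan on `1, …, n`: every number from `1` to `n` appears exactly once, pairs are written
with their smaller coordinate first, and the constituents are listed by increasing largest
coordinate. -/
structure Clan (n : ℕ) where
  parts : List ClanPart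
  lt_of_pair : ∀ a b ε, ClanPart.pair a b ε ∈ parts → a < b
  sorted : parts.Pairwise fun p q => p.largest < q.largest
  perm : (parts.flatMap ClanPart.entries).Perm (List.range' 1 n)

/-! ### Roots, the Cartan involution and the tau-invariant of a clan -/

/-- The unit coordinate vector `e_k`; only `1 ≤ k ≤ n` matters in rank `n`. -/
noncomputable def e (k : ℕ) : ℕ →₀ ℤ := Finsupp.single k 1

/-- The simple roots of type `D_n`: `e₂ + e₁` and `e_{i+1} - e_i` for `1 ≤ i < n`. -/
inductive SimpleRoot (n : ℕ) where
  | plus (h : 2 ≤ n)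
  | diff (i : ℕ) (h₁ : 1 ≤ i) (h₂ : i < n)

/-- The simple root as a vector. -/
noncomputable def SimpleRoot.vec {n : ℕ} : SimpleRoot n → (ℕ →₀ ℤ)
  | .plus _ => e 2 + e 1
  | .diff i _ _ => e (i + 1) - e i

/-- The negative roots of type `D_n` for this choice of simple roots: `-(e_a ± e_b)`, `a > b`. -/
def IsNegativeRoot (n : ℕ) (v : ℕ →₀ ℤ) : Prop :=
  ∃ a b : ℕ, 1 ≤ b ∧ b < a ∧ a ≤ n ∧ (v = -(e a + e b) ∨ v = -(e a - e b))

variable {n : ℕ}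

/-- The image of `e_k` under the Cartan involution of the clan. -/
noncomputable def Clan.thetaBasis (σ : Clan n) (k : ℕ) : ℕ →₀ ℤ :=
  match σ.parts.find? fun p => decide (k ∈ p.entries) with
  | some (.pair a b ε) =>
      let partner := if k = a then b else a
      if ε = 1 then e partner else if b = a + 1 then -e k else -e partner
  | _ => e k

/-- The Cartan involution of the clan. -/
noncomputable def Clan.theta (σ : Clan n) : (ℕ →₀ ℤ) →ₗ[ℤ] (ℕ →₀ ℤ) :=
  Finsupp.linearCombination ℤ σ.thetaBasis

/-- The simple roots that are compact imaginary for the clan. -/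
def Clan.CompactImaginary (σ : Clan n) : SimpleRoot n → Prop
  | .plus _ =>
      (∃ ε, ClanPart.single 1 ε ∈ σ.parts ∧ ClanPart.single 2 (-ε) ∈ σ.parts) ∨
        ClanPart.pair 1 2 1 ∈ σ.parts
  | .diff i _ _ =>
      (∃ ε, ClanPart.single i ε ∈ σ.parts ∧ ClanPart.single (i + 1) ε ∈ σ.parts) ∨
        ClanPart.pair i (i + 1) (-1) ∈ σ.parts

/-- The tau-invariant of a clan: the simple roots that are compact imaginary or are sent to a
negative root by the Cartan involution. -/
def Clan.tau (σ : Clan n) : Set (SimpleRoot n) :=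
  {α | IsNegativeRoot n (σ.theta α.vec) ∨ σ.CompactImaginary α}

/-! ### Dominos and domino tableaux -/

/-- Squares `(row, column)`, both numbered from `1`. -/
abbrev Square := ℕ × ℕ

/-- A domino, given by its upper left square and its direction. -/
structure Domino where
  row : ℕ
  col : ℕ
  vertical : Bool

/-- The upper left square. -/
def Domino.first (d : Domino) : Square := (d.row, d.col)

/-- The other square. -/
def Domino.second (d : Domino) : Square :=
  if d.vertical then (d.row + 1, d.col) else (d.row, d.col + 1)

/-- The two squares of a domino. -/
def Domino.squares (d : Domino) : Finset Square := {d.first, d.second}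

/-- A collection of labelled dominos, listed by increasing label. -/
abbrev DominoTableau := List (ℕ × Domino)

/-- The set of squares covered. -/
def shape (T : DominoTableau) : Finset Square :=
  T.foldr (fun p S => p.2.squares ∪ S) ∅

/-- The length of row `r`. -/
def rowLength (T : DominoTableau) (r : ℕ) : ℕ := ((shape T).filter fun s => s.1 = r).card

/-- The length of column `c`. -/
def colLength (T : DominoTableau) (c : ℕ) : ℕ := ((shape T).filter fun s => s.2 = c).card

/-- The horizontal domino at the end of row `r`. -/
def endOfRow (T : DominoTableau) (r : ℕ) : Domino := ⟨r, rowLength T r + 1, false⟩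

/-- The vertical domino at the end of column `c`. -/
def endOfCol (T : DominoTableau) (c : ℕ) : Domino := ⟨colLength T c + 1, c, true⟩

/-! ### Garfinkle's insertion -/

/-- Put back the domino `d` labelled `k` of the old tableau after all smaller labels have been
dealt with, `S` being the tableau obtained so far: `d` stays if it is disjoint from `S`; if it is
contained in `S` it goes to the end of the next row (column) if it is horizontal (vertical);
if only its first square lies in `S`, it is turned so as to cover its second square
and the square diagonally below and to the right of the first. -/
def bump (S : DominoTableau) (p : ℕ × Domino) : DominoTableau :=
  let d := p.2
  S ++ [(p.1,
    if Disjoint d.squares (shape S) then d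
    else if d.squares ⊆ shape S then
      if d.vertical then endOfCol S (d.col + 1) else endOfRow S (d.row + 1)
    else ⟨d.second.1, d.second.2, !d.vertical⟩)]

/-- Insert a horizontal domino labelled `i` into the first row (`ε = 1`), or a vertical one into
the first column (`ε = -1`), bumping the dominos with larger labels. -/
def insertDomino (T : DominoTableau) (i : ℕ) (ε : ℤˣ) : DominoTableau :=
  let S := T.filter fun p => decide (p.1 < i)
  (T.filter fun p => decide (i < p.1)).foldl bump
    (S ++ [(i, if ε = 1 then endOfRow S 1 else endOfCol S 1)])

/-! ### Cycles and moving through (type `D`: a square is fixed if row + column is even) -/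

/-- The label of the square `s` is less than `k`, where squares in row or column `0` have
label `0` and squares outside the tableau have label `∞`. -/
def LabelLT (T : DominoTableau) (s : Square) (k : ℕ) : Prop :=
  s.1 = 0 ∨ s.2 = 0 ∨ ∃ p ∈ T, s ∈ p.2.squares ∧ p.1 < k

instance (T : DominoTableau) (s : Square) (k : ℕ) : Decidable (LabelLT T s k) := by
  unfold LabelLT; infer_instance

/-- The fixed square of a domino. -/
def Domino.fixedSquare (d : Domino) : Square :=
  if (d.row + d.col) % 2 = 0 then d.first else d.second

/-- The variable square of a domino. -/
def Domino.variableSquare (d : Domino) : Square :=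
  if (d.row + d.col) % 2 = 0 then d.second else d.first

/-- The new position of a labelled domino of `T` when one moves through its cycle.  The fixed
square `(i, j)` is kept.  If the variable square lies to the right of it or above it, then it is
moved below it or to the left of it, according as the label of `(i + 1, j - 1)` is smaller or
larger than that of the domino; if it lies to the left of it or below it, then it is moved to
the right of it or above it, according as the label of `(i - 1, j + 1)` is smaller or larger. -/
def moved (T : DominoTableau) (p : ℕ × Domino) : Domino :=
  let i := p.2.fixedSquare.1
  let j := p.2.fixedSquare.2
  if p.2.variableSquare = (i, j + 1) ∨ p.2.variableSquare = (i - 1, j) then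
    if LabelLT T (i + 1, j - 1) p.1 then ⟨i, j, true⟩ else ⟨i, j - 1, false⟩
  else
    if LabelLT T (i - 1, j + 1) p.1 then ⟨i, j, false⟩ else ⟨i - 1, j, true⟩

/-- `p` and `q` are dominos of `T` and the new position of `p` meets the old position of `q`. -/
def Linked (T : DominoTableau) (p q : ℕ × Domino) : Prop :=
  p ∈ T ∧ q ∈ T ∧ ¬ Disjoint (moved T p).squares q.2.squares

/-- `p` and `q` lie in the same cycle of `T`. -/
def SameCycle (T : DominoTableau) (p q : ℕ × Domino) : Prop :=
  Relation.EqvGen (Linked T) p q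

/-- `q` lies in the cycle of the domino of `T` that occupies the square `s`. -/
def InCycleAt (T : DominoTableau) (s : Square) (q : ℕ × Domino) : Prop :=
  ∃ p ∈ T, s ∈ p.2.squares ∧ SameCycle T p q

open Classical in
/-- Move `T` through the cycle of the domino occupying the square `s`. -/
noncomputable def moveThrough (T : DominoTableau) (s : Square) : DominoTableau :=
  T.map fun q => if InCycleAt T s q then (q.1, moved T q) else q

/-! ### Signed tableaux

Double rows are numbered from `0`: the double row `r` consists of the rows `2r + 1`, `2r + 2`. -/

/-- A double row of a signed tableau: its two rows have length `len`, the signs alternate along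
each row, and both rows end in the sign `last`. -/
structure DoubleRow where
  len : ℕ
  last : ℤˣ

/-- Change all signs of a double row. -/
def DoubleRow.flip (R : DoubleRow) : DoubleRow := ⟨R.len, -R.last⟩

/-- The number of plus signs in each of the two rows. -/
def DoubleRow.plusCount (R : DoubleRow) : ℕ :=
  ((List.range R.len).filter fun t => decide (R.last * (-1) ^ t = 1)).length

/-- A signed tableau, as the list of its double rows from top to bottom. -/
abbrev SignedTableau := List DoubleRow

/-- Double row `r`; the empty double row if there is none. -/
def SignedTableau.get (S : SignedTableau) (r : ℕ) : DoubleRow := List.getD S r ⟨0, 1⟩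

/-- Replace double row `r`, or append a new last double row if `r` is the number of double rows. -/
def SignedTableau.put (S : SignedTableau) (r : ℕ) (R : DoubleRow) : SignedTableau :=
  List.take r S ++ R :: List.drop (r + 1) S

/-- The cycle of the domino of `T` occupying the last square of the lower row of the double row
`r` (of length `l`) is open with its hole there, and its corner is at the end of the upper row of
the double row `r'`: moving through it removes the former square and adds the latter. -/
def HoleCorner (T : DominoTableau) (r l r' : ℕ) : Prop :=
  let U := moveThrough T (2 * r + 2, l)
  (2 * r + 2, l) ∈ shape T ∧ (2 * r + 2, l) ∉ shape U ∧
    ∃ c, (2 * r' + 1, c) ∈ shape U ∧ (2 * r' + 1, c) ∉ shape T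

/-- The moves generating the equivalence of signed tableaux of the same shape as `T`: interchange
two double rows of the same length; change all signs in two double rows of the same odd length,
or of different odd lengths if an open cycle of `T` has its hole in one of them and its corner
in the other. -/
inductive SignedMove (T : DominoTableau) : SignedTableau → SignedTableau → Prop where
  | swap (S : SignedTableau) (r r' : ℕ) (hr : r < S.length) (hr' : r' < S.length)
      (h : (S.get r).len = (S.get r').len) :
      SignedMove T S ((S.put r (S.get r')).put r' (S.get r))
  | same (S : SignedTableau) (r r' : ℕ) (hr : r < S.length) (hr' : r' < S.length) (hne : r ≠ r')
      (hodd : Odd (S.get r).len) (h : (S.get r).len = (S.get r').len) :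
      SignedMove T S ((S.put r (S.get r).flip).put r' (S.get r').flip)
  | cycle (S : SignedTableau) (r r' : ℕ) (hr : r < S.length) (hr' : r' < S.length)
      (hodd : Odd (S.get r).len) (hodd' : Odd (S.get r').len)
      (hne : (S.get r).len ≠ (S.get r').len) (h : HoleCorner T r (S.get r).len r') :
      SignedMove T S ((S.put r (S.get r).flip).put r' (S.get r').flip)

/-! ### The algorithm -/

/-- A domino tableau together with a signed tableau. -/
abbrev TableauPair := DominoTableau × SignedTableau

/-- The first double row `q ≥ m` of length `l` that ends in the sign `s`, if any. -/
def rowEndingIn (S : SignedTableau) (m l : ℕ) (s : ℤˣ) : Option ℕ :=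
  (List.range S.length).find? fun q =>
    decide (m ≤ q ∧ (S.get q).len = l ∧ (S.get q).last = s)

/-- The first double row `r ≥ m` into which the sign `ε` can be inserted: one of odd length, or
one of even length such that it or a lower double row of the same length ends in `-ε`. -/
def availableRow (S : SignedTableau) (m : ℕ) (ε : ℤˣ) : Option ℕ :=
  (List.range S.length).find? fun r =>
    decide (m ≤ r) &&
      (decide (Odd (S.get r).len) || (rowEndingIn S m (S.get r).len (-ε)).isSome)

open Classical in
/-- Insert the singleton `(i, ε)`, using only the double rows `r ≥ m`. -/
noncomputable def insertSingle (X : TableauPair) (i : ℕ) (ε : ℤˣ) (m : ℕ) : TableauPair :=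
  let T := X.1
  let S := X.2
  match availableRow S m ε with
  | none =>
      -- start a new double row
      (T ++ [(i, ⟨2 * S.length + 1, 1, true⟩)], S ++ [⟨1, ε⟩])
  | some r =>
      let l := (S.get r).len
      let T' := T ++ [(i, ⟨2 * r + 1, l + 1, true⟩)]
      match rowEndingIn S m l (-ε) with
      | some q =>
          -- interchange the double rows `r` and `q`, then add `ε`
          (T', (S.put q (S.get r)).put r ⟨l + 1, ε⟩)
      | none =>
          if r + 1 < S.length ∧ (S.get (r + 1)).len = l then
            -- change all signs in the first two double rows of length `l`, then add `ε`
            (T', (S.put (r + 1) (S.get (r + 1)).flip).put r ⟨l + 1, ε⟩)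
          else if HoleCorner T r l r then
            (moveThrough T (2 * r + 2, l) ++ [(i, ⟨2 * r + 2, l, false⟩)], S.put r ⟨l + 1, ε⟩)
          else
            -- change all signs in `r` and in the double row of the corner, then add `ε`
            (T', SignedTableau.put
              (S.mapIdx fun r' R => if HoleCorner T r l r' then R.flip else R) r ⟨l + 1, ε⟩)

/-- The sign that each row gains if `R` is replaced by the double row `R'` that is longer by one
square. -/
def gained (R R' : DoubleRow) : ℤˣ := if R.plusCount < R'.plusCount then 1 else -1

/-- Insert the pair `(i, j)^ε`. -/
noncomputable def insertPair (X : TableauPair) (i j : ℕ) (ε : ℤˣ) : TableauPair :=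
  let T := X.1
  let S := X.2
  let T' := insertDomino T i ε
  -- the domino by which the shape has grown, and the double row in which it lies
  let D := shape T' \ shape T
  let r := (D.sup Prod.fst - 1) / 2
  let R := S.get r
  let l := R.len
  if (D.image Prod.fst).card = 1 then
    -- `D` is horizontal
    if Odd l then
      (T' ++ [(j, ⟨2 * r + 2, l + 1, false⟩)], S.put r ⟨l + 2, R.last⟩)
    else
      let R' : DoubleRow := ⟨l + 1, if l = 0 then 1 else -R.last⟩
      insertSingle (moveThrough T' (2 * r + 1, l + 2), S.put r R') j (-gained R R') (r + 1)
  else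
    -- `D` is vertical
    let R' : DoubleRow := ⟨l + 1, if l = 0 then 1 else R.last⟩
    insertSingle (T', S.put r R') j (gained R R') (r + 1)

/-- Insert the next constituent of a clan. -/
noncomputable def insertPart (X : TableauPair) : ClanPart → TableauPair
  | .single i ε => insertSingle X i ε 0
  | .pair i j ε => insertPair X i j ε

/-- The domino tableau and the representing signed tableau computed by the algorithm. -/
noncomputable def algorithm (σ : Clan n) : TableauPair := σ.parts.foldl insertPart ([], [])

/-- A domino tableau together with an equivalence class of signed tableaux. -/
abbrev ClassPair := Σ T : DominoTableau, Quot (SignedMove T)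

/-- The map `H`. -/
noncomputable def H (σ : Clan n) : ClassPair :=
  ⟨(algorithm σ).1, Quot.mk _ (algorithm σ).2⟩

/-! ### The tau-invariant of a tableau -/

/-- The tau-invariant of a domino tableau: `e_{i+1} - e_i` belongs to it if the domino labelled
`i + 1` lies strictly below the domino labelled `i`, and `e₂ + e₁` if the domino labelled `2` is
vertical and lies in one of the first two columns. -/
def tableauTau (n : ℕ) (T : DominoTableau) : Set (SimpleRoot n) := fun α =>
  match α with
  | .plus _ => ∃ d, (2, d) ∈ T ∧ d.vertical = true ∧ (d.col = 1 ∨ d.col = 2)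
  | .diff i _ _ => ∃ d d', (i, d) ∈ T ∧ (i + 1, d') ∈ T ∧
      ∀ s ∈ d.squares, ∀ s' ∈ d'.squares, s.1 < s'.1

/-- The tau-invariant of a pair is that of its domino tableau. -/
def ClassPair.tau (n : ℕ) (X : ClassPair) : Set (SimpleRoot n) := tableauTau n X.1

end SOStar

namespace SOStar

/-! ### Young diagrams and addable dominos -/

/-! Every simple root involves two consecutive numbers: i and i+1, or 1 and 2 for e_2 + e_1. On the
side of the clan, the sign of a root is the sign of its coordinate of largest index
(`isNegativeRoot_iff`). Membership in the tau-invariant can therefore be read off from the parts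
containing the two numbers, and this gives a short table of cases. The theorem says that the
relative position of the two dominos in the tableau obeys the same table. Two facts are needed: the
position never changes once both labels are present, and it is the right one when the second label
enters.

Persistence. After both labels are present the tableau changes only by moving through open cycles,
by inserting other labels, and by adding larger labels (`Grows`). Moving through cycles fixes the
squares of even coordinate sum. For consecutive labels k, k+1 the contents (column minus row) of
these fixed squares decide whether k+1 lies below k or to the right of it; when the contents agree,
the two dominos form a 2×2 block, which is a closed cycle and is not touched
(`Std.block_of_content`, `TabEquiv.belowIn`). Insertion is a succession of local growth rules, and
two consecutive rules preserve "right of" (`LocalRule.rightOf`); transposition gives "below". One of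
the two relations always holds and they exclude each other, so preserving both fixes the truth value
(`Admissible.belowIn_of_prefix`). For e_2 + e_1 the domino 2 has only four possible positions
(`Std.first_two`).

Entry as a smaller coordinate. A label inserted into the first row lies to the right of its
predecessor and has its successor below it (`Ins.rightIn_pred`, `Ins.belowIn_succ`); for the first
column these are transposed.

Entry of both as largest coordinates. The two parts are then adjacent in the clan, and the double
rows receiving i and i+1 have to be compared. For equal signs the second goes lower, or into the
same double row by turning the vertical domino i (`SingleStep.below_of_same`). If a double row not
below i can receive the second, it does not go below (`SingleStep.not_below`). For two pairs one
compares the growths of the shape under the two insertions: as for ordinary row insertion, the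
contents increase or decrease according to the signs and to the order of the smaller coordinates
(`Ins.growth_right`, `Ins.growth_left`). There is one exception, in which the second growth lies
diagonally next to the first and has the same content. There the signs decide, because the cycle
used for i does not have its corner in the double row concerned (`Valid.not_holeCorner`).

All of this needs control of open cycles. A square of odd coordinate sum has at most two candidate
dominos and a domino has exactly two candidate squares, so cycles are alternating chains. An
invariant parity shows that the hole and the corner of an open cycle lie in rows of different parity
(`Std.moveThrough_spec`); hence moving a hole out of a lower row produces a corner in an upper row,
as the algorithm requires. -/

/-- A finite set of squares that is the diagram of a partition. -/
def Young (Y : Finset Square) : Prop :=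
  ∀ x y, (x, y) ∈ Y → 1 ≤ x ∧ 1 ≤ y ∧
    ∀ x' y', 1 ≤ x' → 1 ≤ y' → x' ≤ x → y' ≤ y → (x', y') ∈ Y

/-- The domino `d` can be added to the diagram `Y`. -/
def Addable (Y : Finset Square) (d : Domino) : Prop :=
  Disjoint d.squares Y ∧ Young (Y ∪ d.squares)

lemma Young.down {Y : Finset Square} (h : Young Y) {x y x' y' : ℕ} (hm : (x, y) ∈ Y)
    (h1 : 1 ≤ x') (h2 : 1 ≤ y') (h3 : x' ≤ x) (h4 : y' ≤ y) : (x', y') ∈ Y :=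
  (h x y hm).2.2 x' y' h1 h2 h3 h4

lemma mem_hdomino {r c x y : ℕ} :
    (x, y) ∈ (⟨r, c, false⟩ : Domino).squares ↔ x = r ∧ (y = c ∨ y = c + 1) := by
  simp [Domino.squares, Domino.first, Domino.second]; omega

lemma mem_vdomino {r c x y : ℕ} :
    (x, y) ∈ (⟨r, c, true⟩ : Domino).squares ↔ y = c ∧ (x = r ∨ x = r + 1) := by
  simp [Domino.squares, Domino.first, Domino.second]; omega

lemma domino_card (d : Domino) : d.squares.card = 2 := by
  obtain ⟨r, c, _ | _⟩ := d <;> simp [Domino.squares, Domino.first, Domino.second]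

lemma Addable.notMem {Y : Finset Square} {d : Domino} (h : Addable Y d) {s : Square}
    (hs : s ∈ d.squares) : s ∉ Y := Finset.disjoint_left.mp h.1 hs

/-- Besides the first square only two squares matter: the one to the left of the first square and
the one above the second, which forces the one above the first. -/
lemma addable_h_iff {Y : Finset Square} (hY : Young Y) {r c : ℕ} :
    Addable Y ⟨r, c, false⟩ ↔ 1 ≤ r ∧ 1 ≤ c ∧ (r, c) ∉ Y ∧ (c = 1 ∨ (r, c - 1) ∈ Y) ∧
      (r = 1 ∨ (r - 1, c + 1) ∈ Y) := by
  constructor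
  · rintro ⟨h1, h2⟩
    have hn : (r, c) ∉ Y := Finset.disjoint_left.mp h1 (mem_hdomino.2 (by simp))
    have hm : (r, c + 1) ∈ Y ∪ (⟨r, c, false⟩ : Domino).squares :=
      Finset.mem_union_right _ (mem_hdomino.2 (by simp))
    have hm' : (r, c) ∈ Y ∪ (⟨r, c, false⟩ : Domino).squares :=
      Finset.mem_union_right _ (mem_hdomino.2 (by simp))
    have hr := (h2 _ _ hm').1
    have hc := (h2 _ _ hm').2.1
    refine ⟨hr, hc, hn, ?_, ?_⟩
    · by_cases h : c = 1
      · exact Or.inl h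
      · right
        have := h2.down hm' (x' := r) (y' := c - 1) (by omega) (by omega) (by omega) (by omega)
        rw [Finset.mem_union, mem_hdomino] at this
        rcases this with h | h
        · exact h
        · omega
    · by_cases h : r = 1
      · exact Or.inl h
      · right
        have := h2.down hm (x' := r - 1) (y' := c + 1) (by omega) (by omega) (by omega) (by omega)
        rw [Finset.mem_union, mem_hdomino] at this
        rcases this with h | h
        · exact h
        · omega
  · rintro ⟨hr, hc, hn, h1, h2⟩
    constructor
    · rw [Finset.disjoint_left]
      rintro ⟨x, y⟩ hs hY'
      rw [mem_hdomino] at hs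
      exact hn (hY.down hY' hr hc (by omega) (by omega))
    · intro x y hm
      rw [Finset.mem_union, mem_hdomino] at hm
      rcases hm with hm | hm
      · exact ⟨(hY x y hm).1, (hY x y hm).2.1, fun x' y' a b e f =>
          Finset.mem_union_left _ (hY.down hm a b e f)⟩
      · refine ⟨by omega, by omega, fun x' y' a b e f => ?_⟩
        rw [Finset.mem_union, mem_hdomino]
        by_cases hx : x' = r
        · by_cases hy : c ≤ y'
          · right; omega
          · left
            rcases h1 with h1 | h1
            · omega
            · exact hY.down h1 a b (by omega) (by omega)
        · left
          rcases h2 with h2 | h2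
          · omega
          · exact hY.down h2 a b (by omega) (by omega)

lemma addable_v_iff {Y : Finset Square} (hY : Young Y) {r c : ℕ} :
    Addable Y ⟨r, c, true⟩ ↔ 1 ≤ r ∧ 1 ≤ c ∧ (r, c) ∉ Y ∧ (r = 1 ∨ (r - 1, c) ∈ Y) ∧
      (c = 1 ∨ (r + 1, c - 1) ∈ Y) := by
  constructor
  · rintro ⟨h1, h2⟩
    have hn : (r, c) ∉ Y := Finset.disjoint_left.mp h1 (mem_vdomino.2 (by simp))
    have hm : (r + 1, c) ∈ Y ∪ (⟨r, c, true⟩ : Domino).squares :=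
      Finset.mem_union_right _ (mem_vdomino.2 (by simp))
    have hm' : (r, c) ∈ Y ∪ (⟨r, c, true⟩ : Domino).squares :=
      Finset.mem_union_right _ (mem_vdomino.2 (by simp))
    have hr := (h2 _ _ hm').1
    have hc := (h2 _ _ hm').2.1
    refine ⟨hr, hc, hn, ?_, ?_⟩
    · by_cases h : r = 1
      · exact Or.inl h
      · right
        have := h2.down hm' (x' := r - 1) (y' := c) (by omega) (by omega) (by omega) (by omega)
        rw [Finset.mem_union, mem_vdomino] at this
        rcases this with h | h
        · exact h
        · omega
    · by_cases h : c = 1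
      · exact Or.inl h
      · right
        have := h2.down hm (x' := r + 1) (y' := c - 1) (by omega) (by omega) (by omega) (by omega)
        rw [Finset.mem_union, mem_vdomino] at this
        rcases this with h | h
        · exact h
        · omega
  · rintro ⟨hr, hc, hn, h1, h2⟩
    constructor
    · rw [Finset.disjoint_left]
      rintro ⟨x, y⟩ hs hY'
      rw [mem_vdomino] at hs
      exact hn (hY.down hY' hr hc (by omega) (by omega))
    · intro x y hm
      rw [Finset.mem_union, mem_vdomino] at hm
      rcases hm with hm | hm
      · exact ⟨(hY x y hm).1, (hY x y hm).2.1, fun x' y' a b e f =>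
          Finset.mem_union_left _ (hY.down hm a b e f)⟩
      · refine ⟨by omega, by omega, fun x' y' a b e f => ?_⟩
        rw [Finset.mem_union, mem_vdomino]
        by_cases hx : y' = c
        · by_cases hy : r ≤ x'
          · right; omega
          · left
            rcases h1 with h1 | h1
            · omega
            · exact hY.down h1 a b (by omega) (by omega)
        · left
          rcases h2 with h2 | h2
          · omega
          · exact hY.down h2 a b (by omega) (by omega)

/-! ### Standard domino tableaux -/

/-- Standard domino tableaux: the labels increase along the list, and the dominos build up a
chain of Young diagrams. -/
inductive Std : DominoTableau → Prop
  | nil : Std []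
  | snoc {T : DominoTableau} {k : ℕ} {d : Domino} : Std T → 1 ≤ k → (∀ p ∈ T, p.1 < k) →
      Addable (shape T) d → Std (T ++ [(k, d)])

lemma mem_shape {T : DominoTableau} {s : Square} : s ∈ shape T ↔ ∃ p ∈ T, s ∈ p.2.squares := by
  induction T with
  | nil => simp [shape]
  | cons p T ih =>
    have : shape (p :: T) = p.2.squares ∪ shape T := rfl
    rw [this, Finset.mem_union, ih]; simp

lemma shape_append (A B : DominoTableau) : shape (A ++ B) = shape A ∪ shape B := by
  ext s; simp only [mem_shape, Finset.mem_union, List.mem_append]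
  constructor
  · rintro ⟨p, h | h, hs⟩
    · exact Or.inl ⟨p, h, hs⟩
    · exact Or.inr ⟨p, h, hs⟩
  · rintro (⟨p, h, hs⟩ | ⟨p, h, hs⟩)
    · exact ⟨p, Or.inl h, hs⟩
    · exact ⟨p, Or.inr h, hs⟩

lemma shape_singleton (p : ℕ × Domino) : shape [p] = p.2.squares := by
  ext s; simp [mem_shape]

lemma shape_snoc (T : DominoTableau) (p : ℕ × Domino) :
    shape (T ++ [p]) = shape T ∪ p.2.squares := by rw [shape_append, shape_singleton]

lemma shape_nil : shape [] = ∅ := rfl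

lemma std_snoc_iff {T : DominoTableau} {k : ℕ} {d : Domino} :
    Std (T ++ [(k, d)]) ↔ Std T ∧ 1 ≤ k ∧ (∀ p ∈ T, p.1 < k) ∧ Addable (shape T) d := by
  constructor
  · intro h
    generalize hU : T ++ [(k, d)] = U at h
    cases h with
    | nil => simp at hU
    | snoc h1 h2 h3 h4 =>
      obtain ⟨rfl, hh⟩ := List.append_inj' hU rfl
      simp only [List.cons.injEq, Prod.mk.injEq, and_true] at hh
      obtain ⟨rfl, rfl⟩ := hh
      exact ⟨h1, h2, h3, h4⟩
  · rintro ⟨h1, h2, h3, h4⟩; exact Std.snoc h1 h2 h3 h4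

lemma Std.young {T : DominoTableau} (h : Std T) : Young (shape T) := by
  cases h with
  | nil => intro x y h; simp [shape] at h
  | snoc h1 h2 h3 h4 => rw [shape_snoc]; exact h4.2

lemma Std.left {A B : DominoTableau} (h : Std (A ++ B)) : Std A := by
  induction B using List.reverseRecOn with
  | nil => simpa using h
  | append_singleton B p ih =>
    rw [← List.append_assoc] at h
    exact ih (std_snoc_iff.1 h).1

lemma Std.pos {T : DominoTableau} (h : Std T) {p : ℕ × Domino} (hp : p ∈ T) : 1 ≤ p.1 := by
  induction h with
  | nil => simp at hp
  | snoc h1 h2 h3 h4 ih =>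
    rw [List.mem_append, List.mem_singleton] at hp
    rcases hp with hp | rfl
    · exact ih hp
    · exact h2

lemma Std.pairwise {T : DominoTableau} (h : Std T) : T.Pairwise fun p q => p.1 < q.1 := by
  induction h with
  | nil => exact List.Pairwise.nil
  | snoc h1 h2 h3 h4 ih =>
    rw [List.pairwise_append]
    exact ⟨ih, List.pairwise_singleton _ _, fun p hp q hq => by
      rw [List.mem_singleton] at hq; subst hq; exact h3 p hp⟩

lemma Std.eq_of_label {T : DominoTableau} (h : Std T) {p q : ℕ × Domino} (hp : p ∈ T) (hq : q ∈ T)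
    (e : p.1 = q.1) : p = q := by
  induction h with
  | nil => simp at hp
  | snoc h1 h2 h3 h4 ih =>
    rw [List.mem_append, List.mem_singleton] at hp hq
    rcases hp with hp | rfl <;> rcases hq with hq | rfl
    · exact ih hp hq
    · exact absurd e (h3 p hp).ne
    · exact absurd e.symm (h3 q hq).ne
    · rfl

lemma Std.eq_of_square {T : DominoTableau} (h : Std T) {p q : ℕ × Domino} (hp : p ∈ T) (hq : q ∈ T)
    {s : Square} (h1 : s ∈ p.2.squares) (h2 : s ∈ q.2.squares) : p = q := by
  induction h with
  | nil => simp at hp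
  | snoc h1' h2' h3 h4 ih =>
    rw [List.mem_append, List.mem_singleton] at hp hq
    rcases hp with hp | rfl <;> rcases hq with hq | rfl
    · exact ih hp hq
    · exact absurd (mem_shape.2 ⟨p, hp, h1⟩) (h4.notMem h2)
    · exact absurd (mem_shape.2 ⟨q, hq, h2⟩) (h4.notMem h1)
    · rfl

/-- The squares present when `p` is added form a Young diagram and carry labels at most that of `p`.
-/
lemma Std.mono {T : DominoTableau} (h : Std T) {p : ℕ × Domino} (hp : p ∈ T) {x y x' y' : ℕ}
    (hs : (x, y) ∈ p.2.squares) (h1 : 1 ≤ x') (h2 : 1 ≤ y') (h3 : x' ≤ x) (h4 : y' ≤ y) :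
    ∃ q ∈ T, q.1 ≤ p.1 ∧ (x', y') ∈ q.2.squares := by
  induction h with
  | nil => simp at hp
  | @snoc T k d h1' h2' h3' h4' ih =>
    rw [List.mem_append, List.mem_singleton] at hp
    rcases hp with hp | rfl
    · obtain ⟨q, hq, hh⟩ := ih hp
      exact ⟨q, List.mem_append_left _ hq, hh⟩
    · have := h4'.2.down (Finset.mem_union_right _ hs) h1 h2 h3 h4
      rw [Finset.mem_union, mem_shape] at this
      rcases this with ⟨q, hq, hh⟩ | hh
      · exact ⟨q, List.mem_append_left _ hq, (h3' q hq).le, hh⟩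
      · exact ⟨(k, d), by simp, le_rfl, hh⟩

lemma Std.coord_pos {T : DominoTableau} (h : Std T) {p : ℕ × Domino} (hp : p ∈ T) {x y : ℕ}
    (hs : (x, y) ∈ p.2.squares) : 1 ≤ x ∧ 1 ≤ y := by
  have := h.young x y (mem_shape.2 ⟨p, hp, hs⟩)
  exact ⟨this.1, this.2.1⟩

lemma Std.card_shape {T : DominoTableau} (h : Std T) : (shape T).card = 2 * T.length := by
  induction h with
  | nil => simp [shape]
  | snoc h1 h2 h3 h4 ih =>
    rw [shape_snoc, Finset.card_union_of_disjoint h4.1.symm, ih, domino_card]; simp; ring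

/-- A criterion for being standard. -/
lemma std_of_local {T : DominoTableau} (hpw : T.Pairwise fun p q => p.1 < q.1)
    (hpos : ∀ p ∈ T, 1 ≤ p.1) (hc : ∀ p ∈ T, ∀ x y, (x, y) ∈ p.2.squares → 1 ≤ x ∧ 1 ≤ y)
    (hd : ∀ p ∈ T, ∀ q ∈ T, ∀ s, s ∈ p.2.squares → s ∈ q.2.squares → p = q)
    (hl : ∀ p ∈ T, ∀ x y, (x, y) ∈ p.2.squares → 2 ≤ y →
      ∃ q ∈ T, q.1 ≤ p.1 ∧ (x, y - 1) ∈ q.2.squares)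
    (hu : ∀ p ∈ T, ∀ x y, (x, y) ∈ p.2.squares → 2 ≤ x →
      ∃ q ∈ T, q.1 ≤ p.1 ∧ (x - 1, y) ∈ q.2.squares) : Std T := by
  induction T using List.reverseRecOn with
  | nil => exact Std.nil
  | append_singleton T p ih =>
    obtain ⟨k, d⟩ := p
    rw [List.pairwise_append] at hpw
    have hlt : ∀ q ∈ T, q.1 < k := fun q hq => hpw.2.2 q hq _ (List.mem_singleton_self _)
    have hin : ∀ q ∈ T, q ∈ T ++ [(k, d)] := fun q hq => List.mem_append_left _ hq
    have hk : (k, d) ∈ T ++ [(k, d)] := by simp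
    -- The neighbours provided by `hl` and `hu` have labels at most that of a domino of `T`, hence
    -- less than `k`; so both hypotheses restrict to `T`.
    have hT : Std T := by
      refine ih hpw.1 (fun q hq => hpos q (hin q hq)) (fun q hq => hc q (hin q hq))
        (fun p hp q hq => hd p (hin p hp) q (hin q hq)) ?_ ?_
      · intro p hp x y hs hy
        obtain ⟨q, hq, h1, h2⟩ := hl p (hin p hp) x y hs hy
        rw [List.mem_append, List.mem_singleton] at hq
        rcases hq with hq | rfl
        · exact ⟨q, hq, h1, h2⟩
        · exact absurd (hlt p hp) (not_lt.2 h1)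
      · intro p hp x y hs hy
        obtain ⟨q, hq, h1, h2⟩ := hu p (hin p hp) x y hs hy
        rw [List.mem_append, List.mem_singleton] at hq
        rcases hq with hq | rfl
        · exact ⟨q, hq, h1, h2⟩
        · exact absurd (hlt p hp) (not_lt.2 h1)
    refine Std.snoc hT (hpos _ hk) hlt ⟨?_, ?_⟩
    · rw [Finset.disjoint_left]
      intro s hs hs'
      obtain ⟨q, hq, hsq⟩ := mem_shape.1 hs'
      have := hd _ (hin q hq) _ hk s hsq hs
      have h2 := hlt q hq
      rw [this] at h2; exact lt_irrefl _ h2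
    · rw [← shape_snoc T (k, d)]
      -- One step to the left or upwards at a time, by induction on the sum of the coordinates.
      have key : ∀ n x y, x + y = n → (x, y) ∈ shape (T ++ [(k, d)]) → ∀ x' y', 1 ≤ x' → 1 ≤ y' →
          x' ≤ x → y' ≤ y → (x', y') ∈ shape (T ++ [(k, d)]) := by
        intro n
        induction n with
        | zero => intro x y h _ x' y' _ _ _ _; omega
        | succ n ihn =>
          intro x y hn hm x' y' h1 h2 h3 h4
          obtain ⟨p, hp, hs⟩ := mem_shape.1 hm
          by_cases hx : x' = x
          · by_cases hy : y' = y
            · subst hx hy; exact hm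
            · obtain ⟨q, hq, _, hqs⟩ := hl p hp x y hs (by omega)
              exact ihn x (y - 1) (by omega) (mem_shape.2 ⟨q, hq, hqs⟩) x' y' h1 h2 (by omega)
                (by omega)
          · obtain ⟨q, hq, _, hqs⟩ := hu p hp x y hs (by omega)
            exact ihn (x - 1) y (by omega) (mem_shape.2 ⟨q, hq, hqs⟩) x' y' h1 h2 (by omega)
                (by omega)
      intro x y hm
      obtain ⟨p, hp, hs⟩ := mem_shape.1 hm
      exact ⟨(hc p hp x y hs).1, (hc p hp x y hs).2, key _ x y rfl hm⟩

/-! ### Labels of squares -/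

/-- A number larger than all labels of `T`. -/
def labelBound (T : DominoTableau) : ℕ := (T.map Prod.fst).sum + 1

/-- The label of a square: `0` in row or column `0`, and `labelBound T` outside `T`. -/
def lab (T : DominoTableau) (x y : ℕ) : ℕ :=
  if x = 0 ∨ y = 0 then 0 else
    match T.find? fun p => decide ((x, y) ∈ p.2.squares) with
    | some p => p.1
    | none => labelBound T

lemma lt_labelBound {T : DominoTableau} {p : ℕ × Domino} (hp : p ∈ T) : p.1 < labelBound T :=
  Nat.lt_succ_of_le (List.single_le_sum (fun _ _ => Nat.zero_le _) _ (List.mem_map_of_mem hp))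

lemma lab_zero_row (T : DominoTableau) (y : ℕ) : lab T 0 y = 0 := by simp [lab]

lemma lab_zero_col (T : DominoTableau) (x : ℕ) : lab T x 0 = 0 := by simp [lab]

lemma Std.lab_eq {T : DominoTableau} (h : Std T) {p : ℕ × Domino} (hp : p ∈ T) {x y : ℕ}
    (hs : (x, y) ∈ p.2.squares) : lab T x y = p.1 := by
  have hpos := h.coord_pos hp hs
  unfold lab
  rw [if_neg (by omega)]
  cases hf : T.find? fun p => decide ((x, y) ∈ p.2.squares) with
  | none =>
    rw [List.find?_eq_none] at hf
    exact absurd hs (by simpa using hf p hp)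
  | some q =>
    have h1 := List.find?_some hf
    have h2 := List.mem_of_find?_eq_some hf
    rw [h.eq_of_square h2 hp (by simpa using h1) hs]

lemma lab_of_notMem {T : DominoTableau} {x y : ℕ} (hx : 1 ≤ x) (hy : 1 ≤ y)
    (h : (x, y) ∉ shape T) : lab T x y = labelBound T := by
  unfold lab
  rw [if_neg (by omega)]
  cases hf : T.find? fun p => decide ((x, y) ∈ p.2.squares) with
  | none => rfl
  | some q =>
    have h1 := List.find?_some hf
    have h2 := List.mem_of_find?_eq_some hf
    exact absurd (mem_shape.2 ⟨q, h2, by simpa using h1⟩) h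

lemma Std.exists_of_lab {T : DominoTableau} (h : Std T) {x y : ℕ} (hx : 1 ≤ x) (hy : 1 ≤ y)
    (hl : lab T x y < labelBound T) : ∃ p ∈ T, p.1 = lab T x y ∧ (x, y) ∈ p.2.squares := by
  by_cases hm : (x, y) ∈ shape T
  · obtain ⟨p, hp, hs⟩ := mem_shape.1 hm
    exact ⟨p, hp, (h.lab_eq hp hs).symm, hs⟩
  · rw [lab_of_notMem hx hy hm] at hl; exact absurd hl (lt_irrefl _)

lemma Std.lab_le_bound {T : DominoTableau} (h : Std T) (x y : ℕ) : lab T x y ≤ labelBound T := by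
  by_cases h0 : x = 0 ∨ y = 0
  · rcases h0 with rfl | rfl
    · simp [lab_zero_row]
    · simp [lab_zero_col]
  · by_cases hm : (x, y) ∈ shape T
    · obtain ⟨p, hp, hs⟩ := mem_shape.1 hm
      rw [h.lab_eq hp hs]; exact (lt_labelBound hp).le
    · rw [lab_of_notMem (by omega) (by omega) hm]

/-- The values 0 on the border and `labelBound T` outside the shape make this hold on all of ℕ × ℕ,
without side conditions. -/
lemma Std.lab_mono {T : DominoTableau} (h : Std T) {x y x' y' : ℕ} (hx : x' ≤ x) (hy : y' ≤ y) :
    lab T x' y' ≤ lab T x y := by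
  by_cases h0 : x' = 0 ∨ y' = 0
  · rcases h0 with rfl | rfl
    · simp [lab_zero_row]
    · simp [lab_zero_col]
  · by_cases hm : (x, y) ∈ shape T
    · obtain ⟨p, hp, hs⟩ := mem_shape.1 hm
      obtain ⟨q, hq, hle, hqs⟩ := h.mono hp hs (x' := x') (y' := y') (by omega) (by omega) hx hy
      rw [h.lab_eq hp hs, h.lab_eq hq hqs]; exact hle
    · rw [lab_of_notMem (x := x) (y := y) (by omega) (by omega) hm]
      exact h.lab_le_bound _ _

/-- Replaces the definition by an inequality between numbers. The label compared with is one that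
occurs in `T`, so it lies strictly between the two artificial values 0 and `labelBound T`. -/
lemma Std.labelLT_iff {T : DominoTableau} (h : Std T) {p : ℕ × Domino} (hp : p ∈ T) (x y : ℕ) :
    LabelLT T (x, y) p.1 ↔ lab T x y < p.1 := by
  have hpos := h.pos hp
  constructor
  · rintro (h0 | h0 | ⟨q, hq, hs, hlt⟩)
    · simp only at h0; subst h0; rw [lab_zero_row]; exact hpos
    · simp only at h0; subst h0; rw [lab_zero_col]; exact hpos
    · rw [h.lab_eq hq hs]; exact hlt
  · intro hl
    by_cases h0 : x = 0 ∨ y = 0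
    · rcases h0 with h0 | h0
      · exact Or.inl h0
      · exact Or.inr (Or.inl h0)
    · obtain ⟨q, hq, he, hs⟩ := h.exists_of_lab (x := x) (y := y) (by omega) (by omega)
        (hl.trans (lt_labelBound hp))
      exact Or.inr (Or.inr ⟨q, hq, hs, by omega⟩)

lemma Std.mem_shape_of_lab {T : DominoTableau} (h : Std T) {p : ℕ × Domino} (hp : p ∈ T) {x y : ℕ}
    (hx : 1 ≤ x) (hy : 1 ≤ y) (hl : lab T x y ≤ p.1) : (x, y) ∈ shape T := by
  obtain ⟨q, hq, _, hs⟩ := h.exists_of_lab hx hy (hl.trans_lt (lt_labelBound hp))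
  exact mem_shape.2 ⟨q, hq, hs⟩

end SOStar
namespace SOStar

/-! ### Fixed and variable squares -/

lemma fixedSquare_even (d : Domino) : (d.fixedSquare.1 + d.fixedSquare.2) % 2 = 0 := by
  obtain ⟨r, c, _ | _⟩ := d <;>
    by_cases h : (r + c) % 2 = 0 <;>
      simp [Domino.fixedSquare, Domino.first, Domino.second, h] <;> omega

lemma variableSquare_odd (d : Domino) : (d.variableSquare.1 + d.variableSquare.2) % 2 = 1 := by
  obtain ⟨r, c, _ | _⟩ := d <;>
    by_cases h : (r + c) % 2 = 0 <;>
      simp [Domino.variableSquare, Domino.first, Domino.second, h] <;> omega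

lemma mem_squares_iff {d : Domino} {s : Square} :
    s ∈ d.squares ↔ s = d.fixedSquare ∨ s = d.variableSquare := by
  unfold Domino.squares Domino.fixedSquare Domino.variableSquare
  split <;> simp [or_comm]

lemma fixedSquare_mem (d : Domino) : d.fixedSquare ∈ d.squares := mem_squares_iff.2 (Or.inl rfl)

lemma variableSquare_mem (d : Domino) : d.variableSquare ∈ d.squares :=
  mem_squares_iff.2 (Or.inr rfl)

lemma eq_fixedSquare_of_mem {d : Domino} {x y : ℕ} (h : (x, y) ∈ d.squares)
    (hp : (x + y) % 2 = 0) : d.fixedSquare = (x, y) := by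
  rcases mem_squares_iff.1 h with h | h
  · exact h.symm
  · have := variableSquare_odd d; rw [← h] at this; simp only at this; omega

lemma eq_variableSquare_of_mem {d : Domino} {x y : ℕ} (h : (x, y) ∈ d.squares)
    (hp : (x + y) % 2 = 1) : d.variableSquare = (x, y) := by
  rcases mem_squares_iff.1 h with h | h
  · have := fixedSquare_even d; rw [← h] at this; simp only at this; omega
  · exact h.symm

lemma domino_cases (d : Domino) : ∃ i j, d.fixedSquare = (i, j) ∧ (i + j) % 2 = 0 ∧
    ((d = ⟨i, j, false⟩ ∧ d.variableSquare = (i, j + 1)) ∨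
     (d = ⟨i, j, true⟩ ∧ d.variableSquare = (i + 1, j)) ∨
     (1 ≤ i ∧ d = ⟨i - 1, j, true⟩ ∧ d.variableSquare = (i - 1, j)) ∨
     (1 ≤ j ∧ d = ⟨i, j - 1, false⟩ ∧ d.variableSquare = (i, j - 1))) := by
  obtain ⟨r, c, _ | _⟩ := d <;> by_cases h : (r + c) % 2 = 0
  · exact ⟨r, c, by simp [Domino.fixedSquare, Domino.first, h], h, Or.inl
      ⟨rfl, by simp [Domino.variableSquare, Domino.second, h]⟩⟩
  · exact ⟨r, c + 1, by simp [Domino.fixedSquare, Domino.second, h], by omega,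
      Or.inr (Or.inr (Or.inr ⟨by omega, by simp, by simp [Domino.variableSquare, Domino.first, h]⟩))⟩
  · exact ⟨r, c, by simp [Domino.fixedSquare, Domino.first, h], h, Or.inr (Or.inl
      ⟨rfl, by simp [Domino.variableSquare, Domino.second, h]⟩)⟩
  · exact ⟨r + 1, c, by simp [Domino.fixedSquare, Domino.second, h], by omega,
      Or.inr (Or.inr (Or.inl ⟨by omega, by simp, by simp [Domino.variableSquare, Domino.first, h]⟩))⟩

lemma fixed_h {i j : ℕ} (h : (i + j) % 2 = 0) : (⟨i, j, false⟩ : Domino).fixedSquare = (i, j) := by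
  simp [Domino.fixedSquare, Domino.first, h]

lemma var_h {i j : ℕ} (h : (i + j) % 2 = 0) :
    (⟨i, j, false⟩ : Domino).variableSquare = (i, j + 1) := by
  simp [Domino.variableSquare, Domino.second, h]

lemma fixed_v {i j : ℕ} (h : (i + j) % 2 = 0) : (⟨i, j, true⟩ : Domino).fixedSquare = (i, j) := by
  simp [Domino.fixedSquare, Domino.first, h]

lemma var_v {i j : ℕ} (h : (i + j) % 2 = 0) :
    (⟨i, j, true⟩ : Domino).variableSquare = (i + 1, j) := by
  simp [Domino.variableSquare, Domino.second, h]

lemma fixed_h' {i j : ℕ} (h : (i + j) % 2 = 1) :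
    (⟨i, j, false⟩ : Domino).fixedSquare = (i, j + 1) := by
  simp [Domino.fixedSquare, Domino.second, h]

lemma var_h' {i j : ℕ} (h : (i + j) % 2 = 1) :
    (⟨i, j, false⟩ : Domino).variableSquare = (i, j) := by
  simp [Domino.variableSquare, Domino.first, h]

lemma fixed_v' {i j : ℕ} (h : (i + j) % 2 = 1) :
    (⟨i, j, true⟩ : Domino).fixedSquare = (i + 1, j) := by
  simp [Domino.fixedSquare, Domino.second, h]

lemma var_v' {i j : ℕ} (h : (i + j) % 2 = 1) :
    (⟨i, j, true⟩ : Domino).variableSquare = (i, j) := by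
  simp [Domino.variableSquare, Domino.first, h]

lemma domino_ext_fixed_var {d d' : Domino} (h1 : d.fixedSquare = d'.fixedSquare)
    (h2 : d.variableSquare = d'.variableSquare) : d = d' := by
  obtain ⟨i, j, e1, e2, hc⟩ := domino_cases d
  obtain ⟨i', j', e1', e2', hc'⟩ := domino_cases d'
  rw [e1, e1', Prod.mk.injEq] at h1
  obtain ⟨rfl, rfl⟩ := h1
  rcases hc with ⟨hd, hv⟩ | ⟨hd, hv⟩ | ⟨_, hd, hv⟩ | ⟨_, hd, hv⟩ <;>
    rcases hc' with ⟨hd', hv'⟩ | ⟨hd', hv'⟩ | ⟨_, hd', hv'⟩ | ⟨_, hd', hv'⟩ <;>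
      rw [hv, hv', Prod.mk.injEq] at h2 <;> first | (rw [hd, hd']; done) | omega

/-! ### The two dominos that may occupy a variable square -/

/-- The larger of the labels to the left of and above a square. -/
def nwLabel (T : DominoTableau) (s : Square) : ℕ := max (lab T (s.1 - 1) s.2) (lab T s.1 (s.2 - 1))

/-- The smaller of the labels to the right of and below a square. -/
def seLabel (T : DominoTableau) (s : Square) : ℕ := min (lab T (s.1 + 1) s.2) (lab T s.1 (s.2 + 1))

/-- The parity that is constant on cycles. -/
def cycleParity (T : DominoTableau) (p : ℕ × Domino) : ℕ :=
  (p.2.variableSquare.1 + if p.1 = nwLabel T p.2.variableSquare then 1 else 0) % 2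

/-- The variable square after moving. -/
def newSquare (T : DominoTableau) (p : ℕ × Domino) : Square := (moved T p).variableSquare

lemma Std.lab_fixed {T : DominoTableau} (h : Std T) {p : ℕ × Domino} (hp : p ∈ T) {i j : ℕ}
    (hf : p.2.fixedSquare = (i, j)) : lab T i j = p.1 :=
  h.lab_eq hp (hf ▸ fixedSquare_mem _)

lemma Std.lab_var {T : DominoTableau} (h : Std T) {p : ℕ × Domino} (hp : p ∈ T) {i j : ℕ}
    (hf : p.2.variableSquare = (i, j)) : lab T i j = p.1 :=
  h.lab_eq hp (hf ▸ variableSquare_mem _)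

/-- Distinct squares with the label of `p` are its fixed and its variable square. -/
lemma Std.square_of_lab {T : DominoTableau} (h : Std T) {p : ℕ × Domino} (hp : p ∈ T) {x y : ℕ}
    (hl : lab T x y = p.1) : (x, y) ∈ p.2.squares := by
  have hpos := h.pos hp
  have hx : 1 ≤ x := by
    rcases Nat.eq_zero_or_pos x with rfl | h0
    · rw [lab_zero_row] at hl; omega
    · exact h0
  have hy : 1 ≤ y := by
    rcases Nat.eq_zero_or_pos y with rfl | h0
    · rw [lab_zero_col] at hl; omega
    · exact h0
  obtain ⟨q, hq, he, hs⟩ := h.exists_of_lab hx hy (hl ▸ lt_labelBound hp)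
  rwa [← h.eq_of_label hq hp (he.trans hl)]

lemma Std.fixed_of_lab {T : DominoTableau} (h : Std T) {p : ℕ × Domino} (hp : p ∈ T) {x y : ℕ}
    (hl : lab T x y = p.1) (he : (x + y) % 2 = 0) : p.2.fixedSquare = (x, y) :=
  eq_fixedSquare_of_mem (h.square_of_lab hp hl) he

/-- The structure of a domino and of its move. -/
lemma Std.move_spec {T : DominoTableau} (h : Std T) {p : ℕ × Domino} (hp : p ∈ T) :
    ∃ i j, p.2.fixedSquare = (i, j) ∧ (i + j) % 2 = 0 ∧ 1 ≤ i ∧ 1 ≤ j ∧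
      (moved T p).fixedSquare = (i, j) ∧
      ((((lab T (i + 1) (j - 1) < p.1 ∧ p.2.variableSquare = (i + 1, j)) ∨
          (p.1 < lab T (i + 1) (j - 1) ∧ 2 ≤ j ∧ p.2.variableSquare = (i, j - 1))) ∧
        ((lab T (i - 1) (j + 1) < p.1 ∧ newSquare T p = (i, j + 1)) ∨
          (p.1 < lab T (i - 1) (j + 1) ∧ 2 ≤ i ∧ newSquare T p = (i - 1, j)))) ∨
       (((lab T (i - 1) (j + 1) < p.1 ∧ p.2.variableSquare = (i, j + 1)) ∨
          (p.1 < lab T (i - 1) (j + 1) ∧ 2 ≤ i ∧ p.2.variableSquare = (i - 1, j))) ∧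
        ((lab T (i + 1) (j - 1) < p.1 ∧ newSquare T p = (i + 1, j)) ∨
          (p.1 < lab T (i + 1) (j - 1) ∧ 2 ≤ j ∧ newSquare T p = (i, j - 1))))) := by
  -- Comparison with the label at (i+1, j-1) selects the square below or to the left of (i, j);
  -- comparison with the label at (i-1, j+1) selects the one to the right or above. The domino
  -- occupies one of the two selected squares and moves to the other.
  obtain ⟨i, j, hf, he, hc⟩ := domino_cases p.2
  have hpos := h.coord_pos hp (hf ▸ fixedSquare_mem _)
  have hlf := h.lab_fixed hp hf
  have hk := h.pos hp
  -- These squares have even coordinate sum, so carrying the label of `p` would make them its fixed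
  -- square. Both comparisons are therefore strict.
  have hsw : lab T (i + 1) (j - 1) ≠ p.1 := by
    intro e
    have := h.fixed_of_lab hp e (by omega)
    rw [hf, Prod.mk.injEq] at this; omega
  have hne : lab T (i - 1) (j + 1) ≠ p.1 := by
    intro e
    have := h.fixed_of_lab hp e (by omega)
    rw [hf, Prod.mk.injEq] at this; omega
  have hvpos : 1 ≤ p.2.variableSquare.1 ∧ 1 ≤ p.2.variableSquare.2 :=
    h.coord_pos hp (variableSquare_mem _)
  -- the move to the lower left
  have low : p.2.variableSquare = (i, j + 1) ∨ p.2.variableSquare = (i - 1, j) →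
      (moved T p).fixedSquare = (i, j) ∧
      ((lab T (i + 1) (j - 1) < p.1 ∧ newSquare T p = (i + 1, j)) ∨
          (p.1 < lab T (i + 1) (j - 1) ∧ 2 ≤ j ∧ newSquare T p = (i, j - 1))) := by
    intro hv
    by_cases hl : lab T (i + 1) (j - 1) < p.1
    · have : moved T p = ⟨i, j, true⟩ := by
        simp only [moved, hf]
        rw [if_pos hv, if_pos ((h.labelLT_iff hp _ _).2 hl)]
      rw [newSquare, this]
      exact ⟨fixed_v he, Or.inl ⟨hl, var_v he⟩⟩
    · have : moved T p = ⟨i, j - 1, false⟩ := by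
        simp only [moved, hf]
        rw [if_pos hv, if_neg (fun hh => hl ((h.labelLT_iff hp _ _).1 hh))]
      have hj : 2 ≤ j := by
        by_contra hj
        have : j - 1 = 0 := by omega
        rw [this, lab_zero_col] at hl; omega
      rw [newSquare, this]
      refine ⟨?_, Or.inr ⟨by omega, hj, var_h' (by omega)⟩⟩
      rw [fixed_h' (by omega)]; congr 1; omega
  have high : ¬ (p.2.variableSquare = (i, j + 1) ∨ p.2.variableSquare = (i - 1, j)) →
      (moved T p).fixedSquare = (i, j) ∧
      ((lab T (i - 1) (j + 1) < p.1 ∧ newSquare T p = (i, j + 1)) ∨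
          (p.1 < lab T (i - 1) (j + 1) ∧ 2 ≤ i ∧ newSquare T p = (i - 1, j))) := by
    intro hv
    by_cases hl : lab T (i - 1) (j + 1) < p.1
    · have : moved T p = ⟨i, j, false⟩ := by
        simp only [moved, hf]
        rw [if_neg hv, if_pos ((h.labelLT_iff hp _ _).2 hl)]
      rw [newSquare, this]
      exact ⟨fixed_h he, Or.inl ⟨hl, var_h he⟩⟩
    · have : moved T p = ⟨i - 1, j, true⟩ := by
        simp only [moved, hf]
        rw [if_neg hv, if_neg (fun hh => hl ((h.labelLT_iff hp _ _).1 hh))]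
      have hj : 2 ≤ i := by
        by_contra hj
        have : i - 1 = 0 := by omega
        rw [this, lab_zero_row] at hl; omega
      rw [newSquare, this]
      refine ⟨?_, Or.inr ⟨by omega, hj, var_v' (by omega)⟩⟩
      rw [fixed_v' (by omega)]; congr 1; omega
  rcases hc with ⟨hd, hv⟩ | ⟨hd, hv⟩ | ⟨_, hd, hv⟩ | ⟨_, hd, hv⟩
  · obtain ⟨h1, h2⟩ := low (Or.inl hv)
    refine ⟨i, j, hf, he, hpos.1, hpos.2, h1, Or.inr ⟨Or.inl ⟨?_, hv⟩, h2⟩⟩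
    have := h.lab_mono (x := i) (y := j + 1) (x' := i - 1) (y' := j + 1) (by omega) (by omega)
    rw [h.lab_var hp hv] at this; omega
  · obtain ⟨h1, h2⟩ := high (by rw [hv]; simp only [Prod.mk.injEq]; omega)
    refine ⟨i, j, hf, he, hpos.1, hpos.2, h1, Or.inl ⟨Or.inl ⟨?_, hv⟩, h2⟩⟩
    have := h.lab_mono (x := i + 1) (y := j) (x' := i + 1) (y' := j - 1) (by omega) (by omega)
    rw [h.lab_var hp hv] at this; omega
  · obtain ⟨h1, h2⟩ := low (Or.inr hv)
    rw [hv] at hvpos; simp only at hvpos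
    refine ⟨i, j, hf, he, hpos.1, hpos.2, h1, Or.inr ⟨Or.inr ⟨?_, by omega, hv⟩, h2⟩⟩
    have := h.lab_mono (x := i - 1) (y := j + 1) (x' := i - 1) (y' := j) (by omega) (by omega)
    rw [h.lab_var hp hv] at this; omega
  · rw [hv] at hvpos; simp only at hvpos
    obtain ⟨h1, h2⟩ := high (by rw [hv]; simp only [Prod.mk.injEq]; omega)
    refine ⟨i, j, hf, he, hpos.1, hpos.2, h1, Or.inl ⟨Or.inr ⟨?_, by omega, hv⟩, h2⟩⟩
    have := h.lab_mono (x := i + 1) (y := j - 1) (x' := i) (y' := j - 1) (by omega) (by omega)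
    rw [h.lab_var hp hv] at this; omega

lemma Std.new_fixed {T : DominoTableau} (h : Std T) {p : ℕ × Domino} (hp : p ∈ T) :
    (moved T p).fixedSquare = p.2.fixedSquare := by
  obtain ⟨i, j, hf, _, _, _, h1, _⟩ := h.move_spec hp
  rw [hf, h1]

lemma Std.new_odd (T : DominoTableau) (p : ℕ × Domino) :
    ((newSquare T p).1 + (newSquare T p).2) % 2 = 1 := variableSquare_odd _

lemma Std.new_pos {T : DominoTableau} (h : Std T) {p : ℕ × Domino} (hp : p ∈ T) :
    1 ≤ (newSquare T p).1 ∧ 1 ≤ (newSquare T p).2 := by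
  obtain ⟨i, j, hf, he, hi, hj, _, hc⟩ := h.move_spec hp
  rcases hc with ⟨_, ⟨_, hn⟩ | ⟨_, _, hn⟩⟩ | ⟨_, ⟨_, hn⟩ | ⟨_, _, hn⟩⟩ <;> rw [hn] <;> simp only <;> omega

lemma Std.new_ne_var {T : DominoTableau} (h : Std T) {p : ℕ × Domino} (hp : p ∈ T) :
    newSquare T p ≠ p.2.variableSquare := by
  obtain ⟨i, j, hf, he, hi, hj, _, hc⟩ := h.move_spec hp
  rcases hc with ⟨⟨_, hv⟩ | ⟨_, _, hv⟩, ⟨_, hn⟩ | ⟨_, _, hn⟩⟩ | ⟨⟨_, hv⟩ | ⟨_, _, hv⟩, ⟨_, hn⟩ | ⟨_, _, hn⟩⟩ <;>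
    rw [hn, hv] <;> simp only [ne_eq, Prod.mk.injEq] <;> omega

/-- Adjacent squares: the label of `p` is the upper left or the lower right label of a square. -/
lemma Std.var_label {T : DominoTableau} (h : Std T) {p : ℕ × Domino} (hp : p ∈ T) :
    p.1 = nwLabel T p.2.variableSquare ∨ p.1 = seLabel T p.2.variableSquare := by
  obtain ⟨i, j, hf, he, hi, hj, _, hc⟩ := h.move_spec hp
  have hl := h.lab_fixed hp hf
  rcases hc with ⟨⟨_, hv⟩ | ⟨_, _, hv⟩, _⟩ | ⟨⟨_, hv⟩ | ⟨_, _, hv⟩, _⟩ <;> rw [hv]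
  · left; simp only [nwLabel, Nat.add_sub_cancel, hl]; omega
  · right; simp only [seLabel, show j - 1 + 1 = j by omega, hl]; omega
  · left; simp only [nwLabel, Nat.add_sub_cancel, hl]; omega
  · right; simp only [seLabel, show i - 1 + 1 = i by omega, hl]; omega

/-- For a new square to the right of or below the fixed square, the other term of the maximum is the
label that the comparison found smaller; for one above or to the left, the other term of the minimum
is the label found larger. -/
lemma Std.new_label {T : DominoTableau} (h : Std T) {p : ℕ × Domino} (hp : p ∈ T) :
    p.1 = nwLabel T (newSquare T p) ∨ p.1 = seLabel T (newSquare T p) := by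
  obtain ⟨i, j, hf, he, hi, hj, _, hc⟩ := h.move_spec hp
  have hl := h.lab_fixed hp hf
  rcases hc with ⟨_, ⟨_, hv⟩ | ⟨_, _, hv⟩⟩ | ⟨_, ⟨_, hv⟩ | ⟨_, _, hv⟩⟩ <;> rw [hv]
  · left; simp only [nwLabel, Nat.add_sub_cancel, hl]; omega
  · right; simp only [seLabel, show i - 1 + 1 = i by omega, hl]; omega
  · left; simp only [nwLabel, Nat.add_sub_cancel, hl]; omega
  · right; simp only [seLabel, show j - 1 + 1 = j by omega, hl]; omega

/-- If the label of `p` is the upper left label of a variable square, the fixed square of `p` lies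
above it or to the left of it. -/
lemma Std.fixed_of_nw {T : DominoTableau} (h : Std T) {p : ℕ × Domino} (hp : p ∈ T) {x y : ℕ}
    (ho : (x + y) % 2 = 1) (hl : p.1 = nwLabel T (x, y)) :
    (2 ≤ x ∧ p.2.fixedSquare = (x - 1, y) ∧ lab T x (y - 1) < p.1) ∨
      (2 ≤ y ∧ p.2.fixedSquare = (x, y - 1) ∧ lab T (x - 1) y < p.1) := by
  have hpos := h.pos hp
  simp only [nwLabel] at hl
  have h1 : lab T (x - 1) y = p.1 → 2 ≤ x ∧ p.2.fixedSquare = (x - 1, y) := by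
    intro e
    have hx : 2 ≤ x := by
      by_contra hx
      have : x - 1 = 0 := by omega
      rw [this, lab_zero_row] at e; omega
    exact ⟨hx, h.fixed_of_lab hp e (by omega)⟩
  have h2 : lab T x (y - 1) = p.1 → 2 ≤ y ∧ p.2.fixedSquare = (x, y - 1) := by
    intro e
    have hx : 2 ≤ y := by
      by_contra hx
      have : y - 1 = 0 := by omega
      rw [this, lab_zero_col] at e; omega
    exact ⟨hx, h.fixed_of_lab hp e (by omega)⟩
  by_cases e1 : lab T (x - 1) y = p.1
  · by_cases e2 : lab T x (y - 1) = p.1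
    · have a := (h1 e1); have b := (h2 e2)
      rw [a.2, Prod.mk.injEq] at b; omega
    · left; exact ⟨(h1 e1).1, (h1 e1).2, by omega⟩
  · have e2 : lab T x (y - 1) = p.1 := by omega
    right; exact ⟨(h2 e2).1, (h2 e2).2, by omega⟩

lemma Std.fixed_of_se {T : DominoTableau} (h : Std T) {p : ℕ × Domino} (hp : p ∈ T) {x y : ℕ}
    (ho : (x + y) % 2 = 1) (hl : p.1 = seLabel T (x, y)) :
    (p.2.fixedSquare = (x + 1, y) ∧ p.1 < lab T x (y + 1)) ∨
      (p.2.fixedSquare = (x, y + 1) ∧ p.1 < lab T (x + 1) y) := by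
  simp only [seLabel] at hl
  have h1 : lab T (x + 1) y = p.1 → p.2.fixedSquare = (x + 1, y) :=
    fun e => h.fixed_of_lab hp e (by omega)
  have h2 : lab T x (y + 1) = p.1 → p.2.fixedSquare = (x, y + 1) :=
    fun e => h.fixed_of_lab hp e (by omega)
  by_cases e1 : lab T (x + 1) y = p.1
  · by_cases e2 : lab T x (y + 1) = p.1
    · have a := (h1 e1); have b := (h2 e2)
      rw [a, Prod.mk.injEq] at b; omega
    · left; exact ⟨h1 e1, by omega⟩
  · have e2 : lab T x (y + 1) = p.1 := by omega
    right; exact ⟨h2 e2, by omega⟩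

/-- The fixed square of `p` cannot lie both before and after the square (x, y). -/
lemma Std.not_nw_of_se {T : DominoTableau} (h : Std T) {p : ℕ × Domino} (hp : p ∈ T) {x y : ℕ}
    (ho : (x + y) % 2 = 1) (hl : p.1 = seLabel T (x, y)) : p.1 ≠ nwLabel T (x, y) := by
  intro hn
  rcases h.fixed_of_nw hp ho hn with ⟨h1, h2, _⟩ | ⟨h1, h2, _⟩ <;>
    rcases h.fixed_of_se hp ho hl with ⟨h3, _⟩ | ⟨h3, _⟩ <;>
      rw [h2, Prod.mk.injEq] at h3 <;> omega

/-- A variable square with the label of `p` as upper left or lower right label is the old or the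
new variable square of `p`. -/
lemma Std.old_or_new {T : DominoTableau} (h : Std T) {p : ℕ × Domino} (hp : p ∈ T) {x y : ℕ}
    (hx : 1 ≤ x) (hy : 1 ≤ y)
    (ho : (x + y) % 2 = 1) (hl : p.1 = nwLabel T (x, y) ∨ p.1 = seLabel T (x, y)) :
    p.2.variableSquare = (x, y) ∨ newSquare T p = (x, y) := by
  obtain ⟨i, j, hf, he, hi, hj, _, hc⟩ := h.move_spec hp
  have key : (x = i + 1 ∧ y = j ∧ lab T (i + 1) (j - 1) < p.1) ∨
      (x = i ∧ y = j + 1 ∧ lab T (i - 1) (j + 1) < p.1) ∨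
      (x = i - 1 ∧ y = j ∧ p.1 < lab T (i - 1) (j + 1)) ∨
      (x = i ∧ y = j - 1 ∧ p.1 < lab T (i + 1) (j - 1)) := by
    rcases hl with hl | hl
    · rcases h.fixed_of_nw hp ho hl with ⟨h1, h2, h3⟩ | ⟨h1, h2, h3⟩ <;>
        rw [hf, Prod.mk.injEq] at h2 <;> obtain ⟨rfl, rfl⟩ := h2
      · left; exact ⟨by omega, rfl, by rwa [show x - 1 + 1 = x by omega]⟩
      · right; left; exact ⟨rfl, by omega, by rwa [show y - 1 + 1 = y by omega]⟩
    · rcases h.fixed_of_se hp ho hl with ⟨h2, h3⟩ | ⟨h2, h3⟩ <;>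
        rw [hf, Prod.mk.injEq] at h2 <;> obtain ⟨rfl, rfl⟩ := h2
      · right; right; left; exact ⟨by omega, rfl, by rwa [show x + 1 - 1 = x by omega]⟩
      · right; right; right; exact ⟨rfl, by omega, by rwa [show y + 1 - 1 = y by omega]⟩
  rcases hc with ⟨⟨_, hv⟩ | ⟨_, _, hv⟩, ⟨_, hn⟩ | ⟨_, _, hn⟩⟩ | ⟨⟨_, hv⟩ | ⟨_, _, hv⟩, ⟨_, hn⟩ | ⟨_, _, hn⟩⟩ <;>
    rw [hn, hv] <;> simp only [Prod.mk.injEq] <;> omega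

lemma Std.nw_le_lab {T : DominoTableau} (h : Std T) (x y : ℕ) : nwLabel T (x, y) ≤ lab T x y := by
  have h1 := h.lab_mono (x := x) (y := y) (x' := x - 1) (y' := y) (by omega) le_rfl
  have h2 := h.lab_mono (x := x) (y := y) (x' := x) (y' := y - 1) le_rfl (by omega)
  simp only [nwLabel]; omega

lemma Std.lab_le_se {T : DominoTableau} (h : Std T) (x y : ℕ) : lab T x y ≤ seLabel T (x, y) := by
  have h1 := h.lab_mono (x := x + 1) (y := y) (x' := x) (y' := y) (by omega) le_rfl
  have h2 := h.lab_mono (x := x) (y := y + 1) (x' := x) (y' := y) le_rfl (by omega)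
  simp only [seLabel]; omega

/-- Two different dominos with a common candidate: one of them occupies it. -/
lemma Std.occupied {T : DominoTableau} (h : Std T) {p q : ℕ × Domino} (hp : p ∈ T) (hq : q ∈ T)
    (hne : p ≠ q) {x y : ℕ} (hx : 1 ≤ x) (hy : 1 ≤ y) (ho : (x + y) % 2 = 1)
    (hlp : p.1 = nwLabel T (x, y) ∨ p.1 = seLabel T (x, y))
    (hlq : q.1 = nwLabel T (x, y) ∨ q.1 = seLabel T (x, y)) :
    p.2.variableSquare = (x, y) ∨ q.2.variableSquare = (x, y) := by
  have hne' : p.1 ≠ q.1 := fun e => hne (h.eq_of_label hp hq e)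
  have h1 := h.nw_le_lab x y
  have h2 := h.lab_le_se x y
  -- Two different candidates are the upper left and the lower right one, and the label of the
  -- square lies between theirs; so the square belongs to the shape.
  have hlt : lab T x y < labelBound T := by
    have := lt_labelBound hp
    have := lt_labelBound hq
    omega
  obtain ⟨t, ht, htl, hts⟩ := h.exists_of_lab hx hy hlt
  have hv := eq_variableSquare_of_mem hts ho
  have hl := h.var_label ht
  rw [hv] at hl
  have : t.1 = p.1 ∨ t.1 = q.1 := by omega
  rcases this with e | e
  · left; rw [← h.eq_of_label ht hp e]; exact hv
  · right; rw [← h.eq_of_label ht hq e]; exact hv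

/-- Moving all dominos keeps them disjoint. -/
lemma Std.new_injective {T : DominoTableau} (h : Std T) {p q : ℕ × Domino} (hp : p ∈ T)
    (hq : q ∈ T) (he : newSquare T p = newSquare T q) : p = q := by
  by_contra hne
  have hpos := h.new_pos hp
  rcases h.occupied hp hq hne hpos.1 hpos.2 (Std.new_odd T p) (h.new_label hp)
    (by rw [Prod.mk.eta, he]; exact h.new_label hq) with h1 | h1
  · exact h.new_ne_var hp h1.symm
  · rw [Prod.mk.eta, he] at h1; exact h.new_ne_var hq h1.symm

lemma Std.var_injective {T : DominoTableau} (h : Std T) {p q : ℕ × Domino} (hp : p ∈ T)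
    (hq : q ∈ T) (he : p.2.variableSquare = q.2.variableSquare) : p = q :=
  h.eq_of_square hp hq (variableSquare_mem _) (he ▸ variableSquare_mem _)

/-- Fixed squares do not move and have another parity than variable ones. So apart from `p = q` a
link means that `p` moves onto the variable square that `q` occupied, and a cycle is a chain of such
replacements. -/
lemma Std.linked_iff {T : DominoTableau} (h : Std T) {p q : ℕ × Domino} (hp : p ∈ T) (hq : q ∈ T) :
    Linked T p q ↔ p = q ∨ newSquare T p = q.2.variableSquare := by
  unfold Linked
  constructor
  · rintro ⟨_, _, hd⟩
    rw [Finset.not_disjoint_iff] at hd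
    obtain ⟨s, h1, h2⟩ := hd
    have e1 := fixedSquare_even q.2
    have e2 := variableSquare_odd q.2
    rcases mem_squares_iff.1 h1 with h1 | h1
    · rw [h.new_fixed hp] at h1
      exact Or.inl (h.eq_of_square hp hq (h1 ▸ fixedSquare_mem _) h2)
    · change s = newSquare T p at h1
      have e3 := Std.new_odd T p
      rcases mem_squares_iff.1 h2 with h2 | h2
      · rw [← h1, h2] at e3; omega
      · right; rw [← h1, h2]
  · intro hh
    refine ⟨hp, hq, ?_⟩
    rw [Finset.not_disjoint_iff]
    rcases hh with rfl | hh
    · exact ⟨_, h.new_fixed hp ▸ fixedSquare_mem _, fixedSquare_mem _⟩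
    · exact ⟨_, variableSquare_mem _, by
        change newSquare T p ∈ _; rw [hh]; exact variableSquare_mem _⟩

/-! ### The parity of a cycle -/

lemma Std.cycleParity_nw {T : DominoTableau} {p : ℕ × Domino} {x y : ℕ}
    (hv : p.2.variableSquare = (x, y)) (hl : p.1 = nwLabel T (x, y)) :
    cycleParity T p = (x + 1) % 2 := by
  simp only [cycleParity, hv, if_pos hl]

lemma Std.cycleParity_se {T : DominoTableau} (h : Std T) {p : ℕ × Domino} (hp : p ∈ T) {x y : ℕ}
    (hv : p.2.variableSquare = (x, y)) (hl : p.1 = seLabel T (x, y)) :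
    cycleParity T p = x % 2 := by
  have ho := variableSquare_odd p.2
  rw [hv] at ho
  simp only [cycleParity, hv, if_neg (h.not_nw_of_se hp ho hl), add_zero]

/-- Makes the parity computable from the new square as well: the old variable square lies to the
right or above exactly when the new one lies to the left or below. -/
lemma Std.cycleParity_eq {T : DominoTableau} (h : Std T) {p : ℕ × Domino} (hp : p ∈ T) {i j : ℕ}
    (hf : p.2.fixedSquare = (i, j)) :
    cycleParity T p = (i + if p.2.variableSquare = (i, j + 1) ∨ p.2.variableSquare = (i - 1, j)
      then 1 else 0) % 2 := by
  have ho := variableSquare_odd p.2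
  obtain ⟨i', j', hf', he, hi, hj, _, hc⟩ := h.move_spec hp
  rw [hf, Prod.mk.injEq] at hf'
  obtain ⟨rfl, rfl⟩ := hf'
  have hl := h.lab_fixed hp hf
  rcases hc with ⟨⟨_, hv⟩ | ⟨_, _, hv⟩, _⟩ | ⟨⟨_, hv⟩ | ⟨_, _, hv⟩, _⟩
  · rw [Std.cycleParity_nw hv (by simp only [nwLabel, Nat.add_sub_cancel, hl]; omega), hv,
      if_neg (by simp only [Prod.mk.injEq]; omega)]; omega
  · rw [h.cycleParity_se hp hv (by simp only [seLabel, show j - 1 + 1 = j by omega, hl]; omega), hv,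
      if_neg (by simp only [Prod.mk.injEq]; omega)]; omega
  · rw [Std.cycleParity_nw hv (by simp only [nwLabel, Nat.add_sub_cancel, hl]; omega), hv,
      if_pos (by simp)]
  · rw [h.cycleParity_se hp hv (by simp only [seLabel, show i - 1 + 1 = i by omega, hl]; omega), hv,
      if_pos (by simp)]; omega

lemma Std.cycleParity_new_nw {T : DominoTableau} (h : Std T) {p : ℕ × Domino} (hp : p ∈ T)
    {x y : ℕ} (hv : newSquare T p = (x, y)) (hl : p.1 = nwLabel T (x, y)) :
    cycleParity T p = x % 2 := by
  have ho := Std.new_odd T p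
  rw [hv] at ho
  obtain ⟨i, j, hf, he, hi, hj, _, hc⟩ := h.move_spec hp
  rw [h.cycleParity_eq hp hf]
  rcases h.fixed_of_nw hp ho hl with ⟨h1, h2, h3⟩ | ⟨h1, h2, h3⟩ <;>
    rw [hf, Prod.mk.injEq] at h2 <;>
    rcases hc with ⟨⟨_, hv'⟩ | ⟨_, _, hv'⟩, ⟨_, hn⟩ | ⟨_, _, hn⟩⟩ | ⟨⟨_, hv'⟩ | ⟨_, _, hv'⟩, ⟨_, hn⟩ | ⟨_, _, hn⟩⟩ <;>
    rw [hv, Prod.mk.injEq] at hn <;> rw [hv'] <;>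
    first
    | (exfalso; omega)
    | (rw [if_pos (by simp)]; omega)
    | (rw [if_neg (by simp only [Prod.mk.injEq]; omega)]; omega)

lemma Std.cycleParity_new_se {T : DominoTableau} (h : Std T) {p : ℕ × Domino} (hp : p ∈ T)
    {x y : ℕ} (hv : newSquare T p = (x, y)) (hl : p.1 = seLabel T (x, y)) :
    cycleParity T p = (x + 1) % 2 := by
  have ho := Std.new_odd T p
  rw [hv] at ho
  obtain ⟨i, j, hf, he, hi, hj, _, hc⟩ := h.move_spec hp
  rw [h.cycleParity_eq hp hf]
  rcases h.fixed_of_se hp ho hl with ⟨h2, h3⟩ | ⟨h2, h3⟩ <;>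
    rw [hf, Prod.mk.injEq] at h2 <;>
    rcases hc with ⟨⟨_, hv'⟩ | ⟨_, _, hv'⟩, ⟨_, hn⟩ | ⟨_, _, hn⟩⟩ | ⟨⟨_, hv'⟩ | ⟨_, _, hv'⟩, ⟨_, hn⟩ | ⟨_, _, hn⟩⟩ <;>
    rw [hv, Prod.mk.injEq] at hn <;> rw [hv'] <;>
    first
    | (exfalso; omega)
    | (rw [if_pos (by simp)]; omega)
    | (rw [if_neg (by simp only [Prod.mk.injEq]; omega)]; omega)

/-- When `p` enters the square left by `q`, the two are its different candidates, one upper left and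
one lower right. The formulas for old and for new squares are opposite to each other in just the way
that makes the values agree. -/
lemma Std.cycleParity_linked {T : DominoTableau} (h : Std T) {p q : ℕ × Domino}
    (hl : Linked T p q) : cycleParity T p = cycleParity T q := by
  have hp := hl.1
  have hq := hl.2.1
  rcases (h.linked_iff hp hq).1 hl with rfl | he
  · rfl
  · have hne : p.1 ≠ q.1 := by
      intro e
      have := h.eq_of_label hp hq e
      subst this
      exact h.new_ne_var hp he
    have h1 := h.new_label hp
    have h2 := h.var_label hq
    rw [he] at h1
    rcases hg : q.2.variableSquare with ⟨x, y⟩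
    rw [hg] at h1 h2 he
    rcases h1 with h1 | h1 <;> rcases h2 with h2 | h2
    · omega
    · rw [h.cycleParity_new_nw hp he h1, h.cycleParity_se hq hg h2]
    · rw [h.cycleParity_new_se hp he h1, Std.cycleParity_nw hg h2]
    · omega

end SOStar
namespace SOStar

/-! ### Moving through a union of cycles -/

open Classical in
/-- Move the dominos of `T` that satisfy `C`. -/
noncomputable def moveSet (T : DominoTableau) (C : ℕ × Domino → Prop) : DominoTableau :=
  T.map fun q => if C q then (q.1, moved T q) else q

open Classical in
/-- The variable square of a domino of `T` after moving the dominos that satisfy `C`. -/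
noncomputable def movedVar (T : DominoTableau) (C : ℕ × Domino → Prop) (q : ℕ × Domino) : Square :=
  if C q then newSquare T q else q.2.variableSquare

lemma movedVar_pos {T : DominoTableau} {C : ℕ × Domino → Prop} {q : ℕ × Domino} (h : C q) :
    movedVar T C q = newSquare T q := if_pos h

lemma movedVar_neg {T : DominoTableau} {C : ℕ × Domino → Prop} {q : ℕ × Domino} (h : ¬ C q) :
    movedVar T C q = q.2.variableSquare := if_neg h

lemma moveThrough_eq (T : DominoTableau) (s : Square) :
    moveThrough T s = moveSet T (InCycleAt T s) := rfl

lemma mem_moveSet {T : DominoTableau} (h : Std T) {C : ℕ × Domino → Prop} {p : ℕ × Domino} :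
    p ∈ moveSet T C ↔ ∃ q ∈ T, p.1 = q.1 ∧ p.2.fixedSquare = q.2.fixedSquare ∧
      p.2.variableSquare = movedVar T C q := by
  unfold moveSet
  rw [List.mem_map]
  constructor
  · rintro ⟨q, hq, rfl⟩
    refine ⟨q, hq, ?_⟩
    by_cases hc : C q
    · rw [if_pos hc, movedVar_pos hc]; exact ⟨rfl, h.new_fixed hq, rfl⟩
    · rw [if_neg hc, movedVar_neg hc]; exact ⟨rfl, rfl, rfl⟩
  · rintro ⟨q, hq, h1, h2, h3⟩
    refine ⟨q, hq, ?_⟩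
    by_cases hc : C q
    · rw [if_pos hc]; rw [movedVar_pos hc] at h3
      exact Prod.ext h1.symm (domino_ext_fixed_var ((h.new_fixed hq).trans h2.symm) h3.symm)
    · rw [if_neg hc]; rw [movedVar_neg hc] at h3
      exact Prod.ext h1.symm (domino_ext_fixed_var h2.symm h3.symm)

lemma exists_mem_moveSet {T : DominoTableau} (h : Std T) (C : ℕ × Domino → Prop)
    {q : ℕ × Domino} (hq : q ∈ T) : ∃ p ∈ moveSet T C, p.1 = q.1 ∧
      p.2.fixedSquare = q.2.fixedSquare ∧ p.2.variableSquare = movedVar T C q := by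
  classical
  refine ⟨if C q then (q.1, moved T q) else q, List.mem_map_of_mem hq, ?_⟩
  by_cases hc : C q
  · rw [if_pos hc, movedVar_pos hc]; exact ⟨rfl, h.new_fixed hq, rfl⟩
  · rw [if_neg hc, movedVar_neg hc]; exact ⟨rfl, rfl, rfl⟩

lemma movedVar_odd (T : DominoTableau) (C : ℕ × Domino → Prop) (q : ℕ × Domino) :
    ((movedVar T C q).1 + (movedVar T C q).2) % 2 = 1 := by
  by_cases hc : C q
  · rw [movedVar_pos hc]; exact Std.new_odd T q
  · rw [movedVar_neg hc]; exact variableSquare_odd _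

lemma Std.movedVar_label {T : DominoTableau} (h : Std T) (C : ℕ × Domino → Prop) {q : ℕ × Domino}
    (hq : q ∈ T) :
    q.1 = nwLabel T (movedVar T C q) ∨ q.1 = seLabel T (movedVar T C q) := by
  by_cases hc : C q
  · rw [movedVar_pos hc]; exact h.new_label hq
  · rw [movedVar_neg hc]; exact h.var_label hq

lemma Std.movedVar_pos' {T : DominoTableau} (h : Std T) (C : ℕ × Domino → Prop) {q : ℕ × Domino}
    (hq : q ∈ T) : 1 ≤ (movedVar T C q).1 ∧ 1 ≤ (movedVar T C q).2 := by
  by_cases hc : C q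
  · rw [movedVar_pos hc]; exact h.new_pos hq
  · rw [movedVar_neg hc]; exact h.coord_pos hq (variableSquare_mem _)

lemma Std.movedVar_injective {T : DominoTableau} (h : Std T) {C : ℕ × Domino → Prop}
    (hC : ∀ p q, Linked T p q → (C p ↔ C q)) {p q : ℕ × Domino} (hp : p ∈ T) (hq : q ∈ T)
    (he : movedVar T C p = movedVar T C q) : p = q := by
  by_cases h1 : C p <;> by_cases h2 : C q
  · rw [movedVar_pos h1, movedVar_pos h2] at he; exact h.new_injective hp hq he
  · rw [movedVar_pos h1, movedVar_neg h2] at he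
    exact absurd ((hC p q ((h.linked_iff hp hq).2 (Or.inr he))).1 h1) h2
  · rw [movedVar_neg h1, movedVar_pos h2] at he
    exact absurd ((hC q p ((h.linked_iff hq hp).2 (Or.inr he.symm))).1 h2) h1
  · rw [movedVar_neg h1, movedVar_neg h2] at he; exact h.var_injective hp hq he

/-- A variable square to the left of or above a square of `T` stays covered. -/
lemma Std.movedVar_covers {T : DominoTableau} (h : Std T) {C : ℕ × Domino → Prop}
    (hC : ∀ p q, Linked T p q → (C p ↔ C q)) {q : ℕ × Domino} (hq : q ∈ T) {x y : ℕ} (hx : 1 ≤ x)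
    (hy : 1 ≤ y) (ho : (x + y) % 2 = 1) (hl : seLabel T (x, y) ≤ q.1) :
    ∃ t ∈ T, t.1 ≤ q.1 ∧ movedVar T C t = (x, y) := by
  have h1 := h.nw_le_lab x y
  have h2 := h.lab_le_se x y
  have hb := lt_labelBound hq
  -- Both candidates exist. The upper left label is positive, because the coordinate sum is odd and
  -- so x and y are not both 1; the lower right one is at most `q.1`.
  obtain ⟨a, ha, hal⟩ : ∃ a ∈ T, a.1 = nwLabel T (x, y) := by
    have hpos : 1 ≤ nwLabel T (x, y) := by
      by_cases hx2 : 2 ≤ x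
      · obtain ⟨t, ht, e, _⟩ := h.exists_of_lab (x := x - 1) (y := y) (by omega) hy
          (by simp only [nwLabel] at h1; omega)
        have := h.pos ht
        simp only [nwLabel]; omega
      · obtain ⟨t, ht, e, _⟩ := h.exists_of_lab (x := x) (y := y - 1) (by omega) (by omega)
          (by simp only [nwLabel] at h1; omega)
        have := h.pos ht
        simp only [nwLabel]; omega
    simp only [nwLabel] at h1 hpos ⊢
    rcases le_total (lab T (x - 1) y) (lab T x (y - 1)) with hle | hle
    · rw [max_eq_right hle] at *
      have : y - 1 ≠ 0 := by intro e; rw [e, lab_zero_col] at hpos; omega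
      obtain ⟨t, ht, e, _⟩ := h.exists_of_lab (x := x) (y := y - 1) hx (by omega) (by omega)
      exact ⟨t, ht, e⟩
    · rw [max_eq_left hle] at *
      have : x - 1 ≠ 0 := by intro e; rw [e, lab_zero_row] at hpos; omega
      obtain ⟨t, ht, e, _⟩ := h.exists_of_lab (x := x - 1) (y := y) (by omega) hy (by omega)
      exact ⟨t, ht, e⟩
  obtain ⟨b, hb', hbl⟩ : ∃ b ∈ T, b.1 = seLabel T (x, y) := by
    simp only [seLabel] at h2 hl ⊢
    rcases le_total (lab T (x + 1) y) (lab T x (y + 1)) with hle | hle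
    · rw [min_eq_left hle] at *
      obtain ⟨t, ht, e, _⟩ := h.exists_of_lab (x := x + 1) (y := y) (by omega) hy (by omega)
      exact ⟨t, ht, e⟩
    · rw [min_eq_right hle] at *
      obtain ⟨t, ht, e, _⟩ := h.exists_of_lab (x := x) (y := y + 1) (by omega) (by omega) (by omega)
      exact ⟨t, ht, e⟩
  have hne : a ≠ b := by
    rintro rfl
    exact h.not_nw_of_se hb' ho hbl hal
  -- If the occupant `c` leaves, then `d`, whose other candidate square this is, belongs to the same
  -- cycle and moves in.
  have key : ∀ c ∈ T, ∀ d ∈ T, c ≠ d → c.2.variableSquare = (x, y) →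
      (d.1 = nwLabel T (x, y) ∨ d.1 = seLabel T (x, y)) →
      movedVar T C c = (x, y) ∨ movedVar T C d = (x, y) := by
    intro c hc d hd hcd hv hl
    rcases h.old_or_new hd hx hy ho hl with hv' | hn
    · exact absurd (h.var_injective hc hd (hv.trans hv'.symm)) hcd
    · by_cases hcc : C c
      · have := (hC d c ((h.linked_iff hd hc).2 (Or.inr (hn.trans hv.symm)))).2 hcc
        right; rw [movedVar_pos this, hn]
      · left; rw [movedVar_neg hcc, hv]
  rcases h.occupied ha hb' hne hx hy ho (Or.inl hal) (Or.inr hbl) with hv | hv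
  · rcases key a ha b hb' hne hv (Or.inr hbl) with hh | hh
    · exact ⟨a, ha, by omega, hh⟩
    · exact ⟨b, hb', by omega, hh⟩
  · rcases key b hb' a ha hne.symm hv (Or.inl hal) with hh | hh
    · exact ⟨b, hb', by omega, hh⟩
    · exact ⟨a, ha, by omega, hh⟩

/-- The left or upper neighbour of a square has the other parity. Next to a fixed square lies a
variable square, which stays covered by `Std.movedVar_covers`; next to a variable square lies a
fixed square, which does not move and whose label is at most the upper left label. So `std_of_local`
applies. -/
lemma Std.moveSet {T : DominoTableau} (h : Std T) {C : ℕ × Domino → Prop}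
    (hC : ∀ p q, Linked T p q → (C p ↔ C q)) : Std (moveSet T C) := by
  have hsq : ∀ p ∈ SOStar.moveSet T C, ∃ q ∈ T, p.1 = q.1 ∧
      p.2.fixedSquare = q.2.fixedSquare ∧ p.2.variableSquare = movedVar T C q :=
    fun p hp => (mem_moveSet h).1 hp
  have nbr : ∀ p ∈ SOStar.moveSet T C, ∀ x y x' y', (x, y) ∈ p.2.squares → 1 ≤ x' → 1 ≤ y' →
      ((x' = x ∧ y' + 1 = y) ∨ (x' + 1 = x ∧ y' = y)) →
      ∃ q ∈ SOStar.moveSet T C, q.1 ≤ p.1 ∧ (x', y') ∈ q.2.squares := by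
    intro p hp x y x' y' hs hx' hy' hxy
    obtain ⟨q, hq, h1, h2, h3⟩ := hsq p hp
    rcases mem_squares_iff.1 hs with hs | hs
    · have he := fixedSquare_even p.2
      rw [← hs] at he
      simp only at he
      have hlq := h.lab_fixed hq (h2.symm.trans hs.symm)
      have hse : seLabel T (x', y') ≤ q.1 := by
        simp only [seLabel]
        rcases hxy with ⟨rfl, rfl⟩ | ⟨rfl, rfl⟩
        · rw [← hlq]; exact min_le_right _ _
        · rw [← hlq]; exact min_le_left _ _
      obtain ⟨t, ht, hle, hv⟩ := h.movedVar_covers hC hq hx' hy' (by omega) hse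
      obtain ⟨p', hp', e1, e2, e3⟩ := exists_mem_moveSet h C ht
      exact ⟨p', hp', by omega, by rw [← hv, ← e3]; exact variableSquare_mem _⟩
    · rw [h3] at hs
      have hodd := movedVar_odd T C q
      rw [← hs] at hodd
      simp only at hodd
      have hl := h.movedVar_label C hq
      rw [← hs] at hl
      have hle : lab T x' y' ≤ q.1 := by
        have hA : lab T x' y' ≤ nwLabel T (x, y) := by
          simp only [nwLabel]
          rcases hxy with ⟨rfl, rfl⟩ | ⟨rfl, rfl⟩
          · rw [Nat.add_sub_cancel]; exact le_max_right _ _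
          · rw [Nat.add_sub_cancel]; exact le_max_left _ _
        have := h.nw_le_lab x y
        have := h.lab_le_se x y
        omega
      obtain ⟨t, ht, e, hts⟩ := h.exists_of_lab hx' hy' (hle.trans_lt (lt_labelBound hq))
      have hf := eq_fixedSquare_of_mem hts (by omega)
      obtain ⟨p', hp', e1, e2, e3⟩ := exists_mem_moveSet h C ht
      exact ⟨p', hp', by omega, by rw [← hf, ← e2]; exact fixedSquare_mem _⟩
  refine std_of_local ?_ ?_ ?_ ?_ ?_ ?_
  · unfold SOStar.moveSet
    rw [List.pairwise_map]
    refine h.pairwise.imp fun {a b} hab => ?_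
    split <;> split <;> exact hab
  · intro p hp
    obtain ⟨q, hq, h1, _⟩ := hsq p hp
    rw [h1]; exact h.pos hq
  · intro p hp x y hs
    obtain ⟨q, hq, h1, h2, h3⟩ := hsq p hp
    rcases mem_squares_iff.1 hs with hs | hs
    · rw [h2] at hs
      exact h.coord_pos hq (hs ▸ fixedSquare_mem _)
    · rw [h3] at hs
      have := h.movedVar_pos' C hq
      rwa [← hs] at this
  · intro p hp p' hp' s hs hs'
    obtain ⟨q, hq, h1, h2, h3⟩ := hsq p hp
    obtain ⟨q', hq', h1', h2', h3'⟩ := hsq p' hp'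
    have : q = q' := by
      rcases mem_squares_iff.1 hs with hs | hs <;> rcases mem_squares_iff.1 hs' with hs' | hs'
      · exact h.eq_of_square hq hq' (s := s) (by rw [hs, h2]; exact fixedSquare_mem _)
          (by rw [hs', h2']; exact fixedSquare_mem _)
      · have e1 := fixedSquare_even p.2
        have e2 := variableSquare_odd p'.2
        rw [← hs] at e1; rw [← hs'] at e2; omega
      · have e1 := fixedSquare_even p'.2
        have e2 := variableSquare_odd p.2
        rw [← hs] at e2; rw [← hs'] at e1; omega
      · exact h.movedVar_injective hC hq hq' (by rw [← h3, ← h3', ← hs, hs'])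
    subst this
    exact Prod.ext (h1.trans h1'.symm)
      (domino_ext_fixed_var (h2.trans h2'.symm) (h3.trans h3'.symm))
  · intro p hp x y hs hy
    exact nbr p hp x y x (y - 1) hs (by
      obtain ⟨q, hq, h1, h2, h3⟩ := hsq p hp
      rcases mem_squares_iff.1 hs with hs | hs
      · rw [h2] at hs
        exact (h.coord_pos hq (hs ▸ fixedSquare_mem _)).1
      · rw [h3] at hs
        have := h.movedVar_pos' C hq
        rw [← hs] at this; exact this.1) (by omega) (Or.inl ⟨rfl, by omega⟩)
  · intro p hp x y hs hx
    exact nbr p hp x y (x - 1) y hs (by omega) (by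
      obtain ⟨q, hq, h1, h2, h3⟩ := hsq p hp
      rcases mem_squares_iff.1 hs with hs | hs
      · rw [h2] at hs
        exact (h.coord_pos hq (hs ▸ fixedSquare_mem _)).2
      · rw [h3] at hs
        have := h.movedVar_pos' C hq
        rw [← hs] at this; exact this.2) (Or.inr ⟨by omega, rfl⟩)

/-! ### Equivalence of tableaux -/

/-- Two dominos that form a closed cycle, both vertical. -/
def VBlock (T : DominoTableau) (k l x y : ℕ) : Prop :=
  (x + y) % 2 = 0 ∧ (k, ⟨x, y, true⟩) ∈ T ∧ (l, ⟨x, y + 1, true⟩) ∈ T ∧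
    LabelLT T (x - 1, y + 1) k ∧ ¬ LabelLT T (x + 2, y) l

/-- Two dominos that form a closed cycle, both horizontal. -/
def HBlock (T : DominoTableau) (k l x y : ℕ) : Prop :=
  (x + y) % 2 = 0 ∧ (k, ⟨x, y, false⟩) ∈ T ∧ (l, ⟨x + 1, y, false⟩) ∈ T ∧
    LabelLT T (x + 1, y - 1) k ∧ ¬ LabelLT T (x, y + 2) l

/-- `U` has the same labels on the fixed squares as `T`, and the closed cycles of two dominos
of `T` are unchanged in `U`. -/
structure TabEquiv (T U : DominoTableau) : Prop where
  std_left : Std T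
  std_right : Std U
  fixed : T.map (fun p => (p.1, p.2.fixedSquare)) = U.map fun p => (p.1, p.2.fixedSquare)
  vblock : ∀ k l x y, VBlock T k l x y → (k, ⟨x, y, true⟩) ∈ U ∧ (l, ⟨x, y + 1, true⟩) ∈ U
  hblock : ∀ k l x y, HBlock T k l x y → (k, ⟨x, y, false⟩) ∈ U ∧ (l, ⟨x + 1, y, false⟩) ∈ U

lemma TabEquiv.refl {T : DominoTableau} (h : Std T) : TabEquiv T T :=
  ⟨h, h, rfl, fun _ _ _ _ hb => ⟨hb.2.1, hb.2.2.1⟩, fun _ _ _ _ hb => ⟨hb.2.1, hb.2.2.1⟩⟩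

lemma TabEquiv.exists_right {T U : DominoTableau} (h : TabEquiv T U) {p : ℕ × Domino}
    (hp : p ∈ T) : ∃ q ∈ U, q.1 = p.1 ∧ q.2.fixedSquare = p.2.fixedSquare := by
  have : (p.1, p.2.fixedSquare) ∈ U.map fun p => (p.1, p.2.fixedSquare) := by
    rw [← h.fixed]; exact List.mem_map_of_mem (f := fun p : ℕ × Domino => (p.1, p.2.fixedSquare)) hp
  obtain ⟨q, hq, e⟩ := List.mem_map.1 this
  simp only [Prod.mk.injEq] at e
  exact ⟨q, hq, e⟩

lemma TabEquiv.exists_left {T U : DominoTableau} (h : TabEquiv T U) {p : ℕ × Domino}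
    (hp : p ∈ U) : ∃ q ∈ T, q.1 = p.1 ∧ q.2.fixedSquare = p.2.fixedSquare := by
  have : (p.1, p.2.fixedSquare) ∈ T.map fun p => (p.1, p.2.fixedSquare) := by
    rw [h.fixed]; exact List.mem_map_of_mem (f := fun p : ℕ × Domino => (p.1, p.2.fixedSquare)) hp
  obtain ⟨q, hq, e⟩ := List.mem_map.1 this
  simp only [Prod.mk.injEq] at e
  exact ⟨q, hq, e⟩

lemma TabEquiv.labelLT {T U : DominoTableau} (h : TabEquiv T U) {x y k : ℕ}
    (he : (x + y) % 2 = 0) : LabelLT T (x, y) k ↔ LabelLT U (x, y) k := by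
  unfold LabelLT
  refine or_congr Iff.rfl (or_congr Iff.rfl ?_)
  constructor
  · rintro ⟨p, hp, hs, hk⟩
    obtain ⟨q, hq, e1, e2⟩ := h.exists_right hp
    rw [eq_fixedSquare_of_mem hs he] at e2
    exact ⟨q, hq, e2 ▸ fixedSquare_mem _, by omega⟩
  · rintro ⟨p, hp, hs, hk⟩
    obtain ⟨q, hq, e1, e2⟩ := h.exists_left hp
    rw [eq_fixedSquare_of_mem hs he] at e2
    exact ⟨q, hq, e2 ▸ fixedSquare_mem _, by omega⟩

/-- The label conditions in the definition of a block concern squares of even coordinate sum, whose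
labels agree in `T` and `U`; so a block of `T` is also a block of `U`. Coordinate 0 is treated
apart, as truncated subtraction would spoil the parity. -/
lemma TabEquiv.trans {T U V : DominoTableau} (h1 : TabEquiv T U) (h2 : TabEquiv U V) :
    TabEquiv T V := by
  refine ⟨h1.std_left, h2.std_right, h1.fixed.trans h2.fixed, ?_, ?_⟩
  · intro k l x y hb
    have := h1.vblock k l x y hb
    refine h2.vblock k l x y ⟨hb.1, this.1, this.2, ?_, ?_⟩
    · rcases Nat.eq_zero_or_pos x with rfl | hx
      · exact Or.inl rfl
      · exact (h1.labelLT (by have := hb.1; omega)).1 hb.2.2.2.1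
    · rw [← h1.labelLT (by have := hb.1; omega)]; exact hb.2.2.2.2
  · intro k l x y hb
    have := h1.hblock k l x y hb
    refine h2.hblock k l x y ⟨hb.1, this.1, this.2, ?_, ?_⟩
    · rcases Nat.eq_zero_or_pos y with rfl | hx
      · exact Or.inr (Or.inl rfl)
      · exact (h1.labelLT (by have := hb.1; omega)).1 hb.2.2.2.1
    · rw [← h1.labelLT (by have := hb.1; omega)]; exact hb.2.2.2.2

/-! ### Open cycles -/

/-- The two label conditions of a block are the comparisons that make each domino turn inside the
2×2 square and not out of it. -/
lemma Std.vblock_new {T : DominoTableau} (h : Std T) {k l x y : ℕ} (hb : VBlock T k l x y) :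
    newSquare T (k, ⟨x, y, true⟩) = (x, y + 1) ∧ newSquare T (l, ⟨x, y + 1, true⟩) = (x + 1, y) := by
  obtain ⟨he, h1, h2, h3, h4⟩ := hb
  constructor
  · obtain ⟨i, j, hf, _, hi, hj, _, hc⟩ := h.move_spec h1
    rw [fixed_v he, Prod.mk.injEq] at hf
    obtain ⟨rfl, rfl⟩ := hf
    have := (h.labelLT_iff h1 _ _).1 h3
    simp only [var_v he, Prod.mk.injEq] at hc this
    rcases hc with ⟨_, ⟨_, hn⟩ | ⟨_, _, hn⟩⟩ | ⟨⟨_, hn⟩ | ⟨_, _, hn⟩, _⟩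
    · exact hn
    all_goals omega
  · obtain ⟨i, j, hf, _, hi, hj, _, hc⟩ := h.move_spec h2
    rw [fixed_v' (by omega), Prod.mk.injEq] at hf
    obtain ⟨rfl, rfl⟩ := hf
    have := mt (h.labelLT_iff h2 _ _).2 h4
    simp only [var_v' (show (x + (y + 1)) % 2 = 1 by omega), Prod.mk.injEq] at hc this
    simp only [Nat.add_sub_cancel, show x + 1 + 1 = x + 2 by omega] at hc
    rcases hc with ⟨⟨_, hn⟩ | ⟨_, _, hn⟩, _⟩ | ⟨_, ⟨_, hn⟩ | ⟨_, _, hn⟩⟩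
    · omega
    · omega
    · omega
    · exact hn

lemma Std.hblock_new {T : DominoTableau} (h : Std T) {k l x y : ℕ} (hb : HBlock T k l x y) :
    newSquare T (k, ⟨x, y, false⟩) = (x + 1, y) ∧
      newSquare T (l, ⟨x + 1, y, false⟩) = (x, y + 1) := by
  obtain ⟨he, h1, h2, h3, h4⟩ := hb
  constructor
  · obtain ⟨i, j, hf, _, hi, hj, _, hc⟩ := h.move_spec h1
    rw [fixed_h he, Prod.mk.injEq] at hf
    obtain ⟨rfl, rfl⟩ := hf
    have := (h.labelLT_iff h1 _ _).1 h3
    simp only [var_h he, Prod.mk.injEq] at hc this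
    rcases hc with ⟨⟨_, hn⟩ | ⟨_, _, hn⟩, _⟩ | ⟨_, ⟨_, hn⟩ | ⟨_, _, hn⟩⟩
    · omega
    · omega
    · exact hn
    · omega
  · obtain ⟨i, j, hf, _, hi, hj, _, hc⟩ := h.move_spec h2
    rw [fixed_h' (by omega), Prod.mk.injEq] at hf
    obtain ⟨rfl, rfl⟩ := hf
    have := mt (h.labelLT_iff h2 _ _).2 h4
    simp only [var_h' (show (x + 1 + y) % 2 = 1 by omega), Prod.mk.injEq] at hc this
    simp only [Nat.add_sub_cancel, show y + 1 + 1 = y + 2 by omega] at hc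
    rcases hc with ⟨_, ⟨_, hn⟩ | ⟨_, _, hn⟩⟩ | ⟨⟨_, hn⟩ | ⟨_, _, hn⟩, _⟩
    · omega
    · exact hn
    · omega
    · omega

/-- Two dominos that exchange their variable squares form a cycle. -/
lemma Std.sameCycle_of_exchange {T : DominoTableau} (h : Std T) {p q : ℕ × Domino} (hp : p ∈ T)
    (hq : q ∈ T) (h1 : newSquare T p = q.2.variableSquare)
    (h2 : newSquare T q = p.2.variableSquare) {a b : ℕ × Domino} (hab : SameCycle T a b) :
    (a = p ∨ a = q) ↔ (b = p ∨ b = q) := by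
  induction hab with
  | rel a b hl =>
    have ha := hl.1
    have hb := hl.2.1
    rcases (h.linked_iff ha hb).1 hl with rfl | he
    · rfl
    · constructor
      · rintro (rfl | rfl)
        · right; exact h.var_injective hb hq (he.symm.trans h1)
        · left; exact h.var_injective hb hp (he.symm.trans h2)
      · rintro (rfl | rfl)
        · right; exact h.new_injective ha hq (he.trans h2.symm)
        · left; exact h.new_injective ha hp (he.trans h1.symm)
  | refl a => rfl
  | symm a b _ ih => exact ih.symm
  | trans a b c _ _ ih1 ih2 => exact ih1.trans ih2

lemma Std.cycleParity_sameCycle {T : DominoTableau} (h : Std T) {p q : ℕ × Domino}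
    (hl : SameCycle T p q) : cycleParity T p = cycleParity T q := by
  induction hl with
  | rel a b hl => exact h.cycleParity_linked hl
  | refl a => rfl
  | symm a b _ ih => exact ih.symm
  | trans a b c _ _ ih1 ih2 => exact ih1.trans ih2

/-- A cycle has at most one domino whose variable square is not filled again. -/
lemma Std.start_unique {T : DominoTableau} (h : Std T) {p q : ℕ × Domino} (hp : p ∈ T)
    (hl : SameCycle T p q) (h1 : ∀ t ∈ T, newSquare T t ≠ p.2.variableSquare)
    (h2 : ∀ t ∈ T, newSquare T t ≠ q.2.variableSquare) : q = p := by
  -- `N` follows a cycle forwards. The dominos reachable from `p` are closed under `N` in both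
  -- directions, since predecessors are unique and `p` has none; so they include `q`, which has no
  -- predecessor either.
  let N : ℕ × Domino → ℕ × Domino → Prop := fun a b =>
    a ∈ T ∧ b ∈ T ∧ newSquare T a = b.2.variableSquare
  have key : ∀ {a b}, SameCycle T a b →
      (Relation.ReflTransGen N p a ↔ Relation.ReflTransGen N p b) := by
    intro a b hab
    induction hab with
    | rel a b hl =>
      have ha := hl.1
      have hb := hl.2.1
      rcases (h.linked_iff ha hb).1 hl with rfl | he
      · rfl
      · constructor
        · intro hh; exact hh.tail ⟨ha, hb, he⟩
        · intro hh
          rcases Relation.ReflTransGen.cases_tail hh with e | ⟨c, hc, hcb⟩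
          · subst e; exact absurd he (h1 a ha)
          · rwa [h.new_injective ha hcb.1 (he.trans hcb.2.2.symm)]
    | refl a => rfl
    | symm a b _ ih => exact ih.symm
    | trans a b c _ _ ih1 ih2 => exact ih1.trans ih2
  have hq := (key hl).1 Relation.ReflTransGen.refl
  rcases Relation.ReflTransGen.cases_tail hq with e | ⟨c, hc, hcb⟩
  · exact e
  · exact absurd hcb.2.2 (h2 c hcb.1)

/-- Moving through the cycle of a removable variable square. -/
theorem Std.moveThrough_spec {T : DominoTableau} (h : Std T) {x y : ℕ} (hs : (x, y) ∈ shape T)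
    (ho : (x + y) % 2 = 1) (hr : (x, y + 1) ∉ shape T) (hd : (x + 1, y) ∉ shape T) :
    TabEquiv T (moveThrough T (x, y)) ∧ ∃ x' y', (x', y') ∉ shape T ∧ (x' + y') % 2 = 1 ∧
      x' % 2 ≠ x % 2 ∧
      shape (moveThrough T (x, y)) = insert (x', y') ((shape T).erase (x, y)) := by
  obtain ⟨p, hp, hps⟩ := mem_shape.1 hs
  have hpos := h.coord_pos hp hps
  have hv := eq_variableSquare_of_mem hps ho
  -- There is nothing to the right or below. Hence `p` is the only candidate for its variable
  -- square, and nobody moves in when it leaves.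
  have hse : seLabel T (x, y) = labelBound T := by
    simp only [seLabel, lab_of_notMem hpos.1 (by omega : 1 ≤ y + 1) hr,
      lab_of_notMem (by omega : 1 ≤ x + 1) hpos.2 hd, min_self]
  have hnw : p.1 = nwLabel T (x, y) := by
    have := h.var_label hp
    rw [hv, hse] at this
    have := lt_labelBound hp
    omega
  have hstart : ∀ t ∈ T, newSquare T t ≠ p.2.variableSquare := by
    intro t ht e
    have h1 := h.new_label ht
    rw [e, hv, hse] at h1
    have h2 := lt_labelBound ht
    have : t = p := h.eq_of_label ht hp (by omega)
    subst this
    exact h.new_ne_var ht e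
  set C := InCycleAt T (x, y) with hCdef
  have hCiff : ∀ q, C q ↔ SameCycle T p q := by
    intro q
    constructor
    · rintro ⟨p', hp', hs', hl⟩
      rwa [h.eq_of_square hp hp' hps hs']
    · intro hl; exact ⟨p, hp, hps, hl⟩
  have hC : ∀ a b, Linked T a b → (C a ↔ C b) := by
    intro a b hab
    rw [hCiff, hCiff]
    exact ⟨fun hh => hh.trans _ _ _ (.rel _ _ hab), fun hh => hh.trans _ _ _ (.symm _ _ (.rel _ _ hab))⟩
  have hCp : C p := (hCiff p).2 (.refl _)
  have hU : Std (moveThrough T (x, y)) := by rw [moveThrough_eq]; exact h.moveSet hC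
  -- Two dominos that exchange their variable squares are a whole cycle in which every square is
  -- refilled, so it is not the cycle of `p`.
  have hex : ∀ a ∈ T, ∀ b ∈ T, newSquare T a = b.2.variableSquare →
      newSquare T b = a.2.variableSquare → ¬ C a ∧ ¬ C b := by
    intro a ha b hb e1 e2
    have aux : ∀ c, (c = a ∨ c = b) → ¬ C c := by
      intro c hc hCc
      have := (h.sameCycle_of_exchange ha hb e1 e2 ((hCiff c).1 hCc)).2 hc
      rcases this with rfl | rfl
      · exact hstart b hb e2
      · exact hstart a ha e1
    exact ⟨aux a (Or.inl rfl), aux b (Or.inr rfl)⟩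
  have hstay : ∀ a ∈ T, ¬ C a → a ∈ moveThrough T (x, y) := by
    intro a ha hCa
    rw [moveThrough_eq, mem_moveSet h]
    exact ⟨a, ha, rfl, rfl, by rw [movedVar_neg hCa]⟩
  refine ⟨⟨h, hU, ?_, ?_, ?_⟩, ?_⟩
  · rw [moveThrough_eq, SOStar.moveSet, List.map_map]
    refine List.map_congr_left fun q hq => ?_
    simp only [Function.comp]
    split
    · rw [h.new_fixed hq]
    · rfl
  · intro k l x y hb
    have hn := h.vblock_new hb
    have he := hb.1
    have := hex _ hb.2.1 _ hb.2.2.1 (by rw [hn.1, var_v' (by omega)]) (by rw [hn.2, var_v he])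
    exact ⟨hstay _ hb.2.1 this.1, hstay _ hb.2.2.1 this.2⟩
  · intro k l x y hb
    have hn := h.hblock_new hb
    have he := hb.1
    have := hex _ hb.2.1 _ hb.2.2.1 (by rw [hn.1, var_h' (by omega)]) (by rw [hn.2, var_h he])
    exact ⟨hstay _ hb.2.1 this.1, hstay _ hb.2.2.1 this.2⟩
  · have hmem : ∀ s, s ∈ shape (moveThrough T (x, y)) ↔
        ∃ q ∈ T, s = q.2.fixedSquare ∨ s = movedVar T C q := by
      intro s
      rw [mem_shape, moveThrough_eq]
      constructor
      · rintro ⟨a, ha, has⟩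
        obtain ⟨q, hq, _, e1, e2⟩ := (mem_moveSet h).1 ha
        refine ⟨q, hq, ?_⟩
        rw [← e1, ← e2]; exact mem_squares_iff.1 has
      · rintro ⟨q, hq, hh⟩
        obtain ⟨a, ha, _, e1, e2⟩ := exists_mem_moveSet h C hq
        refine ⟨a, ha, mem_squares_iff.2 ?_⟩
        rwa [e1, e2]
    -- A square is lost only if its domino moves away and no other moves in; by `Std.start_unique`
    -- this domino is `p`.
    have hdiff : shape T \ shape (moveThrough T (x, y)) = {(x, y)} := by
      ext s
      rw [Finset.mem_sdiff, Finset.mem_singleton]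
      constructor
      · rintro ⟨h1, h2⟩
        obtain ⟨q, hq, hqs⟩ := mem_shape.1 h1
        rw [hmem] at h2
        push Not at h2
        rcases mem_squares_iff.1 hqs with e | e
        · exact absurd e (h2 q hq).1
        · have hCq : C q := by
            by_contra hc
            exact (h2 q hq).2 (by rw [movedVar_neg hc, e])
          have : q = p := by
            refine h.start_unique hp ((hCiff q).1 hCq) hstart fun t ht e' => ?_
            have hCt := (hC t q ((h.linked_iff ht hq).2 (Or.inr e'))).2 hCq
            exact (h2 t ht).2 (by rw [movedVar_pos hCt, e, e'])
          rw [e, this, hv]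
      · rintro rfl
        refine ⟨hs, ?_⟩
        rw [hmem]
        rintro ⟨q, hq, e | e⟩
        · have := fixedSquare_even q.2
          rw [← e] at this; simp only at this; omega
        · by_cases hc : C q
          · rw [movedVar_pos hc] at e
            exact hstart q hq (by rw [← e, hv])
          · rw [movedVar_neg hc] at e
            exact hc (h.var_injective hp hq (hv.trans e) ▸ hCp)
    -- Both tableaux have the same number of dominos, so as many squares are gained as lost.
    have hcard : (shape (moveThrough T (x, y)) \ shape T).card = 1 := by
      rw [Finset.card_sdiff_comm, hdiff, Finset.card_singleton]
      rw [hU.card_shape, h.card_shape, moveThrough, List.length_map]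
    obtain ⟨⟨x', y'⟩, hc⟩ := Finset.card_eq_one.1 hcard
    have hmemc : (x', y') ∈ shape (moveThrough T (x, y)) \ shape T := by rw [hc]; simp
    rw [Finset.mem_sdiff] at hmemc
    obtain ⟨q, hq, e⟩ := (hmem _).1 hmemc.1
    have e' : movedVar T C q = (x', y') := by
      rcases e with e | e
      · exact absurd (mem_shape.2 ⟨q, hq, e ▸ fixedSquare_mem _⟩) hmemc.2
      · exact e.symm
    have hCq : C q := by
      by_contra hcq
      rw [movedVar_neg hcq] at e'
      exact hmemc.2 (mem_shape.2 ⟨q, hq, e' ▸ variableSquare_mem _⟩)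
    rw [movedVar_pos hCq] at e'
    have hodd := Std.new_odd T q
    have hpos' := h.new_pos hq
    rw [e'] at hodd hpos'
    have hql : q.1 = nwLabel T (x', y') := by
      rcases h.new_label hq with hl | hl
      · rw [hl, e']
      · rw [e'] at hl
        exact absurd (h.mem_shape_of_lab hq hpos'.1 hpos'.2
          ((h.lab_le_se x' y').trans hl.symm.le)) hmemc.2
    refine ⟨x', y', hmemc.2, hodd, ?_, ?_⟩
    · have h1 := h.cycleParity_new_nw hq e' hql
      have h2 := Std.cycleParity_nw hv hnw
      have h3 := h.cycleParity_sameCycle ((hCiff q).1 hCq)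
      omega
    · ext s
      have a1 : s ∈ shape T \ shape (moveThrough T (x, y)) ↔ s = (x, y) := by rw [hdiff]; simp
      have a2 : s ∈ shape (moveThrough T (x, y)) \ shape T ↔ s = (x', y') := by rw [hc]; simp
      rw [Finset.mem_sdiff] at a1 a2
      rw [Finset.mem_insert, Finset.mem_erase]
      tauto

end SOStar
namespace SOStar

/-! ### Transposition -/

/-- The transpose of a domino. -/
def Domino.tr (d : Domino) : Domino := ⟨d.col, d.row, !d.vertical⟩

/-- The transpose of a tableau. -/
def tr (T : DominoTableau) : DominoTableau := T.map fun p => (p.1, p.2.tr)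

@[simp] lemma Domino.tr_tr (d : Domino) : d.tr.tr = d := by simp [Domino.tr]

@[simp] lemma tr_tr (T : DominoTableau) : tr (tr T) = T := by
  simp [tr, Function.comp_def]

lemma tr_append (A B : DominoTableau) : tr (A ++ B) = tr A ++ tr B := by simp [tr]

lemma tr_singleton (k : ℕ) (d : Domino) : tr [(k, d)] = [(k, d.tr)] := rfl

lemma mem_tr {T : DominoTableau} {k : ℕ} {d : Domino} : (k, d) ∈ tr T ↔ (k, d.tr) ∈ T := by
  constructor
  · intro h
    obtain ⟨p, hp, e⟩ := List.mem_map.1 h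
    simp only [Prod.mk.injEq] at e
    rw [← e.1, ← e.2, Domino.tr_tr]; exact hp
  · intro h
    exact List.mem_map.2 ⟨_, h, by simp⟩

lemma mem_tr_squares {d : Domino} {x y : ℕ} : (x, y) ∈ d.tr.squares ↔ (y, x) ∈ d.squares := by
  obtain ⟨r, c, _ | _⟩ := d
  · simp only [Domino.tr, Bool.not_false, mem_hdomino, mem_vdomino]
  · simp only [Domino.tr, Bool.not_true, mem_hdomino, mem_vdomino]

lemma mem_shape_tr {T : DominoTableau} {x y : ℕ} : (x, y) ∈ shape (tr T) ↔ (y, x) ∈ shape T := by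
  rw [mem_shape, mem_shape]
  constructor
  · rintro ⟨⟨k, d⟩, hp, hs⟩
    exact ⟨_, mem_tr.1 hp, by rw [mem_tr_squares]; exact hs⟩
  · rintro ⟨⟨k, d⟩, hp, hs⟩
    exact ⟨(k, d.tr), mem_tr.2 (by simpa using hp), by rw [mem_tr_squares]; exact hs⟩

lemma Young.swap {Y Z : Finset Square} (hYZ : ∀ x y, (x, y) ∈ Z ↔ (y, x) ∈ Y) (h : Young Y) :
    Young Z := by
  intro x y hm
  rw [hYZ] at hm
  exact ⟨(h y x hm).2.1, (h y x hm).1, fun x' y' a b c d => (hYZ _ _).2 (h.down hm b a d c)⟩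

lemma Addable.swap {Y Z : Finset Square} (hYZ : ∀ x y, (x, y) ∈ Z ↔ (y, x) ∈ Y) {d : Domino}
    (h : Addable Y d) : Addable Z d.tr := by
  constructor
  · rw [Finset.disjoint_left]
    rintro ⟨x, y⟩ h1 h2
    exact h.notMem (mem_tr_squares.1 h1) ((hYZ _ _).1 h2)
  · refine Young.swap (fun x y => ?_) h.2
    rw [Finset.mem_union, Finset.mem_union, hYZ, mem_tr_squares]

lemma Std.tr {T : DominoTableau} (h : Std T) : Std (tr T) := by
  induction h with
  | nil => exact Std.nil
  | snoc h1 h2 h3 h4 ih =>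
    rw [tr_append, tr_singleton]
    refine Std.snoc ih h2 ?_ (h4.swap fun x y => mem_shape_tr)
    rintro ⟨k, d⟩ hp
    exact h3 (k, d.tr) (mem_tr.1 hp)

lemma fixedSquare_tr (d : Domino) : d.tr.fixedSquare = (d.fixedSquare.2, d.fixedSquare.1) := by
  have h := fixedSquare_mem d
  exact eq_fixedSquare_of_mem (mem_tr_squares.2 h) (by have := fixedSquare_even d; omega)

lemma labelLT_tr {T : DominoTableau} {x y k : ℕ} : LabelLT (tr T) (x, y) k ↔ LabelLT T (y, x) k := by
  have aux : ∀ {T : DominoTableau} {x y : ℕ}, LabelLT T (y, x) k → LabelLT (tr T) (x, y) k := by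
    rintro T x y (h | h | ⟨⟨l, d⟩, hp, hs, hk⟩)
    · exact Or.inr (Or.inl h)
    · exact Or.inl h
    · exact Or.inr (Or.inr ⟨(l, d.tr), mem_tr.2 (by simpa using hp), mem_tr_squares.2 hs, hk⟩)
  exact ⟨fun h => by simpa using aux h, aux⟩

lemma HBlock.tr {T : DominoTableau} {k l x y : ℕ} (h : HBlock T k l x y) :
    VBlock (tr T) k l y x :=
  ⟨by have := h.1; omega, mem_tr.2 h.2.1, mem_tr.2 h.2.2.1, labelLT_tr.2 h.2.2.2.1,
    fun hh => h.2.2.2.2 (labelLT_tr.1 hh)⟩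

lemma VBlock.tr {T : DominoTableau} {k l x y : ℕ} (h : VBlock T k l x y) :
    HBlock (tr T) k l y x :=
  ⟨by have := h.1; omega, mem_tr.2 h.2.1, mem_tr.2 h.2.2.1, labelLT_tr.2 h.2.2.2.1,
    fun hh => h.2.2.2.2 (labelLT_tr.1 hh)⟩

/-- The parity of row plus column is symmetric: transposition respects fixed squares and exchanges
the two kinds of blocks. -/
lemma TabEquiv.tr {T U : DominoTableau} (h : TabEquiv T U) : TabEquiv (tr T) (tr U) := by
  refine ⟨h.std_left.tr, h.std_right.tr, ?_, ?_, ?_⟩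
  · have := congrArg (List.map fun q : ℕ × Square => (q.1, (q.2.2, q.2.1))) h.fixed
    rw [List.map_map, List.map_map] at this
    simpa [SOStar.tr, Function.comp_def, fixedSquare_tr] using this
  · intro k l x y hb
    have := hb.tr
    rw [tr_tr] at this
    have := h.hblock _ _ _ _ this
    exact ⟨mem_tr.2 this.1, mem_tr.2 this.2⟩
  · intro k l x y hb
    have := hb.tr
    rw [tr_tr] at this
    have := h.vblock _ _ _ _ this
    exact ⟨mem_tr.2 this.1, mem_tr.2 this.2⟩

/-! ### The relative position of consecutive labels -/

/-- `d'` lies strictly below `d`. -/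
def Below (d d' : Domino) : Prop := ∀ s ∈ d.squares, ∀ s' ∈ d'.squares, s.1 < s'.1

/-- `d'` lies strictly to the right of `d`. -/
def RightOf (d d' : Domino) : Prop := ∀ s ∈ d.squares, ∀ s' ∈ d'.squares, s.2 < s'.2

/-- The domino labelled `l` lies strictly below the domino labelled `k`. -/
def BelowIn (T : DominoTableau) (k l : ℕ) : Prop :=
  ∃ d d', (k, d) ∈ T ∧ (l, d') ∈ T ∧ Below d d'

/-- The domino labelled `l` lies strictly to the right of the domino labelled `k`. -/
def RightIn (T : DominoTableau) (k l : ℕ) : Prop :=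
  ∃ d d', (k, d) ∈ T ∧ (l, d') ∈ T ∧ RightOf d d'

lemma below_tr {d d' : Domino} : Below d.tr d'.tr ↔ RightOf d d' := by
  constructor
  · rintro h ⟨x, y⟩ hs ⟨x', y'⟩ hs'
    exact h (y, x) (mem_tr_squares.2 hs) (y', x') (mem_tr_squares.2 hs')
  · rintro h ⟨x, y⟩ hs ⟨x', y'⟩ hs'
    exact h (y, x) (mem_tr_squares.1 hs) (y', x') (mem_tr_squares.1 hs')

lemma rightOf_tr {d d' : Domino} : RightOf d.tr d'.tr ↔ Below d d' := by
  rw [← below_tr, Domino.tr_tr, Domino.tr_tr]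

lemma belowIn_tr {T : DominoTableau} {k l : ℕ} : BelowIn (tr T) k l ↔ RightIn T k l := by
  constructor
  · rintro ⟨d, d', h1, h2, h3⟩
    exact ⟨_, _, mem_tr.1 h1, mem_tr.1 h2, by rw [← below_tr]; simpa using h3⟩
  · rintro ⟨d, d', h1, h2, h3⟩
    exact ⟨d.tr, d'.tr, mem_tr.2 (by simpa using h1), mem_tr.2 (by simpa using h2), below_tr.2 h3⟩

lemma rightIn_tr {T : DominoTableau} {k l : ℕ} : RightIn (tr T) k l ↔ BelowIn T k l := by
  rw [← belowIn_tr, tr_tr]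

lemma square_near {d : Domino} {i j x y : ℕ} (hf : d.fixedSquare = (i, j))
    (hs : (x, y) ∈ d.squares) : (x = i ∧ y = j) ∨ (x = i ∧ y = j + 1) ∨ (x = i + 1 ∧ y = j) ∨
      (x + 1 = i ∧ y = j) ∨ (x = i ∧ y + 1 = j) := by
  obtain ⟨i', j', hf', he, hc⟩ := domino_cases d
  rw [hf, Prod.mk.injEq] at hf'
  obtain ⟨rfl, rfl⟩ := hf'
  rcases mem_squares_iff.1 hs with hs | hs
  · rw [hf, Prod.mk.injEq] at hs; omega
  · rcases hc with ⟨_, hv⟩ | ⟨_, hv⟩ | ⟨_, _, hv⟩ | ⟨_, _, hv⟩ <;>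
      rw [hv, Prod.mk.injEq] at hs <;> omega

/-- Contents of fixed squares are even, so they differ by at least 2, while every square of a domino
has content within 1 of that of its fixed square. A square of `q` not below a square of `p` would
then lie weakly above and to the left of it, against the monotony of labels. -/
lemma Std.below_of_content {T : DominoTableau} (h : Std T) {p q : ℕ × Domino} (hp : p ∈ T)
    (hq : q ∈ T) (hpq : p.1 < q.1) {i j i' j' : ℕ} (hf : p.2.fixedSquare = (i, j))
    (hf' : q.2.fixedSquare = (i', j')) (hc : j' + i < j + i') : Below p.2 q.2 := by
  rintro ⟨x, y⟩ hs ⟨x', y'⟩ hs'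
  by_contra hlt
  simp only at hlt
  have e1 := fixedSquare_even p.2
  have e2 := fixedSquare_even q.2
  rw [hf] at e1; rw [hf'] at e2
  simp only at e1 e2
  have n1 := square_near hf hs
  have n2 := square_near hf' hs'
  have := h.lab_mono (x := x) (y := y) (x' := x') (y' := y') (by omega) (by omega)
  rw [h.lab_eq hp hs, h.lab_eq hq hs'] at this
  omega

lemma Std.right_of_content {T : DominoTableau} (h : Std T) {p q : ℕ × Domino} (hp : p ∈ T)
    (hq : q ∈ T) (hpq : p.1 < q.1) {i j i' j' : ℕ} (hf : p.2.fixedSquare = (i, j))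
    (hf' : q.2.fixedSquare = (i', j')) (hc : j + i' < j' + i) : RightOf p.2 q.2 := by
  rw [← below_tr]
  exact h.tr.below_of_content (p := (p.1, p.2.tr)) (q := (q.1, q.2.tr))
    (mem_tr.2 (by simpa using hp)) (mem_tr.2 (by simpa using hq)) hpq
    (by simp only; rw [fixedSquare_tr, hf]) (by simp only; rw [fixedSquare_tr, hf']) (by omega)

/-- Labels of fixed squares increase strictly along a diagonal, so consecutive labels on one
diagonal sit at (i, j) and (i+1, j+1). The two squares in between carry one of the two labels each,
and the way they are distributed gives the direction. The comparisons required of a block hold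
because no other square of even coordinate sum can carry these labels. -/
lemma Std.block_of_content {T : DominoTableau} (h : Std T) {p q : ℕ × Domino} (hp : p ∈ T)
    (hq : q ∈ T) (hpq : q.1 = p.1 + 1) {i j i' j' : ℕ} (hf : p.2.fixedSquare = (i, j))
    (hf' : q.2.fixedSquare = (i', j')) (hc : j + i' = j' + i) :
    (HBlock T p.1 q.1 i j ∧ p.2 = ⟨i, j, false⟩ ∧ q.2 = ⟨i + 1, j, false⟩) ∨
      (VBlock T p.1 q.1 i j ∧ p.2 = ⟨i, j, true⟩ ∧ q.2 = ⟨i, j + 1, true⟩) := by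
  have e1 := fixedSquare_even p.2
  rw [hf] at e1
  simp only at e1
  have l1 := h.lab_fixed hp hf
  have l2 := h.lab_fixed hq hf'
  have pos := h.coord_pos hp (hf ▸ fixedSquare_mem _)
  have hgt : i < i' := by
    by_contra hle
    have := h.lab_mono (x := i) (y := j) (x' := i') (y' := j') (by omega) (by omega)
    omega
  have fp : ∀ x y, lab T x y = p.1 → (x + y) % 2 = 0 → x = i ∧ y = j := by
    intro x y hl he
    have := h.fixed_of_lab hp hl he
    rw [hf, Prod.mk.injEq] at this; omega
  have fq : ∀ x y, lab T x y = q.1 → (x + y) % 2 = 0 → x = i' ∧ y = j' := by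
    intro x y hl he
    have := h.fixed_of_lab hq hl he
    rw [hf', Prod.mk.injEq] at this; omega
  have hi : i' = i + 1 ∧ j' = j + 1 := by
    have m1 := h.lab_mono (x := i + 1) (y := j + 1) (x' := i) (y' := j) (by omega) (by omega)
    have m2 := h.lab_mono (x := i') (y := j') (x' := i + 1) (y' := j + 1) (by omega) (by omega)
    have a1 := fp (i + 1) (j + 1)
    have a2 := fq (i + 1) (j + 1)
    omega
  obtain ⟨rfl, rfl⟩ := hi
  have r1 := h.lab_mono (x := i) (y := j + 1) (x' := i) (y' := j) (by omega) (by omega)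
  have r2 := h.lab_mono (x := i + 1) (y := j + 1) (x' := i) (y' := j + 1) (by omega) (by omega)
  have b1 := h.lab_mono (x := i + 1) (y := j) (x' := i) (y' := j) (by omega) (by omega)
  have b2 := h.lab_mono (x := i + 1) (y := j + 1) (x' := i + 1) (y' := j) (by omega) (by omega)
  have vp : ∀ x y, lab T x y = p.1 → (x + y) % 2 = 1 → p.2.variableSquare = (x, y) :=
    fun x y hl ho => eq_variableSquare_of_mem (h.square_of_lab hp hl) ho
  have vq : ∀ x y, lab T x y = q.1 → (x + y) % 2 = 1 → q.2.variableSquare = (x, y) :=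
    fun x y hl ho => eq_variableSquare_of_mem (h.square_of_lab hq hl) ho
  have hcase : (lab T i (j + 1) = p.1 ∧ lab T (i + 1) j = q.1) ∨
      (lab T i (j + 1) = q.1 ∧ lab T (i + 1) j = p.1) := by
    by_cases c1 : lab T i (j + 1) = p.1
    · by_cases c2 : lab T (i + 1) j = p.1
      · have := (vp _ _ c1 (by omega)).symm.trans (vp _ _ c2 (by omega))
        rw [Prod.mk.injEq] at this; omega
      · omega
    · by_cases c2 : lab T (i + 1) j = q.1
      · have := (vq _ _ (by omega : lab T i (j + 1) = q.1) (by omega)).symm.trans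
          (vq _ _ c2 (by omega))
        rw [Prod.mk.injEq] at this; omega
      · omega
  rcases hcase with ⟨c1, c2⟩ | ⟨c1, c2⟩
  · left
    have d1 : p.2 = ⟨i, j, false⟩ := domino_ext_fixed_var (hf.trans (fixed_h e1).symm)
      ((vp _ _ c1 (by omega)).trans (var_h e1).symm)
    have d2 : q.2 = ⟨i + 1, j, false⟩ := domino_ext_fixed_var
      (hf'.trans (fixed_h' (by omega)).symm) ((vq _ _ c2 (by omega)).trans (var_h' (by omega)).symm)
    refine ⟨⟨e1, by rw [← d1]; exact hp, by rw [← d2]; exact hq, ?_, ?_⟩, d1, d2⟩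
    · rw [h.labelLT_iff hp]
      have := h.lab_mono (x := i + 1) (y := j) (x' := i + 1) (y' := j - 1) (by omega) (by omega)
      have a1 := fp (i + 1) (j - 1)
      have a2 := fq (i + 1) (j - 1)
      omega
    · rw [h.labelLT_iff hq]
      have := h.lab_mono (x := i) (y := j + 2) (x' := i) (y' := j + 1) (by omega) (by omega)
      have a1 := fp i (j + 2)
      omega
  · right
    have d1 : p.2 = ⟨i, j, true⟩ := domino_ext_fixed_var (hf.trans (fixed_v e1).symm)
      ((vp _ _ c2 (by omega)).trans (var_v e1).symm)
    have d2 : q.2 = ⟨i, j + 1, true⟩ := domino_ext_fixed_var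
      (hf'.trans (fixed_v' (by omega)).symm) ((vq _ _ c1 (by omega)).trans (var_v' (by omega)).symm)
    refine ⟨⟨e1, by rw [← d1]; exact hp, by rw [← d2]; exact hq, ?_, ?_⟩, d1, d2⟩
    · rw [h.labelLT_iff hp]
      have := h.lab_mono (x := i) (y := j + 1) (x' := i - 1) (y' := j + 1) (by omega) (by omega)
      have a1 := fp (i - 1) (j + 1)
      have a2 := fq (i - 1) (j + 1)
      omega
    · rw [h.labelLT_iff hq]
      have := h.lab_mono (x := i + 2) (y := j) (x' := i + 1) (y' := j) (by omega) (by omega)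
      have a1 := fp (i + 2) j
      omega

/-- The square in the row of `p` and the column of `q` has a label between two consecutive labels,
so it belongs to `p` or to `q`. -/
lemma Std.not_below_and_right {T : DominoTableau} (h : Std T) {p q : ℕ × Domino} (hp : p ∈ T)
    (hq : q ∈ T) (hpq : q.1 = p.1 + 1) (hb : Below p.2 q.2) (hr : RightOf p.2 q.2) : False := by
  rcases hs : p.2.first with ⟨x, y⟩
  rcases hs' : q.2.first with ⟨x', y'⟩
  have m : (x, y) ∈ p.2.squares := by rw [← hs]; simp [Domino.squares]
  have m' : (x', y') ∈ q.2.squares := by rw [← hs']; simp [Domino.squares]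
  have h1 : x < x' := hb _ m _ m'
  have h2 : y < y' := hr _ m _ m'
  have l1 := h.lab_mono (x := x) (y := y') (x' := x) (y' := y) (by omega) (by omega)
  have l2 := h.lab_mono (x := x') (y := y') (x' := x) (y' := y') (by omega) (by omega)
  rw [h.lab_eq hp m] at l1
  rw [h.lab_eq hq m'] at l2
  have : lab T x y' = p.1 ∨ lab T x y' = q.1 := by omega
  rcases this with e | e
  · have : y' < y' := hr (x, y') (h.square_of_lab hp e) (x', y') m'
    omega
  · have : x < x := hb (x, y) m (x, y') (h.square_of_lab hq e)
    omega

lemma Std.not_belowIn_of_rightIn {T : DominoTableau} (h : Std T) {k : ℕ}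
    (hr : RightIn T k (k + 1)) : ¬ BelowIn T k (k + 1) := by
  rintro ⟨d, d', h1, h2, h3⟩
  obtain ⟨e, e', g1, g2, g3⟩ := hr
  have a := h.eq_of_label h1 g1 rfl
  have b := h.eq_of_label h2 g2 rfl
  simp only [Prod.mk.injEq, true_and] at a b
  subst a b
  exact h.not_below_and_right h1 h2 rfl h3 g3

lemma below_hblock (i j : ℕ) : Below ⟨i, j, false⟩ ⟨i + 1, j, false⟩ := by
  rintro ⟨x, y⟩ hs ⟨x', y'⟩ hs'
  rw [mem_hdomino] at hs hs'
  simp only; omega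

lemma not_below_vblock (i j : ℕ) : ¬ Below ⟨i, j, true⟩ ⟨i, j + 1, true⟩ := by
  intro h
  have := h (i, j) (mem_vdomino.2 (by simp)) (i, j + 1) (mem_vdomino.2 (by simp))
  simp at this

lemma rightOf_vblock (i j : ℕ) : RightOf ⟨i, j, true⟩ ⟨i, j + 1, true⟩ := by
  rintro ⟨x, y⟩ hs ⟨x', y'⟩ hs'
  rw [mem_vdomino] at hs hs'
  simp only; omega

/-- Of two dominos with consecutive labels, the second lies strictly below or strictly to the
right of the first. -/
lemma Std.belowIn_or_rightIn {T : DominoTableau} (h : Std T) {k : ℕ} {d d' : Domino}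
    (h1 : (k, d) ∈ T) (h2 : (k + 1, d') ∈ T) : BelowIn T k (k + 1) ∨ RightIn T k (k + 1) := by
  rcases hf : d.fixedSquare with ⟨i, j⟩
  rcases hf' : d'.fixedSquare with ⟨i', j'⟩
  rcases lt_trichotomy (j' + i) (j + i') with hc | hc | hc
  · exact Or.inl ⟨d, d', h1, h2, h.below_of_content h1 h2 (by simp) hf hf' hc⟩
  · rcases h.block_of_content h1 h2 rfl hf hf' hc.symm with ⟨_, e1, e2⟩ | ⟨_, e1, e2⟩
    · simp only at e1 e2; subst e1 e2
      exact Or.inl ⟨_, _, h1, h2, below_hblock _ _⟩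
    · simp only at e1 e2; subst e1 e2
      exact Or.inr ⟨_, _, h1, h2, rightOf_vblock _ _⟩
  · exact Or.inr ⟨d, d', h1, h2, h.right_of_content h1 h2 (by simp) hf hf' hc⟩

/-- Moving through open cycles preserves the relative position of consecutive labels. -/
lemma TabEquiv.belowIn {T U : DominoTableau} (h : TabEquiv T U) {k : ℕ}
    (hb : BelowIn T k (k + 1)) : BelowIn U k (k + 1) := by
  obtain ⟨d, d', h1, h2, h3⟩ := hb
  rcases hf : d.fixedSquare with ⟨i, j⟩
  rcases hf' : d'.fixedSquare with ⟨i', j'⟩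
  obtain ⟨⟨k1, u⟩, hu, e1, f1⟩ := h.exists_right h1
  obtain ⟨⟨k2, u'⟩, hu', e2, f2⟩ := h.exists_right h2
  simp only at e1 e2 f1 f2
  subst e1 e2
  -- Unequal contents decide the position in both tableaux, since the fixed squares agree; equal
  -- contents give a closed cycle, which is kept.
  rcases lt_trichotomy (j' + i) (j + i') with hc | hc | hc
  · exact ⟨u, u', hu, hu', h.std_right.below_of_content hu hu' (by simp) (f1.trans hf)
      (f2.trans hf') hc⟩
  · rcases h.std_left.block_of_content h1 h2 rfl hf hf' hc.symm with ⟨hB, e1, e2⟩ | ⟨hB, e1, e2⟩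
    · have := h.hblock _ _ _ _ hB
      exact ⟨_, _, this.1, this.2, below_hblock _ _⟩
    · simp only at e1 e2; subst e1 e2
      exact absurd h3 (not_below_vblock _ _)
  · exact absurd (h.std_left.right_of_content h1 h2 (by simp) hf hf' hc)
      fun hr => h.std_left.not_below_and_right h1 h2 rfl h3 hr

lemma TabEquiv.rightIn {T U : DominoTableau} (h : TabEquiv T U) {k : ℕ}
    (hb : RightIn T k (k + 1)) : RightIn U k (k + 1) := by
  rw [← belowIn_tr] at hb ⊢
  exact h.tr.belowIn hb

end SOStar
namespace SOStar

/-! ### Row and column lengths -/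

lemma Young.row_mem_iff {Y : Finset Square} (h : Young Y) {r c : ℕ} (hr : 1 ≤ r) :
    (r, c) ∈ Y ↔ 1 ≤ c ∧ c ≤ (Y.filter fun s => s.1 = r).card := by
  set m := (Y.filter fun s => s.1 = r).sup Prod.snd with hm
  have key : ∀ c, (r, c) ∈ Y ↔ 1 ≤ c ∧ c ≤ m := by
    intro c
    constructor
    · intro hc
      exact ⟨(h r c hc).2.1, Finset.le_sup (f := Prod.snd)
        (Finset.mem_filter.2 ⟨hc, rfl⟩ : (r, c) ∈ Y.filter fun s => s.1 = r)⟩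
    · rintro ⟨h1, h2⟩
      have hne : (Y.filter fun s => s.1 = r).Nonempty := by
        rw [Finset.nonempty_iff_ne_empty]
        intro e
        rw [e, Finset.sup_empty] at hm
        simp at hm; omega
      obtain ⟨⟨x, y⟩, hs, he⟩ := Finset.exists_mem_eq_sup _ hne Prod.snd
      rw [Finset.mem_filter] at hs
      simp only at hs he
      obtain ⟨hs1, rfl⟩ := hs
      exact h.down hs1 hr h1 le_rfl (by omega)
  have hcard : (Y.filter fun s => s.1 = r) = (Finset.Icc 1 m).image fun c => (r, c) := by
    ext ⟨x, y⟩
    rw [Finset.mem_filter, Finset.mem_image]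
    constructor
    · rintro ⟨h1, rfl⟩
      exact ⟨y, Finset.mem_Icc.2 ((key y).1 h1), rfl⟩
    · rintro ⟨c, hc, e⟩
      rw [Prod.mk.injEq] at e
      obtain ⟨rfl, rfl⟩ := e
      exact ⟨(key _).2 (Finset.mem_Icc.1 hc), rfl⟩
  rw [key, hcard, Finset.card_image_of_injective _ (fun a b e => by simpa using e), Nat.card_Icc]
  simp

lemma Young.col_mem_iff {Y : Finset Square} (h : Young Y) {r c : ℕ} (hc : 1 ≤ c) :
    (r, c) ∈ Y ↔ 1 ≤ r ∧ r ≤ (Y.filter fun s => s.2 = c).card := by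
  have hmem : ∀ x y, (x, y) ∈ Y.image Prod.swap ↔ (y, x) ∈ Y := by
    intro x y
    rw [Finset.mem_image]
    constructor
    · rintro ⟨⟨a, b⟩, hs, e⟩
      rw [Prod.swap_prod_mk, Prod.mk.injEq] at e
      obtain ⟨rfl, rfl⟩ := e
      exact hs
    · intro hs; exact ⟨(y, x), hs, rfl⟩
  have h' : Young (Y.image Prod.swap) := h.swap hmem
  rw [← hmem, h'.row_mem_iff hc, Finset.filter_image, Finset.card_image_of_injective _
    Prod.swap_injective]
  rfl

lemma rowLength_spec {T : DominoTableau} (h : Young (shape T)) {r : ℕ} (hr : 1 ≤ r) :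
    (r, rowLength T r + 1) ∉ shape T ∧
      (rowLength T r + 1 = 1 ∨ (r, rowLength T r + 1 - 1) ∈ shape T) := by
  rw [h.row_mem_iff hr, h.row_mem_iff hr]
  unfold rowLength
  omega

lemma colLength_spec {T : DominoTableau} (h : Young (shape T)) {c : ℕ} (hc : 1 ≤ c) :
    (colLength T c + 1, c) ∉ shape T ∧
      (colLength T c + 1 = 1 ∨ (colLength T c + 1 - 1, c) ∈ shape T) := by
  rw [h.col_mem_iff hc, h.col_mem_iff hc]
  unfold colLength
  omega

/-! ### The local rule of the insertion -/

/-- `E` and `D` can both be added to `Y`; `E'` can then be added after `D`, and `D'` after `E`. -/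
inductive LocalRule (Y : Finset Square) : Domino → Domino → Domino → Domino → Prop
  | disj {E D : Domino} (h : Disjoint E.squares D.squares) : LocalRule Y E D E D
  | row {r c c' : ℕ} (hc : 1 ≤ c') (h1 : (r + 1, c') ∉ Y) (h2 : c' = 1 ∨ (r + 1, c' - 1) ∈ Y)
      (h3 : c' ≤ c) :
      LocalRule Y ⟨r, c, false⟩ ⟨r, c, false⟩ ⟨r + 1, c', false⟩ ⟨r + 1, c', false⟩
  | col {r c r' : ℕ} (hc : 1 ≤ r') (h1 : (r', c + 1) ∉ Y) (h2 : r' = 1 ∨ (r' - 1, c + 1) ∈ Y)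
      (h3 : r' ≤ r) :
      LocalRule Y ⟨r, c, true⟩ ⟨r, c, true⟩ ⟨r', c + 1, true⟩ ⟨r', c + 1, true⟩
  | horVert {r c : ℕ} :
      LocalRule Y ⟨r, c, false⟩ ⟨r, c, true⟩ ⟨r, c + 1, true⟩ ⟨r + 1, c, false⟩
  | vertHor {r c : ℕ} :
      LocalRule Y ⟨r, c, true⟩ ⟨r, c, false⟩ ⟨r + 1, c, false⟩ ⟨r, c + 1, true⟩

lemma LocalRule.symm {Y : Finset Square} {E D E' D' : Domino} (h : LocalRule Y E D E' D') :
    LocalRule Y D E D' E' := by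
  cases h with
  | disj h => exact .disj h.symm
  | row a b c d => exact .row a b c d
  | col a b c d => exact .col a b c d
  | horVert => exact .vertHor
  | vertHor => exact .horVert

lemma LocalRule.swap {Y Z : Finset Square} (hYZ : ∀ x y, (x, y) ∈ Z ↔ (y, x) ∈ Y)
    {E D E' D' : Domino} (h : LocalRule Y E D E' D') : LocalRule Z E.tr D.tr E'.tr D'.tr := by
  cases h with
  | disj h =>
    refine .disj (Finset.disjoint_left.2 ?_)
    rintro ⟨x, y⟩ h1 h2
    exact Finset.disjoint_left.1 h (mem_tr_squares.1 h1) (mem_tr_squares.1 h2)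
  | row a b c d => exact .col a (by rwa [hYZ]) (by rwa [hYZ]) d
  | col a b c d => exact .row a (by rwa [hYZ]) (by rwa [hYZ]) d
  | horVert => exact .vertHor
  | vertHor => exact .horVert

/-- Two addable dominos that meet have the same first square. -/
lemma Addable.first_eq {Y : Finset Square} (hY : Young Y) {E D : Domino} (hE : Addable Y E)
    (hD : Addable Y D) (hm : ¬ Disjoint E.squares D.squares) :
    E.row = D.row ∧ E.col = D.col := by
  rw [Finset.not_disjoint_iff] at hm
  obtain ⟨⟨x, y⟩, h1, h2⟩ := hm
  obtain ⟨r, c, _ | _⟩ := E <;> obtain ⟨r', c', _ | _⟩ := D <;>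
    simp only [mem_hdomino, mem_vdomino] at h1 h2 <;>
    simp only [addable_h_iff hY, addable_v_iff hY] at hE hD <;>
    obtain ⟨a1, a2, a3, a4, a5⟩ := hE <;> obtain ⟨b1, b2, b3, b4, b5⟩ := hD <;> simp only
  · refine ⟨by omega, ?_⟩
    obtain ⟨rfl, h1⟩ := h1
    obtain ⟨rfl, h2⟩ := h2
    by_contra hne
    rcases lt_or_gt_of_ne hne with hlt | hlt
    · rcases b4 with b4 | b4
      · omega
      · exact a3 (hY.down b4 a1 a2 (by omega) (by omega))
    · rcases a4 with a4 | a4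
      · omega
      · exact b3 (hY.down a4 a1 b2 (by omega) (by omega))
  · by_contra hne
    rcases Nat.lt_or_ge r' r with hlt | hlt
    · rcases a5 with a5 | a5
      · omega
      · exact b3 (hY.down a5 b1 b2 (by omega) (by omega))
    · rcases b4 with b4 | b4 <;> rcases b5 with b5 | b5
      · omega
      · exact a3 (hY.down b5 a1 a2 (by omega) (by omega))
      · by_cases hc : c' = c
        · exact a3 (hY.down b4 a1 a2 (by omega) (by omega))
        · omega
      · exact a3 (hY.down b5 a1 a2 (by omega) (by omega))
  · by_contra hne
    rcases Nat.lt_or_ge r r' with hlt | hlt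
    · rcases b5 with b5 | b5
      · omega
      · exact a3 (hY.down b5 a1 a2 (by omega) (by omega))
    · rcases a4 with b4 | b4 <;> rcases a5 with b5 | b5
      · omega
      · exact b3 (hY.down b5 b1 b2 (by omega) (by omega))
      · by_cases hc : c' = c
        · exact b3 (hY.down b4 b1 b2 (by omega) (by omega))
        · omega
      · exact b3 (hY.down b5 b1 b2 (by omega) (by omega))
  · refine ⟨?_, by omega⟩
    obtain ⟨rfl, h1⟩ := h1
    obtain ⟨rfl, h2⟩ := h2
    by_contra hne
    rcases lt_or_gt_of_ne hne with hlt | hlt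
    · rcases b4 with b4 | b4
      · omega
      · exact a3 (hY.down b4 a1 a2 (by omega) (by omega))
    · rcases a4 with a4 | a4
      · omega
      · exact b3 (hY.down a4 b1 b2 (by omega) (by omega))

lemma mem_union_domino {Y : Finset Square} {d : Domino} {x y : ℕ} : (x, y) ∈ Y ∪ d.squares ↔
    (x, y) ∈ Y ∨ (x, y) ∈ d.squares := Finset.mem_union

/-- The result of the local rule. -/
lemma LocalRule.addable {Y : Finset Square} (hY : Young Y) {E D E' D' : Domino}
    (hE : Addable Y E) (hD : Addable Y D) (h : LocalRule Y E D E' D') :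
    Addable (Y ∪ D.squares) E' ∧ Y ∪ D.squares ∪ E'.squares = Y ∪ E.squares ∪ D'.squares := by
  have hYD := hD.2
  cases h with
  | disj h =>
    refine ⟨⟨?_, ?_⟩, by rw [Finset.union_right_comm]⟩
    · rw [Finset.disjoint_union_right]; exact ⟨hE.1, h⟩
    · have : Y ∪ D.squares ∪ E.squares = (Y ∪ E.squares) ∪ (Y ∪ D.squares) := by
        ext s; simp only [Finset.mem_union]; tauto
      rw [this]
      intro x y hm
      rcases Finset.mem_union.1 hm with hm | hm
      · exact ⟨(hE.2 x y hm).1, (hE.2 x y hm).2.1, fun x' y' a b c d =>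
          Finset.mem_union_left _ (hE.2.down hm a b c d)⟩
      · exact ⟨(hYD x y hm).1, (hYD x y hm).2.1, fun x' y' a b c d =>
          Finset.mem_union_right _ (hYD.down hm a b c d)⟩
  | @row r c c' hc h1 h2 h3 =>
    refine ⟨?_, rfl⟩
    rw [addable_h_iff hYD]
    simp only [mem_union_domino, mem_hdomino]
    rw [addable_h_iff hY] at hE
    obtain ⟨a1, a2, a3, a4, a5⟩ := hE
    refine ⟨by omega, hc, ?_, ?_, ?_⟩
    · rintro (hh | hh)
      · exact h1 hh
      · omega
    · rcases h2 with h2 | h2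
      · exact Or.inl h2
      · exact Or.inr (Or.inl h2)
    · right
      rw [Nat.add_sub_cancel]
      by_cases hcc : c' + 1 < c
      · left
        rcases a4 with a4 | a4
        · omega
        · exact hY.down a4 a1 (by omega) (by omega) (by omega)
      · right; omega
  | @col r c c' hc h1 h2 h3 =>
    refine ⟨?_, rfl⟩
    rw [addable_v_iff hYD]
    simp only [mem_union_domino, mem_vdomino]
    rw [addable_v_iff hY] at hE
    obtain ⟨a1, a2, a3, a4, a5⟩ := hE
    refine ⟨by omega, by omega, ?_, ?_, ?_⟩
    · rintro (hh | hh)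
      · exact h1 hh
      · omega
    · rcases h2 with h2 | h2
      · exact Or.inl h2
      · exact Or.inr (Or.inl h2)
    · right
      rw [Nat.add_sub_cancel]
      by_cases hcc : c' + 1 < r
      · left
        rcases a4 with a4 | a4
        · omega
        · exact hY.down a4 (by omega) a2 (by omega) (by omega)
      · right; omega
  | @horVert r c =>
    rw [addable_h_iff hY] at hE
    rw [addable_v_iff hY] at hD
    obtain ⟨a1, a2, a3, a4, a5⟩ := hE
    constructor
    · rw [addable_v_iff hYD]
      simp only [mem_union_domino, mem_vdomino]
      refine ⟨a1, by omega, ?_, ?_, ?_⟩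
      · rintro (hh | hh)
        · exact a3 (hY.down hh a1 a2 (by omega) (by omega))
        · omega
      · tauto
      · right; right; simp
    · ext ⟨x, y⟩
      simp only [mem_union_domino, mem_vdomino, mem_hdomino]
      constructor <;> rintro ((hh | hh) | hh) <;> first | (left; left; exact hh) | omega
  | @vertHor r c =>
    rw [addable_v_iff hY] at hE
    obtain ⟨a1, a2, a3, a4, a5⟩ := hE
    constructor
    · rw [addable_h_iff hYD]
      simp only [mem_union_domino, mem_hdomino]
      refine ⟨by omega, by omega, ?_, ?_, ?_⟩
      · rintro (hh | hh)
        · exact a3 (hY.down hh a1 a2 (by omega) (by omega))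
        · omega
      · tauto
      · right; right; simp
    · ext ⟨x, y⟩
      simp only [mem_union_domino, mem_vdomino, mem_hdomino]
      constructor <;> rintro ((hh | hh) | hh) <;> first | (left; left; exact hh) | omega

/-- Putting back a domino follows the local rule. -/
lemma bump_localRule {Y : Finset Square} (hY : Young Y) {S : DominoTableau} {E D : Domino}
    (hE : Addable Y E) (hD : Addable Y D) (hS : shape S = Y ∪ D.squares) (k : ℕ) :
    ∃ E' D', LocalRule Y E D E' D' ∧ bump S (k, E) = S ++ [(k, E')] := by
  have hSY : Young (shape S) := hS ▸ hD.2
  by_cases hd : Disjoint E.squares D.squares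
  · refine ⟨E, D, .disj hd, ?_⟩
    have : Disjoint E.squares (shape S) := by
      rw [hS, Finset.disjoint_union_right]; exact ⟨hE.1, hd⟩
    simp only [bump, if_pos this]
  · have hf := hE.first_eq hY hD hd
    have hnd : ¬ Disjoint E.squares (shape S) := by
      rw [hS, Finset.disjoint_union_right]; exact fun hh => hd hh.2
    have hsub : E.squares ⊆ shape S ↔ E.squares ⊆ D.squares := by
      rw [hS]
      constructor
      · intro hh s hs
        rcases Finset.mem_union.1 (hh hs) with h1 | h1
        · exact absurd h1 (hE.notMem hs)
        · exact h1
      · intro hh; exact hh.trans Finset.subset_union_right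
    obtain ⟨r, c, v⟩ := E
    obtain ⟨r', c', v'⟩ := D
    simp only at hf
    obtain ⟨rfl, rfl⟩ := hf
    simp only [bump, if_neg hnd, hsub]
    cases v <;> cases v'
    · rw [if_pos (Finset.Subset.refl _)]
      have sp := rowLength_spec hSY (r := r + 1) (by omega)
      rw [hS] at sp
      simp only [mem_union_domino, mem_hdomino] at sp
      -- Hence row r+1 of `Y` ends before column c, and its end is weakly to the left of the domino
      -- that is pushed down.
      have hrow : (r + 1, c) ∉ Y := fun hh => by
        rw [addable_h_iff hY] at hE
        exact hE.2.2.1 (hY.down hh hE.1 hE.2.1 (by omega) le_rfl)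
      refine ⟨_, _, .row (c' := rowLength S (r + 1) + 1) (by omega) (fun hh => sp.1 (Or.inl hh))
        ?_ ?_, ?_⟩
      · rcases sp.2 with h1 | h1 | h1
        · exact Or.inl h1
        · exact Or.inr h1
        · omega
      · by_contra hlt
        rcases sp.2 with h1 | h1 | h1
        · rw [addable_h_iff hY] at hE; omega
        · rw [addable_h_iff hY] at hE
          exact hrow (hY.down h1 (by omega) hE.2.1 le_rfl (by omega))
        · omega
      · simp [endOfRow]
    · rw [if_neg ?_]
      · exact ⟨_, _, .horVert, by simp [Domino.second]⟩
      · intro hh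
        have := hh (mem_hdomino.2 ⟨rfl, Or.inr rfl⟩ : (r, c + 1) ∈ _)
        rw [mem_vdomino] at this; omega
    · rw [if_neg ?_]
      · exact ⟨_, _, .vertHor, by simp [Domino.second]⟩
      · intro hh
        have := hh (mem_vdomino.2 ⟨rfl, Or.inr rfl⟩ : (r + 1, c) ∈ _)
        rw [mem_hdomino] at this; omega
    · rw [if_pos (Finset.Subset.refl _)]
      have sp := colLength_spec hSY (c := c + 1) (by omega)
      rw [hS] at sp
      simp only [mem_union_domino, mem_vdomino] at sp
      have hrow : (r, c + 1) ∉ Y := fun hh => by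
        rw [addable_v_iff hY] at hE
        exact hE.2.2.1 (hY.down hh hE.1 hE.2.1 le_rfl (by omega))
      refine ⟨_, _, .col (r' := colLength S (c + 1) + 1) (by omega) (fun hh => sp.1 (Or.inl hh))
        ?_ ?_, ?_⟩
      · rcases sp.2 with h1 | h1 | h1
        · exact Or.inl h1
        · exact Or.inr h1
        · omega
      · by_contra hlt
        rcases sp.2 with h1 | h1 | h1
        · rw [addable_v_iff hY] at hE; omega
        · rw [addable_v_iff hY] at hE
          exact hrow (hY.down h1 hE.1 (by omega) (by omega) le_rfl)
        · omega
      · simp [endOfCol]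

/-! ### Insertion -/

/-- `T'` arises from `T` by inserting a domino labelled `i`, and its shape has grown by `D`. -/
inductive Ins (i : ℕ) (ε : ℤˣ) : DominoTableau → DominoTableau → Domino → Prop
  | row {A : DominoTableau} {c : ℕ} (hA : Std A) (hi : 1 ≤ i) (hlt : ∀ p ∈ A, p.1 < i) (hε : ε = 1)
      (hc : 1 ≤ c) (h1 : (1, c) ∉ shape A) (h2 : c = 1 ∨ (1, c - 1) ∈ shape A) :
      Ins i ε A (A ++ [(i, ⟨1, c, false⟩)]) ⟨1, c, false⟩
  | col {A : DominoTableau} {r : ℕ} (hA : Std A) (hi : 1 ≤ i) (hlt : ∀ p ∈ A, p.1 < i)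
      (hε : ε = -1) (hr : 1 ≤ r) (h1 : (r, 1) ∉ shape A) (h2 : r = 1 ∨ (r - 1, 1) ∈ shape A) :
      Ins i ε A (A ++ [(i, ⟨r, 1, true⟩)]) ⟨r, 1, true⟩
  | step {T T' : DominoTableau} {D E E' D' : Domino} {k : ℕ} (h : Ins i ε T T' D)
      (hk : ∀ p ∈ T', p.1 < k) (hE : Addable (shape T) E)
      (hr : LocalRule (shape T) E D E' D') : Ins i ε (T ++ [(k, E)]) (T' ++ [(k, E')]) D'

lemma Ins.spec {i : ℕ} {ε : ℤˣ} {T T' : DominoTableau} {D : Domino} (h : Ins i ε T T' D) :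
    Std T ∧ Std T' ∧ Addable (shape T) D ∧ shape T' = shape T ∪ D.squares ∧
      (∀ k, (∃ d, (k, d) ∈ T') ↔ k = i ∨ ∃ d, (k, d) ∈ T) := by
  induction h with
  | @row A c hA hi hlt hε hc h1 h2 =>
    have : Addable (shape A) ⟨1, c, false⟩ :=
      (addable_h_iff hA.young).2 ⟨le_rfl, hc, h1, h2, Or.inl rfl⟩
    refine ⟨hA, Std.snoc hA hi hlt this, this, shape_snoc _ _, fun k => ?_⟩
    simp only [List.mem_append, List.mem_singleton, Prod.mk.injEq]
    constructor
    · rintro ⟨d, hd | hd⟩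
      · exact Or.inr ⟨d, hd⟩
      · exact Or.inl hd.1
    · rintro (rfl | ⟨d, hd⟩)
      · exact ⟨_, Or.inr ⟨rfl, rfl⟩⟩
      · exact ⟨d, Or.inl hd⟩
  | @col A r hA hi hlt hε hr h1 h2 =>
    have : Addable (shape A) ⟨r, 1, true⟩ :=
      (addable_v_iff hA.young).2 ⟨hr, le_rfl, h1, h2, Or.inl rfl⟩
    refine ⟨hA, Std.snoc hA hi hlt this, this, shape_snoc _ _, fun k => ?_⟩
    simp only [List.mem_append, List.mem_singleton, Prod.mk.injEq]
    constructor
    · rintro ⟨d, hd | hd⟩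
      · exact Or.inr ⟨d, hd⟩
      · exact Or.inl hd.1
    · rintro (rfl | ⟨d, hd⟩)
      · exact ⟨_, Or.inr ⟨rfl, rfl⟩⟩
      · exact ⟨d, Or.inl hd⟩
  | @step T T' D E E' D' k h hk hE hr ih =>
    obtain ⟨i1, i2, i3, i4, i5⟩ := ih
    have hkT : ∀ p ∈ T, p.1 < k := by
      rintro ⟨l, d⟩ hp
      obtain ⟨d', hd'⟩ := (i5 l).2 (Or.inr ⟨d, hp⟩)
      exact hk (l, d') hd'
    have hk1 : 1 ≤ k := by
      obtain ⟨d', hd'⟩ := (i5 i).2 (Or.inl rfl)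
      have := hk _ hd'
      simp only at this; omega
    have a1 := hr.addable i1.young hE i3
    have a2 := hr.symm.addable i1.young i3 hE
    refine ⟨Std.snoc i1 hk1 hkT hE, Std.snoc i2 hk1 hk (i4 ▸ a1.1), ?_, ?_, fun l => ?_⟩
    · rw [shape_snoc]; exact a2.1
    · rw [shape_snoc, shape_snoc, i4]; exact a1.2
    · simp only [List.mem_append, List.mem_singleton, Prod.mk.injEq]
      constructor
      · rintro ⟨d, hd | hd⟩
        · rcases (i5 l).1 ⟨d, hd⟩ with e | ⟨d', hd'⟩
          · exact Or.inl e
          · exact Or.inr ⟨d', Or.inl hd'⟩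
        · exact Or.inr ⟨E, Or.inr ⟨hd.1, rfl⟩⟩
      · rintro (e | ⟨d, hd | hd⟩)
        · obtain ⟨d', hd'⟩ := (i5 l).2 (Or.inl e)
          exact ⟨d', Or.inl hd'⟩
        · obtain ⟨d', hd'⟩ := (i5 l).2 (Or.inr ⟨d, hd⟩)
          exact ⟨d', Or.inl hd'⟩
        · exact ⟨E', Or.inr ⟨hd.1, rfl⟩⟩

lemma Ins.foldl {i : ℕ} {ε : ℤˣ} {A A' : DominoTableau} {D : Domino} (h : Ins i ε A A' D)
    {B : DominoTableau} (hs : Std (A ++ B)) (hB : ∀ p ∈ B, i < p.1) :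
    ∃ D', Ins i ε (A ++ B) (B.foldl bump A') D' := by
  induction B using List.reverseRecOn with
  | nil => exact ⟨D, by simpa using h⟩
  | append_singleton B p ih =>
    obtain ⟨k, E⟩ := p
    rw [← List.append_assoc] at hs ⊢
    obtain ⟨s1, s2, s3, s4⟩ := std_snoc_iff.1 hs
    obtain ⟨D', hD'⟩ := ih s1 fun p hp => hB p (List.mem_append_left _ hp)
    obtain ⟨i1, i2, i3, i4, i5⟩ := hD'.spec
    obtain ⟨E', D'', hr, hb⟩ := bump_localRule i1.young s4 i3 i4 k
    refine ⟨D'', ?_⟩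
    rw [List.foldl_append, List.foldl_cons, List.foldl_nil, hb]
    refine .step hD' ?_ s4 hr
    rintro ⟨l, d⟩ hp
    rcases (i5 l).1 ⟨d, hp⟩ with rfl | ⟨d', hd'⟩
    · exact hB (k, E) (by simp)
    · exact s3 (l, d') hd'

lemma filter_lt_append_filter_gt {T : DominoTableau} (h : Std T) {i : ℕ}
    (hi : ∀ d, (i, d) ∉ T) :
    T.filter (fun p => decide (p.1 < i)) ++ T.filter (fun p => decide (i < p.1)) = T := by
  have hpw := h.pairwise
  clear h
  induction T with
  | nil => rfl
  | cons p T ih =>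
    rw [List.pairwise_cons] at hpw
    have ih' := ih (fun d hd => hi d (List.mem_cons_of_mem _ hd)) hpw.2
    by_cases hlt : p.1 < i
    · have : ¬ i < p.1 := by omega
      rw [List.filter_cons_of_pos (by simpa using hlt), List.filter_cons_of_neg (by simpa using this),
        List.cons_append, ih']
    · have hne : p.1 ≠ i := fun e => hi p.2 (by rw [← e]; simp)
      have hgt : i < p.1 := by omega
      rw [List.filter_cons_of_neg (by simpa using hlt), List.filter_cons_of_pos (by simpa using hgt)]
      have : T.filter (fun p => decide (p.1 < i)) = [] := by
        rw [List.filter_eq_nil_iff]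
        intro q hq
        have := hpw.1 q hq
        simp only [decide_eq_true_eq]; omega
      rw [this, List.nil_append] at ih' ⊢
      rw [ih']

/-- Inserting a domino gives a standard tableau. -/
theorem insertDomino_ins {T : DominoTableau} (h : Std T) {i : ℕ} (hi : ∀ d, (i, d) ∉ T)
    (hpos : 1 ≤ i) (ε : ℤˣ) : ∃ D, Ins i ε T (insertDomino T i ε) D := by
  have hT := filter_lt_append_filter_gt h hi
  have hS : Std (T.filter fun p => decide (p.1 < i)) := by
    rw [← hT] at h; exact h.left
  have hlt : ∀ p ∈ T.filter fun p => decide (p.1 < i), p.1 < i := by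
    intro p hp; simpa using (List.mem_filter.1 hp).2
  have start : ∃ D, Ins i ε (T.filter fun p => decide (p.1 < i))
      (T.filter (fun p => decide (p.1 < i)) ++ [(i, if ε = 1 then
        endOfRow (T.filter fun p => decide (p.1 < i)) 1 else
        endOfCol (T.filter fun p => decide (p.1 < i)) 1)]) D := by
    by_cases hε : ε = 1
    · rw [if_pos hε]
      have sp := rowLength_spec hS.young (r := 1) le_rfl
      exact ⟨_, .row hS hpos hlt hε (by omega) sp.1 sp.2⟩
    · rw [if_neg hε]
      have sp := colLength_spec hS.young (c := 1) le_rfl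
      exact ⟨_, .col hS hpos hlt (by rcases Int.units_eq_one_or ε with e | e <;> tauto) (by omega)
        sp.1 sp.2⟩
  obtain ⟨D, hD⟩ := start
  obtain ⟨D', hD'⟩ := hD.foldl (B := T.filter fun p => decide (i < p.1)) (by rw [hT]; exact h)
    (fun p hp => by simpa using (List.mem_filter.1 hp).2)
  rw [hT] at hD'
  exact ⟨D', hD'⟩

end SOStar
namespace SOStar

/-! ### Insertion and the relative position of consecutive labels -/

lemma rightOf_iff {d d' : Domino} :
    RightOf d d' ↔ d.col + (if d.vertical then 0 else 1) < d'.col := by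
  obtain ⟨r, c, v⟩ := d
  obtain ⟨r', c', v'⟩ := d'
  constructor
  · intro h
    cases v
    · exact h (r, c + 1) (mem_hdomino.2 (by simp)) (r', c') (by simp [Domino.squares, Domino.first])
    · exact h (r, c) (mem_vdomino.2 (by simp)) (r', c') (by simp [Domino.squares, Domino.first])
  · rintro h ⟨x, y⟩ hs ⟨x', y'⟩ hs'
    cases v <;> cases v' <;> simp only [mem_hdomino, mem_vdomino] at hs hs' <;>
      simp at h <;> simp only <;> omega

lemma below_iff {d d' : Domino} :
    Below d d' ↔ d.row + (if d.vertical then 1 else 0) < d'.row := by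
  rw [← rightOf_tr, rightOf_iff]
  cases h : d.vertical <;> simp [Domino.tr, h]

lemma Addable.corner {Y : Finset Square} (hY : Young Y) {d : Domino} (h : Addable Y d) :
    1 ≤ d.row ∧ 1 ≤ d.col ∧ (d.row, d.col) ∉ Y ∧ (d.col = 1 ∨ (d.row, d.col - 1) ∈ Y) ∧
      (d.row = 1 ∨ (d.row - 1, d.col) ∈ Y) := by
  obtain ⟨r, c, _ | _⟩ := d
  · obtain ⟨h1, h2, h3, h4, h5⟩ := (addable_h_iff hY).1 h
    refine ⟨h1, h2, h3, h4, ?_⟩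
    by_cases hr : r = 1
    · exact Or.inl hr
    · exact Or.inr (hY.down (h5.resolve_left hr) (by simp only; omega) h2 le_rfl (by simp))
  · obtain ⟨h1, h2, h3, h4, h5⟩ := (addable_v_iff hY).1 h
    refine ⟨h1, h2, h3, ?_, h4⟩
    by_cases hr : c = 1
    · exact Or.inl hr
    · exact Or.inr (hY.down (h5.resolve_left hr) h1 (by simp only; omega) (by simp) le_rfl)

lemma first_mem (d : Domino) : (d.row, d.col) ∈ d.squares := by simp [Domino.squares, Domino.first]

/-- Transposing an insertion exchanges rows and columns. -/
lemma Ins.tr {i : ℕ} {ε : ℤˣ} {T T' : DominoTableau} {D : Domino} (h : Ins i ε T T' D) :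
    Ins i (-ε) (tr T) (tr T') D.tr := by
  induction h with
  | row hA hi hlt hε hc h1 h2 =>
    rw [tr_append, tr_singleton]
    refine .col hA.tr hi ?_ (by rw [hε]) hc (by rwa [mem_shape_tr]) (by rwa [mem_shape_tr])
    rintro ⟨k, d⟩ hp
    exact hlt (k, d.tr) (mem_tr.1 hp)
  | col hA hi hlt hε hc h1 h2 =>
    rw [tr_append, tr_singleton]
    refine .row hA.tr hi ?_ (by rw [hε, neg_neg]) hc (by rwa [mem_shape_tr])
      (by rwa [mem_shape_tr])
    rintro ⟨k, d⟩ hp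
    exact hlt (k, d.tr) (mem_tr.1 hp)
  | step h hk hE hr ih =>
    rw [tr_append, tr_append, tr_singleton, tr_singleton]
    refine .step ih ?_ (hE.swap fun x y => mem_shape_tr) (hr.swap fun x y => mem_shape_tr)
    rintro ⟨k, d⟩ hp
    exact hk (k, d.tr) (mem_tr.1 hp)

/-- Two consecutive local rules preserve the relation of lying to the right. -/
lemma LocalRule.rightOf {Y : Finset Square} (hY : Young Y) {E₁ D E₁' D₁ E₂ E₂' D₂ : Domino}
    (hE₁ : Addable Y E₁) (hD : Addable Y D) (hE₂ : Addable (Y ∪ E₁.squares) E₂)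
    (h₁ : LocalRule Y E₁ D E₁' D₁) (h₂ : LocalRule (Y ∪ E₁.squares) E₂ D₁ E₂' D₂)
    (hr : RightOf E₁ E₂) : RightOf E₁' E₂' := by
  have hYE := hE₁.2
  have cE₁ := hE₁.corner hY
  have cE₂ := hE₂.corner hYE
  have cD := hD.corner hY
  rw [rightOf_iff] at hr ⊢
  cases h₁ with
  | disj h =>
    cases h₂ with
    | disj h' => exact hr
    | @row r c c' hc h1 h2 h3 =>
      obtain ⟨a, b, v⟩ := E₁
      simp only at hr cE₁ cE₂ cD
      -- `E₁` ends before column c, and row r of `Y` already reaches column c-1, so `E₁` lies below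
      -- row r. Row r+1 of `Y ∪ E₁.squares` then extends at least to the end of `E₁`, and `E₂'` is
      -- put after it.
      have hlow : r + 1 ≤ a := by
        by_contra hlt
        refine cE₁.2.2.1 (hY.down (cD.2.2.2.1.resolve_left (by omega)) cE₁.1 cE₁.2.1 (by omega) ?_)
        cases v <;> simp at hr <;> omega
      by_contra hcc
      apply h1
      cases v
      · exact hYE.down (Finset.mem_union_right _ (mem_hdomino.2 ⟨rfl, Or.inr rfl⟩))
          (by omega) hc hlow (by simp at hcc; omega)
      · exact hYE.down (Finset.mem_union_right _ (mem_vdomino.2 ⟨rfl, Or.inl rfl⟩))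
          (by omega) hc hlow (by simpa using hcc)
    | col hc h1 h2 h3 => simp only at hr ⊢; omega
    | horVert => simp only at hr ⊢; omega
    | vertHor => exact hr
  | @row r c c' hc h1 h2 h3 =>
    simp at hr ⊢
    cases h₂ with
    | disj h' => omega
    | row => simp only at hr ⊢; omega
    | vertHor => simp only at hr ⊢; omega
  | @col r c r' hc h1 h2 h3 =>
    simp at hr ⊢
    cases h₂ with
    | disj h' =>
      obtain ⟨a, b, v⟩ := E₂
      simp only at hr cE₁ cE₂ cD ⊢
      by_contra hlt
      have hb : b = c + 1 := by omega
      subst hb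
      -- A domino `E₂` starting in column c+1 would start at the end of that column, and this is
      -- where `D₁` already lies.
      have : a = r' := by
        by_contra hne
        rcases lt_or_gt_of_ne hne with hlt | hlt
        · exact cE₂.2.2.1 (Finset.mem_union_left _ (hY.down (h2.resolve_left (by omega)) cE₂.1
            (by omega) (by omega) le_rfl))
        · rcases Finset.mem_union.1 (cE₂.2.2.2.2.resolve_left (by omega)) with hh | hh
          · exact h1 (hY.down hh hc (by omega) (by omega) le_rfl)
          · rw [mem_vdomino] at hh; omega
      subst this
      exact Finset.disjoint_left.1 h' (first_mem _) (first_mem _)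
    | col => simp only; omega
    | horVert => simp only; omega
  | @horVert r c =>
    simp at hr ⊢
    cases h₂ with
    | disj h' => omega
    | row => simp only at hr ⊢; omega
    | vertHor => simp only at hr ⊢; omega
  | @vertHor r c =>
    simp at hr ⊢
    cases h₂ with
    | disj h' =>
      obtain ⟨a, b, v⟩ := E₂
      simp only at hr cE₁ cE₂ cD ⊢
      by_contra hlt
      have hb : b = c + 1 := by omega
      subst hb
      have : a = r := by
        by_contra hne
        rcases lt_or_gt_of_ne hne with hlt | hlt
        · rcases ((addable_h_iff hY).1 hD).2.2.2.2 with h5 | h5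
          · omega
          · exact cE₂.2.2.1 (Finset.mem_union_left _ (hY.down h5 cE₂.1 (by omega) (by omega) le_rfl))
        · rcases Finset.mem_union.1 (cE₂.2.2.2.2.resolve_left (by omega)) with hh | hh
          · exact cE₁.2.2.1 (hY.down hh (by omega) (by omega) (by omega) (by omega))
          · rw [mem_vdomino] at hh; omega
      subst this
      exact Finset.disjoint_left.1 h' (first_mem _) (first_mem _)
    | col => simp only; omega
    | horVert => simp only; omega

lemma RightIn.append {T : DominoTableau} {k l : ℕ} (h : RightIn T k l) (B : DominoTableau) :
    RightIn (T ++ B) k l := by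
  obtain ⟨d, d', h1, h2, h3⟩ := h
  exact ⟨d, d', List.mem_append_left _ h1, List.mem_append_left _ h2, h3⟩

lemma BelowIn.append {T : DominoTableau} {k l : ℕ} (h : BelowIn T k l) (B : DominoTableau) :
    BelowIn (T ++ B) k l := by
  obtain ⟨d, d', h1, h2, h3⟩ := h
  exact ⟨d, d', List.mem_append_left _ h1, List.mem_append_left _ h2, h3⟩

lemma mem_snoc (T : DominoTableau) (p : ℕ × Domino) : p ∈ T ++ [p] :=
  List.mem_append_right _ (List.mem_singleton_self _)

/-- Insertion preserves the relation of lying to the right. -/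
lemma Ins.rightIn {i : ℕ} {ε : ℤˣ} {T T' : DominoTableau} {D : Domino} (h : Ins i ε T T' D)
    {k : ℕ} (hr : RightIn T k (k + 1)) : RightIn T' k (k + 1) := by
  induction h with
  | row => exact hr.append _
  | col => exact hr.append _
  | @step T T' D E E' D' m h hm hE hrule ih =>
    have hmT : ∀ p ∈ T, p.1 < m := by
      rintro ⟨l, d⟩ hp
      obtain ⟨d', hd'⟩ := (h.spec.2.2.2.2 l).2 (Or.inr ⟨d, hp⟩)
      exact hm (l, d') hd'
    obtain ⟨d, d', h1, h2, h3⟩ := hr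
    rw [List.mem_append, List.mem_singleton, Prod.mk.injEq] at h1 h2
    rcases h2 with h2 | ⟨rfl, rfl⟩
    · have : (k, d) ∈ T := by
        rcases h1 with h1 | ⟨rfl, rfl⟩
        · exact h1
        · have := hmT _ h2; simp only at this; omega
      exact (ih ⟨d, d', this, h2, h3⟩).append _
    · have h1' : (k, d) ∈ T := by
        rcases h1 with h1 | ⟨h1, _⟩
        · exact h1
        · omega
      cases h with
      | row hA hi hlt hε hc g1 g2 =>
        have a1 := hlt _ h1'
        have a2 := hm (i, _) (mem_snoc _ _)
        simp only at a1 a2; omega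
      | col hA hi hlt hε hc g1 g2 =>
        have a1 := hlt _ h1'
        have a2 := hm (i, _) (mem_snoc _ _)
        simp only at a1 a2; omega
      | @step A A' D₀ E₁ E₁' D₁ m' h hm' hE₁ hr₁ =>
        have hl := (Std.pairwise (Ins.step h hm' hE₁ hr₁).spec.1)
        have hm1 := hmT (m', E₁) (by simp)
        rw [List.mem_append, List.mem_singleton, Prod.mk.injEq] at h1'
        -- Labels increase along the list, so the predecessor of the last label was put back in the
        -- step just before.
        have : k = m' ∧ d = E₁ := by
          rcases h1' with h1' | h1'
          · have := (List.pairwise_append.1 hl).2.2 _ h1' (m', E₁) (by simp)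
            simp only at this hm1; omega
          · exact h1'
        obtain ⟨rfl, rfl⟩ := this
        obtain ⟨s1, s2, s3, s4, s5⟩ := h.spec
        rw [shape_snoc] at hrule hE
        exact ⟨E₁', E', by simp, by simp, hr₁.rightOf s1.young hE₁ s3 hE hrule h3⟩

lemma Ins.belowIn {i : ℕ} {ε : ℤˣ} {T T' : DominoTableau} {D : Domino} (h : Ins i ε T T' D)
    {k : ℕ} (hr : BelowIn T k (k + 1)) : BelowIn T' k (k + 1) := by
  rw [← rightIn_tr] at hr ⊢
  exact h.tr.rightIn hr

/-- A domino inserted in the first row lies to the right of its predecessor. -/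
lemma Ins.rightIn_pred {k : ℕ} {T T' : DominoTableau} {D : Domino} (h : Ins (k + 1) 1 T T' D)
    (hk : ∃ d, (k, d) ∈ T) : RightIn T' k (k + 1) := by
  induction h with
  | @row A c hA hi hlt hε hc h1 h2 =>
    obtain ⟨d, hd⟩ := hk
    refine ⟨d, _, List.mem_append_left _ hd, mem_snoc _ _, ?_⟩
    rintro ⟨x, y⟩ hs ⟨x', y'⟩ hs'
    rw [mem_hdomino] at hs'
    have hm : (x, y) ∈ shape A := mem_shape.2 ⟨_, hd, hs⟩
    have : y < c := by
      by_contra hlt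
      exact h1 (hA.young.down hm le_rfl hc (hA.young _ _ hm).1 (by omega))
    simp only; omega
  | col _ _ _ hε => exact absurd hε (by decide)
  | @step T T' D E E' D' m h hm hE hrule ih =>
    obtain ⟨d, hd⟩ := hk
    obtain ⟨d', hd'⟩ := (h.spec.2.2.2.2 (k + 1)).2 (Or.inl rfl)
    have := hm _ hd'
    rw [List.mem_append, List.mem_singleton, Prod.mk.injEq] at hd
    rcases hd with hd | ⟨hd, _⟩
    · exact (ih ⟨d, hd⟩).append _
    · simp only at this; omega

lemma Ins.belowIn_pred {k : ℕ} {T T' : DominoTableau} {D : Domino} (h : Ins (k + 1) (-1) T T' D)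
    (hk : ∃ d, (k, d) ∈ T) : BelowIn T' k (k + 1) := by
  rw [← rightIn_tr]
  have := h.tr
  rw [neg_neg] at this
  exact this.rightIn_pred (by obtain ⟨d, hd⟩ := hk; exact ⟨d.tr, mem_tr.2 (by simpa using hd)⟩)

/-- The successor of a domino inserted in the first row lies below it. -/
lemma Ins.belowIn_succ {k : ℕ} {T T' : DominoTableau} {D : Domino} (h : Ins k 1 T T' D)
    (hk : ∃ d, (k + 1, d) ∈ T) : BelowIn T' k (k + 1) := by
  induction h with
  | @row A c hA hi hlt hε hc h1 h2 =>
    obtain ⟨d, hd⟩ := hk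
    have := hlt _ hd
    simp only at this; omega
  | col _ _ _ hε => exact absurd hε (by decide)
  | @step T T' D E E' D' m h hm hE hrule ih =>
    obtain ⟨d, hd⟩ := hk
    rw [List.mem_append, List.mem_singleton, Prod.mk.injEq] at hd
    rcases hd with hd | ⟨rfl, rfl⟩
    · exact (ih ⟨d, hd⟩).append _
    · cases h with
      | @row _ c hA hi hlt hε hc h1 h2 =>
        refine ⟨⟨1, c, false⟩, E', by simp, by simp, ?_⟩
        rw [below_iff]
        simp
        cases hrule with
        | disj hd =>
          -- If the successor had been left in the first row, it would start at the end of that row,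
          -- where `k` has just been inserted.
          have cE := hE.corner hA.young
          by_contra hlt
          have hrow : E'.row = 1 := by omega
          rw [hrow] at cE
          have : E'.col = c := by
            by_contra hne
            rcases lt_or_gt_of_ne hne with hlt | hlt
            · exact cE.2.2.1 (hA.young.down (h2.resolve_left (by omega)) le_rfl cE.2.1 le_rfl
                (by omega))
            · exact h1 (hA.young.down (cE.2.2.2.1.resolve_left (by omega)) le_rfl hc le_rfl
                (by omega))
          have f := first_mem E'
          rw [hrow, this] at f
          exact Finset.disjoint_left.1 hd f (first_mem _)
        | row => simp
        | vertHor => simp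
      | col _ _ _ hε => exact absurd hε (by decide)
      | @step A A' D₀ E₁ E₁' D₁ m' h hm' hE₁ hr₁ =>
        have a := hm (m', E₁') (by simp)
        obtain ⟨d', hd'⟩ := (h.spec.2.2.2.2 k).2 (Or.inl rfl)
        have b := hm' _ hd'
        simp only at a b; omega

lemma Ins.rightIn_succ {k : ℕ} {T T' : DominoTableau} {D : Domino} (h : Ins k (-1) T T' D)
    (hk : ∃ d, (k + 1, d) ∈ T) : RightIn T' k (k + 1) := by
  rw [← belowIn_tr]
  have := h.tr
  rw [neg_neg] at this
  exact this.belowIn_succ (by obtain ⟨d, hd⟩ := hk; exact ⟨d.tr, mem_tr.2 (by simpa using hd)⟩)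

end SOStar
namespace SOStar

/-! ### Two successive insertions -/

lemma fixed_h_eq (r c : ℕ) : Domino.fixedSquare ⟨r, c, false⟩ = (r, c + (r + c) % 2) := by
  rcases Nat.mod_two_eq_zero_or_one (r + c) with h | h
  · rw [fixed_h h, h, Nat.add_zero]
  · rw [fixed_h' h, h]

lemma fixed_v_eq (r c : ℕ) : Domino.fixedSquare ⟨r, c, true⟩ = (r + (r + c) % 2, c) := by
  rcases Nat.mod_two_eq_zero_or_one (r + c) with h | h
  · rw [fixed_v h, h, Nat.add_zero]
  · rw [fixed_v' h, h]

/-- An even square weakly above and to the left of the fixed square of an addable domino belongs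
to the shape or is that fixed square. -/
lemma Addable.le_fixed {V : Finset Square} {d : Domino} (h : Addable V d) {x y X Y : ℕ}
    (hf : d.fixedSquare = (X, Y)) (he : (x + y) % 2 = 0) (hx : 1 ≤ x) (hy : 1 ≤ y) (hX : x ≤ X)
    (hY : y ≤ Y) : (x, y) ∈ V ∨ (x = X ∧ y = Y) := by
  have hm : (X, Y) ∈ V ∪ d.squares := Finset.mem_union_right _ (hf ▸ fixedSquare_mem d)
  rcases Finset.mem_union.1 (h.2.down hm hx hy hX hY) with h1 | h1
  · exact Or.inl h1
  · have := eq_fixedSquare_of_mem h1 he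
    rw [hf, Prod.mk.injEq] at this
    exact Or.inr ⟨this.1.symm, this.2.symm⟩

lemma Addable.fixed_notMem {V : Finset Square} {d : Domino} (h : Addable V d) {X Y : ℕ}
    (hf : d.fixedSquare = (X, Y)) : (X, Y) ∉ V := by
  rw [← hf]; exact h.notMem (fixedSquare_mem d)

lemma Young.one_le {Y : Finset Square} (h : Young Y) {s : Square} (hs : s ∈ Y) :
    1 ≤ s.1 ∧ 1 ≤ s.2 := ⟨(h s.1 s.2 hs).1, (h s.1 s.2 hs).2.1⟩

lemma Young.le_mem {Y : Finset Square} (h : Young Y) {s : Square} (hs : s ∈ Y) {x y : ℕ}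
    (hx : 1 ≤ x) (hy : 1 ≤ y) (hx' : x ≤ s.1) (hy' : y ≤ s.2) : (x, y) ∈ Y :=
  (h s.1 s.2 hs).2.2 x y hx hy hx' hy'

lemma TabEquiv.even_mem {T U : DominoTableau} (h : TabEquiv T U) {x y : ℕ} (he : (x + y) % 2 = 0) :
    (x, y) ∈ shape T ↔ (x, y) ∈ shape U := by
  rw [mem_shape, mem_shape]
  constructor
  · rintro ⟨p, hp, hs⟩
    obtain ⟨q, hq, e, f⟩ := h.exists_right hp
    refine ⟨q, hq, ?_⟩
    rw [eq_fixedSquare_of_mem hs he] at f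
    rw [← f]; exact fixedSquare_mem _
  · rintro ⟨p, hp, hs⟩
    obtain ⟨q, hq, e, f⟩ := h.exists_left hp
    refine ⟨q, hq, ?_⟩
    rw [eq_fixedSquare_of_mem hs he] at f
    rw [← f]; exact fixedSquare_mem _

/-- The conditions for a block refer only to labels smaller than those of the block, so adding or
removing the largest label does not affect the blocks of smaller labels. -/
lemma TabEquiv.prefix {A B : DominoTableau} {k l : ℕ} {d d' : Domino}
    (h : TabEquiv (A ++ [(k, d)]) (B ++ [(l, d')])) :
    TabEquiv A B ∧ k = l ∧ d.fixedSquare = d'.fixedSquare := by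
  obtain ⟨s1, s2, s3, s4⟩ := std_snoc_iff.1 h.std_left
  obtain ⟨t1, t2, t3, t4⟩ := std_snoc_iff.1 h.std_right
  have hf := h.fixed
  rw [List.map_append, List.map_append] at hf
  have hf' := List.append_inj' hf (by simp)
  simp only [List.map_cons, List.map_nil, List.cons.injEq, Prod.mk.injEq, and_true] at hf'
  obtain ⟨f1, rfl, f3⟩ := hf'
  have mono : ∀ s m, LabelLT A s m → LabelLT (A ++ [(k, d)]) s m := by
    rintro s m (h | h | ⟨p, hp, h⟩)
    · exact Or.inl h
    · exact Or.inr (Or.inl h)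
    · exact Or.inr (Or.inr ⟨p, List.mem_append_left _ hp, h⟩)
  have mono' : ∀ s m, m < k → LabelLT (A ++ [(k, d)]) s m → LabelLT A s m := by
    rintro s m hm (h | h | ⟨p, hp, h⟩)
    · exact Or.inl h
    · exact Or.inr (Or.inl h)
    · rw [List.mem_append, List.mem_singleton] at hp
      rcases hp with hp | rfl
      · exact Or.inr (Or.inr ⟨p, hp, h⟩)
      · have := h.2; simp only at this; omega
  have back : ∀ m e, m < k → (m, e) ∈ B ++ [(k, d')] → (m, e) ∈ B := by
    intro m e hm hp
    rw [List.mem_append, List.mem_singleton, Prod.mk.injEq] at hp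
    rcases hp with hp | ⟨hp, _⟩
    · exact hp
    · omega
  refine ⟨⟨s1, t1, f1, ?_, ?_⟩, rfl, f3⟩
  · rintro m l x y ⟨b1, b2, b3, b4, b5⟩
    have m1 := s3 _ b2
    have m2 := s3 _ b3
    have := h.vblock m l x y ⟨b1, List.mem_append_left _ b2, List.mem_append_left _ b3,
      mono _ _ b4, fun hh => b5 (mono' _ _ m2 hh)⟩
    exact ⟨back _ _ m1 this.1, back _ _ m2 this.2⟩
  · rintro m l x y ⟨b1, b2, b3, b4, b5⟩
    have m1 := s3 _ b2
    have m2 := s3 _ b3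
    have := h.hblock m l x y ⟨b1, List.mem_append_left _ b2, List.mem_append_left _ b3,
      mono _ _ b4, fun hh => b5 (mono' _ _ m2 hh)⟩
    exact ⟨back _ _ m1 this.1, back _ _ m2 this.2⟩

/-- The effect of the local rule on the fixed squares. -/
lemma LocalRule.fixed_cases {V : Finset Square} (hV : Young V) {E D E' D' : Domino}
    (hE : Addable V E) (hD : Addable V D) (h : LocalRule V E D E' D') :
    (E.fixedSquare ≠ D.fixedSquare ∧ D'.fixedSquare = D.fixedSquare) ∨
    (∃ x y, (x + y) % 2 = 0 ∧ E.fixedSquare = (x, y) ∧ D.fixedSquare = (x, y) ∧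
      D'.fixedSquare = (x + 1, y + 1) ∧ (x = 1 ∨ (x - 1, y + 1) ∈ V) ∧ E.row = x ∧ E.col = y) ∨
    (∃ r c c', E = ⟨r, c, false⟩ ∧ D = ⟨r, c, false⟩ ∧ D' = ⟨r + 1, c', false⟩ ∧ 1 ≤ c' ∧
      (r + 1, c') ∉ V ∧ (c' = 1 ∨ (r + 1, c' - 1) ∈ V) ∧ c' ≤ c) ∨
    (∃ r c r', E = ⟨r, c, true⟩ ∧ D = ⟨r, c, true⟩ ∧ D' = ⟨r', c + 1, true⟩ ∧ 1 ≤ r' ∧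
      (r', c + 1) ∉ V ∧ (r' = 1 ∨ (r' - 1, c + 1) ∈ V) ∧ r' ≤ r) := by
  cases h with
  | disj h =>
    refine Or.inl ⟨fun e => ?_, rfl⟩
    exact Finset.disjoint_left.1 h (fixedSquare_mem E) (e ▸ fixedSquare_mem D)
  | row a b c d => exact Or.inr (Or.inr (Or.inl ⟨_, _, _, rfl, rfl, rfl, a, b, c, d⟩))
  | col a b c d => exact Or.inr (Or.inr (Or.inr ⟨_, _, _, rfl, rfl, rfl, a, b, c, d⟩))
  | @horVert r c =>
    -- If r + c is even the two dominos share their fixed square, and that of the growth moves one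
    -- step diagonally; if it is odd they share only the variable square, and the fixed square of
    -- the growth stays.
    rcases Nat.mod_two_eq_zero_or_one (r + c) with h | h
    · refine Or.inr (Or.inl ⟨r, c, h, fixed_h h, fixed_v h, ?_, ?_, rfl, rfl⟩)
      · rw [fixed_h_eq, Prod.mk.injEq]; omega
      · exact ((addable_h_iff hV).1 hE).2.2.2.2
    · left
      rw [fixed_h_eq, fixed_v_eq, fixed_h_eq]
      simp only [ne_eq, Prod.mk.injEq]; omega
  | @vertHor r c =>
    rcases Nat.mod_two_eq_zero_or_one (r + c) with h | h
    · refine Or.inr (Or.inl ⟨r, c, h, fixed_v h, fixed_h h, ?_, ?_, rfl, rfl⟩)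
      · rw [fixed_v_eq, Prod.mk.injEq]; omega
      · exact ((addable_h_iff hV).1 hD).2.2.2.2
    · left
      rw [fixed_h_eq, fixed_v_eq, fixed_v_eq]
      simp only [ne_eq, Prod.mk.injEq]; omega

/-- The position of the growth `D'` of a second insertion relative to the growth `D` of the
first: it has larger content, or `D` is vertical and blocked on its right. -/
def GrowsRight (T : DominoTableau) (D D' : Domino) : Prop :=
  D.fixedSquare.2 + D'.fixedSquare.1 < D'.fixedSquare.2 + D.fixedSquare.1 ∨
  ∃ x y k, D = ⟨x, y, true⟩ ∧ (x + y) % 2 = 0 ∧ D'.fixedSquare = (x + 1, y + 1) ∧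
    (k, D) ∈ T ∧ LabelLT T (x - 1, y + 1) k

/-- The case of a vertical domino put at the end of the next column. -/
lemma growsRight_of_column {P : DominoTableau} {V : Finset Square} {k h c : ℕ}
    (hP : Young (shape P)) (hlt : ∀ p ∈ P, p.1 < k) (hV : Young V)
    (heven : ∀ x y, (x + y) % 2 = 0 → ((x, y) ∈ shape P ↔ (x, y) ∈ V))
    (hA : Addable (shape P) ⟨h, c + 1, true⟩) {E D₀ E' D' : Domino} (hE : Addable V E)
    (hD : Addable V D₀) (hr : LocalRule V E D₀ E' D')
    (hf : E.fixedSquare = Domino.fixedSquare ⟨h, c + 1, true⟩)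
    (hc : c = 0 ∨ ∃ x₀, (x₀, c) ∈ V ∧ (x₀ + c) % 2 = 0 ∧ h ≤ x₀ ∧
      c + D₀.fixedSquare.1 < D₀.fixedSquare.2 + x₀) :
    GrowsRight (P ++ [(k, ⟨h, c + 1, true⟩)]) ⟨h, c + 1, true⟩ D' := by
  obtain ⟨a1, a2, a3, a4, a5⟩ := (addable_v_iff hP).1 hA
  rw [fixed_v_eq] at hf
  set X := h + (h + (c + 1)) % 2 with hX
  have hXe : (X + (c + 1)) % 2 = 0 := by omega
  -- the blocked state
  have blocked : (X = 1 ∨ (X - 1, c + 2) ∈ V) → D'.fixedSquare = (X + 1, c + 2) →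
      GrowsRight (P ++ [(k, ⟨h, c + 1, true⟩)]) ⟨h, c + 1, true⟩ D' := by
    intro hb hD'
    have hb' : X = 1 ∨ (X - 1, c + 2) ∈ shape P := by
      by_cases hX1 : X = 1
      · exact Or.inl hX1
      · exact hb.imp_right fun hh => (heven _ _ (by omega)).2 hh
    have hXh : X = h := by
      by_contra hne
      have h1 : X = h + 1 := by omega
      rcases hb' with hb' | hb'
      · omega
      · exact a3 (hP.down hb' a1 a2 (by omega) (by omega))
    refine Or.inr ⟨h, c + 1, k, rfl, by omega, by rw [hD', hXh], mem_snoc _ _, ?_⟩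
    rcases hb' with hb' | hb'
    · left; simp only; omega
    · obtain ⟨p, hp, hs⟩ := mem_shape.1 hb'
      rw [hXh] at hs
      exact Or.inr (Or.inr ⟨p, List.mem_append_left _ hp, hs, hlt p hp⟩)
  rcases hr.fixed_cases hV hE hD with ⟨hne, hfix⟩ | ⟨x, y, he, f1, f2, f3, hb, _, _⟩ |
    ⟨r, c₁, c', rfl, rfl, rfl, b1, b2, b3, b4⟩ | ⟨r, c₁, r', rfl, rfl, rfl, b1, b2, b3, b4⟩
  · left
    rw [fixed_v_eq, hfix]
    simp only
    rcases hf' : D₀.fixedSquare with ⟨x', y'⟩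
    rw [hf'] at hc hne
    rw [hf] at hne
    have he' := fixedSquare_even D₀
    rw [hf'] at he'
    have hmem : (x', y') ∈ V ∪ D₀.squares := Finset.mem_union_right _ (hf' ▸ fixedSquare_mem D₀)
    obtain ⟨px, py, _⟩ := hD.2 _ _ hmem
    simp only at hc he' ⊢
    by_contra hle
    -- If the content were not larger there are two possibilities. In column c+1 or beyond, the
    -- fixed square of `D₀` is weakly below and to the right of (X, c+1), which must then belong to
    -- `V` or be that square. In a smaller column it is weakly above and to the left of (x₀, c),
    -- hence in `V`. Both are excluded.
    by_cases hy : c + 1 ≤ y'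
    · rcases hD.le_fixed hf' hXe (by omega) (by omega) (by omega) hy with h1 | h1
      · exact hE.fixed_notMem hf h1
      · apply hne
        rw [Prod.mk.injEq]; omega
    · rcases hc with hc | ⟨x₀, c1, c2, c3, c4⟩
      · omega
      · exact hD.fixed_notMem hf' (hV.down c1 px py (by omega) (by omega))
  · rw [f1, Prod.mk.injEq] at hf
    obtain ⟨rfl, rfl⟩ := hf
    exact blocked hb f3
  · rw [fixed_h_eq, Prod.mk.injEq] at hf
    obtain ⟨rfl, hf2⟩ := hf
    obtain ⟨e1, e2, e3, e4, e5⟩ := (addable_h_iff hV).1 hE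
    by_cases hc1 : c₁ = c + 1
    · subst hc1
      refine blocked e5 ?_
      have hXh : X = h := by
        by_contra hne
        have h1 : X = h + 1 := by omega
        rcases e5 with hb' | hb'
        · omega
        · have := (heven _ _ (by omega)).2 hb'
          exact a3 (hP.down this a1 a2 (by omega) (by omega))
      have : c' = c + 1 := by
        by_contra hne
        have hlt' : c' ≤ c := by omega
        rcases a5 with a5 | a5
        · omega
        · rw [Nat.add_sub_cancel, ← hXh] at a5
          exact b2 (hV.down ((heven _ _ (by omega)).1 a5) (by omega) b1 le_rfl hlt')
      rw [fixed_h_eq, this, Prod.mk.injEq]; omega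
    · exfalso
      have hcc : c₁ = c := by omega
      subst hcc
      rcases hc with hc | ⟨x₀, c1, c2, c3, c4⟩
      · omega
      · rw [fixed_h_eq] at c4
        simp only at c4
        have : x₀ < X := by
          by_contra hge
          exact e3 (hV.down c1 e1 e2 (by omega) le_rfl)
        omega
  · rw [fixed_v_eq, Prod.mk.injEq] at hf
    obtain ⟨hf1, rfl⟩ := hf
    by_cases heq : r' + (r' + (c + 2)) % 2 = X + 1
    · refine blocked ?_ ?_
      · have : r' = X := by omega
        rw [this] at b3
        exact b3
      · rw [fixed_v_eq, Prod.mk.injEq]; omega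
    · left
      rw [fixed_v_eq, fixed_v_eq]
      simp only
      omega


/-- The label `k` is put back in both insertions, with `E'` and `F` having the same fixed square.
Suppose first that `D₀'` has larger content than `D₀`. If the first growth is pushed to the next
row, its content does not increase, and the displaced domino has too small a content to disturb
`D₀'`. If it is pushed to the next column, `growsRight_of_column` applies. If instead `D₀` is
blocked, either neither growth meets `k`, or `k` is turned into the column next to `D₀`. In the
latter situation it forms a closed cycle with `D₀`, the second tableau contains the same block, and
the second growth is pushed one column further. -/
lemma growsRight_step {P P' Q : DominoTableau} {k : ℕ} {D₀ E E' D D₀' F F' D' : Domino}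
    (hP : Std P) (hP' : Std P') (hsh : shape P' = shape P ∪ D₀.squares)
    (hlt : ∀ p ∈ P', p.1 < k) (hD₀ : Addable (shape P) D₀) (hE : Addable (shape P) E)
    (hr : LocalRule (shape P) E D₀ E' D) (hF : Addable (shape Q) F)
    (hD₀' : Addable (shape Q) D₀') (hr' : LocalRule (shape Q) F D₀' F' D')
    (heq : TabEquiv (P' ++ [(k, E')]) (Q ++ [(k, F)])) (hinv : GrowsRight P' D₀ D₀') :
    GrowsRight (P' ++ [(k, E')]) D D' := by
  obtain ⟨hPQ, -, hfix⟩ := heq.prefix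
  have hV := hPQ.std_right.young
  have hE' := (hr.addable hP.young hE hD₀).1
  have hD := (hr.symm.addable hP.young hD₀ hE).1
  rw [← hsh] at hE'
  have heven : ∀ x y, (x + y) % 2 = 0 → ((x, y) ∈ shape P' ↔ (x, y) ∈ shape Q) :=
    fun x y he => hPQ.even_mem he
  have hφ₀ : D₀.fixedSquare ∈ shape Q := by
    rw [← heven _ _ (fixedSquare_even D₀), hsh]
    exact Finset.mem_union_right _ (fixedSquare_mem D₀)
  have hpos₀ := hD₀.2.one_le (Finset.mem_union_right _ (fixedSquare_mem D₀))
  rcases hinv with hs | ⟨x, y, k₀, rfl, he, hf', hk₀, hl⟩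
  · -- larger content
    have keep : D'.fixedSquare = D₀'.fixedSquare →
        D.fixedSquare.2 + D₀.fixedSquare.1 ≤ D₀.fixedSquare.2 + D.fixedSquare.1 →
        GrowsRight (P' ++ [(k, E')]) D D' := by
      intro h1 h2
      left; rw [h1]; omega
    -- the fixed square of the growth does not change
    have stay : D.fixedSquare = D₀.fixedSquare → E'.fixedSquare ≠ D₀.fixedSquare →
        E'.fixedSquare ∈ shape P ∪ E.squares ∪ D.squares → GrowsRight (P' ++ [(k, E')]) D D' := by
      intro h1 h2 hmem
      rcases hr'.fixed_cases hV hF hD₀' with ⟨hne, hfx⟩ | ⟨x, y, he, f1, f2, f3, hb, _, _⟩ |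
        ⟨r, c₁, c', rfl, rfl, rfl, b1, b2, b3, b4⟩ | ⟨r, c₁, r', rfl, rfl, rfl, b1, b2, b3, b4⟩
      · exact keep hfx (by rw [h1])
      · left
        rw [h1, f3]; rw [f2] at hs
        simp only at hs ⊢; omega
      · left
        rw [h1]
        rcases hx : D₀.fixedSquare with ⟨x, y⟩
        rw [hx] at hs hφ₀ h1 h2 hpos₀
        rw [fixed_h_eq] at hs ⊢
        simp only at hs ⊢
        rw [hfix, fixed_h_eq] at hmem h2
        have hxr : r + 1 ≤ x := by
          by_contra hlt'
          rcases Finset.mem_union.1 hmem with hm | hm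
          · have : (x, y) ∈ shape P ∪ E.squares :=
              hE.2.down hm hpos₀.1 hpos₀.2 (by omega) (by omega)
            exact hD.fixed_notMem h1 this
          · have := eq_fixedSquare_of_mem hm (by omega)
            exact h2 (this.symm.trans h1)
        have : y < c' := by
          by_contra hge
          exact b2 (hV.down hφ₀ (by omega) b1 hxr (by omega))
        omega
      · left
        rw [h1]
        rw [fixed_v_eq] at hs ⊢
        simp only at hs ⊢
        omega
    cases hr with
    | disj h =>
      refine stay rfl (fun e => ?_) ?_
      · exact Finset.disjoint_left.1 h (fixedSquare_mem _) (e ▸ fixedSquare_mem _)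
      · exact Finset.mem_union_left _ (Finset.mem_union_right _ (fixedSquare_mem _))
    | @row r c c' hc h1 h2 h3 =>
      rw [fixed_h_eq] at hs
      rcases hr'.fixed_cases hV hF hD₀' with ⟨hne, hfx⟩ | ⟨x, y, he, f1, f2, f3, hb, _, _⟩ |
        ⟨r, c₁, c', rfl, rfl, rfl, b1, b2, b3, b4⟩ | ⟨r, c₁, r', rfl, rfl, rfl, b1, b2, b3, b4⟩
      · refine keep hfx ?_
        simp only [fixed_h_eq]; omega
      · exfalso
        rw [f2] at hs
        rw [f1, fixed_h_eq, Prod.mk.injEq] at hfix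
        simp only at hs; omega
      · exfalso
        rw [← hfix, fixed_h_eq] at hs
        simp only at hs; omega
      · exfalso
        rw [← hfix, fixed_h_eq] at hs
        simp only at hs; omega
    | @col r c r' hc h1 h2 h3 =>
      refine growsRight_of_column hP'.young hlt hV heven hE' hF hD₀' hr' hfix.symm (Or.inr ?_)
      rw [fixed_v_eq] at hs hφ₀
      refine ⟨_, hφ₀, by omega, by omega, hs⟩
    | @horVert r c =>
      rcases Nat.mod_two_eq_zero_or_one (r + c) with he | he
      · rw [fixed_v_eq] at hs
        rcases hr'.fixed_cases hV hF hD₀' with ⟨hne, hfx⟩ | ⟨x, y, he, f1, f2, f3, hb, _, _⟩ |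
          ⟨r, c₁, c', rfl, rfl, rfl, b1, b2, b3, b4⟩ | ⟨r, c₁, r', rfl, rfl, rfl, b1, b2, b3, b4⟩
        · refine keep hfx ?_
          simp only [fixed_h_eq, fixed_v_eq]; omega
        · exfalso
          rw [f2] at hs
          rw [f1, fixed_v_eq, Prod.mk.injEq] at hfix
          simp only at hs; omega
        · exfalso
          rw [← hfix, fixed_v_eq] at hs
          simp only at hs; omega
        · exfalso
          rw [← hfix, fixed_v_eq] at hs
          simp only at hs; omega
      · refine stay ?_ ?_ ?_
        · rw [fixed_h_eq, fixed_v_eq, Prod.mk.injEq]; omega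
        · rw [fixed_v_eq, fixed_v_eq, ne_eq, Prod.mk.injEq]; omega
        · rw [fixed_v_eq]
          refine Finset.mem_union_left _ (Finset.mem_union_right _ ?_)
          rw [mem_hdomino]; omega
    | @vertHor r c =>
      rcases Nat.mod_two_eq_zero_or_one (r + c) with he | he
      · rw [fixed_h_eq] at hs
        rcases hr'.fixed_cases hV hF hD₀' with ⟨hne, hfx⟩ | ⟨x, y, he, f1, f2, f3, hb, _, _⟩ |
          ⟨r, c₁, c', rfl, rfl, rfl, b1, b2, b3, b4⟩ | ⟨r, c₁, r', rfl, rfl, rfl, b1, b2, b3, b4⟩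
        · refine keep hfx ?_
          simp only [fixed_h_eq, fixed_v_eq]; omega
        · exfalso
          rw [f2] at hs
          rw [f1, fixed_h_eq, Prod.mk.injEq] at hfix
          simp only at hs; omega
        · exfalso
          rw [← hfix, fixed_h_eq] at hs
          simp only at hs; omega
        · exfalso
          rw [← hfix, fixed_h_eq] at hs
          simp only at hs; omega
      · refine stay ?_ ?_ ?_
        · rw [fixed_h_eq, fixed_v_eq, Prod.mk.injEq]; omega
        · rw [fixed_h_eq, fixed_h_eq, ne_eq, Prod.mk.injEq]; omega
        · rw [fixed_h_eq]
          refine Finset.mem_union_left _ (Finset.mem_union_right _ ?_)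
          rw [mem_vdomino]; omega
  · -- blocked
    obtain ⟨d1, d2, d3, d4, d5⟩ := (addable_v_iff hP.young).1 hD₀
    have turn : E' = ⟨x, y + 1, true⟩ → D.fixedSquare = (x + 1, y + 1) →
        GrowsRight (P' ++ [(k, E')]) D D' := by
      rintro rfl hDf
      have hmono : ∀ s m, LabelLT P' s m → LabelLT (P' ++ [(k, ⟨x, y + 1, true⟩)]) s m := by
        rintro s m (h | h | ⟨p, hp, h⟩)
        · exact Or.inl h
        · exact Or.inr (Or.inl h)
        · exact Or.inr (Or.inr ⟨p, List.mem_append_left _ hp, h⟩)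
      -- The square (x+2, y) below the growth `D₀` lies outside the shape, and the condition at
      -- (x-1, y+1) is the one by which `D₀` was blocked.
      have hB : VBlock (P' ++ [(k, ⟨x, y + 1, true⟩)]) k₀ k x y := by
        refine ⟨he, List.mem_append_left _ hk₀, mem_snoc _ _, hmono _ _ hl, ?_⟩
        rintro (h | h | ⟨p, hp, h, hpk⟩)
        · simp at h
        · simp only at h; omega
        · rw [List.mem_append, List.mem_singleton] at hp
          rcases hp with hp | rfl
          · have : (x + 2, y) ∈ shape P' := mem_shape.2 ⟨p, hp, h⟩
            rw [hsh, Finset.mem_union, mem_vdomino] at this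
            rcases this with hh | hh
            · exact d3 (hP.young.down hh d1 d2 (by omega) le_rfl)
            · omega
          · simp only at hpk; omega
      have hFm := (heq.vblock _ _ _ _ hB).2
      have hFe : F = ⟨x, y + 1, true⟩ := by
        have := heq.std_right.eq_of_label (mem_snoc _ _) hFm rfl
        simpa using this
      subst hFe
      left
      rw [hDf]
      rcases hr'.fixed_cases hV hF hD₀' with ⟨hne, hfx⟩ | ⟨x, y, he', f1, f2, f3, hb, g1, g2⟩ |
        ⟨r, c₁, c', e1, e2, rfl, b1, b2, b3, b4⟩ | ⟨r, c₁, r', e1, e2, rfl, b1, b2, b3, b4⟩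
      · exfalso
        apply hne
        rw [hf', fixed_v_eq, Prod.mk.injEq]; omega
      · exfalso
        simp only at g1 g2
        rw [fixed_v_eq, Prod.mk.injEq] at f1
        omega
      · simp at e1
      · simp only [Domino.mk.injEq, and_true] at e1
        rw [fixed_v_eq]
        simp only
        omega
    cases hr with
    | disj h =>
      have hne : F.fixedSquare ≠ D₀'.fixedSquare := by
        rw [hf', ← hfix]
        intro e
        have hm : (x + 1, y + 1) ∈ shape P ∪ E.squares :=
          Finset.mem_union_right _ (e ▸ fixedSquare_mem E)
        rcases Finset.mem_union.1 (hE.2.down hm d1 d2 (by omega) (by omega)) with hh | hh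
        · exact d3 hh
        · exact Finset.disjoint_left.1 h hh (mem_vdomino.2 (by simp))
      have hfx : D'.fixedSquare = D₀'.fixedSquare := by
        rcases hr'.fixed_cases hV hF hD₀' with ⟨hne, hfx⟩ | ⟨x, y, he', f1, f2, f3, hb, g1, g2⟩ |
          ⟨r, c₁, c', e1, e2, rfl, b1, b2, b3, b4⟩ | ⟨r, c₁, r', e1, e2, rfl, b1, b2, b3, b4⟩
        · exact hfx
        · exact absurd (f1.trans f2.symm) hne
        · exact absurd (by rw [e1, e2]) hne
        · exact absurd (by rw [e1, e2]) hne
      refine Or.inr ⟨x, y, k₀, rfl, he, by rw [hfx, hf'], List.mem_append_left _ hk₀, ?_⟩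
      rcases hl with h | h | ⟨p, hp, h⟩
      · exact Or.inl h
      · exact Or.inr (Or.inl h)
      · exact Or.inr (Or.inr ⟨p, List.mem_append_left _ hp, h⟩)
    | @col _ _ r' hc h1 h2 h3 =>
      have hr'x : r' = x := by
        by_contra hne
        rcases hl with h | h | ⟨p, hp, h, _⟩
        · simp only at h; omega
        · simp at h
        · have : (x - 1, y + 1) ∈ shape P' := mem_shape.2 ⟨p, hp, h⟩
          rw [hsh, Finset.mem_union, mem_vdomino] at this
          rcases this with hh | hh
          · exact h1 (hP.young.down hh hc (by omega) (by omega) le_rfl)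
          · omega
      subst hr'x
      refine turn rfl ?_
      rw [fixed_v_eq, Prod.mk.injEq]; omega
    | horVert =>
      refine turn rfl ?_
      rw [fixed_h_eq, Prod.mk.injEq]; omega

/-- The growth of a second insertion compared with that of the first. -/
theorem Ins.growsRight {a a' : ℕ} {ε ε' : ℤˣ} {T₀ T' : DominoTableau} {D : Domino}
    (h : Ins a ε T₀ T' D) {U U' : DominoTableau} {D' : Domino} (heq : TabEquiv T' U)
    (h' : Ins a' ε' U U' D') (hc : (a < a' ∧ ε' = 1) ∨ (a' < a ∧ ε = -1)) :
    GrowsRight T' D D' := by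
  -- A second insertion that merely appends to the first row grows in a column beyond all squares of
  -- the shape, so to the right of `D`.
  have start : ∀ {T₀ T' : DominoTableau} {D : Domino} {U U' : DominoTableau} {c : ℕ},
      Ins a ε T₀ T' D → TabEquiv T' U → (1, c) ∉ shape U → 1 ≤ c →
      GrowsRight T' D ⟨1, c, false⟩ := by
    intro T₀ T' D U U' c h heq h1 hc
    left
    obtain ⟨s1, s2, s3, s4, -⟩ := h.spec
    have hm : D.fixedSquare ∈ shape T' := by
      rw [s4]; exact Finset.mem_union_right _ (fixedSquare_mem D)
    have hm' : D.fixedSquare ∈ shape U := (heq.even_mem (fixedSquare_even D)).1 hm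
    have hp := heq.std_right.young.one_le hm'
    have : D.fixedSquare.2 < c := by
      by_contra hge
      exact h1 (heq.std_right.young.le_mem hm' le_rfl hc hp.1 (by omega))
    rw [fixed_h_eq]
    simp only
    omega
  induction h generalizing U U' D' with
  | @row A c hA hi hlt hε hc' g1 g2 =>
    have hins : Ins a ε A _ _ := .row hA hi hlt hε hc' g1 g2
    have haa : a < a' := by
      rcases hc with hc | hc
      · exact hc.1
      · exact absurd (hε.symm.trans hc.2) (by decide)
    cases h' with
    | row hA' hi' hlt' hε' hc'' g1' g2' => exact start (U' := []) hins heq g1' hc''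
    | col hA' hi' hlt' hε' hc'' g1' g2' =>
      rcases hc with hc | hc
      · exact absurd (hε'.symm.trans hc.2) (by decide)
      · omega
    | @step Q Q' D₀' F F' D' k h'' hk hF hr =>
      obtain ⟨d, hd⟩ := (h''.spec.2.2.2.2 a').2 (Or.inl rfl)
      have := hk _ hd
      have := heq.prefix.2.1
      simp only at *; omega
  | @col A r hA hi hlt hε hc' g1 g2 =>
    have hins : Ins a ε A _ _ := .col hA hi hlt hε hc' g1 g2
    cases h' with
    | row hA' hi' hlt' hε' hc'' g1' g2' => exact start (U' := []) hins heq g1' hc''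
    | col hA' hi' hlt' hε' hc'' g1' g2' =>
      rcases hc with hc | hc
      · exact absurd (hε'.symm.trans hc.2) (by decide)
      · obtain ⟨q, hq, e, _⟩ := heq.exists_right (mem_snoc _ _)
        have := hlt' q hq
        simp only at e; omega
    | @step Q Q' D₀' F F' D' k h'' hk hF hr =>
      obtain ⟨e1, e2, e3⟩ := heq.prefix
      subst e2
      exact growsRight_of_column (c := 0) hA.young hlt e1.std_right.young
        (fun x y he => e1.even_mem he) hins.spec.2.2.1 hF h''.spec.2.2.1 hr e3.symm (Or.inl rfl)
  | @step P P' D₀ E E' D k hins hk hE hr ih =>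
    have hins' : Ins a ε (P ++ [(k, E)]) (P' ++ [(k, E')]) D := .step hins hk hE hr
    cases h' with
    | row hA' hi' hlt' hε' hc'' g1' g2' => exact start (U' := []) hins' heq g1' hc''
    | col hA' hi' hlt' hε' hc'' g1' g2' =>
      rcases hc with hc | hc
      · exact absurd (hε'.symm.trans hc.2) (by decide)
      · obtain ⟨d, hd⟩ := (hins'.spec.2.2.2.2 a).2 (Or.inl rfl)
        obtain ⟨q, hq, e, _⟩ := heq.exists_right hd
        have := hlt' q hq
        simp only at e; omega
    | @step Q Q' D₀' F F' D' k h'' hk' hF hr' =>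
      obtain ⟨e1, e2, e3⟩ := heq.prefix
      subst e2
      obtain ⟨s1, s2, s3, s4, -⟩ := hins.spec
      exact growsRight_step s1 s2 s4 hk s3 hE hr hF h''.spec.2.2.1 hr' heq (ih e1 h'')

/-- The square to the left of a domino has a smaller label. -/
lemma Std.labelLT_left {T : DominoTableau} (h : Std T) {k x y : ℕ} {d : Domino} (hd : (k, d) ∈ T)
    (hs : (x, y) ∈ d.squares) (hs' : (x, y - 1) ∉ d.squares) : LabelLT T (x, y - 1) k := by
  by_cases hy : y - 1 = 0
  · exact Or.inr (Or.inl hy)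
  · have h1 := h.young.one_le (mem_shape.2 ⟨_, hd, hs⟩)
    obtain ⟨p, hp, hle, hps⟩ := h.mono hd hs (x' := x) (y' := y - 1) h1.1 (by omega) le_rfl
      (by omega)
    refine Or.inr (Or.inr ⟨p, hp, hps, lt_of_le_of_ne hle fun e => hs' ?_⟩)
    rw [h.eq_of_label hp hd e] at hps
    exact hps

/-- The growth of a second insertion has larger content than that of the first, or lies
diagonally next to it. -/
theorem Ins.growth_right {a a' : ℕ} {ε ε' : ℤˣ} {T₀ T' : DominoTableau} {D : Domino}
    (h : Ins a ε T₀ T' D) {U U' : DominoTableau} {D' : Domino} (heq : TabEquiv T' U)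
    (h' : Ins a' ε' U U' D') (hc : (a < a' ∧ ε' = 1) ∨ (a' < a ∧ ε = -1)) :
    D.fixedSquare.2 + D'.fixedSquare.1 < D'.fixedSquare.2 + D.fixedSquare.1 ∨
      (D'.fixedSquare = (D.fixedSquare.1 + 1, D.fixedSquare.2 + 1) ∧ D.vertical = true ∧
        ∃ k, (k, D) ∈ T' ∧ LabelLT T' (D.fixedSquare.1 - 1, D.fixedSquare.2 + 1) k ∧
          LabelLT T' (D.fixedSquare.1 + 1, D.fixedSquare.2 - 1) k) := by
  rcases h.growsRight heq h' hc with hs | ⟨x, y, k, rfl, he, hf, hk, hl⟩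
  · exact Or.inl hs
  · right
    rw [fixed_v he]
    refine ⟨hf, rfl, k, hk, hl, heq.std_left.labelLT_left hk (mem_vdomino.2 (by simp)) ?_⟩
    have := heq.std_left.young.one_le (mem_shape.2 ⟨_, hk, (mem_vdomino.2 ⟨rfl, Or.inl rfl⟩ :
      (x, y) ∈ _)⟩)
    rw [mem_vdomino]
    simp only at this ⊢; omega

/-- By transposition, which exchanges insertion into rows and columns and reverses contents; the
exceptional first growth is now horizontal. -/
theorem Ins.growth_left {a a' : ℕ} {ε ε' : ℤˣ} {T₀ T' : DominoTableau} {D : Domino}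
    (h : Ins a ε T₀ T' D) {U U' : DominoTableau} {D' : Domino} (heq : TabEquiv T' U)
    (h' : Ins a' ε' U U' D') (hc : (a < a' ∧ ε' = -1) ∨ (a' < a ∧ ε = 1)) :
    D'.fixedSquare.2 + D.fixedSquare.1 < D.fixedSquare.2 + D'.fixedSquare.1 ∨
      (D'.fixedSquare = (D.fixedSquare.1 + 1, D.fixedSquare.2 + 1) ∧ D.vertical = false ∧
        ∃ k, (k, D) ∈ T' ∧ LabelLT T' (D.fixedSquare.1 - 1, D.fixedSquare.2 + 1) k ∧
          LabelLT T' (D.fixedSquare.1 + 1, D.fixedSquare.2 - 1) k) := by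
  have := h.tr.growth_right heq.tr h'.tr (by
    rcases hc with hc | hc
    · exact Or.inl ⟨hc.1, by rw [hc.2, neg_neg]⟩
    · exact Or.inr ⟨hc.1, by rw [hc.2]⟩)
  rw [fixedSquare_tr, fixedSquare_tr] at this
  simp only [Prod.mk.injEq] at this
  rcases this with h | ⟨h1, h2, k, h3, h4, h5⟩
  · left; omega
  · right
    rw [mem_tr, Domino.tr_tr] at h3
    rw [labelLT_tr] at h4 h5
    exact ⟨Prod.ext h1.2 h1.1, by simpa [Domino.tr] using h2, k, h3, h5, h4⟩

lemma LocalRule.det {Y : Finset Square} (hY : Young Y) {E D E₁ D₁ E₂ D₂ : Domino}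
    (h₁ : LocalRule Y E D E₁ D₁) (h₂ : LocalRule Y E D E₂ D₂) : E₁ = E₂ ∧ D₁ = D₂ := by
  have hne : ∀ {r c : ℕ} {v v' : Bool},
      ¬ Disjoint (⟨r, c, v⟩ : Domino).squares (⟨r, c, v'⟩ : Domino).squares := by
    intro r c v v' h
    exact Finset.disjoint_left.1 h (first_mem _) (first_mem _)
  cases h₁ with
  | disj h =>
    cases h₂ with
    | disj _ => exact ⟨rfl, rfl⟩
    | row => exact absurd h hne
    | col => exact absurd h hne
    | horVert => exact absurd h hne
    | vertHor => exact absurd h hne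
  | @row r c c' g1 g2 g3 g4 =>
    cases h₂ with
    | disj h => exact absurd h hne
    | @row _ _ c'' k1 k2 k3 k4 =>
      have : c' = c'' := by
        by_contra hcc
        rcases lt_or_gt_of_ne hcc with hlt | hlt
        · exact g2 (hY.down (k3.resolve_left (by omega)) (by omega) g1 le_rfl (by omega))
        · exact k2 (hY.down (g3.resolve_left (by omega)) (by omega) k1 le_rfl (by omega))
      subst this
      exact ⟨rfl, rfl⟩
  | @col r c c' g1 g2 g3 g4 =>
    cases h₂ with
    | disj h => exact absurd h hne
    | @col _ _ c'' k1 k2 k3 k4 =>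
      have : c' = c'' := by
        by_contra hcc
        rcases lt_or_gt_of_ne hcc with hlt | hlt
        · exact g2 (hY.down (k3.resolve_left (by omega)) g1 (by omega) (by omega) le_rfl)
        · exact k2 (hY.down (g3.resolve_left (by omega)) k1 (by omega) (by omega) le_rfl)
      subst this
      exact ⟨rfl, rfl⟩
  | horVert =>
    cases h₂ with
    | disj h => exact absurd h hne
    | horVert => exact ⟨rfl, rfl⟩
  | vertHor =>
    cases h₂ with
    | disj h => exact absurd h hne
    | vertHor => exact ⟨rfl, rfl⟩

/-- The growth of an insertion is determined. -/
lemma Ins.det {a : ℕ} {ε : ℤˣ} {T T₁ T₂ : DominoTableau} {D₁ D₂ : Domino}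
    (h₁ : Ins a ε T T₁ D₁) (h₂ : Ins a ε T T₂ D₂) : T₁ = T₂ ∧ D₁ = D₂ := by
  have hlabel : ∀ {P P' : DominoTableau} {D₀ E : Domino} {k : ℕ}, Ins a ε P P' D₀ →
      (∀ p ∈ P', p.1 < k) → ¬ ∀ p ∈ P ++ [(k, E)], p.1 < a := by
    intro P P' D₀ E k h hk hlt
    obtain ⟨d, hd⟩ := (h.spec.2.2.2.2 a).2 (Or.inl rfl)
    have h1 := hk _ hd
    have h2 := hlt (k, E) (mem_snoc _ _)
    simp only at h1 h2; omega
  induction h₁ generalizing T₂ D₂ with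
  | @row A c hA hi hlt hε hc g1 g2 =>
    cases h₂ with
    | @row _ c' hA' hi' hlt' hε' hc' g1' g2' =>
      have : c = c' := by
        by_contra hcc
        rcases lt_or_gt_of_ne hcc with hl | hl
        · exact g1 (hA.young.down (g2'.resolve_left (by omega)) le_rfl hc le_rfl (by omega))
        · exact g1' (hA.young.down (g2.resolve_left (by omega)) le_rfl hc' le_rfl (by omega))
      subst this
      exact ⟨rfl, rfl⟩
    | col hA' hi' hlt' hε' hc' g1' g2' => exact absurd (hε.symm.trans hε') (by decide)
    | step h hk hE hr => exact absurd hlt (hlabel h hk)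
  | @col A c hA hi hlt hε hc g1 g2 =>
    cases h₂ with
    | row hA' hi' hlt' hε' hc' g1' g2' => exact absurd (hε.symm.trans hε') (by decide)
    | @col _ c' hA' hi' hlt' hε' hc' g1' g2' =>
      have : c = c' := by
        by_contra hcc
        rcases lt_or_gt_of_ne hcc with hl | hl
        · exact g1 (hA.young.down (g2'.resolve_left (by omega)) hc le_rfl (by omega) le_rfl)
        · exact g1' (hA.young.down (g2.resolve_left (by omega)) hc' le_rfl (by omega) le_rfl)
      subst this
      exact ⟨rfl, rfl⟩
    | step h hk hE hr => exact absurd hlt (hlabel h hk)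
  | @step P P' D₀ E E' D k h hk hE hr ih =>
    generalize hT : P ++ [(k, E)] = T at h₂
    cases h₂ with
    | row hA' hi' hlt' hε' hc' g1' g2' => subst hT; exact absurd hlt' (hlabel h hk)
    | col hA' hi' hlt' hε' hc' g1' g2' => subst hT; exact absurd hlt' (hlabel h hk)
    | @step Q Q' D₀' F F' D' k' h' hk' hF hr' =>
      have := List.append_inj' hT (by simp)
      simp only [List.cons.injEq, Prod.mk.injEq, and_true] at this
      obtain ⟨rfl, rfl, rfl⟩ := this
      obtain ⟨rfl, rfl⟩ := ih h'
      obtain ⟨rfl, rfl⟩ := hr.det h.spec.1.young hr'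
      exact ⟨rfl, rfl⟩

end SOStar
namespace SOStar

/-! ### Double rows -/

lemma SignedTableau.get_of_le {S : SignedTableau} {r : ℕ} (h : S.length ≤ r) :
    S.get r = ⟨0, 1⟩ := List.getD_eq_default _ _ h

lemma SignedTableau.get_put {S : SignedTableau} {r : ℕ} (h : r ≤ S.length) (R : DoubleRow)
    (q : ℕ) : (S.put r R).get q = if q = r then R else S.get q := by
  unfold SignedTableau.put SignedTableau.get
  rw [List.getD_eq_getElem?_getD, List.getD_eq_getElem?_getD]
  rcases lt_trichotomy q r with hq | rfl | hq
  · rw [if_neg (by omega), List.getElem?_append_left (by rw [List.length_take]; omega),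
      List.getElem?_take_of_lt hq]
  · rw [if_pos rfl, List.getElem?_append_right (by rw [List.length_take]; omega),
      List.length_take, min_eq_left h, Nat.sub_self]
    simp
  · rw [if_neg (by omega), List.getElem?_append_right (by rw [List.length_take]; omega),
      List.length_take, min_eq_left h]
    obtain ⟨t, ht⟩ : ∃ t, q - r = t + 1 := ⟨q - r - 1, by omega⟩
    rw [ht, List.getElem?_cons_succ, List.getElem?_drop]
    congr 2; omega

lemma SignedTableau.length_put {S : SignedTableau} {r : ℕ} (h : r ≤ S.length) (R : DoubleRow) :
    (S.put r R).length = max S.length (r + 1) := by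
  unfold SignedTableau.put
  rw [List.length_append, List.length_cons, List.length_take, List.length_drop]
  omega

lemma SignedTableau.get_mapIdx (S : SignedTableau) (f : ℕ → DoubleRow → DoubleRow) {q : ℕ}
    (hq : q < S.length) : SignedTableau.get (S.mapIdx f) q = f q (S.get q) := by
  unfold SignedTableau.get
  rw [List.getD_eq_getElem?_getD, List.getD_eq_getElem?_getD, List.getElem?_mapIdx,
    List.getElem?_eq_getElem hq]
  rfl

/-- The two tableaux have the same shape, which consists of double rows. -/
structure Valid (T : DominoTableau) (S : SignedTableau) : Prop where
  std : Std T
  pos : ∀ r, r < S.length → 1 ≤ (S.get r).len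
  upper : ∀ r c, (2 * r + 1, c) ∈ shape T ↔ 1 ≤ c ∧ c ≤ (S.get r).len
  lower : ∀ r c, (2 * r + 2, c) ∈ shape T ↔ 1 ≤ c ∧ c ≤ (S.get r).len

lemma valid_nil : Valid [] [] := by
  refine ⟨Std.nil, by simp, fun r c => ?_, fun r c => ?_⟩ <;>
    rw [SignedTableau.get_of_le (Nat.zero_le _)] <;>
    simp only [shape_nil, Finset.notMem_empty, false_iff] <;> omega

lemma Valid.anti {T : DominoTableau} {S : SignedTableau} (h : Valid T S) {r r' : ℕ} (hr : r ≤ r') :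
    (S.get r').len ≤ (S.get r).len := by
  by_cases h0 : (S.get r').len = 0
  · omega
  · have hm : (2 * r' + 1, (S.get r').len) ∈ shape T := (h.upper _ _).2 ⟨by omega, le_rfl⟩
    exact ((h.upper _ _).1 (h.std.young.down hm (by omega) (by omega) (by omega) le_rfl)).2

lemma SignedTableau.lt_length {S : SignedTableau} {r : ℕ}
    (hr : 1 ≤ (S.get r).len) : r < S.length := by
  by_contra hge
  rw [SignedTableau.get_of_le (by omega)] at hr
  simp at hr

lemma row_cases {x : ℕ} (h : 1 ≤ x) : ∃ r, x = 2 * r + 1 ∨ x = 2 * r + 2 :=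
  ⟨(x - 1) / 2, by omega⟩

/-- Serves all stages of the algorithm: `t = 1` when both rows of a double row gain one square, `t =
2` when a pair adds two horizontal dominos. -/
lemma Valid.extend {T T' : DominoTableau} {S S' : SignedTableau} {q t : ℕ} (h : Valid T S)
    (ht : 1 ≤ t) (hq : q ≤ S.length) (hstd : Std T') (hlen : S'.length = max S.length (q + 1))
    (hget : ∀ ρ, (S'.get ρ).len = if ρ = q then (S.get q).len + t else (S.get ρ).len)
    (hsh : ∀ x y, (x, y) ∈ shape T' ↔ (x, y) ∈ shape T ∨
      ((x = 2 * q + 1 ∨ x = 2 * q + 2) ∧ (S.get q).len < y ∧ y ≤ (S.get q).len + t)) :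
    Valid T' S' := by
  refine ⟨hstd, fun r hr => ?_, fun r c => ?_, fun r c => ?_⟩
  · rw [hget]
    split_ifs with hrq
    · omega
    · exact h.pos r (by omega)
  · rw [hsh, h.upper, hget]
    split_ifs with hrq
    · subst hrq; omega
    · omega
  · rw [hsh, h.lower, hget]
    split_ifs with hrq
    · subst hrq; omega
    · omega

/-- A domino added to a shape consisting of double rows. -/
lemma Valid.addable {T : DominoTableau} {S : SignedTableau} (h : Valid T S) {D : Domino}
    (hD : Addable (shape T) D) : ∃ r, r ≤ S.length ∧ D.row = 2 * r + 1 ∧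
      D.col = (S.get r).len + 1 ∧ (r = 0 ∨
        (S.get r).len + (if D.vertical then 1 else 2) ≤ (S.get (r - 1)).len) := by
  obtain ⟨h1, h2, h3, h4, h5⟩ := hD.corner h.std.young
  obtain ⟨r, hr | hr⟩ := row_cases h1
  · rw [hr] at h3 h4 h5
    rw [h.upper] at h3 h4
    have hcol : D.col = (S.get r).len + 1 := by omega
    have hprev : r = 0 ∨ (S.get r).len + (if D.vertical then 1 else 2) ≤ (S.get (r - 1)).len := by
      rcases Nat.eq_zero_or_pos r with h0 | h0
      · exact Or.inl h0
      · right
        obtain ⟨a, b, v⟩ := D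
        simp only at hr hcol
        subst hr hcol
        obtain ⟨t, rfl⟩ : ∃ t, r = t + 1 := ⟨r - 1, by omega⟩
        cases v
        · have := ((addable_h_iff h.std.young).1 hD).2.2.2.2.resolve_left (by omega)
          rw [show 2 * (t + 1) + 1 - 1 = 2 * t + 2 by omega, h.lower] at this
          exact this.2
        · have := ((addable_v_iff h.std.young).1 hD).2.2.2.1.resolve_left (by omega)
          rw [show 2 * (t + 1) + 1 - 1 = 2 * t + 2 by omega, h.lower] at this
          simpa using this.2
    refine ⟨r, ?_, hr, hcol, hprev⟩
    by_contra hlt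
    rcases hprev with hp | hp
    · omega
    · have : (S.get (r - 1)).len = 0 := by rw [SignedTableau.get_of_le (by omega)]
      split_ifs at hp <;> omega
  -- A domino cannot start in a lower row: the upper row of the same double row is not longer.
  · exfalso
    rw [hr, h.lower] at h3
    rw [hr, show 2 * r + 2 - 1 = 2 * r + 1 by omega, h.upper] at h5
    omega

/-! ### Insertion of a singleton -/

/-- Double row `r ≥ m` can receive the sign `ε`. -/
def Avail (S : SignedTableau) (m : ℕ) (ε : ℤˣ) (r : ℕ) : Prop :=
  r < S.length ∧ (Odd (S.get r).len ∨
    ∃ q, m ≤ q ∧ q < S.length ∧ (S.get q).len = (S.get r).len ∧ (S.get q).last = -ε)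

lemma rowEndingIn_some {S : SignedTableau} {m l q : ℕ} {s : ℤˣ} (h : rowEndingIn S m l s = some q) :
    q < S.length ∧ m ≤ q ∧ (S.get q).len = l ∧ (S.get q).last = s := by
  rw [rowEndingIn, List.find?_range_eq_some] at h
  obtain ⟨h1, h2, -⟩ := h
  rw [decide_eq_true_eq] at h1
  exact ⟨List.mem_range.1 h2, h1⟩

lemma rowEndingIn_none {S : SignedTableau} {m l : ℕ} {s : ℤˣ} (h : rowEndingIn S m l s = none) :
    ∀ q, q < S.length → m ≤ q → (S.get q).len = l → (S.get q).last ≠ s := by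
  rw [rowEndingIn, List.find?_range_eq_none] at h
  intro q hq hm hl hs
  simpa [hm, hl, hs] using h q hq

lemma avail_iff {S : SignedTableau} {m r : ℕ} {ε : ℤˣ} (hr : r < S.length) :
    (decide (Odd (S.get r).len) || (rowEndingIn S m (S.get r).len (-ε)).isSome) = true ↔
      Avail S m ε r := by
  rw [Bool.or_eq_true, decide_eq_true_eq, Avail, and_iff_right hr]
  refine or_congr Iff.rfl ?_
  cases h : rowEndingIn S m (S.get r).len (-ε) with
  | none =>
    simp only [Option.isSome_none, Bool.false_eq_true, false_iff]
    rintro ⟨q, h1, h2, h3, h4⟩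
    exact rowEndingIn_none h q h2 h1 h3 h4
  | some q =>
    simp only [Option.isSome_some, true_iff]
    obtain ⟨h1, h2, h3, h4⟩ := rowEndingIn_some h
    exact ⟨q, h2, h1, h3, h4⟩

lemma availableRow_some {S : SignedTableau} {m r : ℕ} {ε : ℤˣ} (h : availableRow S m ε = some r) :
    m ≤ r ∧ Avail S m ε r ∧ ∀ ρ, m ≤ ρ → ρ < r → ¬ Avail S m ε ρ := by
  rw [availableRow, List.find?_range_eq_some] at h
  obtain ⟨h1, h2, h3⟩ := h
  rw [List.mem_range] at h2
  rw [Bool.and_eq_true, decide_eq_true_eq, avail_iff h2] at h1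
  refine ⟨h1.1, h1.2, fun ρ hm hρ ha => ?_⟩
  have h4 := h3 ρ hρ
  rw [Bool.not_eq_true', Bool.and_eq_false_iff] at h4
  rcases h4 with h4 | h4
  · simp [hm] at h4
  · rw [(avail_iff (by omega)).2 ha] at h4
    exact absurd h4 (by decide)

lemma availableRow_none {S : SignedTableau} {m : ℕ} {ε : ℤˣ} (h : availableRow S m ε = none) :
    ∀ ρ, m ≤ ρ → ¬ Avail S m ε ρ := by
  rw [availableRow, List.find?_range_eq_none] at h
  intro ρ hm ha
  have h4 := h ρ ha.1
  rw [Bool.not_eq_true', Bool.and_eq_false_iff] at h4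
  rcases h4 with h4 | h4
  · simp [hm] at h4
  · rw [(avail_iff ha.1).2 ha] at h4
    exact absurd h4 (by decide)

/-- The hypothesis `hp` puts the new square in an upper row, where it must be at the end; as its
coordinate sum is odd, that row has odd length. -/
lemma Valid.mem_iff_of_erase {T U : DominoTableau} {S : SignedTableau} (h : Valid T S) {r l x' y' : ℕ}
    (hU : Young (shape U))
    (hsh : shape U = insert (x', y') ((shape T).erase (2 * r + 2, l)))
    (hn : (x', y') ∉ shape T) (ho : (x' + y') % 2 = 1) (hp : x' % 2 ≠ (2 * r + 2) % 2) :
    ∃ r', x' = 2 * r' + 1 ∧ y' = (S.get r').len + 1 ∧ Odd (S.get r').len := by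
  have hm : (x', y') ∈ shape U := by rw [hsh]; exact Finset.mem_insert_self _ _
  have h1 := hU.one_le hm
  simp only at h1
  obtain ⟨r', hr' | hr'⟩ := row_cases h1.1
  · subst hr'
    rw [h.upper] at hn
    have : y' = (S.get r').len + 1 := by
      by_contra hne
      have hm' : (2 * r' + 1, y' - 1) ∈ shape U :=
        hU.down hm (by omega) (by omega) le_rfl (by omega)
      rw [hsh, Finset.mem_insert, Finset.mem_erase, h.upper, Prod.mk.injEq] at hm'
      omega
    exact ⟨r', rfl, this, by rw [Nat.odd_iff]; omega⟩
  · omega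

/-- The hole and the corner of the cycle through the end of the lower row of a double row of odd
length that is the last of its length. -/
lemma Valid.moveThrough_lower {T : DominoTableau} {S : SignedTableau} (h : Valid T S) {r l : ℕ}
    (hl : (S.get r).len = l) (hodd : Odd l) (hlast : (S.get (r + 1)).len ≠ l) :
    TabEquiv T (moveThrough T (2 * r + 2, l)) ∧ ∃ r₁,
      shape (moveThrough T (2 * r + 2, l)) =
        insert (2 * r₁ + 1, (S.get r₁).len + 1) ((shape T).erase (2 * r + 2, l)) ∧
      Odd (S.get r₁).len ∧ ∀ r', HoleCorner T r l r' ↔ r' = r₁ := by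
  have ho := Nat.odd_iff.1 hodd
  have hanti := h.anti (r := r) (r' := r + 1) (by omega)
  have hm : (2 * r + 2, l) ∈ shape T := (h.lower _ _).2 ⟨by omega, by omega⟩
  obtain ⟨heq, x', y', h1, h2, h3, h4⟩ := h.std.moveThrough_spec hm (by omega)
    (by rw [h.lower]; omega)
    (by rw [show 2 * r + 2 + 1 = 2 * (r + 1) + 1 by omega, h.upper]; omega)
  refine ⟨heq, ?_⟩
  obtain ⟨r₁, rfl, rfl, h5⟩ := h.mem_iff_of_erase heq.std_right.young h4 h1 h2 h3
  refine ⟨r₁, h4, h5, fun r' => ?_⟩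
  simp only [HoleCorner, h4]
  constructor
  · rintro ⟨_, _, c, g1, g2⟩
    rw [Finset.mem_insert, Finset.mem_erase] at g1
    rcases g1 with g1 | g1
    · rw [Prod.mk.injEq] at g1; omega
    · exact absurd g1.2 g2
  · rintro rfl
    refine ⟨hm, ?_, _, Finset.mem_insert_self _ _, h1⟩
    rw [Finset.mem_insert, Finset.mem_erase, Prod.mk.injEq]
    rintro (hh | hh)
    · omega
    · exact hh.1 rfl

/-- The result of inserting a singleton `(i, ε)` using only the double rows from `m` on: it is put
into double row `q`. -/
structure SingleStep (T : DominoTableau) (S : SignedTableau) (i : ℕ) (ε : ℤˣ) (m : ℕ)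
    (T' : DominoTableau) (S' : SignedTableau) (q : ℕ) : Prop where
  le : m ≤ q
  le_length : q ≤ S.length
  avail : q < S.length → Avail S m ε q
  not_avail : ∀ ρ, m ≤ ρ → ρ < q → ¬ Avail S m ε ρ
  valid : Valid T' S'
  get_row : S'.get q = ⟨(S.get q).len + 1, ε⟩
  len_eq : ∀ ρ, ρ ≠ q → (S'.get ρ).len = (S.get ρ).len
  even_eq : ∀ ρ, ρ < q → Even (S.get ρ).len → S'.get ρ = S.get ρ
  keep : ∀ ρ, ρ < q → (Odd (S.get q).len → (S.get (q + 1)).len ≠ (S.get q).len →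
    ¬ HoleCorner T q (S.get q).len ρ) → S'.get ρ = S.get ρ
  tab : (T' = T ++ [(i, ⟨2 * q + 1, (S.get q).len + 1, true⟩)] ∧
      ((∃ ρ, m ≤ ρ ∧ ρ < S.length ∧ (S.get ρ).len = (S.get q).len ∧ (S.get ρ).last = -ε) ∨
        (S.get (q + 1)).len = (S.get q).len ∨ ¬ HoleCorner T q (S.get q).len q)) ∨
    (Odd (S.get q).len ∧
      (∀ ρ, m ≤ ρ → ρ < S.length → (S.get ρ).len = (S.get q).len → (S.get ρ).last ≠ -ε) ∧
      TabEquiv T (moveThrough T (2 * q + 2, (S.get q).len)) ∧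
      T' = moveThrough T (2 * q + 2, (S.get q).len) ++ [(i, ⟨2 * q + 2, (S.get q).len, false⟩)])

lemma TabEquiv.label_lt {T U : DominoTableau} (h : TabEquiv T U) {i : ℕ} (hi : ∀ p ∈ T, p.1 < i) :
    ∀ p ∈ U, p.1 < i := by
  intro p hp
  obtain ⟨q, hq, e, _⟩ := h.exists_left hp
  rw [← e]; exact hi q hq

-- The hypothesis `hm'` is needed for the domino to be addable: double row `m` must be shorter than
-- its predecessor, which is not available. Inside the available range the first available double
-- row automatically has a longer predecessor.
open Classical in
lemma insertSingle_spec {T : DominoTableau} {S : SignedTableau} {i m : ℕ} {ε : ℤˣ}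
    (h : Valid T S) (hm : m ≤ S.length) (hm' : m = 0 ∨ (S.get m).len < (S.get (m - 1)).len)
    (hi : ∀ p ∈ T, p.1 < i) (hi1 : 1 ≤ i) :
    ∃ q, SingleStep T S i ε m (insertSingle (T, S) i ε m).1 (insertSingle (T, S) i ε m).2 q := by
  -- a vertical domino at the end of double row `q`
  have vert : ∀ q, m ≤ q → q ≤ S.length → (q = m ∨ (S.get q).len < (S.get (q - 1)).len) →
      ∀ S' : SignedTableau, S'.length = max S.length (q + 1) →
      (∀ ρ, (S'.get ρ).len = if ρ = q then (S.get q).len + 1 else (S.get ρ).len) →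
      Valid (T ++ [(i, ⟨2 * q + 1, (S.get q).len + 1, true⟩)]) S' := by
    intro q hmq hq hq' S' hl hg
    have hA : Addable (shape T) ⟨2 * q + 1, (S.get q).len + 1, true⟩ := by
      rw [addable_v_iff h.std.young]
      refine ⟨by omega, by omega, by rw [h.upper]; omega, ?_, ?_⟩
      · rcases Nat.eq_zero_or_pos q with h0 | h0
        · left; omega
        · right
          obtain ⟨t, rfl⟩ : ∃ t, q = t + 1 := ⟨q - 1, by omega⟩
          rw [show 2 * (t + 1) + 1 - 1 = 2 * t + 2 by omega, h.lower]
          have : (S.get (t + 1)).len < (S.get t).len := by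
            rcases hq' with hq' | hq'
            · subst hq'
              simpa using hm'
            · simpa using hq'
          omega
      · rw [show 2 * q + 1 + 1 = 2 * q + 2 by omega, h.lower]; omega
    refine h.extend (t := 1) le_rfl hq (Std.snoc h.std hi1 hi hA) hl hg fun x y => ?_
    rw [shape_snoc, Finset.mem_union, mem_vdomino]
    refine or_congr Iff.rfl ?_
    omega
  unfold insertSingle
  simp only
  cases hav : availableRow S m ε with
  | none =>
    have hna := availableRow_none hav
    simp only
    have hget : ∀ ρ, SignedTableau.get (S ++ [(⟨1, ε⟩ : DoubleRow)]) ρ =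
        if ρ = S.length then ⟨1, ε⟩ else S.get ρ := by
      intro ρ
      have : S ++ [(⟨1, ε⟩ : DoubleRow)] = S.put S.length ⟨1, ε⟩ := by
        simp [SignedTableau.put]
      rw [this, SignedTableau.get_put le_rfl]
    have h0 : (S.get S.length).len = 0 := by rw [SignedTableau.get_of_le le_rfl]
    refine ⟨S.length, hm, le_rfl, fun hh => absurd hh (lt_irrefl _), fun ρ h1 _ => hna ρ h1, ?_,
      by rw [hget, if_pos rfl, h0], fun ρ hρ => by rw [hget, if_neg hρ],
      fun ρ hρ _ => by rw [hget, if_neg (by omega)],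
      fun ρ hρ _ => by rw [hget, if_neg (by omega)], Or.inl ⟨by rw [h0], Or.inr (Or.inr ?_)⟩⟩
    · have := vert S.length hm le_rfl ?_ (S ++ [⟨1, ε⟩]) (by simp) ?_
      · rwa [h0] at this
      · by_cases hms : S.length = m
        · exact Or.inl hms
        · right
          rw [h0]
          exact h.pos _ (by omega)
      · intro ρ
        rw [hget, h0]
        split_ifs <;> rfl
    · rw [h0]
      rintro ⟨h1, _⟩
      rw [h.lower] at h1; omega
  | some r =>
    obtain ⟨hmr, har, hnr⟩ := availableRow_some hav
    have hrS := har.1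
    -- Inside the range, being available depends only on the length and the sign, so a preceding
    -- double row of equal length would have been chosen first.
    have hfirst : r = m ∨ (S.get r).len < (S.get (r - 1)).len := by
      by_cases hrm : r = m
      · exact Or.inl hrm
      · right
        by_contra hge
        have hle := h.anti (r := r - 1) (r' := r) (by omega)
        refine hnr (r - 1) (by omega) (by omega) ⟨by omega, ?_⟩
        rw [show (S.get (r - 1)).len = (S.get r).len by omega]
        exact har.2
    simp only
    cases hre : rowEndingIn S m (S.get r).len (-ε) with
    | some q =>
      obtain ⟨q1, q2, q3, q4⟩ := rowEndingIn_some hre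
      simp only
      have hrq : r ≤ q := by
        by_contra hlt
        exact hnr q q2 (by omega) ⟨q1, Or.inr ⟨q, q2, q1, rfl, q4⟩⟩
      have hget : ∀ ρ, ((S.put q (S.get r)).put r ⟨(S.get r).len + 1, ε⟩).get ρ =
          if ρ = r then ⟨(S.get r).len + 1, ε⟩ else if ρ = q then S.get r else S.get ρ := by
        intro ρ
        rw [SignedTableau.get_put (by rw [SignedTableau.length_put (by omega)]; omega),
          SignedTableau.get_put (by omega)]
      refine ⟨r, hmr, by omega, fun _ => har, hnr, ?_, by rw [hget, if_pos rfl], ?_, ?_, ?_,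
        Or.inl ⟨rfl, Or.inl ⟨q, q2, q1, q3, q4⟩⟩⟩
      · refine vert r hmr (by omega) hfirst _ ?_ ?_
        · rw [SignedTableau.length_put (by rw [SignedTableau.length_put (by omega)]; omega),
            SignedTableau.length_put (by omega)]
          omega
        · intro ρ
          rw [hget]
          split_ifs with e1 e2
          · rfl
          · rw [e2, q3]
          · rfl
      · intro ρ hρ
        rw [hget, if_neg hρ]
        split_ifs with e2
        · rw [e2, q3]
        · rfl
      · intro ρ hρ _
        rw [hget, if_neg (by omega), if_neg (by omega)]
      · intro ρ hρ _
        rw [hget, if_neg (by omega), if_neg (by omega)]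
    | none =>
      have hnone := rowEndingIn_none hre
      have hodd : Odd (S.get r).len := by
        rcases har.2 with ho | ⟨q, q1, q2, q3, q4⟩
        · exact ho
        · exact absurd q4 (hnone q q2 q1 q3)
      have hol := Nat.odd_iff.1 hodd
      simp only
      split_ifs with hnext hhc
      · have hget : ∀ ρ, ((S.put (r + 1) (S.get (r + 1)).flip).put r
            ⟨(S.get r).len + 1, ε⟩).get ρ =
            if ρ = r then ⟨(S.get r).len + 1, ε⟩ else if ρ = r + 1 then (S.get (r + 1)).flip
              else S.get ρ := by
          intro ρ
          rw [SignedTableau.get_put (by rw [SignedTableau.length_put (by omega)]; omega),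
            SignedTableau.get_put (by omega)]
        refine ⟨r, hmr, by omega, fun _ => har, hnr, ?_, by rw [hget, if_pos rfl], ?_, ?_, ?_,
          Or.inl ⟨rfl, Or.inr (Or.inl hnext.2)⟩⟩
        · refine vert r hmr (by omega) hfirst _ ?_ ?_
          · rw [SignedTableau.length_put (by rw [SignedTableau.length_put (by omega)]; omega),
              SignedTableau.length_put (by omega)]
            omega
          · intro ρ
            rw [hget]
            split_ifs with e1 e2
            · rfl
            · rw [e2]; rfl
            · rfl
        · intro ρ hρ
          rw [hget, if_neg hρ]
          split_ifs with e2
          · rw [e2]; rfl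
          · rfl
        · intro ρ hρ _
          rw [hget, if_neg (by omega), if_neg (by omega)]
        · intro ρ hρ _
          rw [hget, if_neg (by omega), if_neg (by omega)]
      · have hlast : (S.get (r + 1)).len ≠ (S.get r).len := by
          intro e
          exact hnext ⟨SignedTableau.lt_length (by omega), e⟩
        obtain ⟨heq, r₁, hsh, ho₁, hiff⟩ := h.moveThrough_lower rfl hodd hlast
        have : r = r₁ := (hiff r).1 hhc
        subst this
        have hget : ∀ ρ, (S.put r ⟨(S.get r).len + 1, ε⟩).get ρ =
            if ρ = r then ⟨(S.get r).len + 1, ε⟩ else S.get ρ :=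
          fun ρ => SignedTableau.get_put (by omega) _ _
        have hlt := h.anti (r := r) (r' := r + 1) (by omega)
        refine ⟨r, hmr, by omega, fun _ => har, hnr, ?_, by rw [hget, if_pos rfl], ?_, ?_, ?_,
          Or.inr ⟨hodd, fun ρ h1 h2 h3 => hnone ρ h2 h1 h3, heq, rfl⟩⟩
        · have memU : ∀ x y, (x, y) ∈ shape (moveThrough T (2 * r + 2, (S.get r).len)) ↔
              (x = 2 * r + 1 ∧ y = (S.get r).len + 1) ∨
                (¬ (x = 2 * r + 2 ∧ y = (S.get r).len) ∧ (x, y) ∈ shape T) := by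
            intro x y
            rw [hsh, Finset.mem_insert, Finset.mem_erase, ne_eq, Prod.mk.injEq, Prod.mk.injEq]
          have hA : Addable (shape (moveThrough T (2 * r + 2, (S.get r).len)))
              ⟨2 * r + 2, (S.get r).len, false⟩ := by
            rw [addable_h_iff heq.std_right.young]
            simp only [memU]
            refine ⟨by omega, by omega, ?_, ?_, ?_⟩
            · rintro (h1 | h1)
              · omega
              · exact h1.1 ⟨trivial, trivial⟩
            · rw [h.lower]; omega
            · right; left; exact ⟨by omega, trivial⟩
          refine h.extend (t := 1) le_rfl (by omega)
            (Std.snoc heq.std_right hi1 (heq.label_lt hi) hA)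
            (SignedTableau.length_put (by omega) _) (fun ρ => ?_) fun x y => ?_
          · rw [hget]; split_ifs <;> rfl
          · rw [shape_snoc, Finset.mem_union, mem_hdomino, memU]
            have : (2 * r + 2, (S.get r).len) ∈ shape T := (h.lower _ _).2 (by omega)
            constructor
            · rintro ((h1 | h1) | h1)
              · right; omega
              · exact Or.inl h1.2
              · by_cases hy : y = (S.get r).len
                · left
                  rw [h1.1, hy]; exact this
                · right; omega
            · rintro (h1 | h1)
              · by_cases hy : x = 2 * r + 2 ∧ y = (S.get r).len
                · right; omega
                · left; right; exact ⟨hy, h1⟩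
              · rcases h1.1 with h2 | h2
                · left; left; omega
                · right; omega
        · intro ρ hρ
          rw [hget, if_neg hρ]
        · intro ρ hρ _
          rw [hget, if_neg (by omega)]
        · intro ρ hρ _
          rw [hget, if_neg (by omega)]
      · have hlast : (S.get (r + 1)).len ≠ (S.get r).len := by
          intro e
          exact hnext ⟨SignedTableau.lt_length (by omega), e⟩
        obtain ⟨heq, r₁, hsh, ho₁, hiff⟩ := h.moveThrough_lower rfl hodd hlast
        set S₁ : SignedTableau :=
          S.mapIdx fun r' R => if HoleCorner T r (S.get r).len r' then R.flip else R with hS₁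
        have hlen₁ : S₁.length = S.length := by rw [hS₁, List.length_mapIdx]
        -- Signs change only in the double row of the corner, and that one has odd length.
        have hget₁ : ∀ ρ, (S₁.get ρ).len = (S.get ρ).len ∧
            (Even (S.get ρ).len → S₁.get ρ = S.get ρ) := by
          intro ρ
          by_cases hρ : ρ < S.length
          · rw [hS₁, SignedTableau.get_mapIdx _ _ hρ]
            split_ifs with hc
            · refine ⟨rfl, fun he => ?_⟩
              rw [hiff] at hc
              subst hc
              exact absurd ho₁ (Nat.not_odd_iff_even.2 he)
            · exact ⟨rfl, fun _ => rfl⟩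
          · rw [SignedTableau.get_of_le (by omega), SignedTableau.get_of_le (by omega)]
            exact ⟨rfl, fun _ => rfl⟩
        have hget : ∀ ρ, (S₁.put r ⟨(S.get r).len + 1, ε⟩).get ρ =
            if ρ = r then ⟨(S.get r).len + 1, ε⟩ else S₁.get ρ :=
          fun ρ => SignedTableau.get_put (by omega) _ _
        refine ⟨r, hmr, by omega, fun _ => har, hnr, ?_, by rw [hget, if_pos rfl], ?_, ?_, ?_,
          Or.inl ⟨rfl, Or.inr (Or.inr hhc)⟩⟩
        · refine vert r hmr (by omega) hfirst _ ?_ ?_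
          · rw [SignedTableau.length_put (by omega), hlen₁]
          · intro ρ
            rw [hget]
            split_ifs with e1
            · rfl
            · exact (hget₁ ρ).1
        · intro ρ hρ
          rw [hget, if_neg hρ]
          exact (hget₁ ρ).1
        · intro ρ hρ he
          rw [hget, if_neg (by omega)]
          exact (hget₁ ρ).2 he
        · intro ρ hρ hn
          rw [hget, if_neg (by omega), hS₁, SignedTableau.get_mapIdx _ _ (by omega),
            if_neg (hn hodd hlast)]

end SOStar
namespace SOStar

/-! ### Insertion of a pair -/

lemma plusCount_eq (n : ℕ) (t : ℤˣ) :
    DoubleRow.plusCount ⟨n, t⟩ = if t = 1 then (n + 1) / 2 else n / 2 := by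
  unfold DoubleRow.plusCount
  simp only
  induction n with
  | zero => simp
  | succ n ih =>
    rw [List.range_succ, List.filter_append, List.length_append, ih]
    have h1 : (-1 : ℤˣ) ≠ 1 := by decide
    rcases Int.units_eq_one_or t with rfl | rfl <;> rcases Nat.even_or_odd n with hn | hn <;>
      simp [hn.neg_one_pow, h1] <;> obtain ⟨m, rfl⟩ := hn <;> omega

/-- A row of even length has equally many signs of both kinds, and one of odd length has one more of
its last sign. So an even row gains its new last sign, while an odd row, lengthened, gains the
opposite of its old last sign. -/
lemma gained_of_even {l : ℕ} (hl : Even l) (s t : ℤˣ) : gained ⟨l, t⟩ ⟨l + 1, s⟩ = s := by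
  unfold gained
  rw [plusCount_eq, plusCount_eq]
  obtain ⟨m, rfl⟩ := hl
  rcases Int.units_eq_one_or t with rfl | rfl <;> rcases Int.units_eq_one_or s with rfl | rfl <;>
    simp <;> omega

lemma gained_of_odd {l : ℕ} (hl : Odd l) (s : ℤˣ) : gained ⟨l, s⟩ ⟨l + 1, s⟩ = -s := by
  unfold gained
  rw [plusCount_eq, plusCount_eq]
  obtain ⟨m, rfl⟩ := hl
  rcases Int.units_eq_one_or s with rfl | rfl <;> simp <;> omega

/-- The result of inserting a pair `(a, j)^ε`: the second coordinate is put directly below the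
growth of the shape, or it is inserted like a singleton `(j, δ)` below it. -/
inductive PairStep (T : DominoTableau) (S : SignedTableau) (a j : ℕ) (ε : ℤˣ)
    (T₁ : DominoTableau) (S₁ : SignedTableau) : Prop
  | hor {T' : DominoTableau} {r : ℕ} (hins : Ins a ε T T' ⟨2 * r + 1, (S.get r).len + 1, false⟩)
      (hr : r ≤ S.length) (hodd : Odd (S.get r).len)
      (hT : T₁ = T' ++ [(j, ⟨2 * r + 2, (S.get r).len + 1, false⟩)])
      (hget : ∀ ρ, S₁.get ρ = if ρ = r then ⟨(S.get r).len + 2, (S.get r).last⟩ else S.get ρ)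
      (hv : Valid T₁ S₁)
  | sing {T' U : DominoTableau} {S' : SignedTableau} {r q : ℕ} {v : Bool} {s δ : ℤˣ}
      (hins : Ins a ε T T' ⟨2 * r + 1, (S.get r).len + 1, v⟩) (hr : r ≤ S.length)
      (heq : TabEquiv T' U) (hv : v = false → Even (S.get r).len) (hmid : Valid U S')
      (hget : ∀ ρ, S'.get ρ = if ρ = r then ⟨(S.get r).len + 1, s⟩ else S.get ρ)
      (hs : 1 ≤ (S.get r).len → s = if v = true then (S.get r).last else -(S.get r).last)
      (hδ : δ = if v = true ∧ Even (S.get r).len then s else -s)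
      (hstep : SingleStep U S' j δ (r + 1) T₁ S₁ q)

lemma PairStep.valid {T T₁ : DominoTableau} {S S₁ : SignedTableau} {a j : ℕ} {ε : ℤˣ}
    (h : PairStep T S a j ε T₁ S₁) : Valid T₁ S₁ := by
  cases h with
  | hor _ _ _ _ _ hv => exact hv
  | sing _ _ _ _ _ _ _ _ hstep => exact hstep.valid

lemma Ins.sdiff {a : ℕ} {ε : ℤˣ} {T T' : DominoTableau} {D : Domino} (h : Ins a ε T T' D) :
    shape T' \ shape T = D.squares := by
  obtain ⟨_, _, h3, h4, _⟩ := h.spec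
  rw [h4, Finset.union_sdiff_left, Finset.sdiff_eq_self_of_disjoint h3.1]

lemma Ins.label_lt {a j : ℕ} {ε : ℤˣ} {T T' : DominoTableau} {D : Domino} (h : Ins a ε T T' D)
    (haj : a < j) (hj : ∀ p ∈ T, p.1 < j) : ∀ p ∈ T', p.1 < j := by
  rintro ⟨k, d⟩ hp
  rcases (h.spec.2.2.2.2 k).1 ⟨d, hp⟩ with rfl | ⟨d', hd'⟩
  · exact haj
  · exact hj (k, d') hd'

lemma insertPair_spec {T : DominoTableau} {S : SignedTableau} {a j : ℕ} {ε : ℤˣ}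
    (h : Valid T S) (ha : ∀ d, (a, d) ∉ T) (ha1 : 1 ≤ a) (haj : a < j)
    (hj : ∀ p ∈ T, p.1 < j) :
    PairStep T S a j ε (insertPair (T, S) a j ε).1 (insertPair (T, S) a j ε).2 := by
  obtain ⟨D, hins⟩ := insertDomino_ins h.std ha ha1 ε
  obtain ⟨s1, s2, s3, s4, s5⟩ := hins.spec
  obtain ⟨r, hrS, hrow, hcol, hprev⟩ := h.addable s3
  have hlt := hins.label_lt haj hj
  obtain ⟨x, y, v⟩ := D
  simp only at hrow hcol hprev
  subst hrow hcol
  set l := (S.get r).len with hl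
  have mem' : ∀ x y, (x, y) ∈ shape (insertDomino T a ε) ↔
      (x, y) ∈ shape T ∨ (x, y) ∈ (⟨2 * r + 1, l + 1, v⟩ : Domino).squares := by
    intro x y; rw [s4, Finset.mem_union]
  have hR : S.get r = ⟨l, (S.get r).last⟩ := rfl
  have hput : ∀ R, ∀ ρ, (S.put r R).get ρ = if ρ = r then R else S.get ρ :=
    fun R ρ => SignedTableau.get_put hrS _ _
  -- After the growth double row r is strictly longer than the next one, as `insertSingle_spec`
  -- requires for the range starting at r+1.
  have hbelow : ∀ s : ℤˣ, r + 1 = 0 ∨ ((S.put r ⟨l + 1, s⟩).get (r + 1)).len <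
      ((S.put r ⟨l + 1, s⟩).get (r + 1 - 1)).len := by
    intro s
    right
    rw [hput, hput, if_neg (by omega), if_pos (by omega)]
    have := h.anti (r := r) (r' := r + 1) (by omega)
    simp only; omega
  have hlen : ∀ R, r + 1 ≤ (S.put r R).length := fun R => by
    rw [SignedTableau.length_put hrS]; omega
  unfold insertPair
  simp only
  rw [hins.sdiff]
  cases v with
  | false =>
    have hr' : ((⟨2 * r + 1, l + 1, false⟩ : Domino).squares.sup Prod.fst - 1) / 2 = r := by
      simp [Domino.squares, Domino.first, Domino.second]
    rw [hr', if_pos (by simp [Domino.squares, Domino.first, Domino.second])]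
    simp only [mem_hdomino] at mem'
    rw [← hl]
    by_cases hodd : Odd l
    · rw [if_pos hodd]
      refine .hor hins hrS hodd rfl (hput _) ?_
      have hA : Addable (shape (insertDomino T a ε)) ⟨2 * r + 2, l + 1, false⟩ := by
        rw [addable_h_iff s2.young]
        simp only [mem', h.lower]
        refine ⟨by omega, by omega, ?_, ?_, ?_⟩
        · omega
        · omega
        · right; right; constructor
          · omega
          · exact Or.inr trivial
      refine h.extend (t := 2) (by omega) hrS (Std.snoc s2 (by omega) hlt hA)
        (SignedTableau.length_put hrS _) (fun ρ => ?_) fun x y => ?_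
      · rw [hput]; split_ifs <;> rfl
      · rw [shape_snoc, Finset.mem_union, mem', mem_hdomino, or_assoc]
        refine or_congr Iff.rfl ?_
        omega
    · rw [if_neg hodd]
      rw [Nat.not_odd_iff_even] at hodd
      have hev := Nat.even_iff.1 hodd
      obtain ⟨heq, x', y', h1, h2, h3, h4⟩ := s2.moveThrough_spec (x := 2 * r + 1) (y := l + 2)
        ((mem' _ _).2 (Or.inr ⟨rfl, Or.inr rfl⟩)) (by omega)
        (by rw [mem', h.upper]; omega)
        (by rw [mem', show 2 * r + 1 + 1 = 2 * r + 2 by omega, h.lower]; omega)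
      set U := moveThrough (insertDomino T a ε) (2 * r + 1, l + 2) with hU
      have hUm : ∀ x y, (x, y) ∈ shape U ↔ (x = x' ∧ y = y') ∨
          (¬ (x = 2 * r + 1 ∧ y = l + 2) ∧
            ((x, y) ∈ shape T ∨ (x = 2 * r + 1 ∧ (y = l + 1 ∨ y = l + 1 + 1)))) := by
        intro x y
        rw [h4, Finset.mem_insert, Finset.mem_erase, mem', ne_eq, Prod.mk.injEq, Prod.mk.injEq]
      have hUy := heq.std_right.young
      -- The hole is in an odd row, so the corner is in an even one. The square above the corner is
      -- present, and only in double row r is the upper row now longer than the lower one.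
      have hc : x' = 2 * r + 2 ∧ y' = l + 1 := by
        have hm : (x', y') ∈ shape U := (hUm _ _).2 (Or.inl ⟨rfl, rfl⟩)
        have hp := hUy.one_le hm
        simp only at hp
        obtain ⟨ρ, hρ | hρ⟩ := row_cases hp.1
        · omega
        · subst hρ
          rw [mem', h.lower] at h1
          have hab := (hUm _ _).1 (hUy.down hm (x' := 2 * ρ + 1) (y' := y') (by omega) hp.2
            (by omega) le_rfl)
          rw [h.upper] at hab
          by_cases hρr : ρ = r
          · subst hρr
            omega
          · omega
      have hmid : ∀ s, Valid U (S.put r ⟨l + 1, s⟩) := by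
        intro s
        refine h.extend (t := 1) le_rfl hrS heq.std_right (SignedTableau.length_put hrS _)
          (fun ρ => ?_) fun x y => ?_
        · rw [hput]; split_ifs <;> rfl
        · rw [hUm, hc.1, hc.2]
          have hn : (2 * r + 1, l + 2) ∉ shape T := by rw [h.upper]; omega
          constructor
          · rintro (hh | ⟨hh, hh' | hh'⟩)
            · right; omega
            · exact Or.inl hh'
            · right; omega
          · rintro (hh | ⟨hh | hh, hh'⟩)
            · refine Or.inr ⟨?_, Or.inl hh⟩
              rintro ⟨rfl, rfl⟩
              exact hn hh
            · right; omega
            · left; omega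
      obtain ⟨q, hstep⟩ := insertSingle_spec (i := j)
        (ε := -gained (S.get r) ⟨l + 1, if l = 0 then 1 else -(S.get r).last⟩)
        (hmid (if l = 0 then 1 else -(S.get r).last)) (hlen _) (hbelow _) (heq.label_lt hlt)
        (by omega)
      refine .sing hins hrS heq (fun _ => hodd) (hmid _) (hput _) (fun h0 => by rw [if_neg (by omega)]; simp) ?_ hstep
      rw [hR, gained_of_even hodd]
      simp
  | true =>
    have hr' : ((⟨2 * r + 1, l + 1, true⟩ : Domino).squares.sup Prod.fst - 1) / 2 = r := by
      simp [Domino.squares, Domino.first, Domino.second]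
      omega
    rw [hr', if_neg (by simp [Domino.squares, Domino.first, Domino.second])]
    simp only [mem_vdomino] at mem'
    rw [← hl]
    have hmid : ∀ s, Valid (insertDomino T a ε) (S.put r ⟨l + 1, s⟩) := by
      intro s
      refine h.extend (t := 1) le_rfl hrS s2 (SignedTableau.length_put hrS _)
        (fun ρ => ?_) fun x y => ?_
      · rw [hput]; split_ifs <;> rfl
      · rw [mem']
        refine or_congr Iff.rfl ?_
        omega
    obtain ⟨q, hstep⟩ := insertSingle_spec (i := j)
      (ε := gained (S.get r) ⟨l + 1, if l = 0 then 1 else (S.get r).last⟩)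
      (hmid (if l = 0 then 1 else (S.get r).last)) (hlen _) (hbelow _) hlt (by omega)
    refine .sing hins hrS (TabEquiv.refl s2) (by simp) (hmid _) (hput _)
      (fun h0 => by rw [if_neg (by omega)]; simp) ?_ hstep
    rcases Nat.even_or_odd l with he | ho
    · rw [hR, gained_of_even he]
      simp [he]
    · have h0 : l ≠ 0 := by rintro h0; rw [h0] at ho; exact absurd ho (by decide)
      rw [if_neg h0, hR, gained_of_odd ho, if_neg]
      rw [← hl]
      exact fun hh => Nat.not_odd_iff_even.2 hh.2 ho

end SOStar
namespace SOStar

/-! ### Where the next label goes -/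

lemma Std.not_belowIn {T : DominoTableau} (h : Std T) {i j : ℕ} {u w : Domino} (hu : (i, u) ∈ T)
    (hw : (j, w) ∈ T) {s s' : Square} (hs : s ∈ u.squares) (hs' : s' ∈ w.squares)
    (hle : s'.1 ≤ s.1) : ¬ BelowIn T i j := by
  rintro ⟨d, d', h1, h2, h3⟩
  have e1 := h.eq_of_label hu h1 rfl
  have e2 := h.eq_of_label hw h2 rfl
  simp only [Prod.mk.injEq, true_and] at e1 e2
  subst e1 e2
  have := h3 s hs s' hs'
  omega

lemma fixed_row_le {d : Domino} {s : Square} (hs : s ∈ d.squares) :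
    s.1 ≤ d.fixedSquare.1 + 1 ∧ d.fixedSquare.1 ≤ s.1 + 1 := by
  rcases hf : d.fixedSquare with ⟨i, j⟩
  have := square_near hf (x := s.1) (y := s.2) hs
  simp only; omega

/-- The domino with the largest label does not reach below the double row of its fixed square. -/
lemma Valid.row_le_of_max {U : DominoTableau} {S : SignedTableau} (h : Valid U S) {i : ℕ}
    {u : Domino} (hu : (i, u) ∈ U) (hmax : ∀ p ∈ U, p.1 ≤ i) {m : ℕ}
    (hf : u.fixedSquare.1 ≤ 2 * m) : ∀ s ∈ u.squares, s.1 ≤ 2 * m := by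
  rintro ⟨x, y⟩ hs
  by_contra hlt
  have hx : x = 2 * m + 1 := by
    have := fixed_row_le hs
    simp only at this hlt; omega
  subst hx
  have hm : (2 * m + 1, y) ∈ shape U := mem_shape.2 ⟨_, hu, hs⟩
  -- Both rows of a double row have the same length. The label of this lower square is at least the
  -- maximal one, so the domino is vertical in rows 2m+1, 2m+2, and its fixed square cannot be
  -- higher.
  have hm2 : (2 * m + 2, y) ∈ shape U := by rw [h.lower, ← h.upper]; exact hm
  obtain ⟨p, hp, hps⟩ := mem_shape.1 hm2
  have h1 := h.upper m y |>.1 hm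
  obtain ⟨p', hp', hle, hps'⟩ := h.std.mono hp hps (x' := 2 * m + 1) (y' := y) (by omega) h1.1
    (by omega) le_rfl
  have e := h.std.eq_of_square hp' hu hps' hs
  subst e
  have hpi := hmax p hp
  have e := h.std.eq_of_label hp hu (by simp only at hle ⊢; omega)
  subst e
  have hfm := fixedSquare_mem u
  rcases Nat.mod_two_eq_zero_or_one (2 * m + 1 + y) with he | he
  · rw [eq_fixedSquare_of_mem hs he] at hf
    simp only at hf; omega
  · rw [eq_fixedSquare_of_mem hps (by omega)] at hf
    simp only at hf; omega

lemma SingleStep.mem {T T' : DominoTableau} {S S' : SignedTableau} {j m q : ℕ} {ε : ℤˣ}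
    (h : SingleStep T S j ε m T' S' q) :
    ∃ w, (j, w) ∈ T' ∧ (w.row = 2 * q + 1 ∨ w.row = 2 * q + 2) := by
  rcases h.tab with ⟨e, _⟩ | ⟨_, _, _, e⟩
  · exact ⟨_, by rw [e]; exact mem_snoc _ _, Or.inl rfl⟩
  · exact ⟨_, by rw [e]; exact mem_snoc _ _, Or.inr rfl⟩

/-- If the largest label lies above the available double rows, the next one is put below it. -/
lemma SingleStep.below_of_fixed {U T₂ : DominoTableau} {S S₂ : SignedTableau} {i j m q M : ℕ}
    {δ : ℤˣ} {u : Domino} (hst : SingleStep U S j δ m T₂ S₂ q) (hV : Valid U S)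
    (hu : (i, u) ∈ U) (hmax : ∀ p ∈ U, p.1 ≤ i) (hf : u.fixedSquare.1 ≤ 2 * M) (hM : M ≤ q) :
    BelowIn T₂ i j := by
  rcases hst.tab with ⟨e, _⟩ | ⟨_, _, heq, e⟩
  · rw [e]
    refine ⟨u, _, List.mem_append_left _ hu, mem_snoc _ _, ?_⟩
    rintro s hs ⟨x, y⟩ hs'
    have := hV.row_le_of_max hu hmax hf s hs
    rw [mem_vdomino] at hs'
    simp only; omega
  · obtain ⟨⟨k, u'⟩, hu', e1, e2⟩ := heq.exists_right hu
    simp only at e1 e2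
    subst e1
    rw [e]
    refine ⟨u', _, List.mem_append_left _ hu', mem_snoc _ _, ?_⟩
    rintro s hs ⟨x, y⟩ hs'
    -- Even if the cycle has turned the domino, it reaches at most one row below its fixed square,
    -- and the new domino is in a lower row 2q+2.
    have := fixed_row_le hs
    rw [e2] at this
    rw [mem_hdomino] at hs'
    simp only; omega

/-- If a double row above the largest label is available, the next one is not put below it. -/
lemma SingleStep.not_below {U T₂ : DominoTableau} {S S₂ : SignedTableau} {i j m q q' : ℕ}
    {ε : ℤˣ} {u : Domino} (hst : SingleStep U S j ε m T₂ S₂ q') (hu : (i, u) ∈ U)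
    (hq : m ≤ q) (ha : Avail S m ε q) (hf : 2 * q + 1 ≤ u.fixedSquare.1)
    (hc : 2 * q + 2 ≤ u.fixedSquare.1 ∨ (S.get q).last = -ε ∨ Even (S.get q).len) :
    ¬ BelowIn T₂ i j := by
  have hqq : q' ≤ q := by
    by_contra hlt
    exact hst.not_avail q hq (by omega) ha
  rcases hst.tab with ⟨e, _⟩ | ⟨hodd, hno, heq, e⟩
  · refine hst.valid.std.not_belowIn (u := u) (w := ⟨2 * q' + 1, (S.get q').len + 1, true⟩)
      (by rw [e]; exact List.mem_append_left _ hu) (by rw [e]; exact mem_snoc _ _)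
      (fixedSquare_mem u) (first_mem _) ?_
    simp only; omega
  · obtain ⟨⟨k, u'⟩, hu', e1, e2⟩ := heq.exists_right hu
    simp only at e1 e2
    subst e1
    refine hst.valid.std.not_belowIn (u := u') (w := ⟨2 * q' + 2, (S.get q').len, false⟩)
      (by rw [e]; exact List.mem_append_left _ hu') (by rw [e]; exact mem_snoc _ _)
      (fixedSquare_mem u') (first_mem _) ?_
    rw [e2]
    simp only
    -- In double row q itself, the hypothesis `hc` says that the fixed square is in the lower row,
    -- or else that the horizontal position is impossible: that one requires odd length and no
    -- double row of this length ending in -ε.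
    by_cases hlt : q' = q
    · subst hlt
      rcases hc with hc | hc | hc
      · exact hc
      · exact absurd hc (hno q' hq ha.1 rfl)
      · exact absurd hodd (Nat.not_odd_iff_even.2 hc)
    · omega

/-- The square below the fixed square carries a label at least as large as the maximal one, so it
belongs to the same domino. -/
lemma Std.vertical_of_max {U : DominoTableau} (h : Std U) {i x y : ℕ} {u : Domino}
    (hu : (i, u) ∈ U) (hmax : ∀ p ∈ U, p.1 ≤ i) (hf : u.fixedSquare = (x, y))
    (hm : (x + 1, y) ∈ shape U) : u = ⟨x, y, true⟩ := by
  have hs : (x, y) ∈ u.squares := hf ▸ fixedSquare_mem u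
  have hp0 := h.young.one_le (mem_shape.2 ⟨_, hu, hs⟩)
  obtain ⟨p, hp, hps⟩ := mem_shape.1 hm
  obtain ⟨p', hp', hle, hps'⟩ := h.mono hp hps (x' := x) (y' := y) hp0.1 hp0.2 (by omega) le_rfl
  have e := h.eq_of_square hp' hu hps' hs
  subst e
  have hpi := hmax p hp
  have e := h.eq_of_label hp hu (by simp only at hle ⊢; omega)
  subst e
  have he := fixedSquare_even u
  rw [hf] at he
  simp only at he
  refine domino_ext_fixed_var (by rw [hf, fixed_v he]) ?_
  rw [eq_variableSquare_of_mem hps (by omega), var_v he]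

/-- What is known about the signed tableau after a singleton `(i, δ)` has been put into double row
`q`, previously of length `l`. -/
structure AfterSingle (S : SignedTableau) (δ : ℤˣ) (m q l : ℕ) : Prop where
  row : S.get q = ⟨l + 1, δ⟩
  still : ∀ ρ, m ≤ ρ → ρ < q → ¬ Avail S m δ ρ
  same : ∀ ρ, m ≤ ρ → (S.get ρ).len = l + 1 → (S.get ρ).last = δ
  next : (S.get (q + 1)).len ≤ l
  prev : Even l → m < q → l + 2 ≤ (S.get (q - 1)).len

lemma units_eq_of_ne_neg {s δ : ℤˣ} (h : s ≠ -δ) : s = δ := by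
  rcases Int.units_eq_one_or s with rfl | rfl <;> rcases Int.units_eq_one_or δ with rfl | rfl <;>
    simp_all

lemma units_ne_neg (s : ℤˣ) : s ≠ -s := by
  rcases Int.units_eq_one_or s with rfl | rfl <;> decide

/-- The double rows of the range above q were unavailable: they have even length and end in δ, and
no double row of the range with the same length ends in -δ. Inserting at q changes only the length
of q, and no sign in an even double row above it. If l is even, the preceding length, being even and
larger, exceeds l by at least 2. -/
lemma SingleStep.after {T T₁ : DominoTableau} {S S₁ : SignedTableau} {i m q : ℕ} {δ : ℤˣ}
    (h : SingleStep T S i δ m T₁ S₁ q) (hV : Valid T S) :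
    AfterSingle S₁ δ m q (S.get q).len := by
  have hlast : ∀ ρ, m ≤ ρ → ρ < q → Even (S.get ρ).len ∧ (S.get ρ).last = δ ∧ ρ < S.length := by
    intro ρ h1 h2
    have hlen : ρ < S.length := lt_of_lt_of_le h2 h.le_length
    have hna := h.not_avail ρ h1 h2
    unfold Avail at hna
    rw [not_and] at hna
    have hna := hna hlen
    rw [not_or] at hna
    refine ⟨Nat.not_odd_iff_even.1 hna.1, units_eq_of_ne_neg fun e => ?_, hlen⟩
    exact hna.2 ⟨ρ, h1, hlen, rfl, e⟩
  refine ⟨h.get_row, ?_, ?_, ?_, ?_⟩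
  · rintro ρ h1 h2 ⟨h3, h4⟩
    obtain ⟨g1, g2, g3⟩ := hlast ρ h1 h2
    rw [h.len_eq ρ (by omega)] at h4
    rcases h4 with h4 | ⟨ρ', k1, k2, k3, k4⟩
    · exact Nat.not_odd_iff_even.2 g1 h4
    · rcases lt_trichotomy ρ' q with hlt | rfl | hgt
      · obtain ⟨g1', g2', g3'⟩ := hlast ρ' k1 hlt
        rw [h.even_eq ρ' hlt g1', g2'] at k4
        exact units_ne_neg _ k4
      · rw [h.get_row] at k4
        exact units_ne_neg _ k4
      -- Lengths decrease weakly, so double row q had the same length as ρ and ρ' before the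
      -- insertion, and ρ would have been available like q.
      · rw [h.len_eq ρ' (by omega)] at k3
        have a1 := hV.anti (r := ρ) (r' := q) (by omega)
        have a2 := hV.anti (r := q) (r' := ρ') (by omega)
        have hql : q < S.length := by
          have := hV.pos ρ g3
          have := SignedTableau.lt_length (S := S) (r := ρ') (by omega)
          omega
        refine h.not_avail ρ h1 h2 ⟨g3, ?_⟩
        rw [show (S.get ρ).len = (S.get q).len by omega]
        exact (h.avail hql).2
  · intro ρ h1 h2
    rcases lt_trichotomy ρ q with hlt | rfl | hgt
    · obtain ⟨g1', g2', g3'⟩ := hlast ρ h1 hlt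
      rw [h.even_eq ρ hlt g1', g2']
    · rw [h.get_row]
    · rw [h.len_eq ρ (by omega)] at h2
      have a2 := hV.anti (r := q) (r' := ρ) (by omega)
      omega
  · rw [h.len_eq _ (by omega)]
    exact hV.anti (by omega)
  · intro he hm
    obtain ⟨g1', g2', g3'⟩ := hlast (q - 1) (by omega) (by omega)
    have a := h.valid.anti (r := q - 1) (r' := q) (by omega)
    rw [h.get_row] at a
    rw [h.len_eq _ (by omega)] at a ⊢
    obtain ⟨b, hb⟩ := g1'
    obtain ⟨c, hc⟩ := he
    simp only at a
    omega

/-- A second singleton of the same sign is put below the first. -/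
lemma SingleStep.below_of_same {U T₂ : DominoTableau} {S S₂ : SignedTableau}
    {i j m q q' l : ℕ} {δ : ℤˣ} {u : Domino} (hst : SingleStep U S j δ m T₂ S₂ q')
    (hV : Valid U S) (hu : (i, u) ∈ U) (hmax : ∀ p ∈ U, p.1 ≤ i)
    (haf : AfterSingle S δ m q l) (hf : u.fixedSquare.1 ≤ 2 * q + 2)
    (hf' : Even l → u.fixedSquare = (2 * q + 1, l + 1))
    (hprev : Even l → q = 0 ∨ l + 2 ≤ (S.get (q - 1)).len) (hmq : m ≤ q) : BelowIn T₂ i j := by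
  have hlen : (S.get q).len = l + 1 := by rw [haf.row]
  have hqS : q < S.length := SignedTableau.lt_length (by omega)
  rcases lt_or_ge q q' with hlt | hge
  · exact hst.below_of_fixed hV hu hmax (M := q + 1) (by omega) (by omega)
  · have hqq : q' = q := by
      by_contra hne
      exact haf.still q' hst.le (by omega) (hst.avail (by omega))
    subst hqq
    have hno : ¬ ∃ ρ, m ≤ ρ ∧ ρ < S.length ∧ (S.get ρ).len = (S.get q').len ∧
        (S.get ρ).last = -δ := by
      rintro ⟨ρ, k1, k2, k3, k4⟩
      rw [haf.same ρ k1 (by omega)] at k4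
      exact units_ne_neg _ k4
    have hodd : Odd (l + 1) := by
      rcases (hst.avail hqS).2 with h1 | h1
      · rwa [hlen] at h1
      · exact absurd h1 hno
    have hev : Even l := by
      rw [Nat.even_iff]; rw [Nat.odd_iff] at hodd; omega
    have hle := Nat.even_iff.1 hev
    have hu' : u = ⟨2 * q' + 1, l + 1, true⟩ :=
      hV.std.vertical_of_max hu hmax (hf' hev) ((hV.lower _ _).2 (by omega))
    have hnext := haf.next
    -- The second singleton goes into the same double row, now of odd length, where `i` is the
    -- vertical last domino. No double row of this length in the range ends in -δ, and the next one
    -- is shorter, so the cycle rule applies. The square (2q', l+2) lies in row 0 or has a label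
    -- smaller than `i`; hence moving turns `i` into the upper row, and the corner is in the same
    -- double row.
    obtain ⟨heq, r₁, hsh, ho₁, hiff⟩ := hV.moveThrough_lower hlen hodd (by omega)
    have hmoved : moved U (i, u) = ⟨2 * q' + 1, l + 1, false⟩ := by
      have he : (2 * q' + 1 + (l + 1)) % 2 = 0 := by omega
      rw [hu']
      unfold moved
      simp only [fixed_v he, var_v he, Prod.mk.injEq]
      rw [if_neg (by omega), if_pos]
      rcases hprev hev with h0 | h0
      · left; simp only; omega
      · by_cases hq0 : q' = 0
        · left; simp only; omega
        · have hm : (2 * (q' - 1) + 2, l + 2) ∈ shape U := (hV.lower _ _).2 (by omega)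
          rw [show 2 * (q' - 1) + 2 = 2 * q' + 1 - 1 by omega] at hm
          obtain ⟨p, hp, hps⟩ := mem_shape.1 hm
          refine Or.inr (Or.inr ⟨p, hp, hps, ?_⟩)
          refine lt_of_le_of_ne (hmax p hp) fun e => ?_
          have := hV.std.eq_of_label hp hu e
          rw [this, hu', mem_vdomino] at hps
          omega
    have hmem : (i, (⟨2 * q' + 1, l + 1, false⟩ : Domino)) ∈ moveThrough U (2 * q' + 2, l + 1) := by
      unfold moveThrough
      refine List.mem_map.2 ⟨(i, u), hu, ?_⟩
      rw [if_pos ⟨(i, u), hu, by rw [hu', mem_vdomino]; simp, Relation.EqvGen.refl _⟩, hmoved]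
    have hr₁ : q' = r₁ := by
      have : (2 * q' + 1, l + 2) ∈ shape (moveThrough U (2 * q' + 2, l + 1)) :=
        mem_shape.2 ⟨_, hmem, by rw [mem_hdomino]; simp⟩
      rw [hsh, Finset.mem_insert, Finset.mem_erase, hV.upper, Prod.mk.injEq] at this
      omega
    have hhc : HoleCorner U q' (l + 1) q' := (hiff q').2 hr₁
    rcases hst.tab with ⟨e, h1 | h1 | h1⟩ | ⟨_, _, heq, e⟩
    · exact absurd h1 hno
    · omega
    · rw [hlen] at h1
      exact absurd hhc h1
    · rw [hlen] at e
      rw [e]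
      refine ⟨_, _, List.mem_append_left _ hmem, mem_snoc _ _, ?_⟩
      rw [below_iff]; simp

/-- The domino inserted by `SingleStep`. -/
lemma SingleStep.decomp {T T₁ : DominoTableau} {S S₁ : SignedTableau} {i m q : ℕ} {δ : ℤˣ}
    (h : SingleStep T S i δ m T₁ S₁ q) (hV : Valid T S) :
    ∃ V d, T₁ = V ++ [(i, d)] ∧ TabEquiv T V ∧
      (d = ⟨2 * q + 1, (S.get q).len + 1, true⟩ ∨
        (Odd (S.get q).len ∧ d = ⟨2 * q + 2, (S.get q).len, false⟩)) := by
  rcases h.tab with ⟨e, _⟩ | ⟨ho, _, heq, e⟩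
  · exact ⟨_, _, e, TabEquiv.refl hV.std, Or.inl rfl⟩
  · exact ⟨_, _, e, heq, Or.inr ⟨ho, rfl⟩⟩

/-- As `i` exceeds `a` and stands last, it is put back in the last step. This exposes the growth
before `i` comes into play, to which `Ins.growth_right` and `Ins.growth_left` apply. -/
lemma Ins.last_step {a i : ℕ} {ε : ℤˣ} {V T' : DominoTableau} {d D : Domino}
    (h : Ins a ε (V ++ [(i, d)]) T' D) (hai : a < i) : ∃ V' D₀ d', Ins a ε V V' D₀ ∧
      T' = V' ++ [(i, d')] ∧ Addable (shape V) d ∧ LocalRule (shape V) d D₀ d' D := by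
  generalize hT : V ++ [(i, d)] = T at h
  cases h with
  | row hA hi hlt hε hc h1 h2 =>
    have := hlt (i, d) (by rw [← hT]; exact mem_snoc _ _)
    simp only at this; omega
  | col hA hi hlt hε hc h1 h2 =>
    have := hlt (i, d) (by rw [← hT]; exact mem_snoc _ _)
    simp only at this; omega
  | @step P P' D₀ E E' D' k h hk hE hr =>
    have := List.append_inj' hT (by simp)
    simp only [List.cons.injEq, Prod.mk.injEq, and_true] at this
    obtain ⟨rfl, rfl, rfl⟩ := this
    exact ⟨P', D₀, E', h, rfl, hE, hr⟩

end SOStar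
namespace SOStar

/-! ### A pair after the largest label -/

lemma std_snoc_max {V : DominoTableau} {i : ℕ} {d : Domino} (h : Std (V ++ [(i, d)])) :
    ∀ p ∈ V ++ [(i, d)], p.1 ≤ i := by
  intro p hp
  rw [List.mem_append, List.mem_singleton] at hp
  rcases hp with hp | rfl
  · exact ((std_snoc_iff.1 h).2.2.1 p hp).le
  · exact le_rfl

lemma mem_shape_of_snoc {V : DominoTableau} {i : ℕ} {d : Domino} (h : Std (V ++ [(i, d)]))
    (s : Square) : s ∈ shape V ↔ s ∈ shape (V ++ [(i, d)]) ∧ s ∉ d.squares := by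
  have := (std_snoc_iff.1 h).2.2.2
  rw [shape_snoc, Finset.mem_union]
  constructor
  · intro hs; exact ⟨Or.inl hs, fun hh => this.notMem hh hs⟩
  · rintro ⟨h1 | h1, h2⟩
    · exact h1
    · exact absurd h1 h2

lemma TabEquiv.max_le {T U : DominoTableau} (h : TabEquiv T U) {i : ℕ} (hi : ∀ p ∈ T, p.1 ≤ i) :
    ∀ p ∈ U, p.1 ≤ i := by
  intro p hp
  obtain ⟨q, hq, e, _⟩ := h.exists_left hp
  rw [← e]; exact hi q hq

/-- The pair lengthens double row r, which lies just above the range available for its second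
coordinate; inside that range nothing has changed. -/
lemma AfterSingle.restrict {S S' : SignedTableau} {δ : ℤˣ} {m q l r : ℕ} {R : DoubleRow}
    (h : AfterSingle S δ m q l) (hmr : m ≤ r + 1) (hrq : r < q)
    (hpos : ∀ ρ, ρ < S'.length → 1 ≤ (S'.get ρ).len)
    (hget : ∀ ρ, S'.get ρ = if ρ = r then R else S.get ρ) :
    AfterSingle S' δ (r + 1) q l := by
  have hg : ∀ ρ, r + 1 ≤ ρ → S'.get ρ = S.get ρ := fun ρ hρ => by
    rw [hget, if_neg (by omega)]
  have hl : ∀ ρ, r + 1 ≤ ρ → ρ < S'.length → ρ < S.length := fun ρ hρ h' => by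
    have := hpos ρ h'
    rw [hg ρ hρ] at this
    exact SignedTableau.lt_length this
  refine ⟨by rw [hg q (by omega)]; exact h.row, ?_, ?_, ?_, ?_⟩
  · rintro ρ h1 h2 ⟨h3, h4⟩
    refine h.still ρ (by omega) h2 ⟨hl ρ h1 h3, ?_⟩
    rw [hg ρ h1] at h4
    refine h4.imp_right ?_
    rintro ⟨k, k1, k2, k3, k4⟩
    rw [hg k k1] at k3 k4
    exact ⟨k, by omega, hl k k1 k2, k3, k4⟩
  · intro ρ h1 h2
    rw [hg ρ h1] at h2 ⊢
    exact h.same ρ (by omega) h2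
  · rw [hg _ (by omega)]; exact h.next
  · intro he hlt
    rw [hg _ (by omega)]
    exact h.prev he (by omega)

/-- A pair inserted after `(i, δ)` whose growth does not lie above the available double rows
has its second coordinate put below `i`. -/
lemma SingleStep.pair_below {T₀ T₁ T₂ V : DominoTableau} {S₀ S₁ S₂ : SignedTableau}
    {i j a m q : ℕ} {δ ε : ℤˣ} {d : Domino} (h : SingleStep T₀ S₀ i δ m T₁ S₁ q)
    (hV₀ : Valid T₀ S₀) (hT₁ : T₁ = V ++ [(i, d)])
    (hd : d = ⟨2 * q + 1, (S₀.get q).len + 1, true⟩ ∨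
      (Odd (S₀.get q).len ∧ d = ⟨2 * q + 2, (S₀.get q).len, false⟩))
    (hp : PairStep T₁ S₁ a j ε T₂ S₂) (hai : a < i)
    (hD : ∀ V' D₀, Ins a ε V V' D₀ → 2 * m + 1 ≤ D₀.row) : BelowIn T₂ i j := by
  have haf := h.after hV₀
  set l := (S₀.get q).len with hl
  have hV₁ := h.valid
  subst hT₁
  have hmem := mem_shape_of_snoc hV₁.std
  have hmax := std_snoc_max hV₁.std
  have hlq : (S₁.get q).len = l + 1 := by rw [haf.row]
  have heven : ∀ ρ, m ≤ ρ → ρ < q → Even (S₁.get ρ).len ∧ (S₁.get ρ).last = δ ∧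
      1 ≤ (S₁.get ρ).len := by
    intro ρ h1 h2
    have h3 := hV₁.anti (r := ρ) (r' := q) (by omega)
    have hρ : ρ < S₁.length := SignedTableau.lt_length (by omega)
    have hna := haf.still ρ h1 h2
    unfold Avail at hna
    rw [not_and] at hna
    have hna := hna hρ
    rw [not_or] at hna
    refine ⟨Nat.not_odd_iff_even.1 hna.1, units_eq_of_ne_neg fun e => ?_, by omega⟩
    exact hna.2 ⟨ρ, h1, hρ, rfl, e⟩
  cases hp with
  | @hor T' r hins hr hodd hT hget hv =>
    obtain ⟨V', D₀, d', hins₀, rfl, hA, hrule⟩ := hins.last_step hai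
    have hr0 := hD _ _ hins₀
    have hD₀A := hins₀.spec.2.2.1
    have hVy := hins₀.spec.1.young
    rw [hT]
    refine ⟨d', _, List.mem_append_left _ (mem_snoc _ _), mem_snoc _ _, ?_⟩
    rw [below_iff]
    simp only
    have ho := Nat.odd_iff.1 hodd
    generalize hD' : (⟨2 * r + 1, (S₁.get r).len + 1, false⟩ : Domino) = D' at hrule
    cases hrule with
    | disj hdis =>
      subst hD'
      simp only at hr0
      -- In this case the horizontal growth is in a double row of odd length, while those from m to
      -- q-1 have even length. Nor is r = q possible: if `d` is vertical, the growth would have `d`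
      -- on its left and could not come before it; if `d` is horizontal, the length l+1 is even.
      rcases lt_trichotomy r q with hlt | rfl | hgt
      · exact absurd hodd (Nat.not_odd_iff_even.2 (heven r (by omega) hlt).1)
      · rcases hd with rfl | ⟨ho', rfl⟩
        · have := (hD₀A.corner hVy).2.2.2.1
          simp only [hlq] at this
          rcases this with h1 | h1
          · omega
          · have h2 := ((hmem _).1 h1).2
            rw [mem_vdomino] at h2
            omega
        · rw [Nat.odd_iff] at ho'; omega
      · rcases hd with rfl | ⟨ho', rfl⟩ <;> simp <;> omega
    | row => simp only [Domino.mk.injEq] at hD'; simp; omega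
    | col => simp at hD'
    | @horVert r₁ c₁ =>
      simp only [Domino.mk.injEq, and_true] at hD'
      rcases hd with hd | ⟨ho', hd⟩
      · simp at hd
      · exfalso
        simp only [Domino.mk.injEq, and_true] at hd
        rw [Nat.odd_iff] at ho'
        omega
    | vertHor => simp at hD'
  | @sing T' U S' r q' v s δ' hins hr heq hv hmid hget hs hδ hstep =>
    obtain ⟨V', D₀, d', hins₀, rfl, hA, hrule⟩ := hins.last_step hai
    have hr0 := hD _ _ hins₀
    have hD₀A := hins₀.spec.2.2.1
    have hVy := hins₀.spec.1.young
    obtain ⟨⟨i', u⟩, hu, e1, hfu⟩ := heq.exists_right (mem_snoc V' (i, d'))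
    simp only at e1 hfu
    subst e1
    have hmaxU : ∀ p ∈ U, p.1 ≤ i' := heq.max_le (std_snoc_max heq.std_left)
    have done : d'.fixedSquare.1 ≤ 2 * r + 2 → BelowIn T₂ i' j := fun hle =>
      hstep.below_of_fixed hmid hu hmaxU (M := r + 1) (by rw [hfu]; omega) hstep.le
    generalize hD' : (⟨2 * r + 1, (S₁.get r).len + 1, v⟩ : Domino) = D' at hrule
    cases hrule with
    | disj hdis =>
      subst hD'
      simp only at hr0
      rcases lt_trichotomy r q with hlt | rfl | hgt
      · obtain ⟨k1, k2, k3⟩ := heven r (by omega) hlt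
        -- Double row r has even length and ends in δ. A vertical growth keeps the last sign and
        -- passes it on, a horizontal one reverses it twice; so the second coordinate behaves like a
        -- second singleton of sign δ.
        have hδδ : δ' = δ := by
          rw [hδ, hs k3, k2]
          cases v <;> simp [k1]
        subst hδδ
        have haf' := haf.restrict (by omega) hlt hmid.pos hget
        refine hstep.below_of_same hmid hu hmaxU haf' ?_ ?_ ?_ (by omega)
        · rw [hfu]
          rcases hd with rfl | ⟨ho', rfl⟩
          · rw [fixed_v_eq]; simp only; omega
          · rw [fixed_h_eq]
        · intro he
          rw [hfu]
          rcases hd with rfl | ⟨ho', rfl⟩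
          · rw [Nat.even_iff] at he
            exact fixed_v (by omega)
          · exact absurd ho' (Nat.not_odd_iff_even.2 he)
        · intro he
          right
          have := haf.prev he (by omega)
          rw [hget]
          split_ifs with hc
          · rw [hc] at this
            simp only; omega
          · exact this
      · rcases hd with rfl | ⟨ho', rfl⟩
        · have := (hD₀A.corner hVy).2.2.2.1
          simp only [hlq] at this
          rcases this with h1 | h1
          · omega
          · have h2 := ((hmem _).1 h1).2
            rw [mem_vdomino] at h2
            omega
        · refine done ?_
          rw [fixed_h_eq]
      · refine done ?_
        rcases hd with rfl | ⟨ho', rfl⟩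
        · rw [fixed_v_eq]; simp only; omega
        · rw [fixed_h_eq]; simp only; omega
    | row =>
      refine done ?_
      simp only [Domino.mk.injEq] at hD'
      rw [fixed_h_eq]; simp only; omega
    | col =>
      refine done ?_
      simp only [Domino.mk.injEq] at hD'
      rw [fixed_v_eq]; simp only; omega
    | @horVert r₁ c₁ =>
      refine done ?_
      simp only [Domino.mk.injEq] at hD'
      rw [fixed_v_eq]; simp only; omega
    | @vertHor r₁ c₁ =>
      refine done ?_
      simp only [Domino.mk.injEq] at hD'
      rw [fixed_h_eq]; simp only; omega

end SOStar
namespace SOStar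

/-! ### Two successive pairs -/

lemma Addable.of_upper_rows {Y : Finset Square} (hY : Young Y) {S : SignedTableau} {R : ℕ}
    (hrows : ∀ ρ, ρ < R → ∀ c, ((2 * ρ + 1, c) ∈ Y ↔ 1 ≤ c ∧ c ≤ (S.get ρ).len) ∧
      ((2 * ρ + 2, c) ∈ Y ↔ 1 ≤ c ∧ c ≤ (S.get ρ).len)) {D : Domino} (hD : Addable Y D)
    (hrow : D.row ≤ 2 * R) : ∃ ρ, ρ < R ∧ D.row = 2 * ρ + 1 ∧ D.col = (S.get ρ).len + 1 := by
  obtain ⟨h1, h2, h3, h4, h5⟩ := hD.corner hY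
  obtain ⟨ρ, hρ | hρ⟩ := row_cases h1
  · have hlt : ρ < R := by omega
    refine ⟨ρ, hlt, hρ, ?_⟩
    rw [hρ, (hrows ρ hlt _).1] at h3
    rw [hρ, (hrows ρ hlt _).1] at h4
    omega
  · exfalso
    have hlt : ρ < R := by omega
    rw [hρ, (hrows ρ hlt _).2] at h3
    rw [hρ, show 2 * ρ + 2 - 1 = 2 * ρ + 1 by omega, (hrows ρ hlt _).1] at h5
    omega

/-- A domino added below row `x` does not reach beyond the end of row `x`. -/
lemma Addable.col_le {Y : Finset Square} (hY : Young Y) {D : Domino} (hD : Addable Y D) {x l : ℕ}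
    (hx1 : 1 ≤ x) (hx : x < D.row) (hl : ∀ c, (x, c) ∈ Y → c ≤ l) :
    D.fixedSquare.2 ≤ l ∧ D.row ≤ D.fixedSquare.1 := by
  obtain ⟨r, c, _ | _⟩ := D
  · obtain ⟨h1, h2, h3, h4, h5⟩ := (addable_h_iff hY).1 hD
    simp only at hx
    have := hl (c + 1) (hY.down (h5.resolve_left (by omega)) hx1 (by omega) (by omega) le_rfl)
    rw [fixed_h_eq]
    simp only; omega
  · obtain ⟨h1, h2, h3, h4, h5⟩ := (addable_v_iff hY).1 hD
    simp only at hx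
    have := hl c (hY.down (h4.resolve_left (by omega)) hx1 (by omega) (by omega) le_rfl)
    rw [fixed_v_eq]
    simp only; omega

lemma LocalRule.eq_of_row_ne {Y : Finset Square} {E D E' D' : Domino} (h : LocalRule Y E D E' D')
    (hne : E.row ≠ D.row) : E' = E ∧ D' = D := by
  cases h with
  | disj => exact ⟨rfl, rfl⟩
  | row => exact absurd rfl hne
  | col => exact absurd rfl hne
  | horVert => exact absurd rfl hne
  | vertHor => exact absurd rfl hne

lemma fixed_bounds (d : Domino) : d.row ≤ d.fixedSquare.1 ∧ d.col ≤ d.fixedSquare.2 ∧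
    d.fixedSquare.1 ≤ d.row + 1 ∧ d.fixedSquare.2 ≤ d.col + 1 := by
  obtain ⟨r, c, _ | _⟩ := d
  · rw [fixed_h_eq]; simp only; omega
  · rw [fixed_v_eq]; simp only; omega

/-- A cycle whose hole lies in another double row does not have its corner at the end of the
upper row of `r` if the domino there is free to move from below to the right. -/
lemma Valid.not_holeCorner {U : DominoTableau} {S : SignedTableau} (h : Valid U S) {r q l k : ℕ}
    {u : Domino} (hl : (S.get r).len = l + 1) (he : Even l) (hnext : (S.get (r + 1)).len ≤ l)
    (hk : (k, u) ∈ U) (hf : u.fixedSquare = (2 * r + 1, l + 1))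
    (hl1 : LabelLT U (2 * r, l + 2) k) (hl2 : LabelLT U (2 * r + 2, l) k) (hrq : r < q)
    (hodd : Odd (S.get q).len) (hlast : (S.get (q + 1)).len ≠ (S.get q).len) :
    ¬ HoleCorner U q (S.get q).len r := by
  intro hhc
  rw [Nat.even_iff] at he
  obtain ⟨heq, r₁, hsh, ho₁, hiff⟩ := h.moveThrough_lower rfl hodd hlast
  have := (hiff r).1 hhc
  subst this
  set W := moveThrough U (2 * q + 2, (S.get q).len) with hW
  rw [hl] at hsh
  obtain ⟨⟨k', w⟩, hw, e1, e2⟩ := heq.exists_right hk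
  simp only at e1 e2
  subst e1
  rw [hf] at e2
  have hWs := heq.std_right
  have hev : ∀ x y, (x + y) % 2 = 0 → ((x, y) ∈ shape W ↔ (x, y) ∈ shape U) :=
    fun x y hxy => (heq.even_mem hxy).symm
  rw [heq.labelLT (by omega)] at hl1 hl2
  have hfw : (2 * r + 1, l + 1) ∈ w.squares := e2 ▸ fixedSquare_mem w
  have owner : ∀ {p : ℕ × Domino} {x y : ℕ}, p ∈ W → p.2.fixedSquare = (x, y) →
      (x, y) ∈ shape U := by
    intro p x y hp hpf
    have he := fixedSquare_even p.2
    rw [hpf] at he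
    rw [← hev x y he]
    exact mem_shape.2 ⟨p, hp, hpf ▸ fixedSquare_mem _⟩
  have notlt : ∀ {p : ℕ × Domino} {x y : ℕ}, p ∈ W → (x, y) ∈ p.2.squares → LabelLT W (x, y) k' →
      p.1 < k' := by
    rintro p x y hp hps (h1 | h1 | ⟨p', hp', hps', hlt⟩)
    · have := hWs.young.one_le (mem_shape.2 ⟨p, hp, hps⟩)
      simp only at this h1; omega
    · have := hWs.young.one_le (mem_shape.2 ⟨p, hp, hps⟩)
      simp only at this h1; omega
    · rw [hWs.eq_of_square hp hp' hps hps']; exact hlt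
  -- After the move both (2r+2, l+1) and (2r+1, l+2) are covered. Other owners would have their
  -- fixed squares outside the shape, or at (2r+2, l) and (2r, l+2), where the labels are smaller
  -- than `k`, against monotony. So `w` would have to cover both, besides its fixed square.
  have hA : (2 * r + 2, l + 1) ∈ w.squares := by
    have hm : (2 * r + 2, l + 1) ∈ shape W := by
      rw [hsh, Finset.mem_insert, Finset.mem_erase, h.lower]
      refine Or.inr ⟨fun e => ?_, by omega⟩
      rw [Prod.mk.injEq] at e; omega
    obtain ⟨p, hp, hps⟩ := mem_shape.1 hm
    rcases hpf : p.2.fixedSquare with ⟨x, y⟩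
    have hmem : (x, y) ∈ p.2.squares := hpf ▸ fixedSquare_mem _
    have hpo := owner hp hpf
    have hpe := fixedSquare_even p.2
    rw [hpf] at hpe
    simp only at hpe
    rcases square_near hpf hps with ⟨rfl, rfl⟩ | ⟨h1, h2⟩ | ⟨h1, h2⟩ | ⟨h1, h2⟩ | ⟨h1, h2⟩
    · omega
    · exfalso
      have hx : x = 2 * r + 2 := by omega
      have hy : y = l := by omega
      subst hx hy
      have hlt := notlt hp hmem hl2
      obtain ⟨p', hp', hle, hps'⟩ := hWs.mono hp hps (x' := 2 * r + 1) (y' := y + 1) (by omega)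
        (by omega) (by omega) le_rfl
      have := hWs.eq_of_square hp' hw hps' hfw
      subst this
      simp only at hle; omega
    · have hx : x = 2 * r + 1 := by omega
      subst hx h2
      have := hWs.eq_of_square hp hw hmem hfw
      subst this
      exact hps
    · exfalso
      have hx : x = 2 * (r + 1) + 1 := by omega
      subst hx
      rw [h.upper] at hpo; omega
    · exfalso
      have hx : x = 2 * r + 2 := by omega
      subst hx
      rw [h.lower] at hpo; omega
  have hB : (2 * r + 1, l + 2) ∈ w.squares := by
    have hm : (2 * r + 1, l + 2) ∈ shape W := by
      rw [hsh]; exact Finset.mem_insert_self _ _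
    obtain ⟨p, hp, hps⟩ := mem_shape.1 hm
    rcases hpf : p.2.fixedSquare with ⟨x, y⟩
    have hmem : (x, y) ∈ p.2.squares := hpf ▸ fixedSquare_mem _
    have hpo := owner hp hpf
    have hpe := fixedSquare_even p.2
    rw [hpf] at hpe
    simp only at hpe
    rcases square_near hpf hps with ⟨rfl, rfl⟩ | ⟨h1, h2⟩ | ⟨h1, h2⟩ | ⟨h1, h2⟩ | ⟨h1, h2⟩
    · omega
    · have hy : y = l + 1 := by omega
      subst h1 hy
      have := hWs.eq_of_square hp hw hmem hfw
      subst this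
      exact hps
    · exfalso
      have hx : x = 2 * r := by omega
      subst hx h2
      have hlt := notlt hp hmem hl1
      obtain ⟨p', hp', hle, hps'⟩ := hWs.mono hp hps (x' := 2 * r + 1) (y' := l + 1) (by omega)
        (by omega) le_rfl (by omega)
      have := hWs.eq_of_square hp' hw hps' hfw
      subst this
      simp only at hle; omega
    · exfalso
      have hx : x = 2 * r + 2 := by omega
      subst hx
      rw [h.lower] at hpo; omega
    · exfalso
      subst h1
      rw [h.upper] at hpo; omega
  have v1 := eq_variableSquare_of_mem hA (by omega)
  have v2 := eq_variableSquare_of_mem hB (by omega)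
  rw [v1, Prod.mk.injEq] at v2
  omega

/-- Two pairs, the second coordinate of the first lying directly below the growth. -/
lemma pair_pair_hor {T₀ T' T₂ : DominoTableau} {S₀ S₁ S₂ : SignedTableau} {a a' i j r : ℕ}
    {ε ε' : ℤˣ}
    (hins : Ins a ε T₀ T' ⟨2 * r + 1, (S₀.get r).len + 1, false⟩)
    (hodd : Odd (S₀.get r).len)
    (hget : ∀ ρ, S₁.get ρ = if ρ = r then ⟨(S₀.get r).len + 2, (S₀.get r).last⟩ else S₀.get ρ)
    (hV₁ : Valid (T' ++ [(i, ⟨2 * r + 2, (S₀.get r).len + 1, false⟩)]) S₁)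
    (hp : PairStep (T' ++ [(i, ⟨2 * r + 2, (S₀.get r).len + 1, false⟩)]) S₁ a' j ε' T₂ S₂)
    (hai : a' < i) :
    ((a < a' ∧ ε' = 1) ∨ (a' < a ∧ ε = -1) → ¬ BelowIn T₂ i j) ∧
    ((a < a' ∧ ε' = -1) ∨ (a' < a ∧ ε = 1) → BelowIn T₂ i j) := by
  set l := (S₀.get r).len with hl
  have hol := Nat.odd_iff.1 hodd
  have hr1 : (S₁.get r).len = l + 2 := by rw [hget, if_pos rfl]
  have hmem := mem_shape_of_snoc hV₁.std
  have hT' := hins.spec.2.1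
  have hrefl := TabEquiv.refl hT'
  have hfD : Domino.fixedSquare ⟨2 * r + 1, l + 1, false⟩ = (2 * r + 1, l + 2) := by
    rw [fixed_h_eq, Prod.mk.injEq]; omega
  -- Without `i`, the upper row of double row r is two squares longer than the lower one. The next
  -- growth can lie above, extend the upper row, start at the end of the lower row, or lie further
  -- below.
  have hup : ∀ c, (2 * r + 1, c) ∈ shape T' ↔ 1 ≤ c ∧ c ≤ l + 2 := by
    intro c
    rw [hmem, hV₁.upper, hr1, mem_hdomino]; omega
  have hlo : ∀ c, (2 * r + 2, c) ∈ shape T' ↔ 1 ≤ c ∧ c ≤ l := by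
    intro c
    rw [hmem, hV₁.lower, hr1, mem_hdomino]; omega
  have hrows : ∀ ρ, ρ < r → ∀ c, ((2 * ρ + 1, c) ∈ shape T' ↔ 1 ≤ c ∧ c ≤ (S₁.get ρ).len) ∧
      ((2 * ρ + 2, c) ∈ shape T' ↔ 1 ≤ c ∧ c ≤ (S₁.get ρ).len) := by
    intro ρ hρ c
    rw [hmem, hmem, hV₁.upper, hV₁.lower, mem_hdomino, mem_hdomino]
    constructor <;> omega
  -- the position of the growth before `i` is put back
  have pos : ∀ D₀ : Domino, Addable (shape T') D₀ →
      (∃ ρ, ρ < r ∧ D₀.row = 2 * ρ + 1 ∧ l + 3 ≤ D₀.col) ∨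
      (D₀ = ⟨2 * r + 1, l + 3, false⟩) ∨ (D₀.row = 2 * r + 2 ∧ D₀.col = l + 1) ∨
      (2 * r + 3 ≤ D₀.row ∧ D₀.fixedSquare.2 ≤ l) := by
    intro D₀ hA
    obtain ⟨c1, c2, c3, c4, c5⟩ := hA.corner hT'.young
    rcases Nat.lt_or_ge (2 * r) D₀.row with hgt | hle
    · right
      rcases Nat.lt_or_ge D₀.row (2 * r + 3) with hlt | hge
      · by_cases h1 : D₀.row = 2 * r + 1
        · left
          rw [h1, hup] at c3
          rw [h1, hup] at c4
          have hcol : D₀.col = l + 3 := by omega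
          obtain ⟨x, y, v⟩ := D₀
          simp only at h1 hcol
          subst h1 hcol
          cases v
          · rfl
          · have := ((addable_v_iff hT'.young).1 hA).2.2.2.2
            rw [show 2 * r + 1 + 1 = 2 * r + 2 by omega, hlo] at this
            omega
        · right; left
          have h2 : D₀.row = 2 * r + 2 := by omega
          rw [h2, hlo] at c3
          rw [h2, hlo] at c4
          omega
      · right; right
        exact ⟨hge, (hA.col_le hT'.young (x := 2 * r + 2) (by omega) (by omega)
          fun c hc => ((hlo c).1 hc).2).1⟩
    · left
      obtain ⟨ρ, h1, h2, h3⟩ := hA.of_upper_rows hT'.young hrows hle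
      have := hV₁.anti (r := ρ) (r' := r) (by omega)
      exact ⟨ρ, h1, h2, by omega⟩
  constructor
  · intro hc
    have up : ∀ V' D₀, Ins a' ε' T' V' D₀ →
        (∃ ρ, ρ < r ∧ D₀.row = 2 * ρ + 1 ∧ l + 3 ≤ D₀.col) ∨
        (D₀ = ⟨2 * r + 1, l + 3, false⟩) := by
      intro V' D₀ hins₀
      -- The exceptional case is absent, since it needs a vertical first growth.
      have hg := hins.growth_right hrefl hins₀ hc
      rw [hfD] at hg
      have hb := fixed_bounds D₀
      simp only [Bool.false_eq_true, false_and, and_false, or_false] at hg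
      rcases pos D₀ hins₀.spec.2.2.1 with h1 | h1 | h1 | h1
      · exact Or.inl h1
      · exact Or.inr h1
      · omega
      · omega
    cases hp with
    | @hor T'' r' hins' hr' hodd' hT hget' hv' =>
      obtain ⟨V', D₀, d', hins₀, rfl, hA, hrule⟩ := hins'.last_step hai
      have hpos := up V' D₀ hins₀
      obtain ⟨rfl, hD⟩ := hrule.eq_of_row_ne (by
        rcases hpos with ⟨ρ, h1, h2, h3⟩ | h1
        · simp only; omega
        · rw [h1]; simp)
      refine hv'.std.not_belowIn (u := ⟨2 * r + 2, l + 1, false⟩)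
        (w := ⟨2 * r' + 2, (S₁.get r').len + 1, false⟩)
        (by rw [hT]; exact List.mem_append_left _ (mem_snoc _ _)) (by rw [hT]; exact mem_snoc _ _)
        (first_mem _) (first_mem _) ?_
      simp only
      rcases hpos with ⟨ρ, h1, h2, h3⟩ | h1
      · rw [← hD] at h2; simp only at h2; omega
      · rw [h1] at hD; simp only [Domino.mk.injEq] at hD; omega
    | @sing T'' U S' r' q v s δ hins' hr' heq hv hmid hget' hs hδ hstep =>
      obtain ⟨V', D₀, d', hins₀, rfl, hA, hrule⟩ := hins'.last_step hai
      have hpos := up V' D₀ hins₀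
      obtain ⟨rfl, hD⟩ := hrule.eq_of_row_ne (by
        rcases hpos with ⟨ρ, h1, h2, h3⟩ | h1
        · simp only; omega
        · rw [h1]; simp)
      obtain ⟨⟨i', u⟩, hu, e1, hfu⟩ := heq.exists_right (mem_snoc V' _)
      simp only at e1 hfu
      subst e1
      rw [fixed_h_eq] at hfu
      rcases hpos with ⟨ρ, h1, h2, h3⟩ | h1
      · rw [← hD] at h2
        simp only at h2
        have hgr : (S'.get r).len = l + 2 := by rw [hget', if_neg (by omega), hr1]
        refine hstep.not_below hu (q := r) (by omega)
          ⟨SignedTableau.lt_length (by omega), Or.inl ?_⟩ (by rw [hfu]; simp)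
          (Or.inl (by rw [hfu]))
        rw [hgr, Nat.odd_iff]; omega
      · rw [h1] at hD
        simp only [Domino.mk.injEq] at hD
        have hrr : r' = r := by omega
        subst hrr
        -- A horizontal growth in double row r, of odd length l+2, falls under the other kind of
        -- step.
        have := Nat.even_iff.1 (hv hD.2.2)
        omega
  · intro hc
    have low : ∀ V' D₀, Ins a' ε' T' V' D₀ → 2 * r + 2 ≤ D₀.row := by
      intro V' D₀ hins₀
      have hg := hins.growth_left hrefl hins₀ hc
      rw [hfD] at hg
      have hb := fixed_bounds D₀
      rcases pos D₀ hins₀.spec.2.2.1 with ⟨ρ, h1, h2, h3⟩ | h1 | h1 | h1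
      · exfalso
        rcases hg with hg | ⟨hg, _⟩
        · omega
        · rw [hg] at hb; simp only at hb; omega
      · exfalso
        rw [h1, fixed_h_eq] at hg
        simp only [Prod.mk.injEq] at hg
        omega
      · omega
      · omega
    cases hp with
    | @hor T'' r' hins' hr' hodd' hT hget' hv' =>
      obtain ⟨V', D₀, d', hins₀, rfl, hA, hrule⟩ := hins'.last_step hai
      have hlow := low V' D₀ hins₀
      rw [hT]
      refine ⟨d', _, List.mem_append_left _ (mem_snoc _ _), mem_snoc _ _, ?_⟩
      rw [below_iff]
      simp only
      generalize hD' : (⟨2 * r' + 1, (S₁.get r').len + 1, false⟩ : Domino) = D' at hrule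
      cases hrule with
      | disj =>
        subst hD'
        simp at hlow ⊢
        omega
      | row => simp only [Domino.mk.injEq] at hD'; simp; omega
      | horVert => simp only [Domino.mk.injEq] at hD'; simp; omega
    | @sing T'' U S' r' q v s δ hins' hr' heq hv hmid hget' hs hδ hstep =>
      obtain ⟨V', D₀, d', hins₀, rfl, hA, hrule⟩ := hins'.last_step hai
      have hlow := low V' D₀ hins₀
      obtain ⟨⟨i', u⟩, hu, e1, hfu⟩ := heq.exists_right (mem_snoc V' (i, d'))
      simp only at e1 hfu
      subst e1
      have hmaxU : ∀ p ∈ U, p.1 ≤ i' := heq.max_le (std_snoc_max heq.std_left)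
      refine hstep.below_of_fixed hmid hu hmaxU (M := r' + 1) ?_ hstep.le
      rw [hfu]
      generalize hD' : (⟨2 * r' + 1, (S₁.get r').len + 1, v⟩ : Domino) = D' at hrule
      cases hrule with
      | disj =>
        subst hD'
        rw [fixed_h_eq]
        simp only at hlow ⊢; omega
      | row => simp only [Domino.mk.injEq] at hD'; rw [fixed_h_eq]; simp only; omega
      | horVert => simp only [Domino.mk.injEq] at hD'; rw [fixed_v_eq]; simp only; omega

lemma PairStep.exists_ins {T T₁ : DominoTableau} {S S₁ : SignedTableau} {a j : ℕ} {ε : ℤˣ}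
    (h : PairStep T S a j ε T₁ S₁) : ∃ T' D, Ins a ε T T' D := by
  cases h with
  | hor hins => exact ⟨_, _, hins⟩
  | sing hins => exact ⟨_, _, hins⟩

/-- Two pairs, the second coordinate of the first being inserted like a singleton. -/
lemma pair_pair_sing {T₀ T' U T₁ T₂ : DominoTableau} {S₀ S' S₁ S₂ : SignedTableau}
    {a a' i j r q : ℕ} {ε ε' s δ : ℤˣ} {v : Bool} (hV₀ : Valid T₀ S₀)
    (hins : Ins a ε T₀ T' ⟨2 * r + 1, (S₀.get r).len + 1, v⟩) (heq : TabEquiv T' U)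
    (hv : v = false → Even (S₀.get r).len) (hmid : Valid U S')
    (hget : ∀ ρ, S'.get ρ = if ρ = r then ⟨(S₀.get r).len + 1, s⟩ else S₀.get ρ)
    (hδ : δ = if v = true ∧ Even (S₀.get r).len then s else -s)
    (hstep : SingleStep U S' i δ (r + 1) T₁ S₁ q) (hp : PairStep T₁ S₁ a' j ε' T₂ S₂)
    (hai : a' < i) :
    ((a < a' ∧ ε' = 1) ∨ (a' < a ∧ ε = -1) → ¬ BelowIn T₂ i j) ∧
    ((a < a' ∧ ε' = -1) ∨ (a' < a ∧ ε = 1) → BelowIn T₂ i j) := by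
  obtain ⟨V, d, rfl, hUV, hd⟩ := hstep.decomp hmid
  have haf := hstep.after hmid
  have hrq := hstep.le
  set l := (S₀.get r).len with hl
  set lq := (S'.get q).len with hlq
  have hV₁ := hstep.valid
  have hmem := mem_shape_of_snoc hV₁.std
  have hS'r : S'.get r = ⟨l + 1, s⟩ := by rw [hget, if_pos rfl]
  have hr1 : (S₁.get r).len = l + 1 := by rw [hstep.len_eq r (by omega), hS'r]
  have hdrow : 2 * r + 3 ≤ d.row := by rcases hd with rfl | ⟨_, rfl⟩ <;> simp only <;> omega
  have hdfix : 2 * q + 1 ≤ d.fixedSquare.1 ∧ d.fixedSquare.1 ≤ 2 * q + 2 := by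
    rcases hd with rfl | ⟨_, rfl⟩
    · rw [fixed_v_eq]; simp only; omega
    · rw [fixed_h_eq]; simp only; omega
  have hdsq : ∀ x y, (x, y) ∈ d.squares → 2 * r + 3 ≤ x := by
    intro x y hs
    rcases hd with rfl | ⟨_, rfl⟩
    · rw [mem_vdomino] at hs; omega
    · rw [mem_hdomino] at hs; omega
  have hTV := heq.trans hUV
  have hVy := hUV.std_right.young
  have hrows : ∀ ρ, ρ < r + 1 → ∀ c, ((2 * ρ + 1, c) ∈ shape V ↔ 1 ≤ c ∧ c ≤ (S₁.get ρ).len) ∧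
      ((2 * ρ + 2, c) ∈ shape V ↔ 1 ≤ c ∧ c ≤ (S₁.get ρ).len) := by
    intro ρ hρ c
    rw [hmem, hmem, hV₁.upper, hV₁.lower]
    refine ⟨and_iff_left fun hh => ?_, and_iff_left fun hh => ?_⟩
    · have := hdsq _ _ hh; omega
    · have := hdsq _ _ hh; omega
  have hφ : (Domino.fixedSquare ⟨2 * r + 1, l + 1, v⟩).2 = l + 1 ∧
      (Domino.fixedSquare ⟨2 * r + 1, l + 1, v⟩).1 = 2 * r + 1 + l % 2 := by
    cases v
    · have := Nat.even_iff.1 (hv rfl)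
      rw [fixed_h_eq]; simp only; omega
    · rw [fixed_v_eq]; exact ⟨rfl, by simp only; omega⟩
  have hnext : (S'.get (r + 1)).len ≤ l := by
    rw [hget, if_neg (by omega)]
    exact hV₀.anti (by omega)
  -- In the exceptional case of the growth comparison, the corner of the cycle used for `i` is not
  -- in double row r, whose sign is therefore unchanged.
  have keep : Even l → (∃ k, (k, (⟨2 * r + 1, l + 1, v⟩ : Domino)) ∈ T' ∧
      LabelLT T' ((Domino.fixedSquare ⟨2 * r + 1, l + 1, v⟩).1 - 1,
        (Domino.fixedSquare ⟨2 * r + 1, l + 1, v⟩).2 + 1) k ∧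
      LabelLT T' ((Domino.fixedSquare ⟨2 * r + 1, l + 1, v⟩).1 + 1,
        (Domino.fixedSquare ⟨2 * r + 1, l + 1, v⟩).2 - 1) k) → S₁.get r = ⟨l + 1, s⟩ := by
    rintro he ⟨k, hk, hl1, hl2⟩
    have hle := Nat.even_iff.1 he
    rw [hφ.1, hφ.2, hle] at hl1 hl2
    rw [← hS'r]
    refine hstep.keep r (by omega) fun hodd hlast => ?_
    obtain ⟨⟨k', u⟩, hu, e1, e2⟩ := heq.exists_right hk
    simp only at e1 e2
    subst e1
    rw [heq.labelLT (by omega)] at hl1 hl2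
    exact hmid.not_holeCorner (l := l) (by rw [hS'r]) he hnext hu
      (by rw [e2]; exact Prod.ext (by rw [hφ.2, hle]) hφ.1) hl1 hl2 (by omega) hodd hlast
  -- Now l+1 is even, and signs of even double rows above q never change.
  have keep' : Odd l → S₁.get r = ⟨l + 1, s⟩ := by
    intro ho
    rw [← hS'r]
    refine hstep.even_eq r (by omega) ?_
    rw [hS'r]
    simp only
    rw [Nat.even_iff]; rw [Nat.odd_iff] at ho; omega
  constructor
  · intro hc
    -- A growth below double row r stays within the columns up to l+1, so its content would be
    -- smaller than that of the first growth; the exceptional position is too high as well.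
    have up : ∀ V' D₀, Ins a' ε' V V' D₀ →
        ∃ ρ, ρ < r + 1 ∧ D₀.row = 2 * ρ + 1 ∧ D₀.col = (S₁.get ρ).len + 1 := by
      intro V' D₀ hins₀
      refine hins₀.spec.2.2.1.of_upper_rows hVy hrows ?_
      by_contra hgt
      have h1 := hins₀.spec.2.2.1.col_le hVy (x := 2 * r + 2) (l := l + 1) (by omega) (by omega)
        fun c hc => by
          have := ((hrows r (by omega) c).2.1 hc).2
          omega
      rcases hins.growth_right hTV hins₀ hc with hg | ⟨hg, _⟩
      · omega
      · rw [hg] at h1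
        simp only at h1; omega
    cases hp with
    | @hor T'' r' hins' hr' hodd' hT hget' hv' =>
      obtain ⟨V', D₀, d', hins₀, rfl, hA, hrule⟩ := hins'.last_step hai
      obtain ⟨ρ, h1, h2, h3⟩ := up V' D₀ hins₀
      obtain ⟨rfl, rfl⟩ := hrule.eq_of_row_ne (by omega)
      simp only at h2
      refine hv'.std.not_belowIn (u := d') (w := ⟨2 * r' + 2, (S₁.get r').len + 1, false⟩)
        (by rw [hT]; exact List.mem_append_left _ (mem_snoc _ _)) (by rw [hT]; exact mem_snoc _ _)
        (first_mem _) (first_mem _) ?_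
      simp only
      omega
    | @sing T'' U₂ S'' r' q' v' s' δ' hins' hr' heq' hv' hmid' hget' hs' hδ' hstep' =>
      obtain ⟨V', D₀, d', hins₀, rfl, hA, hrule⟩ := hins'.last_step hai
      obtain ⟨ρ, h1, h2, h3⟩ := up V' D₀ hins₀
      obtain ⟨rfl, rfl⟩ := hrule.eq_of_row_ne (by omega)
      simp only at h2
      have hρ : ρ = r' := by omega
      subst hρ
      obtain ⟨⟨i', u⟩, hu, e1, hfu⟩ := heq'.exists_right (mem_snoc V' (i, d'))
      simp only at e1 hfu
      subst e1
      -- if the signs are opposite, double row `q` is available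
      have opp : δ = -δ' → ¬ BelowIn T₂ i' j := by
        intro hop
        have hq'' : S''.get q = ⟨lq + 1, δ⟩ := by rw [hget', if_neg (by omega), haf.row]
        have hlen : q < S''.length := SignedTableau.lt_length (by rw [hq'']; simp)
        refine hstep'.not_below hu (q := q) (by omega)
          ⟨hlen, Or.inr ⟨q, by omega, hlen, rfl, ?_⟩⟩ (by rw [hfu]; exact hdfix.1)
          (Or.inr (Or.inl ?_))
        · rw [hq'', hop]
        · rw [hq'', hop]
      by_cases hlt : ρ < r
      · have hg'' : S''.get r = S₁.get r := by rw [hget', if_neg (by omega)]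
        have hlen : r < S''.length := SignedTableau.lt_length (by rw [hg'', hr1]; omega)
        rcases Nat.even_or_odd l with he | ho
        · refine hstep'.not_below hu (q := r) (by omega) ⟨hlen, Or.inl ?_⟩ (by rw [hfu]; omega)
            (Or.inl (by rw [hfu]; omega))
          rw [hg'', hr1, Nat.odd_iff]
          rw [Nat.even_iff] at he; omega
        · have hkr := keep' ho
          -- Double row r ends in s and double row q in -s, so one of the two ends in -δ' and can
          -- receive the second coordinate.
          by_cases hsd : s = -δ'
          · refine hstep'.not_below hu (q := r) (by omega)
              ⟨hlen, Or.inr ⟨r, by omega, hlen, rfl, by rw [hg'', hkr, hsd]⟩⟩ (by rw [hfu]; omega)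
              (Or.inl (by rw [hfu]; omega))
          · apply opp
            rw [hδ, if_neg (fun hh => Nat.not_odd_iff_even.2 hh.2 ho), units_eq_of_ne_neg hsd]
      · have hρr : ρ = r := by omega
        subst hρr
        apply opp
        rcases Nat.even_or_odd l with he | ho
        · have hle := Nat.even_iff.1 he
          have hnE : ¬ Even (S₁.get ρ).len := by rw [hr1, Nat.even_iff]; omega
          -- The length l+1 of double row r is odd, so the second growth there is vertical, with the
          -- same content as the first. This is the exceptional case: the first growth was vertical
          -- and double row r still ends in s, whence δ = s and δ' = -s.
          have hvt : v' = true := by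
            cases v'
            · exact absurd (hv' rfl) hnE
            · rfl
          subst hvt
          have hf0 : Domino.fixedSquare ⟨2 * ρ + 1, (S₁.get ρ).len + 1, true⟩ =
              (2 * ρ + 2, l + 2) := by
            rw [fixed_v_eq, hr1, Prod.mk.injEq]; omega
          rcases hins.growth_right hTV hins₀ hc with hg | ⟨hg, hvv, hk⟩
          · rw [hf0] at hg
            simp only at hg; omega
          · simp only at hvv
            subst hvv
            have hkr := keep he hk
            rw [hδ, hδ', hs' (by omega), hkr, if_pos ⟨rfl, he⟩, if_neg (by
              simp only [true_and]; rw [Nat.even_iff]; omega)]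
            simp
        · have hkr := keep' ho
          have hE : Even (l + 1) := ho.add_one
          rw [hδ, hδ', hs' (by omega), hkr, if_neg (fun hh => Nat.not_odd_iff_even.2 hh.2 ho)]
          cases v' <;> simp [hE]
  · intro hc
    obtain ⟨T'', D', hins'⟩ := hp.exists_ins
    obtain ⟨V', D₀, d', hins₀, -, hA, hrule⟩ := hins'.last_step hai
    by_cases hlow : 2 * (r + 1) + 1 ≤ D₀.row
    · refine hstep.pair_below hmid rfl hd hp hai fun V'' D₁ h1 => ?_
      rw [← (hins₀.det h1).2]
      exact hlow
    · obtain ⟨ρ, h1, h2, h3⟩ := hins₀.spec.2.2.1.of_upper_rows hVy hrows (by omega)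
      have hg := hins.growth_left hTV hins₀ hc
      have hb := fixed_bounds D₀
      have hanti := hV₁.anti (r := ρ) (r' := r) (by omega)
      have hρr : ρ = r := by
        by_contra hne
        rcases hg with hg | ⟨hg, _⟩
        · omega
        · rw [hg] at hb; simp only at hb; omega
      subst hρr
      obtain ⟨x, y, v₀⟩ := D₀
      simp only at h2 h3
      subst h2 h3
      -- Two growths in the same double row cannot have decreasing content. Only the exceptional
      -- case remains: a horizontal growth followed by a vertical one diagonally next to it.
      have hfin : v₀ = true ∧ v = false ∧ Even l ∧ S₁.get ρ = ⟨l + 1, s⟩ := by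
        cases v₀
        · exfalso
          rw [fixed_h_eq] at hg
          rcases hg with hg | ⟨hg, _⟩
          · simp only at hg; omega
          · rw [Prod.mk.injEq] at hg; omega
        · rcases Nat.even_or_odd l with he | ho
          · have hle := Nat.even_iff.1 he
            rw [fixed_v_eq] at hg
            rcases hg with hg | ⟨hg, hvf, hk⟩
            · simp only at hg; omega
            · exact ⟨rfl, hvf, he, keep he hk⟩
          · exfalso
            have hle := Nat.odd_iff.1 ho
            rw [fixed_v_eq] at hg
            rcases hg with hg | ⟨hg, _⟩
            · simp only at hg; omega
            · rw [Prod.mk.injEq] at hg; omega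
      obtain ⟨rfl, rfl, he, hkr⟩ := hfin
      have hle := Nat.even_iff.1 he
      have hnE : ¬ Even (l + 1) := by rw [Nat.even_iff]; omega
      clear hins' hrule
      cases hp with
      | @hor T'' r' hins' hr' hodd' hT hget' hv' =>
        exfalso
        obtain ⟨V'', D₁, d'', hins₁, -, hA', hrule'⟩ := hins'.last_step hai
        obtain ⟨-, rfl⟩ := hins₀.det hins₁
        have := (hrule'.eq_of_row_ne (by simp only; omega)).2
        simp at this
      | @sing T'' U₂ S'' r' q' v' s' δ' hins' hr' heq' hv' hmid' hget' hs' hδ' hstep' =>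
        obtain ⟨V'', D₁, d'', hins₁, rfl, hA', hrule'⟩ := hins'.last_step hai
        obtain ⟨-, rfl⟩ := hins₀.det hins₁
        obtain ⟨rfl, hD⟩ := hrule'.eq_of_row_ne (by simp only; omega)
        simp only [Domino.mk.injEq] at hD
        obtain ⟨hD1, -, rfl⟩ := hD
        have hrr : r' = ρ := by omega
        subst hrr
        obtain ⟨⟨i', u⟩, hu, e1, hfu⟩ := heq'.exists_right (mem_snoc V'' (i, d''))
        simp only at e1 hfu
        subst e1
        -- Both are -s: the first growth was horizontal, and the second is vertical in a double row
        -- of odd length ending in s.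
        have hδδ : δ' = δ := by
          rw [hδ, hδ', hs' (by omega), hkr]
          simp [hnE]
        subst hδδ
        refine hstep'.below_of_same hmid' hu (heq'.max_le (std_snoc_max heq'.std_left))
          (haf.restrict le_rfl (by omega) hmid'.pos hget') (by rw [hfu]; exact hdfix.2) ?_ ?_ hrq
        · intro he'
          rw [hfu]
          rcases hd with rfl | ⟨ho', rfl⟩
          · rw [Nat.even_iff] at he'
            exact fixed_v (by omega)
          · exact absurd ho' (Nat.not_odd_iff_even.2 he')
        · intro he'
          right
          rw [hget']
          split_ifs with hc'
          · have hlq1 := hmid.anti (r := r') (r' := q) (by omega)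
            rw [hS'r] at hlq1
            rw [Nat.even_iff] at he'
            simp only at hlq1 ⊢
            omega
          · exact haf.prev he' (by omega)

/-- The position of the larger coordinates of two successive pairs. -/
theorem PairStep.pair {T₀ T₁ T₂ : DominoTableau} {S₀ S₁ S₂ : SignedTableau} {a a' i j : ℕ}
    {ε ε' : ℤˣ} (hV₀ : Valid T₀ S₀) (h : PairStep T₀ S₀ a i ε T₁ S₁)
    (h' : PairStep T₁ S₁ a' j ε' T₂ S₂) (hai : a' < i) :
    ((a < a' ∧ ε' = 1) ∨ (a' < a ∧ ε = -1) → ¬ BelowIn T₂ i j) ∧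
    ((a < a' ∧ ε' = -1) ∨ (a' < a ∧ ε = 1) → BelowIn T₂ i j) := by
  cases h with
  | hor hins hr hodd hT hget hv =>
    subst hT
    exact pair_pair_hor hins hodd hget hv h' hai
  | sing hins hr heq hv hmid hget hs hδ hstep =>
    exact pair_pair_sing hV₀ hins heq hv hmid hget hδ hstep h' hai

end SOStar

namespace SOStar

/-! ### Consecutive largest coordinates, and operations that preserve relative positions -/

lemma SingleStep.fixed_row {T T₁ : DominoTableau} {S S₁ : SignedTableau} {i m q : ℕ} {δ : ℤˣ}
    (h : SingleStep T S i δ m T₁ S₁ q) (hV : Valid T S) : ∃ d, (i, d) ∈ T₁ ∧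
      (∀ p ∈ T₁, p.1 ≤ i) ∧ 2 * q + 1 ≤ d.fixedSquare.1 ∧ d.fixedSquare.1 ≤ 2 * q + 2 ∧
      (Even (S.get q).len → d.fixedSquare = (2 * q + 1, (S.get q).len + 1)) := by
  obtain ⟨V, d, rfl, -, hd⟩ := h.decomp hV
  refine ⟨d, mem_snoc _ _, std_snoc_max h.valid.std, ?_⟩
  rcases hd with rfl | ⟨ho, rfl⟩
  · rw [fixed_v_eq]
    refine ⟨by simp only; omega, by simp only; omega, fun he => ?_⟩
    rw [Nat.even_iff] at he
    rw [Prod.mk.injEq]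
    exact ⟨by omega, rfl⟩
  · rw [fixed_h_eq]
    refine ⟨by simp only; omega, by simp only; omega, fun he => ?_⟩
    exact absurd he (Nat.not_even_iff_odd.2 ho)

/-- Two singletons of the same sign. -/
lemma SingleStep.single_below {T₀ T₁ T₂ : DominoTableau} {S₀ S₁ S₂ : SignedTableau}
    {i j q q' : ℕ} {δ : ℤˣ} (hV₀ : Valid T₀ S₀) (h : SingleStep T₀ S₀ i δ 0 T₁ S₁ q)
    (h' : SingleStep T₁ S₁ j δ 0 T₂ S₂ q') : BelowIn T₂ i j := by
  obtain ⟨d, hd, hmax, -, hf, hf'⟩ := h.fixed_row hV₀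
  have haf := h.after hV₀
  refine h'.below_of_same h.valid hd hmax haf hf hf' (fun he => ?_) (Nat.zero_le _)
  rcases Nat.eq_zero_or_pos q with h0 | h0
  · exact Or.inl h0
  · exact Or.inr (haf.prev he h0)

/-- Two singletons of opposite sign. -/
lemma SingleStep.single_not_below {T₀ T₁ T₂ : DominoTableau} {S₀ S₁ S₂ : SignedTableau}
    {i j q q' m m' : ℕ} {δ : ℤˣ} (hV₀ : Valid T₀ S₀) (h : SingleStep T₀ S₀ i δ m T₁ S₁ q)
    (h' : SingleStep T₁ S₁ j (-δ) m' T₂ S₂ q') (hm : m' ≤ q) : ¬ BelowIn T₂ i j := by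
  obtain ⟨d, hd, hmax, hf, -, -⟩ := h.fixed_row hV₀
  have hlast : (S₁.get q).last = - -δ := by rw [h.get_row, neg_neg]
  have hq : q < S₁.length := SignedTableau.lt_length (by rw [h.get_row]; simp only; omega)
  exact h'.not_below hd hm ⟨hq, Or.inr ⟨q, hm, hq, rfl, hlast⟩⟩ hf (Or.inr (Or.inl hlast))

/-- A pair followed by a singleton. -/
lemma PairStep.single_not_below {T₀ T₁ T₂ : DominoTableau} {S₀ S₁ S₂ : SignedTableau}
    {a i j q' : ℕ} {ε δ' : ℤˣ} (h : PairStep T₀ S₀ a i ε T₁ S₁)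
    (h' : SingleStep T₁ S₁ j δ' 0 T₂ S₂ q') : ¬ BelowIn T₂ i j := by
  cases h with
  | @hor T' r hins hr hodd hT hget hv =>
    have hr1 : S₁.get r = ⟨(S₀.get r).len + 2, (S₀.get r).last⟩ := by rw [hget, if_pos rfl]
    have hq : r < S₁.length := SignedTableau.lt_length (by rw [hr1]; simp only; omega)
    have hf : (Domino.fixedSquare ⟨2 * r + 2, (S₀.get r).len + 1, false⟩).1 = 2 * r + 2 := by
      rw [fixed_h_eq]
    refine h'.not_below (q := r) (by rw [hT]; exact mem_snoc _ _) (Nat.zero_le _)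
      ⟨hq, Or.inl ?_⟩ (by omega) (Or.inl (by omega))
    rw [hr1]
    rw [Nat.odd_iff] at hodd ⊢
    simp only; omega
  | @sing T' U S' r q v s δ hins hr heq hv hmid hget hs hδ hstep =>
    have hr1 : S'.get r = ⟨(S₀.get r).len + 1, s⟩ := by rw [hget, if_pos rfl]
    have hrq := hstep.le
    have hlen : (S₁.get r).len = (S₀.get r).len + 1 := by
      rw [hstep.len_eq r (by omega), hr1]
    have hq : r < S₁.length := SignedTableau.lt_length (by omega)
    obtain ⟨d, hd, hmax, hf, -, -⟩ := hstep.fixed_row hmid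
    -- Double row r lies above `i` and now has length one more. If this is odd, it accepts every
    -- sign. If it is even, it ends in s and the double row of `i` in -s, so one of them accepts δ'.
    rcases Nat.even_or_odd (S₀.get r).len with he | ho
    · refine h'.not_below (q := r) hd (Nat.zero_le _) ⟨hq, Or.inl ?_⟩ (by omega)
        (Or.inl (by omega))
      rw [hlen]; exact he.add_one
    · have hr2 : S₁.get r = ⟨(S₀.get r).len + 1, s⟩ := by
        rw [hstep.even_eq r (by omega) (by rw [hr1]; exact ho.add_one), hr1]
      have hδs : δ = -s := by
        rw [hδ, if_neg]
        rintro ⟨-, he⟩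
        exact Nat.not_even_iff_odd.2 ho he
      by_cases hs' : s = -δ'
      · exact h'.not_below (q := r) hd (Nat.zero_le _)
          ⟨hq, Or.inr ⟨r, Nat.zero_le _, hq, rfl, by rw [hr2]; exact hs'⟩⟩ (by omega)
          (Or.inl (by omega))
      · have hsδ := units_eq_of_ne_neg hs'
        have e : δ' = -δ := by rw [hδs, hsδ, neg_neg]
        subst e
        exact SingleStep.single_not_below hmid hstep h' (Nat.zero_le _)

/-- A singleton followed by a pair. -/
lemma SingleStep.pair_below_zero {T₀ T₁ T₂ : DominoTableau} {S₀ S₁ S₂ : SignedTableau}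
    {i j a q : ℕ} {δ ε : ℤˣ} (hV₀ : Valid T₀ S₀) (h : SingleStep T₀ S₀ i δ 0 T₁ S₁ q)
    (hp : PairStep T₁ S₁ a j ε T₂ S₂) (hai : a < i) : BelowIn T₂ i j := by
  obtain ⟨V, d, hT, -, hd⟩ := h.decomp hV₀
  refine h.pair_below hV₀ hT hd hp hai fun V' D₀ hins => ?_
  have := (hins.spec.2.2.1.corner hins.spec.1.young).1
  omega

lemma Ins.eq_snoc {a : ℕ} {ε : ℤˣ} {T T' : DominoTableau} {D : Domino} (h : Ins a ε T T' D)
    (hlt : ∀ p ∈ T, p.1 < a) : T' = T ++ [(a, D)] := by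
  cases h with
  | row => rfl
  | col => rfl
  | @step T T' D E E' D' k h hk hE hr =>
    have h1 := hlt (k, E) (mem_snoc _ _)
    obtain ⟨d, hd⟩ := (h.spec.2.2.2.2 a).2 (Or.inl rfl)
    have h2 := hk _ hd
    simp only at h1 h2; omega

/-- The two elements of a pair of consecutive numbers. -/
lemma PairStep.below_self {T₀ T₁ : DominoTableau} {S₀ S₁ : SignedTableau} {a : ℕ} {ε : ℤˣ}
    (h : PairStep T₀ S₀ a (a + 1) ε T₁ S₁) (hlt : ∀ p ∈ T₀, p.1 < a) :
    BelowIn T₁ a (a + 1) := by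
  cases h with
  | @hor T' r hins hr hodd hT hget hv =>
    rw [hT, hins.eq_snoc hlt]
    exact ⟨_, _, List.mem_append_left _ (mem_snoc _ _), mem_snoc _ _, below_iff.2 (by simp)⟩
  | @sing T' U S' r q v s δ hins hr heq hv hmid hget hs hδ hstep =>
    have hT' := hins.eq_snoc hlt
    have hma : (a, (⟨2 * r + 1, (S₀.get r).len + 1, v⟩ : Domino)) ∈ T' := hT' ▸ mem_snoc _ _
    obtain ⟨⟨k, u⟩, hu, e1, e2⟩ := heq.exists_right hma
    simp only at e1 e2
    subst e1
    refine hstep.below_of_fixed hmid hu (M := r + 1) (fun p hp => ?_) ?_ hstep.le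
    · exact Nat.lt_succ_iff.1 (heq.label_lt (hins.label_lt (Nat.lt_succ_self k)
        fun p hp => (hlt p hp).trans (Nat.lt_succ_self k)) p hp)
    · rw [e2]
      cases v
      · rw [fixed_h_eq]; simp only; omega
      · rw [fixed_v_eq]; simp only; omega

/-- `T'` is obtained from `T` by moving through cycles, by insertions and by adding dominos with
larger labels. -/
inductive Grows (T : DominoTableau) : DominoTableau → Prop
  | refl : Grows T T
  | equiv {U V : DominoTableau} : Grows T U → TabEquiv U V → Grows T V
  | ins {U V : DominoTableau} {a : ℕ} {ε : ℤˣ} {D : Domino} : Grows T U → (∀ d, (a, d) ∉ U) →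
      Ins a ε U V D → Grows T V
  | snoc {U : DominoTableau} {k : ℕ} {d : Domino} : Grows T U → Std (U ++ [(k, d)]) →
      Grows T (U ++ [(k, d)])

lemma Grows.trans {T U V : DominoTableau} (h : Grows T U) (h' : Grows U V) : Grows T V := by
  induction h' with
  | refl => exact h
  | equiv _ h1 ih => exact .equiv ih h1
  | ins _ h1 h2 ih => exact .ins ih h1 h2
  | snoc _ h1 ih => exact .snoc ih h1

lemma Grows.belowIn {T U : DominoTableau} (h : Grows T U) {k : ℕ} (hb : BelowIn T k (k + 1)) :
    BelowIn U k (k + 1) := by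
  induction h with
  | refl => exact hb
  | equiv _ h1 ih => exact h1.belowIn ih
  | ins _ _ h1 ih => exact h1.belowIn ih
  | snoc _ _ ih => exact ih.append _

lemma Grows.rightIn {T U : DominoTableau} (h : Grows T U) {k : ℕ} (hb : RightIn T k (k + 1)) :
    RightIn U k (k + 1) := by
  induction h with
  | refl => exact hb
  | equiv _ h1 ih => exact h1.rightIn ih
  | ins _ _ h1 ih => exact h1.rightIn ih
  | snoc _ _ ih => exact ih.append _

lemma SingleStep.grows {T T₁ : DominoTableau} {S S₁ : SignedTableau} {i m q : ℕ} {δ : ℤˣ}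
    (h : SingleStep T S i δ m T₁ S₁ q) (hV : Valid T S) : Grows T T₁ := by
  obtain ⟨V, d, rfl, heq, -⟩ := h.decomp hV
  exact .snoc (.equiv .refl heq) h.valid.std

lemma SingleStep.labels {T T₁ : DominoTableau} {S S₁ : SignedTableau} {i m q : ℕ} {δ : ℤˣ}
    (h : SingleStep T S i δ m T₁ S₁ q) (hV : Valid T S) (k : ℕ) :
    (∃ d, (k, d) ∈ T₁) ↔ k = i ∨ ∃ d, (k, d) ∈ T := by
  obtain ⟨V, d, rfl, heq, -⟩ := h.decomp hV
  constructor
  · rintro ⟨u, hu⟩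
    rw [List.mem_append, List.mem_singleton] at hu
    rcases hu with hu | hu
    · obtain ⟨⟨k', u'⟩, h1, e, -⟩ := heq.exists_left hu
      simp only at e; subst e
      exact Or.inr ⟨_, h1⟩
    · exact Or.inl (Prod.mk.inj hu).1
  · rintro (rfl | ⟨u, hu⟩)
    · exact ⟨_, mem_snoc _ _⟩
    · obtain ⟨⟨k', u'⟩, h1, e, -⟩ := heq.exists_right hu
      simp only at e; subst e
      exact ⟨_, List.mem_append_left _ h1⟩

lemma TabEquiv.labels {T U : DominoTableau} (h : TabEquiv T U) (k : ℕ) :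
    (∃ d, (k, d) ∈ U) ↔ ∃ d, (k, d) ∈ T := by
  constructor
  · rintro ⟨u, hu⟩
    obtain ⟨⟨k', u'⟩, h1, e, -⟩ := h.exists_left hu
    simp only at e; subst e
    exact ⟨_, h1⟩
  · rintro ⟨u, hu⟩
    obtain ⟨⟨k', u'⟩, h1, e, -⟩ := h.exists_right hu
    simp only at e; subst e
    exact ⟨_, h1⟩

lemma PairStep.exists_grows {T T₁ : DominoTableau} {S S₁ : SignedTableau} {a j : ℕ} {ε : ℤˣ}
    (h : PairStep T S a j ε T₁ S₁) : ∃ T' D, Ins a ε T T' D ∧ Grows T' T₁ := by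
  cases h with
  | hor hins hr hodd hT hget hv =>
    subst hT
    exact ⟨_, _, hins, .snoc .refl hv.std⟩
  | sing hins hr heq hv hmid hget hs hδ hstep =>
    exact ⟨_, _, hins, (Grows.equiv .refl heq).trans (hstep.grows hmid)⟩

lemma PairStep.labels {T T₁ : DominoTableau} {S S₁ : SignedTableau} {a j : ℕ} {ε : ℤˣ}
    (h : PairStep T S a j ε T₁ S₁) (k : ℕ) :
    (∃ d, (k, d) ∈ T₁) ↔ k = a ∨ k = j ∨ ∃ d, (k, d) ∈ T := by
  cases h with
  | hor hins hr hodd hT hget hv =>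
    rw [or_left_comm, ← hins.spec.2.2.2.2 k, hT]
    simp only [List.mem_append, List.mem_singleton, Prod.mk.injEq]
    constructor
    · rintro ⟨d, hd | hd⟩
      · exact Or.inr ⟨d, hd⟩
      · exact Or.inl hd.1
    · rintro (rfl | ⟨d, hd⟩)
      · exact ⟨_, Or.inr ⟨rfl, rfl⟩⟩
      · exact ⟨d, Or.inl hd⟩
  | sing hins hr heq hv hmid hget hs hδ hstep =>
    rw [hstep.labels hmid, heq.labels, hins.spec.2.2.2.2, or_left_comm]

end SOStar

namespace SOStar

/-! ### The root e₂ + e₁ and the dominos labelled 1 and 2 -/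

/-- The domino labelled `2` is vertical and lies in one of the first two columns. -/
def PlusIn (T : DominoTableau) : Prop :=
  ∃ d, (2, d) ∈ T ∧ d.vertical = true ∧ (d.col = 1 ∨ d.col = 2)

lemma Std.plusIn_iff {T : DominoTableau} (h : Std T) {d : Domino} (hd : (2, d) ∈ T) :
    PlusIn T ↔ d.vertical = true ∧ (d.col = 1 ∨ d.col = 2) := by
  constructor
  · rintro ⟨d', h1, h2⟩
    have e := h.eq_of_label hd h1 rfl
    rw [Prod.mk.injEq] at e
    rw [e.2]; exact h2
  · intro hh
    exact ⟨d, hd, hh⟩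

/-- The possible positions of the dominos labelled `1` and `2`. -/
lemma Std.first_two {T : DominoTableau} (h : Std T) {d₁ d₂ : Domino} (h1 : (1, d₁) ∈ T)
    (h2 : (2, d₂) ∈ T) :
    (d₂.fixedSquare = (3, 1) ∧ d₂.vertical = true ∧ d₂.col = 1) ∨
    (d₂.fixedSquare = (1, 3) ∧ d₂.vertical = false) ∨
    (VBlock T 1 2 1 1 ∧ d₂ = ⟨1, 2, true⟩) ∨ (HBlock T 1 2 1 1 ∧ d₂ = ⟨2, 1, false⟩) := by
  -- a square next to the label `k` belongs to a smaller label
  have small : ∀ {k : ℕ} {d : Domino}, (k, d) ∈ T → ∀ {x y x' y' : ℕ}, (x, y) ∈ d.squares →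
      (x', y') ∉ d.squares → 1 ≤ x' → 1 ≤ y' → x' ≤ x → y' ≤ y →
      ∃ p ∈ T, p.1 < k ∧ (x', y') ∈ p.2.squares := by
    intro k d hd x y x' y' hs hn hx hy hxx hyy
    obtain ⟨p, hp, hle, hs'⟩ := h.mono hd hs hx hy hxx hyy
    refine ⟨p, hp, lt_of_le_of_ne hle fun e => hn ?_, hs'⟩
    have := h.eq_of_label hp hd e
    subst this
    exact hs'
  -- No label is smaller than 1, so domino 1 contains everything above and to the left of its
  -- squares; likewise for 2 together with 1.
  have hin1 : ∀ {x y x' y' : ℕ}, (x, y) ∈ d₁.squares → 1 ≤ x' → 1 ≤ y' → x' ≤ x → y' ≤ y →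
      (x', y') ∈ d₁.squares := by
    intro x y x' y' hs hx hy hxx hyy
    by_contra hn
    obtain ⟨p, hp, hlt, -⟩ := small h1 hs hn hx hy hxx hyy
    have := h.pos hp
    omega
  have hin2 : ∀ {x y x' y' : ℕ}, (x, y) ∈ d₂.squares → 1 ≤ x' → 1 ≤ y' → x' ≤ x → y' ≤ y →
      (x', y') ∈ d₂.squares ∨ (x', y') ∈ d₁.squares := by
    intro x y x' y' hs hx hy hxx hyy
    by_contra hn
    rw [not_or] at hn
    obtain ⟨p, hp, hlt, hs'⟩ := small h2 hs hn.1 hx hy hxx hyy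
    have := h.pos hp
    have e := h.eq_of_label hp h1 (by simp only; omega)
    subst e
    exact hn.2 hs'
  have hdis : ∀ {x y : ℕ}, (x, y) ∈ d₁.squares → (x, y) ∉ d₂.squares := by
    intro x y ha hb
    have := h.eq_of_square h1 h2 ha hb
    simp at this
  have notlt : ∀ {x y : ℕ}, 1 ≤ x → 1 ≤ y → (x, y) ∉ d₁.squares → ¬ LabelLT T (x, y) 2 := by
    rintro x y hx hy hn (h0 | h0 | ⟨p, hp, hs, hlt⟩)
    · simp only at h0; omega
    · simp only at h0; omega
    · have := h.pos hp
      have e := h.eq_of_label hp h1 (by simp only; omega)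
      subst e
      exact hn hs
  obtain ⟨r₁, c₁, v₁⟩ := d₁
  obtain ⟨r₂, c₂, v₂⟩ := d₂
  have p1 := h.coord_pos h1 (first_mem _)
  have p2 := h.coord_pos h2 (first_mem _)
  simp only at p1 p2
  have f1 := hin1 (first_mem _) le_rfl le_rfl p1.1 p1.2
  have f2 := hin2 (first_mem _) le_rfl p2.2 p2.1 le_rfl
  have f3 := hin2 (first_mem _) p2.1 le_rfl le_rfl p2.2
  have g := hdis f1
  cases v₁ <;> cases v₂ <;>
    simp only [mem_hdomino, mem_vdomino, fixed_h_eq, fixed_v_eq] at f1 f2 f3 g hin2 hdis ⊢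
  · obtain ⟨rfl, rfl⟩ : r₁ = 1 ∧ c₁ = 1 := by omega
    by_cases hr : r₂ = 1
    · right; left
      subst hr
      have h1' := @hin2 1 c₂ 1 (c₂ - 1) (by simp) le_rfl (by omega) le_rfl (by omega)
      have h2' := @hdis 1 2 (by simp)
      have : c₂ = 3 := by omega
      subst this
      simp
    · right; right; right
      have h1' := @hin2 r₂ c₂ (r₂ - 1) c₂ (by simp) (by omega) p2.2 (by omega) le_rfl
      obtain ⟨rfl, rfl⟩ : r₂ = 2 ∧ c₂ = 1 := by
        have := @hin2 r₂ c₂ r₂ 1 (by simp) (by omega) le_rfl le_rfl (by omega)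
        have := @hin2 r₂ (c₂+1) (r₂-1) (c₂+1) (by simp) (by omega) (by omega) (by omega) (by omega)
        omega
      exact ⟨⟨rfl, h1, h2, Or.inr (Or.inl rfl), notlt (by simp) (by simp) (by simp [mem_hdomino])⟩, rfl⟩
  · obtain ⟨rfl, rfl⟩ : r₁ = 1 ∧ c₁ = 1 := by omega
    left
    have := @hin2 (r₂+1) c₂ (r₂+1) 1 (by simp) (by omega) le_rfl le_rfl (by omega)
    have h1' : 2 ≤ r₂ := by
      have := @hdis 1 2 (by simp)
      omega
    have h2' := @hin2 r₂ c₂ (r₂ - 1) c₂ (by simp) (by omega) p2.2 (by omega) le_rfl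
    obtain ⟨rfl, rfl⟩ : r₂ = 2 ∧ c₂ = 1 := by omega
    simp
  · obtain ⟨rfl, rfl⟩ : r₁ = 1 ∧ c₁ = 1 := by omega
    right; left
    have := @hin2 r₂ (c₂+1) 1 (c₂+1) (by simp) (by omega) (by omega) (by omega) le_rfl
    have h1' : 2 ≤ c₂ := by
      have := @hdis 2 1 (by simp)
      omega
    have h2' := @hin2 r₂ c₂ r₂ (c₂ - 1) (by simp) p2.1 (by omega) le_rfl (by omega)
    obtain ⟨rfl, rfl⟩ : r₂ = 1 ∧ c₂ = 2 := by omega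
    simp
  · obtain ⟨rfl, rfl⟩ : r₁ = 1 ∧ c₁ = 1 := by omega
    by_cases hr : c₂ = 1
    · left
      subst hr
      have h1' := @hin2 r₂ 1 (r₂ - 1) 1 (by simp) (by omega) le_rfl (by omega) le_rfl
      have h2' := @hdis 2 1 (by simp)
      have : r₂ = 3 := by omega
      subst this
      simp
    · right; right; left
      have h1' := @hin2 r₂ c₂ r₂ (c₂ - 1) (by simp) p2.1 (by omega) le_rfl (by omega)
      obtain ⟨rfl, rfl⟩ : r₂ = 1 ∧ c₂ = 2 := by
        have := @hin2 (r₂+1) c₂ (r₂+1) (c₂-1) (by simp) (by omega) (by omega) (by omega) (by omega)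
        have := @hin2 r₂ c₂ 1 c₂ (by simp) le_rfl (by omega) (by omega) le_rfl
        omega
      exact ⟨⟨rfl, h1, h2, Or.inl rfl, notlt (by simp) (by simp) (by simp [mem_vdomino])⟩, rfl⟩

/-- The fixed square of domino 2 decides unless it is (2, 2); then 1 and 2 form a closed cycle,
which is kept. -/
lemma TabEquiv.plusIn {T U : DominoTableau} (h : TabEquiv T U) {d₁ d₂ : Domino}
    (h1 : (1, d₁) ∈ T) (h2 : (2, d₂) ∈ T) : PlusIn U ↔ PlusIn T := by
  obtain ⟨⟨k, u₁⟩, hu₁, e, -⟩ := h.exists_right h1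
  simp only at e; subst e
  obtain ⟨⟨k, u₂⟩, hu₂, e, hf⟩ := h.exists_right h2
  simp only at e hf; subst e
  rw [h.std_left.plusIn_iff h2, h.std_right.plusIn_iff hu₂]
  rcases h.std_left.first_two h1 h2 with ⟨a1, a2, a3⟩ | ⟨a1, a2⟩ | ⟨hb, rfl⟩ | ⟨hb, rfl⟩
  · rcases h.std_right.first_two hu₁ hu₂ with ⟨b1, b2, b3⟩ | ⟨b1, b2⟩ | ⟨hb, rfl⟩ | ⟨hb, rfl⟩
    · simp [a2, a3, b2, b3]
    · rw [hf, a1] at b1; simp at b1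
    · rw [a1, fixed_v_eq] at hf; simp at hf
    · rw [a1, fixed_h_eq] at hf; simp at hf
  · rcases h.std_right.first_two hu₁ hu₂ with ⟨b1, b2, b3⟩ | ⟨b1, b2⟩ | ⟨hb, rfl⟩ | ⟨hb, rfl⟩
    · rw [hf, a1] at b1; simp at b1
    · simp [a2, b2]
    · rw [a1, fixed_v_eq] at hf; simp at hf
    · rw [a1, fixed_h_eq] at hf; simp at hf
  · have e := h.std_right.eq_of_label hu₂ (h.vblock _ _ _ _ hb).2 rfl
    rw [Prod.mk.injEq] at e
    rw [e.2]
  · have e := h.std_right.eq_of_label hu₂ (h.hblock _ _ _ _ hb).2 rfl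
    rw [Prod.mk.injEq] at e
    rw [e.2]

lemma Ins.mem_of_lt {a : ℕ} {ε : ℤˣ} {T T' : DominoTableau} {D : Domino} (h : Ins a ε T T' D)
    {p : ℕ × Domino} (hp : p ∈ T) (hlt : p.1 < a) : p ∈ T' := by
  induction h with
  | row => exact List.mem_append_left _ hp
  | col => exact List.mem_append_left _ hp
  | @step T T' D E E' D' k h hk hE hr ih =>
    rw [List.mem_append, List.mem_singleton] at hp
    rcases hp with hp | rfl
    · exact List.mem_append_left _ (ih hp)
    · obtain ⟨d, hd⟩ := (h.spec.2.2.2.2 a).2 (Or.inl rfl)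
      have := hk _ hd
      simp only at this hlt; omega

lemma Grows.label {T U : DominoTableau} (h : Grows T U) {k : ℕ} (hk : ∃ d, (k, d) ∈ T) :
    ∃ d, (k, d) ∈ U := by
  induction h with
  | refl => exact hk
  | equiv _ h1 ih => exact (h1.labels k).2 ih
  | ins _ _ h1 ih => exact (h1.spec.2.2.2.2 k).2 (Or.inr ih)
  | snoc _ _ ih => obtain ⟨d, hd⟩ := ih; exact ⟨d, List.mem_append_left _ hd⟩

/-- A label inserted later differs from 1 and 2, so it is larger, and insertion does not move
smaller labels. -/
lemma Grows.plusIn {T U : DominoTableau} (h : Grows T U) (h1 : ∃ d, (1, d) ∈ T)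
    (h2 : ∃ d, (2, d) ∈ T) : PlusIn U ↔ PlusIn T := by
  induction h with
  | refl => rfl
  | equiv hg h3 ih =>
    obtain ⟨d₁, g1⟩ := hg.label h1
    obtain ⟨d₂, g2⟩ := hg.label h2
    rw [h3.plusIn g1 g2, ih]
  | @ins U V a ε D hg ha h3 ih =>
    obtain ⟨d₁, g1⟩ := hg.label h1
    obtain ⟨d₂, g2⟩ := hg.label h2
    have hlt : 2 < a := by
      have p := h3.spec.2.1.pos ((h3.spec.2.2.2.2 a).2 (Or.inl rfl)).choose_spec
      simp only at p
      have n1 : a ≠ 1 := fun e => ha d₁ (e ▸ g1)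
      have n2 : a ≠ 2 := fun e => ha d₂ (e ▸ g2)
      omega
    rw [← ih, h3.spec.1.plusIn_iff g2, h3.spec.2.1.plusIn_iff (h3.mem_of_lt g2 hlt)]
  | @snoc U k d hg h3 ih =>
    obtain ⟨d₂, g2⟩ := hg.label h2
    rw [← ih, h3.left.plusIn_iff g2, h3.plusIn_iff (List.mem_append_left _ g2)]

/-- Inserting `2` after `1`. -/
lemma Ins.plusIn_two {ε : ℤˣ} {T T' : DominoTableau} {D : Domino} (h : Ins 2 ε T T' D) :
    PlusIn T' ↔ ε = -1 := by
  induction h with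
  | @row A c hA hi hlt hε hc h1 h2 =>
    have hs := (Ins.row hA hi hlt hε hc h1 h2).spec.2.1
    rw [hs.plusIn_iff (mem_snoc _ _), hε]
    simp
  | @col A r hA hi hlt hε hc h1 h2 =>
    have hs := (Ins.col hA hi hlt hε hc h1 h2).spec.2.1
    rw [hs.plusIn_iff (mem_snoc _ _), hε]
    simp
  | @step T T' D E E' D' k h hk hE hr ih =>
    obtain ⟨d, hd⟩ := (h.spec.2.2.2.2 2).2 (Or.inl rfl)
    have hs := (Ins.step h hk hE hr).spec.2.1
    rw [← ih, hs.plusIn_iff (List.mem_append_left _ hd), h.spec.2.1.plusIn_iff hd]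

/-- Inserting `1` after `2`. -/
lemma Ins.plusIn_one {ε : ℤˣ} {T T' : DominoTableau} {D : Domino} (h : Ins 1 ε T T' D)
    (h1 : ∀ d, (1, d) ∉ T) (h2 : ∃ d, (2, d) ∈ T) : PlusIn T' ↔ ε = -1 := by
  induction h with
  | @row A c hA hi hlt hε hc h1 h2' =>
    obtain ⟨d, hd⟩ := h2
    have := hlt _ hd
    simp only at this; omega
  | @col A r hA hi hlt hε hc h1 h2' =>
    obtain ⟨d, hd⟩ := h2
    have := hlt _ hd
    simp only at this; omega
  | @step T T' D E E' D' k h hk hE hr ih =>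
    have hs := (Ins.step h hk hE hr).spec.2.1
    by_cases hk2 : k = 2
    · subst hk2
      -- The label 2 is put back right after 1 and nothing precedes it, so it occupied the corner
      -- (1, 1) in one direction or the other and is displaced by 1.
      have hT : T = [] := by
        rw [List.eq_nil_iff_forall_not_mem]
        rintro ⟨l, d⟩ hp
        have a1 := h.spec.1.pos hp
        obtain ⟨d', hd'⟩ := (h.spec.2.2.2.2 l).2 (Or.inr ⟨d, hp⟩)
        have a2 := hk _ hd'
        simp only at a1 a2
        have : l = 1 := by omega
        subst this
        exact h1 d (List.mem_append_left _ hp)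
      subst hT
      have cE := hE.corner (by exact Std.nil.young)
      simp only [shape_nil, Finset.notMem_empty, not_false_eq_true, true_and, or_false] at cE
      rw [hs.plusIn_iff (mem_snoc _ _)]
      generalize hN : ([] : DominoTableau) = N at h
      cases h with
      | @row A c hA hi hlt hε hc g1 g2 =>
        subst hN
        simp only [shape_nil, Finset.notMem_empty, or_false] at g2
        subst g2 hε
        have : E'.vertical = false := by
          generalize hD : (⟨1, 1, false⟩ : Domino) = D at hr
          cases hr with
          | disj hd =>
            subst hD
            exfalso
            refine Finset.disjoint_left.1 hd (first_mem E) ?_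
            rw [cE.2.2.1, cE.2.2.2, mem_hdomino]; simp
          | row => rfl
          | col => simp at hD
          | horVert => simp at hD
          | vertHor => rfl
        rw [this]; simp
      | @col A r hA hi hlt hε hc g1 g2 =>
        subst hN
        simp only [shape_nil, Finset.notMem_empty, or_false] at g2
        subst g2 hε
        have : E'.vertical = true ∧ E'.col = 2 := by
          generalize hD : (⟨1, 1, true⟩ : Domino) = D at hr
          cases hr with
          | disj hd =>
            subst hD
            exfalso
            refine Finset.disjoint_left.1 hd (first_mem E) ?_
            rw [cE.2.2.1, cE.2.2.2, mem_vdomino]; simp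
          | row => simp at hD
          | col => simp only [Domino.mk.injEq] at hD; exact ⟨rfl, by simp only; omega⟩
          | horVert => simp only [Domino.mk.injEq] at hD; exact ⟨rfl, by simp only; omega⟩
          | vertHor => simp at hD
        rw [this.1, this.2]; simp
      | step h => simp at hN
    · obtain ⟨d, hd⟩ := h2
      have hd' : (2, d) ∈ T := by
        rw [List.mem_append, List.mem_singleton, Prod.mk.injEq] at hd
        rcases hd with hd | hd
        · exact hd
        · exact absurd hd.1.symm hk2
      obtain ⟨u, hu⟩ := (h.spec.2.2.2.2 2).2 (Or.inr ⟨d, hd'⟩)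
      rw [← ih (fun d hd => h1 d (List.mem_append_left _ hd)) ⟨d, hd'⟩,
        hs.plusIn_iff (List.mem_append_left _ hu), h.spec.2.1.plusIn_iff hu]

/-- The pair of `1` and `2`. -/
lemma PairStep.plusIn {T₁ : DominoTableau} {S₁ : SignedTableau} {ε : ℤˣ}
    (h : PairStep [] [] 1 2 ε T₁ S₁) : PlusIn T₁ := by
  have hl := h.labels
  obtain ⟨d₁, h1⟩ := (hl 1).2 (Or.inl rfl)
  have hv := h.valid
  have hlen : ∀ r, (SignedTableau.get [] r).len = 0 := fun r => by
    rw [SignedTableau.get_of_le (Nat.zero_le _)]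
  cases h with
  | hor hins hr hodd hT hget hv => rw [hlen] at hodd; simp at hodd
  | @sing T' U S' r q v s δ hins hr heq hv' hmid hget hs hδ hstep =>
    -- The label 2 is put below double row r, so in row 3 or lower; of the four positions only the
    -- vertical one in column 1 remains.
    obtain ⟨w, hw, hrow⟩ := hstep.mem
    have := hstep.le
    rw [hv.std.plusIn_iff hw]
    have hf := fixed_row_le (first_mem w)
    simp only at hf
    rcases hv.std.first_two h1 hw with ⟨a1, a2, a3⟩ | ⟨a1, a2⟩ | ⟨hb, rfl⟩ | ⟨hb, rfl⟩
    · exact ⟨a2, Or.inl a3⟩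
    · rw [a1] at hf; simp only at hf; omega
    · simp only at hrow; omega
    · simp only at hrow; omega

/-- The singletons `1` and `2`. -/
lemma SingleStep.plusIn {T₁ T₂ : DominoTableau} {S₁ S₂ : SignedTableau} {q q' : ℕ} {δ δ' : ℤˣ}
    (h : SingleStep [] [] 1 δ 0 T₁ S₁ q) (h' : SingleStep T₁ S₁ 2 δ' 0 T₂ S₂ q') :
    PlusIn T₂ ↔ δ' = -δ := by
  have hq : q = 0 := by have := h.le_length; simpa using this
  subst hq
  have hr := h.get_row
  rw [SignedTableau.get_of_le (S := []) (Nat.zero_le _)] at hr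
  have h0 : 0 < S₁.length := SignedTableau.lt_length (by rw [hr])
  have hq' : q' = 0 := by
    by_contra hne
    exact h'.not_avail 0 le_rfl (by omega) ⟨h0, Or.inl (by rw [hr]; exact odd_one)⟩
  subst hq'
  obtain ⟨V, d, hT, -, hd⟩ := h'.decomp h.valid
  rw [hr] at hd
  obtain ⟨u, hu⟩ := (h'.labels h.valid 1).2 (Or.inr ((h.labels valid_nil 1).2 (Or.inl rfl)))
  have hw : (2, d) ∈ T₂ := hT ▸ mem_snoc _ _
  rw [h'.valid.std.plusIn_iff hw]
  have key : BelowIn T₂ 1 2 ↔ δ' ≠ -δ := by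
    constructor
    · rintro hb rfl
      exact h.single_not_below valid_nil h' le_rfl hb
    · intro hne
      have e := units_eq_of_ne_neg hne
      subst e
      exact h.single_below valid_nil h'
  -- Since 2 goes into double row 0, only the two 2×2 blocks are possible, and there `PlusIn` is the
  -- negation of lying below.
  rw [← not_iff_not, ← ne_eq, ← key]
  have hs := h'.valid.std
  rcases hs.first_two hu hw with ⟨a1, a2, a3⟩ | ⟨a1, a2⟩ | ⟨hb, rfl⟩ | ⟨hb, rfl⟩
  · rcases hd with rfl | ⟨-, rfl⟩
    · simp at a3
    · simp at a2
  · rcases hd with rfl | ⟨-, rfl⟩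
    · simp at a2
    · rw [fixed_h_eq] at a1; simp at a1
  · simp only [or_true, and_self, not_true, false_iff]
    exact hs.not_belowIn hb.2.1 hb.2.2.1 (first_mem _) (first_mem _) le_rfl
  · simp only [Bool.false_eq_true, false_and, not_false_eq_true, true_iff]
    exact ⟨_, _, hb.2.1, hb.2.2.1, below_hblock 1 1⟩

end SOStar

namespace SOStar

/-! ### Running the algorithm along the parts of a clan -/

/-- One step of the algorithm. -/
inductive PartStep (T : DominoTableau) (S : SignedTableau) (T₁ : DominoTableau)
    (S₁ : SignedTableau) : ClanPart → Prop
  | single {i q : ℕ} {ε : ℤˣ} (h : SingleStep T S i ε 0 T₁ S₁ q) : PartStep T S T₁ S₁ (.single i ε)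
  | pair {a j : ℕ} {ε : ℤˣ} (h : PairStep T S a j ε T₁ S₁) (ha : ∀ d, (a, d) ∉ T) :
      PartStep T S T₁ S₁ (.pair a j ε)

lemma PartStep.valid {T T₁ : DominoTableau} {S S₁ : SignedTableau} {p : ClanPart}
    (h : PartStep T S T₁ S₁ p) : Valid T₁ S₁ := by
  cases h with
  | single h => exact h.valid
  | pair h => exact h.valid

lemma PartStep.labels {T T₁ : DominoTableau} {S S₁ : SignedTableau} {p : ClanPart}
    (h : PartStep T S T₁ S₁ p) (hV : Valid T S) (k : ℕ) :
    (∃ d, (k, d) ∈ T₁) ↔ k ∈ p.entries ∨ ∃ d, (k, d) ∈ T := by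
  cases h with
  | single h => rw [h.labels hV]; simp [ClanPart.entries]
  | pair h => rw [h.labels]; simp [ClanPart.entries, or_assoc]

lemma PartStep.grows {T T₁ : DominoTableau} {S S₁ : SignedTableau} {p : ClanPart}
    (h : PartStep T S T₁ S₁ p) (hV : Valid T S) : Grows T T₁ := by
  cases h with
  | single h => exact h.grows hV
  | pair h ha =>
    obtain ⟨T', D, h1, h2⟩ := h.exists_grows
    exact (Grows.ins .refl ha h1).trans h2

/-- The result of the algorithm for a list of constituents. -/
noncomputable def run (L : List ClanPart) : TableauPair := L.foldl insertPart ([], [])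

lemma run_snoc (L : List ClanPart) (p : ClanPart) : run (L ++ [p]) = insertPart (run L) p := by
  simp [run]

/-- The parts are sorted, and every coordinate is positive and occurs once. -/
structure Admissible (L : List ClanPart) : Prop where
  lt_of_pair : ∀ a b ε, ClanPart.pair a b ε ∈ L → a < b
  sorted : L.Pairwise fun p q => p.largest < q.largest
  nodup : (L.flatMap ClanPart.entries).Nodup
  pos : ∀ p ∈ L, ∀ k ∈ p.entries, 1 ≤ k

lemma Admissible.left {A B : List ClanPart} (h : Admissible (A ++ B)) : Admissible A where
  lt_of_pair a b ε hp := h.lt_of_pair a b ε (List.mem_append_left _ hp)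
  sorted := (List.pairwise_append.1 h.sorted).1
  nodup := by
    have := h.nodup
    rw [List.flatMap_append] at this
    exact this.of_append_left
  pos p hp := h.pos p (List.mem_append_left _ hp)

lemma Clan.admissible {n : ℕ} (σ : Clan n) : Admissible σ.parts where
  lt_of_pair := σ.lt_of_pair
  sorted := σ.sorted
  nodup := σ.perm.nodup_iff.2 (List.nodup_range' 1)
  pos p hp k hk := by
    have := σ.perm.mem_iff.1 (List.mem_flatMap.2 ⟨p, hp, hk⟩)
    rw [List.mem_range'_1] at this
    exact this.1

lemma Admissible.le_largest {L : List ClanPart} (h : Admissible L) {p : ClanPart} (hp : p ∈ L)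
    {k : ℕ} (hk : k ∈ p.entries) : k ≤ p.largest := by
  cases p with
  | single a ε => simp [ClanPart.entries] at hk; simp [ClanPart.largest, hk]
  | pair a b ε =>
    have := h.lt_of_pair a b ε hp
    simp [ClanPart.entries] at hk
    simp only [ClanPart.largest]; omega

/-- Here `hV` and `hl` play the role of an induction hypothesis. Sortedness makes the largest
coordinate exceed all labels present, and distinctness makes the smaller coordinate of a pair a new
label. -/
lemma insertPart_spec {L : List ClanPart} {p : ClanPart} (h : Admissible (L ++ [p]))
    (hV : Valid (run L).1 (run L).2)
    (hl : ∀ k, (∃ d, (k, d) ∈ (run L).1) ↔ ∃ p ∈ L, k ∈ p.entries) :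
    PartStep (run L).1 (run L).2 (run (L ++ [p])).1 (run (L ++ [p])).2 p := by
  have hlt : ∀ q ∈ (run L).1, q.1 < p.largest := by
    rintro ⟨k, d⟩ hq
    obtain ⟨p', hp', hk⟩ := (hl k).1 ⟨d, hq⟩
    exact lt_of_le_of_lt (h.left.le_largest hp' hk)
      ((List.pairwise_append.1 h.sorted).2.2 p' hp' p (List.mem_singleton_self _))
  have hpL : p ∈ L ++ [p] := List.mem_append_right _ (List.mem_singleton_self _)
  have hpos := h.pos p hpL
  rw [run_snoc]
  cases p with
  | single i ε =>
    obtain ⟨q, hq⟩ := insertSingle_spec (ε := ε) hV (Nat.zero_le _) (Or.inl rfl) hlt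
      (hpos i (by simp [ClanPart.entries]))
    exact .single hq
  | pair a j ε =>
    have ha : ∀ d, (a, d) ∉ (run L).1 := by
      intro d hd
      obtain ⟨p', hp', hk⟩ := (hl a).1 ⟨d, hd⟩
      have := h.nodup
      rw [List.flatMap_append, List.nodup_append] at this
      exact this.2.2 a (List.mem_flatMap.2 ⟨p', hp', hk⟩) a
        (List.mem_flatMap.2 ⟨_, List.mem_singleton_self _, by simp [ClanPart.entries]⟩) rfl
    exact .pair (insertPair_spec hV ha (hpos a (by simp [ClanPart.entries]))
      (h.lt_of_pair a j ε hpL) hlt) ha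

lemma run_spec {L : List ClanPart} (h : Admissible L) : Valid (run L).1 (run L).2 ∧
    ∀ k, (∃ d, (k, d) ∈ (run L).1) ↔ ∃ p ∈ L, k ∈ p.entries := by
  induction L using List.reverseRecOn with
  | nil => exact ⟨valid_nil, by simp [run]⟩
  | append_singleton L p ih =>
    obtain ⟨h1, h2⟩ := ih h.left
    have hs := insertPart_spec h h1 h2
    refine ⟨hs.valid, fun k => ?_⟩
    rw [hs.labels h1, h2]
    simp only [List.mem_append, List.mem_singleton]
    constructor
    · rintro (hk | ⟨q, hq, hk⟩)
      · exact ⟨p, Or.inr rfl, hk⟩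
      · exact ⟨q, Or.inl hq, hk⟩
    · rintro ⟨q, hq | rfl, hk⟩
      · exact Or.inr ⟨q, hq, hk⟩
      · exact Or.inl hk

lemma run_step {A : List ClanPart} {p : ClanPart} (h : Admissible (A ++ [p])) :
    PartStep (run A).1 (run A).2 (run (A ++ [p])).1 (run (A ++ [p])).2 p :=
  insertPart_spec h (run_spec h.left).1 (run_spec h.left).2

lemma run_grows {A B : List ClanPart} (h : Admissible (A ++ B)) :
    Grows (run A).1 (run (A ++ B)).1 := by
  induction B using List.reverseRecOn with
  | nil => rw [List.append_nil]; exact .refl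
  | append_singleton B p ih =>
    rw [← List.append_assoc] at h ⊢
    exact (ih h.left).trans ((run_step h).grows (run_spec h.left).1)

lemma Admissible.split {L : List ClanPart} (h : Admissible L) {p p' : ClanPart} (hp : p ∈ L)
    (hp' : p' ∈ L) (hlt : p.largest < p'.largest) :
    ∃ A B C, L = A ++ [p] ++ B ++ [p'] ++ C := by
  obtain ⟨A, R, rfl⟩ := List.append_of_mem hp
  have hs := h.sorted
  rw [List.pairwise_append, List.pairwise_cons] at hs
  rw [List.mem_append, List.mem_cons] at hp'
  rcases hp' with hm | rfl | hm
  · have := hs.2.2 p' hm p (List.mem_cons_self)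
    omega
  · omega
  · obtain ⟨B, C, rfl⟩ := List.append_of_mem hm
    exact ⟨A, B, C, by simp⟩

/-- No largest coordinate fits strictly between two consecutive numbers, so the two parts are
adjacent in the list. -/
lemma Admissible.split_succ {L : List ClanPart} (h : Admissible L) {p p' : ClanPart} (hp : p ∈ L)
    (hp' : p' ∈ L) (hlt : p'.largest = p.largest + 1) :
    ∃ A C, L = A ++ [p] ++ [p'] ++ C := by
  obtain ⟨A, B, C, e⟩ := h.split hp hp' (by omega)
  cases B with
  | nil => exact ⟨A, C, by simpa using e⟩
  | cons b B =>
    have hs := h.sorted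
    rw [e] at hs
    simp only [List.append_assoc, List.cons_append, List.nil_append] at hs
    rw [List.pairwise_append, List.pairwise_cons, List.pairwise_cons] at hs
    have h1 := hs.2.1.1 b List.mem_cons_self
    have h2 := hs.2.1.2.1 p' (by simp)
    omega

variable {L : List ClanPart}

/-- Growth preserves both "below" and "to the right". One of these holds as soon as both labels are
present and they exclude each other, so later steps cannot change the answer. -/
lemma Admissible.belowIn_of_prefix {A C : List ClanPart} (h : Admissible (A ++ C)) {k : ℕ}
    (h1 : ∃ p ∈ A, k ∈ p.entries) (h2 : ∃ p ∈ A, k + 1 ∈ p.entries) :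
    BelowIn (run (A ++ C)).1 k (k + 1) ↔ BelowIn (run A).1 k (k + 1) := by
  have hA := run_spec h.left
  refine ⟨fun hb => ?_, (run_grows h).belowIn⟩
  obtain ⟨d, hd⟩ := (hA.2 k).2 h1
  obtain ⟨d', hd'⟩ := (hA.2 (k + 1)).2 h2
  refine (hA.1.std.belowIn_or_rightIn hd hd').resolve_right fun hr => ?_
  exact (run_spec h).1.std.not_belowIn_of_rightIn ((run_grows h).rightIn hr) hb

lemma Admissible.plusIn_of_prefix {A C : List ClanPart} (h : Admissible (A ++ C))
    (h1 : ∃ p ∈ A, 1 ∈ p.entries) (h2 : ∃ p ∈ A, 2 ∈ p.entries) :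
    PlusIn (run (A ++ C)).1 ↔ PlusIn (run A).1 :=
  (run_grows h).plusIn (((run_spec h.left).2 1).2 h1) (((run_spec h.left).2 2).2 h2)

lemma Admissible.split_labels {A B C : List ClanPart} {p p' : ClanPart}
    (h : Admissible (A ++ [p] ++ B ++ [p'] ++ C)) {k : ℕ} (hk : k ∈ p.entries) :
    ∃ d, (k, d) ∈ (run (A ++ [p] ++ B)).1 :=
  ((run_spec h.left.left).2 k).2 ⟨p, by simp, hk⟩

/-- `i + 1` is inserted as the smaller element of a pair after `i`. -/
lemma Admissible.belowIn_pred (h : Admissible L) {p : ClanPart} {i b : ℕ} {ε : ℤˣ} (hp : p ∈ L)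
    (hi : i ∈ p.entries) (hp' : ClanPart.pair (i + 1) b ε ∈ L) (hlt : p.largest < b) :
    BelowIn (run L).1 i (i + 1) ↔ ε = -1 := by
  obtain ⟨A, B, C, rfl⟩ := h.split hp hp' hlt
  rw [h.belowIn_of_prefix ⟨p, by simp, hi⟩
    ⟨.pair (i + 1) b ε, by simp, by simp [ClanPart.entries]⟩]
  have hl := h.split_labels hi
  have hst := run_step h.left
  have hs := (run_spec h.left).1.std
  cases hst with
  | pair hst =>
    obtain ⟨T', D, hins, hg⟩ := hst.exists_grows
    rcases Int.units_eq_one_or ε with rfl | rfl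
    · exact iff_of_false (hs.not_belowIn_of_rightIn (hg.rightIn (hins.rightIn_pred hl)))
        (by decide)
    · exact iff_of_true (hg.belowIn (hins.belowIn_pred hl)) rfl

/-- `i` is inserted as the smaller element of a pair after `i + 1`. -/
lemma Admissible.belowIn_succ (h : Admissible L) {p : ClanPart} {i b : ℕ} {ε : ℤˣ} (hp : p ∈ L)
    (hi : i + 1 ∈ p.entries) (hp' : ClanPart.pair i b ε ∈ L) (hlt : p.largest < b) :
    BelowIn (run L).1 i (i + 1) ↔ ε = 1 := by
  obtain ⟨A, B, C, rfl⟩ := h.split hp hp' hlt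
  rw [h.belowIn_of_prefix ⟨.pair i b ε, by simp, by simp [ClanPart.entries]⟩
    ⟨p, by simp, hi⟩]
  have hl := h.split_labels hi
  have hst := run_step h.left
  have hs := (run_spec h.left).1.std
  cases hst with
  | pair hst =>
    obtain ⟨T', D, hins, hg⟩ := hst.exists_grows
    rcases Int.units_eq_one_or ε with rfl | rfl
    · exact iff_of_true (hg.belowIn (hins.belowIn_succ hl)) rfl
    · exact iff_of_false (hs.not_belowIn_of_rightIn (hg.rightIn (hins.rightIn_succ hl)))
        (by decide)

lemma Admissible.belowIn_single_single (h : Admissible L) {i : ℕ} {ε ε' : ℤˣ}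
    (hp : ClanPart.single i ε ∈ L) (hp' : ClanPart.single (i + 1) ε' ∈ L) :
    BelowIn (run L).1 i (i + 1) ↔ ε = ε' := by
  obtain ⟨A, C, rfl⟩ := h.split_succ hp hp' rfl
  rw [h.belowIn_of_prefix ⟨.single i ε, by simp, by simp [ClanPart.entries]⟩
    ⟨.single (i + 1) ε', by simp, by simp [ClanPart.entries]⟩]
  cases run_step h.left.left with
  | single h1 =>
    cases run_step h.left with
    | single h2 =>
      have hV := (run_spec h.left.left.left).1
      constructor
      · intro hb
        by_contra hne
        have e : ε' = -ε := by
          by_contra hh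
          exact hne (units_eq_of_ne_neg hh).symm
        subst e
        exact h1.single_not_below hV h2 (Nat.zero_le _) hb
      · rintro rfl
        exact h1.single_below hV h2

lemma Admissible.belowIn_single_pair (h : Admissible L) {i a : ℕ} {ε ε' : ℤˣ}
    (hp : ClanPart.single i ε ∈ L) (hp' : ClanPart.pair a (i + 1) ε' ∈ L) (ha : a < i) :
    BelowIn (run L).1 i (i + 1) := by
  obtain ⟨A, C, rfl⟩ := h.split_succ hp hp' rfl
  refine (run_grows h).belowIn ?_
  cases run_step h.left.left with
  | single h1 =>
    cases run_step h.left with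
    | pair h2 => exact h1.pair_below_zero (run_spec h.left.left.left).1 h2 ha

lemma Admissible.belowIn_pair_single (h : Admissible L) {i a : ℕ} {ε ε' : ℤˣ}
    (hp : ClanPart.pair a i ε ∈ L) (hp' : ClanPart.single (i + 1) ε' ∈ L) :
    ¬ BelowIn (run L).1 i (i + 1) := by
  obtain ⟨A, C, rfl⟩ := h.split_succ hp hp' rfl
  rw [h.belowIn_of_prefix ⟨.pair a i ε, by simp, by simp [ClanPart.entries]⟩
    ⟨.single (i + 1) ε', by simp, by simp [ClanPart.entries]⟩]
  cases run_step h.left.left with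
  | pair h1 =>
    cases run_step h.left with
    | single h2 => exact h1.single_not_below h2

/-- The pair whose smaller coordinate is larger decides, in accordance with the rule that the
coordinate of larger index gives the sign of a root. -/
lemma Admissible.belowIn_pair_pair (h : Admissible L) {i a a' : ℕ} {ε ε' : ℤˣ}
    (hp : ClanPart.pair a i ε ∈ L) (hp' : ClanPart.pair a' (i + 1) ε' ∈ L) (ha : a' < i)
    (hne : a ≠ a') : BelowIn (run L).1 i (i + 1) ↔ if a < a' then ε' = -1 else ε = 1 := by
  obtain ⟨A, C, rfl⟩ := h.split_succ hp hp' rfl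
  rw [h.belowIn_of_prefix ⟨.pair a i ε, by simp, by simp [ClanPart.entries]⟩
    ⟨.pair a' (i + 1) ε', by simp, by simp [ClanPart.entries]⟩]
  cases run_step h.left.left with
  | pair h1 =>
    cases run_step h.left with
    | pair h2 =>
      obtain ⟨hn, hb⟩ := h1.pair (run_spec h.left.left.left).1 h2 ha
      split_ifs with hlt
      · rcases Int.units_eq_one_or ε' with rfl | rfl
        · exact iff_of_false (hn (Or.inl ⟨hlt, rfl⟩)) (by decide)
        · exact iff_of_true (hb (Or.inl ⟨hlt, rfl⟩)) rfl
      · rcases Int.units_eq_one_or ε with rfl | rfl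
        · exact iff_of_true (hb (Or.inr ⟨by omega, rfl⟩)) rfl
        · exact iff_of_false (hn (Or.inr ⟨by omega, rfl⟩)) (by decide)

lemma Admissible.belowIn_pair (h : Admissible L) {i : ℕ} {ε : ℤˣ}
    (hp : ClanPart.pair i (i + 1) ε ∈ L) : BelowIn (run L).1 i (i + 1) := by
  obtain ⟨A, C, rfl⟩ := List.append_of_mem hp
  rw [List.append_cons] at h ⊢
  refine (run_grows h).belowIn ?_
  cases run_step h.left with
  | pair h1 ha =>
    refine h1.below_self ?_
    -- All labels present are less than i+1 because the list is sorted, and different from i because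
    -- i is new.
    rintro ⟨k, d⟩ hk
    obtain ⟨p', hp', hk'⟩ := ((run_spec h.left.left).2 k).1 ⟨d, hk⟩
    have h3 := h.left.left.le_largest hp' hk'
    have h4 := (List.pairwise_append.1 h.left.sorted).2.2 p' hp' _ (List.mem_singleton_self _)
    have h5 : k ≠ i := fun e => ha d (e ▸ hk)
    simp only [ClanPart.largest] at h4 ⊢
    have h6 : (ClanPart.largest p') < i + 1 := h4
    simp only [ne_eq] at *
    omega

/-- `2` is inserted as the smaller element of a pair after `1`. -/
lemma Admissible.plusIn_pred (h : Admissible L) {p : ClanPart} {b : ℕ} {ε : ℤˣ} (hp : p ∈ L)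
    (hi : 1 ∈ p.entries) (hp' : ClanPart.pair 2 b ε ∈ L) (hlt : p.largest < b) :
    PlusIn (run L).1 ↔ ε = -1 := by
  obtain ⟨A, B, C, rfl⟩ := h.split hp hp' hlt
  rw [h.plusIn_of_prefix ⟨p, by simp, hi⟩ ⟨.pair 2 b ε, by simp, by simp [ClanPart.entries]⟩]
  have hl := h.split_labels hi
  cases run_step h.left with
  | pair hst =>
    obtain ⟨T', D, hins, hg⟩ := hst.exists_grows
    rw [hg.plusIn ((hins.spec.2.2.2.2 1).2 (Or.inr hl)) ((hins.spec.2.2.2.2 2).2 (Or.inl rfl)),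
      hins.plusIn_two]

/-- `1` is inserted as the smaller element of a pair after `2`. -/
lemma Admissible.plusIn_succ (h : Admissible L) {p : ClanPart} {b : ℕ} {ε : ℤˣ} (hp : p ∈ L)
    (hi : 2 ∈ p.entries) (hp' : ClanPart.pair 1 b ε ∈ L) (hlt : p.largest < b) :
    PlusIn (run L).1 ↔ ε = -1 := by
  obtain ⟨A, B, C, rfl⟩ := h.split hp hp' hlt
  rw [h.plusIn_of_prefix ⟨.pair 1 b ε, by simp, by simp [ClanPart.entries]⟩ ⟨p, by simp, hi⟩]
  have hl := h.split_labels hi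
  cases run_step h.left with
  | pair hst ha =>
    obtain ⟨T', D, hins, hg⟩ := hst.exists_grows
    rw [hg.plusIn ((hins.spec.2.2.2.2 1).2 (Or.inl rfl)) ((hins.spec.2.2.2.2 2).2 (Or.inr hl)),
      hins.plusIn_one ha hl]

lemma Admissible.largest_pos (h : Admissible L) {p : ClanPart} (hp : p ∈ L) : 1 ≤ p.largest := by
  cases p with
  | single a ε => exact h.pos _ hp a (by simp [ClanPart.entries])
  | pair a b ε => exact h.pos _ hp b (by simp [ClanPart.entries])

lemma largest_mem (p : ClanPart) : p.largest ∈ p.entries := by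
  cases p <;> simp [ClanPart.largest, ClanPart.entries]

lemma Admissible.plusIn_single_single (h : Admissible L) {ε ε' : ℤˣ}
    (hp : ClanPart.single 1 ε ∈ L) (hp' : ClanPart.single 2 ε' ∈ L) :
    PlusIn (run L).1 ↔ ε' = -ε := by
  obtain ⟨A, C, rfl⟩ := h.split_succ hp hp' rfl
  rw [h.plusIn_of_prefix ⟨.single 1 ε, by simp, by simp [ClanPart.entries]⟩
    ⟨.single 2 ε', by simp, by simp [ClanPart.entries]⟩]
  have hA : A = [] := by
    rw [List.eq_nil_iff_forall_not_mem]
    intro q hq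
    have h1 := h.left.left.left.largest_pos hq
    have h2 : q.largest < 1 := (List.pairwise_append.1 h.left.left.sorted).2.2 q hq _
      (List.mem_singleton_self _)
    omega
  subst hA
  cases run_step h.left.left with
  | single h1 =>
    cases run_step h.left with
    | single h2 => exact h1.plusIn h2

lemma Admissible.plusIn_pair (h : Admissible L) {ε : ℤˣ} (hp : ClanPart.pair 1 2 ε ∈ L) :
    PlusIn (run L).1 := by
  obtain ⟨A, C, rfl⟩ := List.append_of_mem hp
  rw [List.append_cons] at h ⊢
  rw [h.plusIn_of_prefix ⟨.pair 1 2 ε, by simp, by simp [ClanPart.entries]⟩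
    ⟨.pair 1 2 ε, by simp, by simp [ClanPart.entries]⟩]
  cases run_step h.left with
  | pair h1 ha =>
    have hA : A = [] := by
      rw [List.eq_nil_iff_forall_not_mem]
      intro q hq
      have h1 := h.left.left.largest_pos hq
      have h2 : q.largest < 2 := (List.pairwise_append.1 h.left.sorted).2.2 q hq _
        (List.mem_singleton_self _)
      have h3 : q.largest = 1 := by omega
      obtain ⟨d, hd⟩ := ((run_spec h.left.left).2 1).2 ⟨q, hq, h3 ▸ largest_mem q⟩
      exact ha d hd
    subst hA
    exact h1.plusIn

end SOStar

namespace SOStar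

/-! ### Signs of roots, the Cartan involution and the comparison of tau-invariants -/

/-- The vector `± e_u`. -/
noncomputable def signedE (x : ℤˣ) (u : ℕ) : ℕ →₀ ℤ := (x : ℤ) • e u

lemma signedE_apply (x : ℤˣ) (u k : ℕ) : signedE x u k = if u = k then (x : ℤ) else 0 := by
  simp [signedE, e, Finsupp.single_apply]

lemma signedE_one (u : ℕ) : signedE 1 u = e u := by simp [signedE]

lemma signedE_neg_one (u : ℕ) : signedE (-1) u = -e u := by simp [signedE]

lemma signedE_neg (x : ℤˣ) (u : ℕ) : signedE (-x) u = -signedE x u := by simp [signedE]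

/-- The sign of a root is that of its coordinate of largest index. -/
lemma isNegativeRoot_iff {n u w : ℕ} {x y : ℤˣ} (hu : 1 ≤ u) (huw : u < w) (hw : w ≤ n) :
    IsNegativeRoot n (signedE y w + signedE x u) ↔ y = -1 := by
  constructor
  · rintro ⟨a, b, hb, hba, ha, h⟩
    by_contra hy
    have hy1 : y = 1 := (Int.units_eq_one_or y).resolve_right hy
    subst hy1
    -- A negative root has coordinate -1 at its largest index a. If the coordinate at w is 1, then a
    -- can only be u, which is less than w, and the coordinate at w would vanish.
    have ha' : (signedE 1 w + signedE x u) a = -1 := by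
      rcases h with h | h <;> rw [h] <;> simp [e, hba.ne]
    have hw' : (signedE 1 w + signedE x u) w = 1 := by
      simp [signedE_apply, huw.ne]
    have haw : a ≠ w := by
      rintro rfl
      rw [hw'] at ha'; exact absurd ha' (by decide)
    have hau : a = u := by
      by_contra hne
      rw [Finsupp.add_apply, signedE_apply, signedE_apply, if_neg (Ne.symm haw),
        if_neg (Ne.symm hne)] at ha'
      simp at ha'
    have : (signedE 1 w + signedE x u) w = 0 := by
      rcases h with h | h <;> rw [h] <;>
        simp [e, Finsupp.single_apply, haw] <;> omega
    omega
  · rintro rfl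
    refine ⟨w, u, hu, huw, hw, ?_⟩
    rcases Int.units_eq_one_or x with rfl | rfl
    · right; rw [signedE_one, signedE_neg_one]; abel
    · left; rw [signedE_neg_one, signedE_neg_one]; abel

lemma isNegativeRoot_iff_of_lt {n u w : ℕ} {x y : ℤˣ} (hw : 1 ≤ w) (huw : w < u) (hu : u ≤ n) :
    IsNegativeRoot n (signedE y w + signedE x u) ↔ x = -1 := by
  rw [add_comm, isNegativeRoot_iff hw huw hu]

lemma isNegativeRoot_sub_iff {n u w : ℕ} {x y : ℤˣ} (hu : 1 ≤ u) (huw : u < w) (hw : w ≤ n) :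
    IsNegativeRoot n (signedE y w - signedE x u) ↔ y = -1 := by
  rw [sub_eq_add_neg, ← signedE_neg, isNegativeRoot_iff hu huw hw]

lemma isNegativeRoot_sub_iff_of_lt {n u w : ℕ} {x y : ℤˣ} (hw : 1 ≤ w) (huw : w < u)
    (hu : u ≤ n) : IsNegativeRoot n (signedE y w - signedE x u) ↔ x = 1 := by
  rw [sub_eq_add_neg, ← signedE_neg, isNegativeRoot_iff_of_lt hw huw hu, neg_inj]

lemma Admissible.eq_of_mem {L : List ClanPart} (h : Admissible L) {p q : ClanPart} (hp : p ∈ L)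
    (hq : q ∈ L) {k : ℕ} (h1 : k ∈ p.entries) (h2 : k ∈ q.entries) : p = q := by
  by_contra hne
  have hd := (List.nodup_flatMap.1 h.nodup).2
  have : _root_.Std.Symm (Function.onFun List.Disjoint ClanPart.entries) :=
    ⟨fun _ _ hab => List.Disjoint.symm hab⟩
  have := hd.forall hp hq hne
  exact this h1 h2

variable {n : ℕ}

lemma Clan.exists_part (σ : Clan n) {k : ℕ} (h1 : 1 ≤ k) (h2 : k ≤ n) :
    ∃ p ∈ σ.parts, k ∈ p.entries := by
  have : k ∈ σ.parts.flatMap ClanPart.entries := by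
    rw [σ.perm.mem_iff, List.mem_range'_1]; omega
  exact List.mem_flatMap.1 this

lemma Clan.le_of_mem (σ : Clan n) {p : ClanPart} (hp : p ∈ σ.parts) {k : ℕ}
    (hk : k ∈ p.entries) : 1 ≤ k ∧ k ≤ n := by
  have := σ.perm.mem_iff.1 (List.mem_flatMap.2 ⟨p, hp, hk⟩)
  rw [List.mem_range'_1] at this
  omega

lemma Clan.find_part (σ : Clan n) {p : ClanPart} (hp : p ∈ σ.parts) {k : ℕ}
    (hk : k ∈ p.entries) : (σ.parts.find? fun p => decide (k ∈ p.entries)) = some p := by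
  cases hf : σ.parts.find? fun p => decide (k ∈ p.entries) with
  | none =>
    have := List.find?_eq_none.1 hf p hp
    simp [hk] at this
  | some q =>
    have h1 := List.find?_some hf
    rw [decide_eq_true_eq] at h1
    rw [σ.admissible.eq_of_mem (List.mem_of_find?_eq_some hf) hp h1 hk]

lemma Clan.theta_e (σ : Clan n) (k : ℕ) : σ.theta (e k) = σ.thetaBasis k := by
  rw [Clan.theta, e, Finsupp.linearCombination_single, one_smul]

lemma Clan.theta_single (σ : Clan n) {k : ℕ} {ε : ℤˣ} (hp : ClanPart.single k ε ∈ σ.parts) :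
    σ.theta (e k) = signedE 1 k := by
  rw [σ.theta_e, Clan.thetaBasis, σ.find_part hp (by simp [ClanPart.entries]), signedE_one]

/-- The index w is the partner except for a negative pair of adjacent numbers, where it is a itself.
The sign is ε in either case, so comparisons using only the sign and the order of indices treat both
at once. -/
lemma Clan.theta_smaller (σ : Clan n) {a b : ℕ} {ε : ℤˣ} (hp : ClanPart.pair a b ε ∈ σ.parts) :
    ∃ w, (w = b ∨ b = a + 1 ∧ w = a) ∧ (ε = 1 → w = b) ∧ σ.theta (e a) = signedE ε w := by
  rw [σ.theta_e, Clan.thetaBasis, σ.find_part hp (by simp [ClanPart.entries])]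
  simp only [if_true]
  rcases Int.units_eq_one_or ε with rfl | rfl
  · exact ⟨b, Or.inl rfl, fun _ => rfl, by rw [if_pos rfl, signedE_one]⟩
  · rw [if_neg (by decide)]
    split_ifs with hb
    · exact ⟨a, Or.inr ⟨hb, rfl⟩, fun hh => absurd hh (by decide), (signedE_neg_one a).symm⟩
    · exact ⟨b, Or.inl rfl, fun _ => rfl, (signedE_neg_one b).symm⟩

lemma Clan.theta_larger (σ : Clan n) {a b : ℕ} {ε : ℤˣ} (hp : ClanPart.pair a b ε ∈ σ.parts) :
    ∃ w, (w = a ∨ b = a + 1 ∧ w = b) ∧ (ε = 1 → w = a) ∧ σ.theta (e b) = signedE ε w := by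
  have hab := σ.lt_of_pair a b ε hp
  rw [σ.theta_e, Clan.thetaBasis, σ.find_part hp (by simp [ClanPart.entries])]
  simp only [if_neg hab.ne']
  rcases Int.units_eq_one_or ε with rfl | rfl
  · exact ⟨a, Or.inl rfl, fun _ => rfl, by rw [if_pos rfl, signedE_one]⟩
  · rw [if_neg (by decide)]
    split_ifs with hb
    · exact ⟨b, Or.inr ⟨hb, rfl⟩, fun hh => absurd hh (by decide), (signedE_neg_one b).symm⟩
    · exact ⟨a, Or.inl rfl, fun _ => rfl, (signedE_neg_one a).symm⟩

lemma mem_entries_single {k a : ℕ} {ε : ℤˣ} : k ∈ (ClanPart.single a ε).entries ↔ k = a := by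
  simp [ClanPart.entries]

lemma mem_entries_pair {k a b : ℕ} {ε : ℤˣ} :
    k ∈ (ClanPart.pair a b ε).entries ↔ k = a ∨ k = b := by
  simp [ClanPart.entries]

lemma Clan.compactImaginary_diff (σ : Clan n) {i : ℕ} {h₁ : 1 ≤ i} {h₂ : i < n} {p p' : ClanPart}
    (hp : p ∈ σ.parts) (hp' : p' ∈ σ.parts) (hi : i ∈ p.entries) (hi' : i + 1 ∈ p'.entries)
    (hno : ∀ ε, ClanPart.pair i (i + 1) ε ∉ σ.parts) :
    σ.CompactImaginary (.diff i h₁ h₂) ↔ ∃ ε, p = .single i ε ∧ p' = .single (i + 1) ε := by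
  simp only [Clan.CompactImaginary, hno, or_false]
  constructor
  · rintro ⟨ε, g1, g2⟩
    exact ⟨ε, σ.admissible.eq_of_mem hp g1 hi (by simp [mem_entries_single]),
      σ.admissible.eq_of_mem hp' g2 hi' (by simp [mem_entries_single])⟩
  · rintro ⟨ε, rfl, rfl⟩
    exact ⟨ε, hp, hp'⟩

lemma Clan.compactImaginary_plus (σ : Clan n) {h₂ : 2 ≤ n} {p p' : ClanPart}
    (hp : p ∈ σ.parts) (hp' : p' ∈ σ.parts) (hi : 1 ∈ p.entries) (hi' : 2 ∈ p'.entries)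
    (hno : ∀ ε, ClanPart.pair 1 2 ε ∉ σ.parts) :
    σ.CompactImaginary (.plus h₂) ↔ ∃ ε, p = .single 1 ε ∧ p' = .single 2 (-ε) := by
  simp only [Clan.CompactImaginary, hno, or_false]
  constructor
  · rintro ⟨ε, g1, g2⟩
    exact ⟨ε, σ.admissible.eq_of_mem hp g1 hi (by simp [mem_entries_single]),
      σ.admissible.eq_of_mem hp' g2 hi' (by simp [mem_entries_single])⟩
  · rintro ⟨ε, rfl, rfl⟩
    exact ⟨ε, hp, hp'⟩

/-- If i or i+1 is the smaller coordinate of a pair listed after the part of the other, the leading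
coordinate of θ(e_{i+1} - e_i) comes from that pair and its sign decides, as in
`Admissible.belowIn_pred` and `Admissible.belowIn_succ`. If both are largest coordinates of
different parts, the comparison is with the lemmas on adjacent parts. Compact imaginary roots matter
only for two singletons and for a pair formed by i and i+1. -/
theorem Clan.diff_mem_tau_iff (σ : Clan n) {i : ℕ} (h₁ : 1 ≤ i) (h₂ : i < n) :
    SimpleRoot.diff i h₁ h₂ ∈ σ.tau ↔ BelowIn (run σ.parts).1 i (i + 1) := by
  have hσ := σ.admissible
  change IsNegativeRoot n (σ.theta (e (i + 1) - e i)) ∨ _ ↔ _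
  rw [map_sub]
  by_cases hno : ∃ ε, ClanPart.pair i (i + 1) ε ∈ σ.parts
  · obtain ⟨ε, hε⟩ := hno
    refine iff_of_true ?_ (hσ.belowIn_pair hε)
    rcases Int.units_eq_one_or ε with rfl | rfl
    · left
      obtain ⟨w, -, hw, e1⟩ := σ.theta_smaller hε
      obtain ⟨w', -, hw', e2⟩ := σ.theta_larger hε
      rw [e1, e2, hw rfl, hw' rfl]
      exact (isNegativeRoot_sub_iff_of_lt h₁ (by omega) h₂).2 rfl
    · exact Or.inr (Or.inr hε)
  rw [not_exists] at hno
  obtain ⟨p, hp, hi⟩ := σ.exists_part h₁ h₂.le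
  obtain ⟨p', hp', hi'⟩ := σ.exists_part (k := i + 1) (by omega) h₂
  rw [σ.compactImaginary_diff hp hp' hi hi' hno]
  have huniq := fun k (ha : k ∈ p.entries) (hb : k ∈ p'.entries) => hσ.eq_of_mem hp hp' ha hb
  have hb := fun k => σ.le_of_mem hp (k := k)
  have hb' := fun k => σ.le_of_mem hp' (k := k)
  cases p with
  | single k ε =>
    obtain rfl := mem_entries_single.1 hi
    rw [σ.theta_single hp]
    cases p' with
    | single k' ε' =>
      obtain rfl := mem_entries_single.1 hi'
      rw [σ.theta_single hp', isNegativeRoot_sub_iff h₁ (by omega) h₂,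
        hσ.belowIn_single_single hp hp']
      simp only [ClanPart.single.injEq, true_and]
      constructor
      · rintro (hh | ⟨x, rfl, rfl⟩)
        · exact absurd hh (by decide)
        · rfl
      · rintro rfl; exact Or.inr ⟨ε, rfl, rfl⟩
    | pair a' b' ε' =>
      have hlt := hσ.lt_of_pair _ _ _ hp'
      simp only [mem_entries_single, mem_entries_pair, reduceCtorEq, and_false, exists_false,
        or_false] at hi' huniq hb' ⊢
      rcases hi' with rfl | rfl
      · obtain ⟨w, hw, -, e1⟩ := σ.theta_smaller hp'
        rw [e1, isNegativeRoot_sub_iff h₁ (by omega)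
          (by have := hb' b' (Or.inr rfl); omega),
          hσ.belowIn_pred hp (by simp [mem_entries_single]) hp' (by simp only [ClanPart.largest]; omega)]
      · have hne : a' ≠ i := fun hh => huniq i rfl (Or.inl hh.symm)
        have := hb' a' (Or.inl rfl)
        obtain ⟨w, hw, -, e1⟩ := σ.theta_larger hp'
        rw [e1]
        exact iff_of_true ((isNegativeRoot_sub_iff_of_lt (by omega) (by omega) h₂.le).2 rfl)
          (hσ.belowIn_single_pair hp hp' (by omega))
  | pair a b ε =>
    have hlt := hσ.lt_of_pair _ _ _ hp
    simp only [reduceCtorEq, false_and, exists_false, or_false]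
    rw [mem_entries_pair] at hi
    rcases hi with rfl | rfl
    · have hbi : b ≠ i + 1 := by rintro rfl; exact hno _ hp
      have hbn := (hb b (by simp [mem_entries_pair])).2
      obtain ⟨w, hw, -, e1⟩ := σ.theta_smaller hp
      obtain rfl : w = b := by omega
      rw [e1]
      cases p' with
      | single k' ε' =>
        obtain rfl := mem_entries_single.1 hi'
        rw [σ.theta_single hp', isNegativeRoot_sub_iff_of_lt (by omega) (by omega) hbn,
          hσ.belowIn_succ hp' hi' hp (by simp only [ClanPart.largest]; omega)]
      | pair a' b' ε' =>
        have hlt' := hσ.lt_of_pair _ _ _ hp'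
        simp only [mem_entries_pair, ClanPart.pair.injEq] at hi' huniq hb'
        have hbn' := hb' b' (Or.inr rfl)
        have han' := hb' a' (Or.inl rfl)
        rcases hi' with rfl | rfl
        · have hne : w ≠ b' := fun hh => by
            have := huniq w (Or.inr rfl) (Or.inr hh); omega
          obtain ⟨w', hw', -, e2⟩ := σ.theta_smaller hp'
          rw [e2]
          rcases lt_or_gt_of_ne hne with hlt2 | hlt2
          · rw [isNegativeRoot_sub_iff (by omega) (by omega) (by omega),
              hσ.belowIn_pred hp (by simp [mem_entries_pair]) hp' hlt2]
          · rw [isNegativeRoot_sub_iff_of_lt (by omega) (by omega) (by omega),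
              hσ.belowIn_succ hp' (by simp [mem_entries_pair]) hp hlt2]
        · obtain ⟨w', hw', -, e2⟩ := σ.theta_larger hp'
          rw [e2, isNegativeRoot_sub_iff_of_lt (by omega) (by omega) (by omega),
              hσ.belowIn_succ hp' (by simp [mem_entries_pair]) hp
              (by simp only [ClanPart.largest]; omega)]
    · have han := hb a (by simp [mem_entries_pair])
      obtain ⟨w, hw, -, e1⟩ := σ.theta_larger hp
      rw [e1]
      cases p' with
      | single k' ε' =>
        obtain rfl := mem_entries_single.1 hi'
        rw [σ.theta_single hp', isNegativeRoot_sub_iff (by omega) (by omega) (by omega)]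
        exact iff_of_false (by decide) (hσ.belowIn_pair_single hp hp')
      | pair a' b' ε' =>
        have hlt' := hσ.lt_of_pair _ _ _ hp'
        simp only [mem_entries_pair, ClanPart.pair.injEq] at hi' huniq hb'
        have hbn' := hb' b' (Or.inr rfl)
        have han' := hb' a' (Or.inl rfl)
        rcases hi' with rfl | rfl
        · obtain ⟨w', hw', -, e2⟩ := σ.theta_smaller hp'
          rw [e2, isNegativeRoot_sub_iff (by omega) (by omega) (by omega),
            hσ.belowIn_pred hp (by simp [mem_entries_pair]) hp'
              (by simp only [ClanPart.largest]; omega)]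
        · have hne : a ≠ a' := fun hh => by
            have := huniq a (Or.inl rfl) (Or.inl hh); omega
          have hne' : a' ≠ i := fun hh => by
            have := huniq a' (Or.inr hh) (Or.inl rfl); omega
          obtain ⟨w', hw', -, e2⟩ := σ.theta_larger hp'
          rw [e2, hσ.belowIn_pair_pair hp hp' (by omega) hne]
          split_ifs with hlt2
          · rw [isNegativeRoot_sub_iff (by omega) (by omega) (by omega)]
          · rw [isNegativeRoot_sub_iff_of_lt (by omega) (by omega) (by omega)]

theorem Clan.plus_mem_tau_iff (σ : Clan n) (h₂ : 2 ≤ n) :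
    SimpleRoot.plus h₂ ∈ σ.tau ↔ PlusIn (run σ.parts).1 := by
  have hσ := σ.admissible
  change IsNegativeRoot n (σ.theta (e 2 + e 1)) ∨ _ ↔ _
  rw [map_add]
  by_cases hno : ∃ ε, ClanPart.pair 1 2 ε ∈ σ.parts
  · obtain ⟨ε, hε⟩ := hno
    refine iff_of_true ?_ (hσ.plusIn_pair hε)
    -- The signs play the opposite roles to those for e_{i+1} - e_i: here the positive pair is
    -- compact imaginary, and the negative pair negates both vectors.
    rcases Int.units_eq_one_or ε with rfl | rfl
    · exact Or.inr (Or.inr hε)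
    · left
      rw [σ.theta_e, σ.theta_e, Clan.thetaBasis, Clan.thetaBasis,
        σ.find_part hε (by simp [mem_entries_pair]), σ.find_part hε (by simp [mem_entries_pair])]
      exact ⟨2, 1, le_rfl, by decide, h₂, Or.inl (by simp [add_comm])⟩
  rw [not_exists] at hno
  obtain ⟨p, hp, hi⟩ := σ.exists_part le_rfl (by omega : 1 ≤ n)
  obtain ⟨p', hp', hi'⟩ := σ.exists_part (k := 2) (by omega) h₂
  rw [σ.compactImaginary_plus hp hp' hi hi' hno]
  have huniq := fun k (ha : k ∈ p.entries) (hb : k ∈ p'.entries) => hσ.eq_of_mem hp hp' ha hb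
  have hb := fun k => σ.le_of_mem hp (k := k)
  have hb' := fun k => σ.le_of_mem hp' (k := k)
  cases p with
  | single k ε =>
    obtain rfl := mem_entries_single.1 hi
    rw [σ.theta_single hp]
    cases p' with
    | single k' ε' =>
      obtain rfl := mem_entries_single.1 hi'
      rw [σ.theta_single hp', isNegativeRoot_iff le_rfl (by omega) h₂,
        hσ.plusIn_single_single hp hp']
      simp only [ClanPart.single.injEq, true_and]
      constructor
      · rintro (hh | ⟨x, rfl, rfl⟩)
        · exact absurd hh (by decide)
        · rfl
      · rintro rfl; exact Or.inr ⟨ε, rfl, rfl⟩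
    | pair a' b' ε' =>
      have hlt := hσ.lt_of_pair _ _ _ hp'
      simp only [mem_entries_single, mem_entries_pair, reduceCtorEq, and_false, exists_false,
        or_false] at hi' huniq hb' ⊢
      have han' := hb' a' (Or.inl rfl)
      have hbn' := hb' b' (Or.inr rfl)
      rcases hi' with rfl | rfl
      · obtain ⟨w, hw, -, e1⟩ := σ.theta_smaller hp'
        rw [e1, isNegativeRoot_iff le_rfl (by omega) (by omega),
          hσ.plusIn_pred hp hi hp' (by simp only [ClanPart.largest]; omega)]
      · exact (huniq 1 rfl (Or.inl (by omega))).elim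
  | pair a b ε =>
    have hlt := hσ.lt_of_pair _ _ _ hp
    have han := hb a (by simp [mem_entries_pair])
    have hbn := hb b (by simp [mem_entries_pair])
    simp only [reduceCtorEq, false_and, exists_false, or_false]
    have hi0 := mem_entries_pair.1 hi
    obtain rfl : a = 1 := by omega
    have hbi : b ≠ 2 := by rintro rfl; exact hno _ hp
    obtain ⟨w, hw, -, e1⟩ := σ.theta_smaller hp
    obtain rfl : w = b := by omega
    rw [e1]
    cases p' with
    | single k' ε' =>
      obtain rfl := mem_entries_single.1 hi'
      rw [σ.theta_single hp', isNegativeRoot_iff_of_lt (by omega) (by omega) (by omega),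
        hσ.plusIn_succ hp' hi' hp (by simp only [ClanPart.largest]; omega)]
    | pair a' b' ε' =>
      have hlt' := hσ.lt_of_pair _ _ _ hp'
      simp only [mem_entries_pair, ClanPart.pair.injEq] at hi' huniq hb'
      have hbn' := hb' b' (Or.inr rfl)
      have han' := hb' a' (Or.inl rfl)
      rcases hi' with rfl | rfl
      · have hne : w ≠ b' := fun hh => by
          have := huniq w (Or.inr rfl) (Or.inr hh); omega
        obtain ⟨w', hw', -, e2⟩ := σ.theta_smaller hp'
        rw [e2]
        rcases lt_or_gt_of_ne hne with hlt2 | hlt2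
        · rw [isNegativeRoot_iff (by omega) (by omega) (by omega),
            hσ.plusIn_pred hp hi hp' hlt2]
        · rw [isNegativeRoot_iff_of_lt (by omega) (by omega) (by omega),
            hσ.plusIn_succ hp' (by simp [mem_entries_pair]) hp hlt2]
      · have := huniq 1 (Or.inl rfl) (Or.inl (by omega))
        omega

end SOStar

theorem mainTheorem6 (n : ℕ) (σ : SOStar.Clan n) (α : SOStar.SimpleRoot n) :
    α ∈ σ.tau ↔ α ∈ SOStar.ClassPair.tau n (SOStar.H σ) := by
  -- The first component of `H σ` is that of `run σ.parts`, and `tableauTau` unfolds to `PlusIn` and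
  -- `BelowIn`; so both cases hold up to unfolding of definitions.
  cases α with
  | plus h => exact σ.plus_mem_tau_iff h
  | diff i h₁ h₂ => exact σ.diff_mem_tau_iff h₁ h₂
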